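/- \textbf{Theorem.} Let $G$ be a connected planar (finite, simple, undirected) graph with vertex set $\{0,\dots,n-1\}$, and let $v$ be a cut-vertex of $G$. Let $B_1,\dots,B_b$, $b=b(v)$, be the blocks (biconnected components, a bridge being a block) of $G$ that contain $v$, and let $\mathcal E_1,\dots,\mathcal E_b$ be planar embeddings of them on the sphere. Let $\delta_v$ be the degree of $v$ in $G$ and $\delta_{v,j}$ its degree in $B_j$. An embedding on the sphere of a connected graph is understood as its rotation system, that is, the circular counter-clockwise orders of the edges around the vertices (equivalently, a class of planar drawings with the same rotation system and face boundaries); a rotation system is planar if and only if $\#\text{vertices}-\#\text{edges}+\#\text{faces}=2$. There is a bijection $\varphi_v$ from the set of planar embeddings on the sphere of $G(v)=B_1\cup\dots\cup B_b$ whose restriction to $B_j$ is $\mathcal E_j$ for every $j$, onto the set of tuples of natural numbers $\langle c_1,\dots,c_b,d_1,\dots,d_{b-2}\rangle$ with $0\le c_j<\delta_{v,j}$ for $j=1,\dots,b$ and $0\le d_j<\delta_v-j$ for $j=1,\dots,b-2$. In particular the number of these embeddings is $\prod_{j=1}^{b}\delta_{v,j}\prod_{j=1}^{b-2}(\delta_v-j)$.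 Moreover, these bijections can be chosen such that $\varphi_v$ can be computed in $O(n)$ time and $\varphi_v^{-1}$ in $O(n\,\alpha(n))$ time, where $\alpha(n)=\min\{k : A(k,k)\ge n\}$ is the inverse Ackermann function: there are two fixed programs of a random access machine with uniform costs and words of $O(\log n)$ bits that, for all $G$, $v$, $B_j$, $\mathcal E_j$ as above, given $n$, $v$, $b$ and $\mathcal E_1,\dots,\mathcal E_b$ as circular adjacency lists (started anywhere), compute $\varphi_v(\mathcal E)$ from circular adjacency lists of $\mathcal E$, and circular adjacency lists of $\varphi_v^{-1}(\tau)$ from the tuple $\tau$, within these times. -/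

import Mathlib

namespace CutVertexRanking

/-! ### Connectivity: cut-vertices and blocks -/

/-- A vertex whose removal leaves a graph that is not connected (the graph without vertices counts
as connected here, so that the only vertex of a one-vertex graph is not a cut-vertex). -/
def IsCutVertex {V : Type*} (G : SimpleGraph V) (v : V) : Prop :=
  ¬ (G.induce {u | u ≠ v}).Preconnected

/-- A block (biconnected component) of `G`: a maximal connected subgraph that has no cut-vertex of
its own. As usual, a bridge together with its two ends is a block. -/
def IsBlock {V : Type*} (G : SimpleGraph V) (H : G.Subgraph) : Prop :=
  Maximal (fun K : G.Subgraph => K.coe.Connected ∧ ∀ u, ¬ IsCutVertex K.coe u) H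

/-! ### Embeddings on the sphere -/

/-- A rotation system of the graph `H` (a subgraph of `G`): at every vertex `u` a circular
(counter-clockwise) ordering of the neighbours of `u` in `H`, that is, of the edges of `H` incident
to `u`. It is given by the map that takes a neighbour to the next one. -/
structure RotationSystem {V : Type*} {G : SimpleGraph V} (H : G.Subgraph) where
  next : (u : V) → Equiv.Perm (H.neighborSet u)
  cyclic : ∀ (u : V) (a b : H.neighborSet u), (next u).SameCycle a b

namespace RotationSystem

variable {V : Type*} {G : SimpleGraph V} {H : G.Subgraph}

/-- One step along the boundary of a face: after the edge from `u` to `w` comes the edge that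
leaves `w` and follows, in the rotation at `w`, the edge back to `u`. -/
def faceStep (ρ : RotationSystem H) (d : {p : V × V // H.Adj p.1 p.2}) :
    {p : V × V // H.Adj p.1 p.2} :=
  ⟨(d.1.2, ρ.next d.1.2 ⟨d.1.1, d.2.symm⟩), (ρ.next d.1.2 ⟨d.1.1, d.2.symm⟩).2⟩

open Classical in
/-- The number of faces of a rotation system of a connected graph: the number of orbits of
`faceStep` on the oriented edges; a graph without edges has one face. -/
noncomputable def faceCount (ρ : RotationSystem H) : ℕ :=
  if H.edgeSet = ∅ then 1 else Nat.card (Quot fun d d' => d' = ρ.faceStep d)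

/-- `ρ` restricts to `σ` on a subgraph `K`: at every vertex `u`, the `K`-neighbour that follows `a`
in `σ` is the first `K`-neighbour of `u` met after `a` when going around `u` according to `ρ`. -/
def RestrictsTo (ρ : RotationSystem H) {K : G.Subgraph} (σ : RotationSystem K) : Prop :=
  ∀ (u : V) (a : K.neighborSet u) (a' : H.neighborSet u), (a' : V) = a →
    ∃ k : ℕ, 0 < k ∧ (((ρ.next u ^ k) a' : H.neighborSet u) : V) = σ.next u a ∧
      ∀ i : ℕ, 0 < i → i < k → (((ρ.next u ^ i) a' : H.neighborSet u) : V) ∉ K.neighborSet u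

end RotationSystem

/-- An embedding on the sphere of a connected graph `H`. Drawings are taken up to equality of
rotation systems and face boundaries, and for a connected graph the rotation system determines the
face boundaries, so an embedding is a rotation system; those that come from planar drawings on the
sphere are the ones with `#vertices - #edges + #faces = 2`. -/
structure SphereEmbedding {V : Type*} {G : SimpleGraph V} (H : G.Subgraph) extends
    RotationSystem H where
  euler : H.verts.ncard + toRotationSystem.faceCount = H.edgeSet.ncard + 2

/-- The embeddings on the sphere of the union of the `B j` that preserve the embeddings `ℰ j`. -/
def PreservingEmbedding {V : Type*} {G : SimpleGraph V} {b : ℕ} {B : Fin b → G.Subgraph}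
    (ℰ : (j : Fin b) → SphereEmbedding (B j)) : Type _ :=
  {E : SphereEmbedding (⨆ j, B j) //
    ∀ j, E.toRotationSystem.RestrictsTo (ℰ j).toRotationSystem}

/-! ### Tuples -/

/-- The degree of `v` in the subgraph `H`. -/
noncomputable def deg {V : Type*} {G : SimpleGraph V} (H : G.Subgraph) (v : V) : ℕ :=
  (H.neighborSet v).ncard

/-- The tuples `⟨c 1, …, c b, d 1, …, d (b - 2)⟩` with `c j` less than the degree of `v` in `B j`
and `d j` less than the degree of `v` in `G` minus `j`. (Positions are counted from `0` in
`Fin`, hence the `j + 1`.) -/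
abbrev Code {V : Type*} {G : SimpleGraph V} (v : V) {b : ℕ} (B : Fin b → G.Subgraph) : Type :=
  ((j : Fin b) → Fin (deg (B j) v)) ×
    ((j : Fin (b - 2)) → Fin (deg (⊤ : G.Subgraph) v - ((j : ℕ) + 1)))

/-- The numbers of a tuple, in order. -/
def Code.toList {V : Type*} {G : SimpleGraph V} {v : V} {b : ℕ} {B : Fin b → G.Subgraph}
    (t : Code v B) : List ℕ :=
  (List.ofFn fun j => (t.1 j : ℕ)) ++ List.ofFn fun j => (t.2 j : ℕ)

/-! ### The inverse Ackermann function -/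

/-- `α(n)`, the least `k` with `A(k, k) ≥ n`. -/
def invAck (n : ℕ) : ℕ := Nat.find (p := fun k => n ≤ ack k k) ⟨n, (lt_ack_right n n).le⟩

/-! ### Random access machine with uniform costs

The machine has registers and finitely many memory banks (those named in its program), each an
array of cells addressed by natural numbers; registers and cells hold natural numbers. Every
operation costs one unit of time. The numbers that occur are required not to exceed a bound `W`,
which will be polynomial in the size of the graph (words of `O(log n)` bits). -/

/-- Expressions of the machine: constants, registers, reading a memory cell whose address is
computed, and arithmetic (truncated subtraction, integer division). -/
inductive Expr : Type
  | const (k : ℕ)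
  | reg (r : ℕ)
  | load (bank : ℕ) (addr : Expr)
  | add (x y : Expr)
  | sub (x y : Expr)
  | mul (x y : Expr)
  | div (x y : Expr)

/-- Programs of the machine. -/
inductive Prog : Type
  | skip
  | assign (r : ℕ) (x : Expr)
  | store (bank : ℕ) (addr x : Expr)
  | seq (p q : Prog)
  | ite (x : Expr) (p q : Prog)
  | loop (x : Expr) (p : Prog)

/-- Contents of the registers and of the memory banks. -/
structure State : Type where
  reg : ℕ → ℕ
  mem : ℕ → ℕ → ℕ

namespace Expr

/-- The value of an expression. -/
def eval (s : State) : Expr → ℕ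
  | const k => k
  | reg r => s.reg r
  | load a i => s.mem a (i.eval s)
  | add x y => x.eval s + y.eval s
  | sub x y => x.eval s - y.eval s
  | mul x y => x.eval s * y.eval s
  | div x y => x.eval s / y.eval s

/-- The number of elementary operations needed to evaluate an expression. -/
def cost : Expr → ℕ
  | const _ => 1
  | reg _ => 1
  | load _ i => i.cost + 1
  | add x y => x.cost + y.cost + 1
  | sub x y => x.cost + y.cost + 1
  | mul x y => x.cost + y.cost + 1
  | div x y => x.cost + y.cost + 1

/-- All numbers that occur when an expression is evaluated (addresses included) are at most `W`. -/
def Fits (W : ℕ) (s : State) : Expr → Prop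
  | const k => k ≤ W
  | reg r => s.reg r ≤ W
  | load a i => i.Fits W s ∧ s.mem a (i.eval s) ≤ W
  | add x y => x.Fits W s ∧ y.Fits W s ∧ x.eval s + y.eval s ≤ W
  | sub x y => x.Fits W s ∧ y.Fits W s
  | mul x y => x.Fits W s ∧ y.Fits W s ∧ x.eval s * y.eval s ≤ W
  | div x y => x.Fits W s ∧ y.Fits W s

end Expr

namespace State

/-- The state after writing `x` to register `r`. -/
def setReg (s : State) (r x : ℕ) : State :=
  { s with reg := Function.update s.reg r x }

/-- The state after writing `x` to cell `i` of memory bank `a`. -/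
def setMem (s : State) (a i x : ℕ) : State :=
  { s with mem := Function.update s.mem a (Function.update (s.mem a) i x) }

/-- The initial state: the two parts of the input stand in banks `0` and `1`, everything else
is `0`. -/
def init (inp₀ inp₁ : List ℕ) : State where
  reg := fun _ => 0
  mem := fun a i => if a = 0 then inp₀.getD i 0 else if a = 1 then inp₁.getD i 0 else 0

/-- The output, read from the beginning of bank `2`, is the list `l`. -/
def HasOutput (s : State) (l : List ℕ) : Prop :=
  ∀ (i : ℕ) (h : i < l.length), s.mem 2 i = l[i]

end State

/-- `Exec W p s s' t`: the program `p`, started in `s`, halts in `s'` after `t` units of time, and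
no number that occurs during the computation exceeds `W`. -/
inductive Exec (W : ℕ) : Prog → State → State → ℕ → Prop
  | skip (s : State) : Exec W .skip s s 1
  | assign (s : State) (r : ℕ) (x : Expr) (hx : x.Fits W s) :
      Exec W (.assign r x) s (s.setReg r (x.eval s)) (x.cost + 1)
  | store (s : State) (a : ℕ) (i x : Expr) (hi : i.Fits W s) (hx : x.Fits W s) :
      Exec W (.store a i x) s (s.setMem a (i.eval s) (x.eval s)) (i.cost + x.cost + 1)
  | seq {p q : Prog} {s s' s'' : State} {t t' : ℕ} (hp : Exec W p s s' t)
      (hq : Exec W q s' s'' t') : Exec W (.seq p q) s s'' (t + t')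
  | ite_true {x : Expr} {p q : Prog} {s s' : State} {t : ℕ} (hx : x.Fits W s)
      (h : x.eval s ≠ 0) (hp : Exec W p s s' t) : Exec W (.ite x p q) s s' (x.cost + 1 + t)
  | ite_false {x : Expr} {p q : Prog} {s s' : State} {t : ℕ} (hx : x.Fits W s)
      (h : x.eval s = 0) (hq : Exec W q s s' t) : Exec W (.ite x p q) s s' (x.cost + 1 + t)
  | loop_true {x : Expr} {p : Prog} {s s' s'' : State} {t t' : ℕ} (hx : x.Fits W s)
      (h : x.eval s ≠ 0) (hp : Exec W p s s' t) (hl : Exec W (.loop x p) s' s'' t') :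
      Exec W (.loop x p) s s'' (x.cost + 1 + t + t')
  | loop_false {x : Expr} {p : Prog} {s : State} (hx : x.Fits W s) (h : x.eval s = 0) :
      Exec W (.loop x p) s s (x.cost + 1)

/-- With words bounded by `W` and within time `T`, the program `p` halts on the given input with an
output that satisfies `out`. -/
def Computes (p : Prog) (W T : ℕ) (inp₀ inp₁ : List ℕ) (out : List ℕ → Prop) : Prop :=
  ∃ (s : State) (t : ℕ) (l : List ℕ),
    Exec W p (State.init inp₀ inp₁) s t ∧ t ≤ T ∧ out l ∧ s.HasOutput l

/-! ### Representation of the data as lists of numbers -/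

section Representation

variable {n : ℕ} {G : SimpleGraph (Fin n)}

/-- `l` is the circular adjacency list of `u`, started at an arbitrary neighbour of `u`. -/
def RotationSystem.IsAdjList {H : G.Subgraph} (ρ : RotationSystem H) (u : Fin n)
    (l : List (Fin n)) : Prop :=
  l.Nodup ∧ (∀ w, w ∈ l ↔ H.Adj u w) ∧
    ∀ (a : H.neighborSet u) (i : ℕ), l[i]? = some (a : Fin n) →
      l[(i + 1) % l.length]? = some (ρ.next u a : Fin n)

/-- `code` represents an embedding by circular adjacency lists: first the number of vertices of the
graph, then for each vertex `u`, in some order, the number `u`, the degree of `u`, and the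
neighbours of `u` in their circular order. -/
def SphereEmbedding.IsRepr {H : G.Subgraph} (E : SphereEmbedding H) (code : List ℕ) : Prop :=
  ∃ (vs : List (Fin n)) (adj : Fin n → List (Fin n)),
    vs.Nodup ∧ (∀ u, u ∈ vs ↔ u ∈ H.verts) ∧
    (∀ u ∈ H.verts, E.toRotationSystem.IsAdjList u (adj u)) ∧
    code = vs.length ::
      vs.flatMap fun u : Fin n => (u : ℕ) :: (adj u).length :: (adj u).map fun w => (w : ℕ)

/-- The representation of the fixed data: the number of vertices of the whole graph, the vertex
`v`, the number of blocks, and the embedding of each block. -/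
def instanceRepr {b : ℕ} (v : Fin n) (blockCode : Fin b → List ℕ) : List ℕ :=
  n :: (v : ℕ) :: b :: (List.ofFn blockCode).flatten

end Representation

end CutVertexRanking

open CutVertexRanking

/-! Every vertex other than `v` lies in at most one of the blocks, so an embedding that preserves
the given ones is determined by the circular order around `v`. This order is a circular word over
the neighbours of `v`, labelled by their blocks, in which each block occurs in its prescribed
circular order. Such a word comes from a planar embedding if and only if no two blocks cross in it.

Planarity enters through a homological form of Euler's formula, `planar_iff`: a rotation system is
planar exactly when every rational flow is the difference, across the edges, of a function on the
faces. If two blocks crossed at `v`, a cycle through two edges of one of them would separate two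
edges of the other, although these are joined by a path avoiding `v` (`nonCrossing_of_planar`).
Conversely, a flow on the union splits into flows on the blocks, each is solved by a function on the
faces of its block, and these functions are shifted by constants until they agree at `v`
(`exists_preservingEmbedding`). The common potential at `v` is given by the suffix sums of the word.

The counting uses stacks. A noncrossing word is the output of a stack that receives a whole block
whenever the block is opened and gives up one element for every position (`run_of_nonCrossing`). So
the word is known once it is known which element opens each block and at which position. The circle
is cut in a canonical way, at the last element of block 1 before block 2 begins (`IsNormal`). The
numbers `c` record the opening elements. The openings of the blocks 3, 4, … occupy distinct
positions, counted from the first element of block 2 and hence nonzero; these are coded by the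
numbers `d` in the manner of the Fisher–Yates shuffle. The position of the opening of block 1 need
not be recorded, by the cycle lemma: when its letter is erased, the stack underflows, and the last
underflow marks its place (`lastUnder_eq`, `decodeWord_map`, `decodeWord_spec`). Hence all codes
occur, each for one embedding (`exists_equiv_code`).

Both directions take linear time, because a planar graph has linearly many edges (`sum_deg_top_le`)
and because the stack can be kept inside the linked circular lists of the blocks, so that pushing a
whole block is a single redirection of a link (`follows_push`). As `invAck n` is positive, the bound
with the inverse Ackermann function follows. The word size is bounded after the fact: the programs
are `tame`, so numbers grow only linearly with time (`Run.exec`). -/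

namespace CutVertexRanking

/-! ### Words as outputs of a stack, and underflows. -/

section Words

variable {α : Type*}

/-- Reading the letters of `o`, push the list `e k` for every letter `k` and then pop one element.
The result consists of the popped elements and of the final stack. -/
def run (e : ℕ → List α) : List ℕ → List α → List α × List α
  | [], S => ([], S)
  | k :: o, S =>
    match e k ++ S with
    | [] => run e o []
    | x :: S' => (x :: (run e o S').1, (run e o S').2)

/-- The number of times that popping from the empty stack is attempted when `run` starts with a
stack of height `g` and `sz k` elements are pushed for the letter `k`. -/
def under (sz : ℕ → ℕ) : List ℕ → ℕ → ℕ
  | [], _ => 0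
  | k :: o, g => if sz k + g = 0 then under sz o 0 + 1 else under sz o (sz k + g - 1)

/-- The index of the last attempt to pop from the empty stack, counted from `t`; it is `st` if
there is none. -/
def lastUnder (sz : ℕ → ℕ) : List ℕ → ℕ → ℕ → ℕ → ℕ
  | [], _, _, st => st
  | k :: o, g, t, st =>
    if sz k + g = 0 then lastUnder sz o 0 (t + 1) t else lastUnder sz o (sz k + g - 1) (t + 1) st

theorem run_nil_cons {e : ℕ → List α} {k : ℕ} {o : List ℕ} {S : List α} (h : e k ++ S = []) :
    run e (k :: o) S = run e o [] := by
  rw [run]; split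
  · rfl
  · simp_all

theorem run_cons_cons {e : ℕ → List α} {k : ℕ} {o : List ℕ} {S : List α} {x : α} {S' : List α}
    (h : e k ++ S = x :: S') :
    run e (k :: o) S = (x :: (run e o S').1, (run e o S').2) := by
  rw [run]; split
  · simp_all
  · simp_all

/-- Every pushed element is either popped or still on the stack at the end. -/
theorem run_perm (e : ℕ → List α) (o : List ℕ) (S : List α) :
    List.Perm ((run e o S).1 ++ (run e o S).2) (o.flatMap e ++ S) := by
  induction o generalizing S with
  | nil => simp [run]
  | cons k o ih =>
    rcases h : e k ++ S with _ | ⟨x, S'⟩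
    · rw [run_nil_cons h]
      simp only [List.append_eq_nil_iff] at h
      simpa [h.1, h.2] using ih []
    · rw [run_cons_cons h]
      have h1 : List.Perm ((k :: o).flatMap e ++ S) (o.flatMap e ++ (e k ++ S)) := by
        rw [List.flatMap_cons]
        calc _ = e k ++ (o.flatMap e ++ S) := by simp
          List.Perm _ (o.flatMap e ++ S ++ e k) := List.perm_append_comm
          _ = o.flatMap e ++ (S ++ e k) := by simp
          List.Perm _ _ := List.Perm.append_left _ List.perm_append_comm
      refine List.Perm.trans ?_ h1.symm
      rw [h]
      exact ((ih S').cons x).trans List.perm_middle.symm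

/-- Every letter either pops one element or underflows. -/
theorem run_length (e : ℕ → List α) (o : List ℕ) (S : List α) :
    (run e o S).1.length + under (fun k => (e k).length) o S.length = o.length := by
  induction o generalizing S with
  | nil => simp [run, under]
  | cons k o ih =>
    rcases h : e k ++ S with _ | ⟨x, S'⟩
    · rw [run_nil_cons h]
      have h1 := congrArg List.length h
      have := ih []
      simp only [List.length_append, List.length_nil] at h1 this
      rw [under, if_pos h1, List.length_cons]
      omega
    · rw [run_cons_cons h]
      have h1 := congrArg List.length h
      have := ih S'
      simp only [List.length_append, List.length_cons] at h1
      rw [under, if_neg (by omega), List.length_cons, List.length_cons]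
      rw [show (e k).length + S.length - 1 = S'.length by omega]
      omega

/-- A list is pushed with its head on top, and later pushes only interleave other elements. This
preserves the circular order of each block. -/
theorem run_sublist (e : ℕ → List α) (o : List ℕ) (S : List α) :
    S.Sublist ((run e o S).1 ++ (run e o S).2) ∧
      ∀ k ∈ o, (e k).Sublist ((run e o S).1 ++ (run e o S).2) := by
  induction o generalizing S with
  | nil => simp [run]
  | cons k o ih =>
    rcases h : e k ++ S with _ | ⟨x, S'⟩
    · rw [run_nil_cons h]
      simp only [List.append_eq_nil_iff] at h
      refine ⟨by simp [h.2], fun i hi => ?_⟩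
      rcases List.mem_cons.1 hi with rfl | hi
      · simp [h.1]
      · exact (ih []).2 i hi
    · rw [run_cons_cons h]
      have h1 : (e k ++ S).Sublist (x :: ((run e o S').1 ++ (run e o S').2)) := by
        rw [h]; exact (ih S').1.cons_cons x
      refine ⟨(List.sublist_append_right _ _).trans h1, fun i hi => ?_⟩
      rcases List.mem_cons.1 hi with rfl | hi
      · exact (List.sublist_append_left _ _).trans h1
      · exact ((ih S').2 i hi).trans (List.sublist_cons_self _ _)

/-- As long as `S` alone suffices, whatever lies below it is never touched. -/
theorem run_frame (e : ℕ → List α) (o : List ℕ) (S R : List α)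
    (h0 : under (fun k => (e k).length) o S.length = 0) :
    run e o (S ++ R) = ((run e o S).1, (run e o S).2 ++ R) := by
  induction o generalizing S with
  | nil => simp [run]
  | cons k o ih =>
    rcases h : e k ++ S with _ | ⟨x, S'⟩
    · have h1 := congrArg List.length h
      simp only [List.length_append, List.length_nil] at h1
      rw [under, if_pos h1] at h0
      omega
    · have h1 := congrArg List.length h
      simp only [List.length_append, List.length_cons] at h1
      rw [under, if_neg (by omega), show (e k).length + S.length - 1 = S'.length by omega] at h0
      rw [run_cons_cons h, run_cons_cons (x := x) (S' := S' ++ R) (by simp [← List.append_assoc, h]),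
        ih _ h0]

theorem run_append (e : ℕ → List α) (o o' : List ℕ) (S : List α) :
    run e (o ++ o') S =
      ((run e o S).1 ++ (run e o' (run e o S).2).1, (run e o' (run e o S).2).2) := by
  induction o generalizing S with
  | nil => simp [run]
  | cons k o ih =>
    rcases h : e k ++ S with _ | ⟨x, S'⟩
    · rw [List.cons_append, run_nil_cons h, run_nil_cons h, ih]
    · rw [List.cons_append, run_cons_cons h, run_cons_cons h, ih]; simp

/-- If the stack underflows without `R` but not with `R`, an element of `R` is popped. -/
theorem exists_mem_run_of_under (e : ℕ → List α) (o : List ℕ) (S R : List α)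
    (h0 : under (fun k => (e k).length) o S.length ≠ 0)
    (h1 : under (fun k => (e k).length) o (S ++ R).length = 0) :
    ∃ x ∈ R, x ∈ (run e o (S ++ R)).1 := by
  induction o generalizing S with
  | nil => simp [under] at h0
  | cons k o ih =>
    rcases h : e k ++ S with _ | ⟨x, S'⟩
    · rcases R with _ | ⟨x, R⟩
      · rw [List.append_nil] at h1; exact absurd h1 h0
      · rw [run_cons_cons (x := x) (S' := R) (by simp [← List.append_assoc, h])]
        exact ⟨x, by simp, by simp⟩
    · have h2 := congrArg List.length h
      simp only [List.length_append, List.length_cons] at h2 h1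
      rw [under, if_neg (by omega), show (e k).length + S.length - 1 = S'.length by omega] at h0
      rw [under, if_neg (by omega),
        show (e k).length + (S.length + R.length) - 1 = (S' ++ R).length by
          rw [List.length_append]; omega] at h1
      rw [run_cons_cons (x := x) (S' := S' ++ R) (by simp [← List.append_assoc, h])]
      obtain ⟨y, hy, hy'⟩ := ih S' h0 h1
      exact ⟨y, hy, List.mem_cons_of_mem _ hy'⟩

/-- The letter of an element: its label if it is the opening of its block, otherwise `0`. -/
def letter [DecidableEq α] (lab : α → ℕ) (op : ℕ → α) (x : α) : ℕ := if op (lab x) = x then lab x else 0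

/-- A nonzero letter at once pops the head of the list that it pushes, and only tails stay on the
stack, where `f` vanishes. The letter `0` pops from such a tail. So the letters can be read off from
the output. -/
theorem run_map_letter (e : ℕ → List α) (f : α → ℕ) (o : List ℕ) (S : List α)
    (he0 : e 0 = [])
    (he : ∀ k ∈ o, k ≠ 0 → ∃ x t, e k = x :: t ∧ f x = k ∧ ∀ y ∈ t, f y = 0)
    (hS : ∀ y ∈ S, f y = 0) (h0 : under (fun k => (e k).length) o S.length = 0) :
    (run e o S).1.map f = o := by
  induction o generalizing S with
  | nil => simp [run]
  | cons k o ih =>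
    have he' : ∀ k ∈ o, k ≠ 0 → ∃ x t, e k = x :: t ∧ f x = k ∧ ∀ y ∈ t, f y = 0 :=
      fun i hi => he i (List.mem_cons_of_mem _ hi)
    rcases h : e k ++ S with _ | ⟨x, S'⟩
    · have h1 := congrArg List.length h
      simp only [List.length_append, List.length_nil] at h1
      rw [under, if_pos h1] at h0
      omega
    · have h1 := congrArg List.length h
      simp only [List.length_append, List.length_cons] at h1
      rw [under, if_neg (by omega), show (e k).length + S.length - 1 = S'.length by omega] at h0
      rw [run_cons_cons h, List.map_cons]
      by_cases hk : k = 0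
      · subst hk
        rw [he0, List.nil_append] at h
        subst h
        rw [ih S' he' (fun y hy => hS y (List.mem_cons_of_mem _ hy)) h0, hS x (by simp)]
      · obtain ⟨x', t, h2, h3, h4⟩ := he k (by simp) hk
        rw [h2, List.cons_append, List.cons.injEq] at h
        obtain ⟨rfl, rfl⟩ := h
        rw [ih _ he' (fun y hy => ?_) h0, h3]
        rcases List.mem_append.1 hy with hy | hy
        exacts [h4 y hy, hS y hy]

/-- In a word without crossings, the elements of the block that is opened first come before the
elements of blocks opened earlier. -/
theorem filter_or_eq (p q : α → Bool) (v : List α)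
    (h : ∀ a c, [a, c].Sublist v → q a → p c → False) (hd : ∀ a, p a → q a → False) :
    v.filter (fun a => p a || q a) = v.filter p ++ v.filter q := by
  induction v with
  | nil => rfl
  | cons x v ih =>
    have ih := ih fun a c hs => h a c (hs.trans (List.sublist_cons_self _ _))
    by_cases hp : p x
    · have hq : q x = false := by
        by_contra hq; exact hd x hp (by simpa using hq)
      simp [hp, hq, ih]
    · by_cases hq : q x
      · have hv : v.filter p = [] := by
          rw [List.filter_eq_nil_iff]
          intro c hc hpc
          exact h x c ((List.singleton_sublist.2 hc).cons_cons x) hq hpc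
        rw [hv] at ih
        simp [hp, hq, ih, hv]
      · simp [hp, hq, ih]

/-- A list of labelled elements in which no two blocks cross. -/
def NonCrossing (lab : α → ℕ) (w : List α) : Prop :=
  ∀ a c a' c', [a, c, a', c'].Sublist w → lab a = lab a' → lab c = lab c' → lab a = lab c

/-- The stack always consists of the remaining elements of the blocks opened so far, in the order of
the word. An opening pushes its whole block on top, and the absence of crossings is what puts this
block before all remaining elements of older blocks. -/
theorem run_of_nonCrossing [DecidableEq α] (lab : α → ℕ) (op : ℕ → α) (e : ℕ → List α) (w : List α)
    (hlab : ∀ x ∈ w, lab x ≠ 0)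
    (hop : ∀ pre x v, w = pre ++ x :: v → (op (lab x) = x ↔ ∀ y ∈ pre, lab y ≠ lab x))
    (he0 : e 0 = []) (he : ∀ k, k ≠ 0 → e k = w.filter fun y => lab y = k)
    (hw : NonCrossing lab w) :
    run e (w.map (letter lab op)) [] = (w, []) := by
  suffices H : ∀ v pre, w = pre ++ v →
      run e (v.map (letter lab op)) (v.filter fun y => ∃ z ∈ pre, lab z = lab y) = (v, []) by
    have := H w [] (by simp)
    simpa using this
  intro v
  induction v with
  | nil => intro pre _; simp [run]
  | cons x v ih =>
    intro pre hpre
    have ih := ih (pre ++ [x]) (by simp [hpre])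
    have hx := hop pre x v hpre
    -- If the block of `x` is already open, the letter is `0` and the open blocks stay the same.
    -- Otherwise `x` opens its block.
    by_cases hin : ∃ z ∈ pre, lab z = lab x
    · have h1 : ¬ op (lab x) = x := by
        rw [hx]; push Not
        obtain ⟨z, hz, hz'⟩ := hin
        exact ⟨z, hz, hz'⟩
      have h2 : letter lab op x = 0 := by simp [letter, h1]
      have h3 : (v.filter fun y => decide (∃ z ∈ pre ++ [x], lab z = lab y)) =
          v.filter fun y => decide (∃ z ∈ pre, lab z = lab y) := by
        refine List.filter_congr fun y _ => ?_
        rw [decide_eq_decide]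
        refine ⟨?_, fun ⟨z, hz, hz'⟩ => ⟨z, by simp [hz], hz'⟩⟩
        rintro ⟨z, hz, hz'⟩
        rcases List.mem_append.1 hz with hz | hz
        · exact ⟨z, hz, hz'⟩
        · obtain ⟨z', hz1, hz2⟩ := hin
          rw [List.mem_singleton] at hz
          subst hz
          exact ⟨z', hz1, hz2.trans hz'⟩
      rw [h3] at ih
      rw [List.map_cons, h2, run_cons_cons (x := x)
        (S' := v.filter fun y => decide (∃ z ∈ pre, lab z = lab y)), ih]
      rw [he0, List.nil_append, List.filter_cons_of_pos (by simpa using hin)]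
    · have h1 : op (lab x) = x := by
        rw [hx]; push Not at hin; exact hin
      have h2 : letter lab op x = lab x := by simp [letter, h1]
      have hx0 : lab x ≠ 0 := hlab x (by simp [hpre])
      have h3 : (v.filter fun y => decide (∃ z ∈ pre ++ [x], lab z = lab y)) =
          (v.filter fun y => lab y = lab x) ++
            v.filter fun y => decide (∃ z ∈ pre, lab z = lab y) := by
        rw [← filter_or_eq]
        · refine List.filter_congr fun y _ => ?_
          rw [← Bool.decide_or, decide_eq_decide]
          constructor
          · rintro ⟨z, hz, hz'⟩
            rcases List.mem_append.1 hz with hz | hz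
            · exact Or.inr ⟨z, hz, hz'⟩
            · rw [List.mem_singleton] at hz
              subst hz
              exact Or.inl hz'.symm
          · rintro (h | ⟨z, hz, hz'⟩)
            · exact ⟨x, by simp, h.symm⟩
            · exact ⟨z, by simp [hz], hz'⟩
        · intro a c hs ha hc
          simp only [decide_eq_true_eq] at ha hc
          obtain ⟨z, hz, hz'⟩ := ha
          -- An element `a` of an older block before an element `c` of the new block would make the
          -- two blocks cross.
          have h4 : [z, x, a, c].Sublist w := by
            rw [hpre]
            exact List.Sublist.append (List.singleton_sublist.2 hz) (hs.cons_cons x)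
          exact hin ⟨z, hz, hw _ _ _ _ h4 hz' hc.symm⟩
        · intro a h4 h5
          simp only [decide_eq_true_eq] at h4 h5
          obtain ⟨z, hz, hz'⟩ := h5
          exact hin ⟨z, hz, hz'.trans h4⟩
      rw [h3] at ih
      have h5 : e (lab x) = x :: v.filter fun y => lab y = lab x := by
        rw [he _ hx0, hpre, List.filter_append, List.filter_cons_of_pos (by simp)]
        rw [List.filter_eq_nil_iff.2, List.nil_append]
        intro y hy h
        exact hin ⟨y, hy, by simpa using h⟩
      rw [List.map_cons, h2, run_cons_cons (x := x), ih]
      rw [h5, List.filter_cons_of_neg (by simpa using hin), List.cons_append]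

/-- The sum of `g` over the part of the list that begins at `x`. -/
def suffixSum [DecidableEq α] (g : α → ℚ) : List α → α → ℚ
  | [], _ => 0
  | y :: l, x => if x = y then g y + (l.map g).sum else suffixSum g l x

/-- From `x` on, the output consists of the stack at that moment and of lists pushed later, whose
sums vanish. So the suffix sum is the sum over the stack from `x` downwards. For the elements of one
list, this is the sum over the rest of the list plus a constant. -/
theorem suffixSum_run [DecidableEq α] (e : ℕ → List α) (g : α → ℚ) (o : List ℕ) (S : List α)
    (hg : ∀ k ∈ o, ((e k).map g).sum = 0)
    (h0 : under (fun k => (e k).length) o S.length = 0) (hr : (run e o S).2 = [])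
    (hn : (run e o S).1.Nodup) :
    (∀ l x r, S = l ++ x :: r → suffixSum g (run e o S).1 x = g x + (r.map g).sum) ∧
    ∀ k ∈ o, ∃ c, ∀ l x r, e k = l ++ x :: r →
      suffixSum g (run e o S).1 x = g x + (r.map g).sum + c := by
  induction o generalizing S with
  | nil =>
    simp only [run] at hr
    subst hr
    simp
  | cons k o ih =>
    rcases h : e k ++ S with _ | ⟨x, S'⟩
    · have h1 := congrArg List.length h
      simp only [List.length_append, List.length_nil] at h1
      rw [under, if_pos h1] at h0
      omega
    · have h1 := congrArg List.length h
      simp only [List.length_append, List.length_cons] at h1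
      rw [under, if_neg (by omega), show (e k).length + S.length - 1 = S'.length by omega] at h0
      rw [run_cons_cons h] at hr hn ⊢
      simp only at hr hn ⊢
      obtain ⟨hxn, hn'⟩ := List.nodup_cons.1 hn
      have hgo : ∀ k ∈ o, ((e k).map g).sum = 0 := fun i hi => hg i (List.mem_cons_of_mem _ hi)
      obtain ⟨ih1, ih2⟩ := ih S' hgo h0 hr hn'
      have hp := run_perm e o S'
      rw [hr, List.append_nil] at hp
      have hsum : ((run e o S').1.map g).sum = (S'.map g).sum := by
        rw [(hp.map g).sum_eq, List.map_append, List.sum_append, List.map_flatMap,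
          List.flatMap, List.sum_flatten]
        rw [List.map_map]
        have : (o.map (List.sum ∘ fun k => (e k).map g)) = o.map fun _ => (0 : ℚ) :=
          List.map_congr_left fun i hi => hgo i hi
        rw [this]; simp
      have hmem : ∀ y ∈ S', y ∈ (run e o S').1 := fun y hy => hp.mem_iff.2 (by simp [hy])
      have key : ∀ l y r, e k ++ S = l ++ y :: r →
          suffixSum g (x :: (run e o S').1) y = g y + (r.map g).sum := by
        intro l y r hl
        rw [h] at hl
        rcases l with _ | ⟨z, l⟩
        · simp only [List.nil_append, List.cons.injEq] at hl
          obtain ⟨rfl, rfl⟩ := hl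
          simp [suffixSum, hsum]
        · simp only [List.cons_append, List.cons.injEq] at hl
          obtain ⟨rfl, hl⟩ := hl
          have : y ≠ x := by
            rintro rfl
            exact hxn (hmem _ (by simp [hl]))
          rw [suffixSum, if_neg this, ih1 l y r hl]
      refine ⟨fun l y r hl => key (e k ++ l) y r (by simp [hl]), fun i hi => ?_⟩
      rcases List.mem_cons.1 hi with rfl | hi
      -- The constant is the sum over the stack that lay below the list when it was pushed.
      · refine ⟨(S.map g).sum, fun l y r hl => ?_⟩
        rw [key l y (r ++ S) (by simp [hl]), List.map_append, List.sum_append]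
        ring
      · obtain ⟨c, hc⟩ := ih2 i hi
        refine ⟨c, fun l y r hl => ?_⟩
        rw [← hc l y r hl, suffixSum, if_neg]
        rintro rfl
        exact hxn (hp.mem_iff.2 (List.mem_append_left _ (List.mem_flatMap.2 ⟨i, hi, by simp [hl]⟩)))

/-! Counting underflows -/

/-- Each additional element at the bottom of the stack prevents one underflow, as long as there are
any; hence the truncated subtraction. -/
theorem under_add (sz : ℕ → ℕ) (o : List ℕ) (g m : ℕ) :
    under sz o (g + m) = under sz o g - m := by
  induction o generalizing g m with
  | nil => simp [under]
  | cons k o ih =>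
    by_cases h : sz k + g = 0
    · rcases m with _ | m
      · simp
      · rw [under, if_neg (by omega), under, if_pos h,
          show sz k + (g + (m + 1)) - 1 = 0 + m by omega, ih]
        omega
    · rw [under, if_neg (by omega), under, if_neg h,
        show sz k + (g + m) - 1 = (sz k + g - 1) + m by omega, ih]

/-- The final height of the stack. -/
def height (sz : ℕ → ℕ) : List ℕ → ℕ → ℕ
  | [], g => g
  | k :: o, g => height sz o (sz k + g - 1)

/-- The balance of pushes and pops; an underflow is a letter whose pop does not take place. -/
theorem height_add (sz : ℕ → ℕ) (o : List ℕ) (g : ℕ) :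
    height sz o g + o.length = g + (o.map sz).sum + under sz o g := by
  induction o generalizing g with
  | nil => simp [under, height]
  | cons k o ih =>
    by_cases h : sz k + g = 0
    · have := ih 0
      rw [under, if_pos h, height, show sz k + g - 1 = 0 by omega, List.length_cons, List.map_cons,
        List.sum_cons]
      omega
    · have := ih (sz k + g - 1)
      rw [under, if_neg h, height, List.length_cons, List.map_cons, List.sum_cons]
      omega

theorem under_append (sz : ℕ → ℕ) (o o' : List ℕ) (g : ℕ) :
    under sz (o ++ o') g = under sz o g + under sz o' (height sz o g) := by
  induction o generalizing g with
  | nil => simp [under, height]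
  | cons k o ih =>
    by_cases h : sz k + g = 0
    · rw [List.cons_append, under, if_pos h, under, if_pos h, height, ih,
        show sz k + g - 1 = 0 by omega]
      omega
    · rw [List.cons_append, under, if_neg h, under, if_neg h, height, ih]

theorem lastUnder_of_under_eq_zero (sz : ℕ → ℕ) (o : List ℕ) (g t st : ℕ)
    (h : under sz o g = 0) : lastUnder sz o g t st = st := by
  induction o generalizing g t with
  | nil => simp [lastUnder]
  | cons k o ih =>
    by_cases h1 : sz k + g = 0
    · rw [under, if_pos h1] at h; omega
    · rw [under, if_neg h1] at h
      rw [lastUnder, if_neg h1, ih _ _ h]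

/-- The stack is empty after `A` and the letter `0` pushes nothing, so there is an underflow here,
and none follows in `B`. -/
theorem lastUnder_eq (sz : ℕ → ℕ) (A B : List ℕ) (g t st : ℕ) (h0 : sz 0 = 0)
    (hA : height sz A g = 0) (hB : under sz B 0 = 0) :
    lastUnder sz (A ++ 0 :: B) g t st = t + A.length := by
  induction A generalizing g t st with
  | nil =>
    simp only [height] at hA
    subst hA
    rw [List.nil_append, lastUnder, if_pos (by omega), lastUnder_of_under_eq_zero _ _ _ _ _ hB]
    simp
  | cons k o ih =>
    rw [height] at hA
    rw [List.cons_append, lastUnder]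
    split_ifs with h
    · rw [show sz k + g - 1 = 0 by omega] at hA
      rw [ih 0 _ _ hA, List.length_cons]; omega
    · rw [ih _ _ _ hA, List.length_cons]; omega

/-- A nonzero letter pushes something before it pops, so underflows happen only at the letter `0`,
and only when the stack is empty before it. -/
theorem exists_last_under (sz : ℕ → ℕ) (o : List ℕ) (g : ℕ) (hsz : ∀ k ∈ o, k ≠ 0 → sz k ≠ 0)
    (h : under sz o g ≠ 0) :
    ∃ A B, o = A ++ 0 :: B ∧ height sz A g = 0 ∧ under sz B 0 = 0 := by
  induction o generalizing g with
  | nil => simp [under] at h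
  | cons k o ih =>
    have ih := fun g => ih g fun i hi => hsz i (List.mem_cons_of_mem _ hi)
    by_cases h1 : under sz o (sz k + g - 1) = 0
    · by_cases h2 : sz k + g = 0
      · have hk : k = 0 := by
          by_contra hk; exact hsz k (by simp) hk (by omega)
        subst hk
        exact ⟨[], o, rfl, by simp [height]; omega, by rwa [show sz 0 + g - 1 = 0 by omega] at h1⟩
      · rw [under, if_neg h2] at h; contradiction
    · obtain ⟨A, B, h2, h3, h4⟩ := ih _ h1
      exact ⟨k :: A, B, by simp [h2], by rw [height, h3], h4⟩

end Words

/-! ### Coding lists of distinct positions by shrinking ranges. -/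

section FisherYates

/-- Choosing distinct entries of an array: every number in the list is the position of the chosen
entry, which is then overwritten by the last entry. -/
def pickAll (a : ℕ → ℕ) (s : ℕ) : List ℕ → List ℕ
  | [] => []
  | d :: ds => a d :: pickAll (Function.update a d (a (s - 1))) (s - 1) ds

/-- The inverse of `pickAll`; `inv` is the inverse of the array `a`. -/
def positions (a inv : ℕ → ℕ) (s : ℕ) : List ℕ → List ℕ
  | [] => []
  | x :: xs => inv x :: positions (Function.update a (inv x) (a (s - 1)))
      (Function.update inv (a (s - 1)) (inv x)) (s - 1) xs

theorem length_pickAll (a : ℕ → ℕ) (s : ℕ) (ds : List ℕ) : (pickAll a s ds).length = ds.length := by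
  induction ds generalizing a s with
  | nil => rfl
  | cons d ds ih => simp [pickAll, ih]

theorem length_positions (a inv : ℕ → ℕ) (s : ℕ) (xs : List ℕ) :
    (positions a inv s xs).length = xs.length := by
  induction xs generalizing a inv s with
  | nil => rfl
  | cons d ds ih => simp [positions, ih]

/-- The last entry has moved to the place `d`, so `inv` needs a correction at this entry only. Its
value at the chosen entry is out of date, but this entry no longer occurs among the first `s - 1`.
-/
theorem update_inv {a inv : ℕ → ℕ} {s d : ℕ} (hs : ∀ i < s, inv (a i) = i) (hd : d < s) :
    ∀ i < s - 1, Function.update inv (a (s - 1)) d (Function.update a d (a (s - 1)) i) = i := by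
  intro i hi
  by_cases h : i = d
  · subst h; simp
  · rw [Function.update_of_ne h, Function.update_of_ne, hs i (by omega)]
    intro h'
    have := congrArg inv h'
    rw [hs i (by omega), hs (s - 1) (by omega)] at this
    omega

theorem positions_pickAll (a inv : ℕ → ℕ) (s : ℕ) (ds : List ℕ)
    (hs : ∀ i < s, inv (a i) = i) (hd : ∀ (i : ℕ) (h : i < ds.length), ds[i] < s - i) :
    positions a inv s (pickAll a s ds) = ds := by
  induction ds generalizing a inv s with
  | nil => rfl
  | cons d ds ih =>
    have hd0 : d < s := by
      have := hd 0 (by simp)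
      rw [List.getElem_cons_zero] at this
      omega
    rw [pickAll, positions, hs d hd0, ih _ _ _ (update_inv hs hd0)]
    intro i hi
    have := hd (i + 1) (by simpa using hi)
    simp only [List.getElem_cons_succ] at this
    omega

theorem update_range {a : ℕ → ℕ} {s d x : ℕ} (hd : d < s) (hx : ∃ i < s, a i = x) (hxd : x ≠ a d) :
    ∃ i < s - 1, Function.update a d (a (s - 1)) i = x := by
  obtain ⟨i, hi, rfl⟩ := hx
  have hid : i ≠ d := by rintro rfl; exact hxd rfl
  by_cases h : i = s - 1
  · subst h
    exact ⟨d, by omega, by simp⟩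
  · exact ⟨i, by omega, by simp [Function.update_of_ne hid]⟩

/-- An entry not yet chosen survives the overwriting, possibly at the place of the chosen one, and
after `i` choices the array has shrunk to `s - i` places. This gives the range of the `i`-th number.
-/
theorem pickAll_positions (a inv : ℕ → ℕ) (s : ℕ) (xs : List ℕ)
    (hs : ∀ i < s, inv (a i) = i) (hx : ∀ x ∈ xs, ∃ i < s, a i = x) (hn : xs.Nodup) :
    pickAll a s (positions a inv s xs) = xs ∧
      ∀ (i : ℕ) (h : i < (positions a inv s xs).length), (positions a inv s xs)[i] < s - i := by
  induction xs generalizing a inv s with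
  | nil => simp [positions, pickAll]
  | cons x xs ih =>
    obtain ⟨d, hd, rfl⟩ := hx x (by simp)
    obtain ⟨hn1, hn2⟩ := List.nodup_cons.1 hn
    obtain ⟨ih1, ih2⟩ := ih _ _ _ (update_inv hs hd)
      (fun y hy => update_range hd (hx y (by simp [hy])) (by rintro rfl; exact hn1 hy)) hn2
    rw [positions, hs d hd]
    refine ⟨by rw [pickAll, ih1], fun i hi => ?_⟩
    rcases i with _ | i
    · simpa using hd
    · have := ih2 i (by simpa using hi)
      simp only [List.getElem_cons_succ]
      omega

theorem pickAll_spec (a inv : ℕ → ℕ) (s : ℕ) (ds : List ℕ)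
    (hs : ∀ i < s, inv (a i) = i) (hd : ∀ (i : ℕ) (h : i < ds.length), ds[i] < s - i) :
    (pickAll a s ds).Nodup ∧ ∀ x ∈ pickAll a s ds, ∃ i < s, a i = x := by
  induction ds generalizing a inv s with
  | nil => simp [pickAll]
  | cons d ds ih =>
    have hd0 : d < s := by
      have := hd 0 (by simp)
      rw [List.getElem_cons_zero] at this
      omega
    obtain ⟨ih1, ih2⟩ := ih _ _ _ (update_inv hs hd0) (fun i hi => by
      have := hd (i + 1) (by simpa using hi)
      simp only [List.getElem_cons_succ] at this
      omega)
    have h3 : ∀ x ∈ pickAll (Function.update a d (a (s - 1))) (s - 1) ds,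
        (∃ i < s, a i = x) ∧ x ≠ a d := by
      intro x hx
      obtain ⟨i, hi, rfl⟩ := ih2 x hx
      have hne : ∀ j < s, ∀ k < s, a j = a k → j = k := fun j hj k hk h => by
        rw [← hs j hj, ← hs k hk, h]
      by_cases h : i = d
      · subst h
        simp only [Function.update_self]
        exact ⟨⟨s - 1, by omega, rfl⟩, fun h => by have := hne _ (by omega) _ (by omega) h; omega⟩
      · rw [Function.update_of_ne h]
        exact ⟨⟨i, by omega, rfl⟩, fun h' => h (hne _ (by omega) _ (by omega) h')⟩
    rw [pickAll]
    refine ⟨List.nodup_cons.2 ⟨fun h => (h3 _ h).2 rfl, ih1⟩, fun x hx => ?_⟩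
    rcases List.mem_cons.1 hx with rfl | hx
    exacts [⟨d, hd0, rfl⟩, (h3 x hx).1]

end FisherYates

/-! ### Normal words, their codes, and decoding as a left inverse. -/

section Codes

/-- `lab` labels the natural numbers by `0, …, b`, and for `k ≠ 0` the elements with the label `k`
are the elements of the nonempty list `L k` if `k ≤ b`. -/
structure Labelled (b : ℕ) (lab : ℕ → ℕ) (L : ℕ → List ℕ) : Prop where
  two_le : 2 ≤ b
  nodup : ∀ k, (L k).Nodup
  mem : ∀ k x, k ≠ 0 → (x ∈ L k ↔ lab x = k)
  zero : L 0 = []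
  ne_nil : ∀ k, k ≠ 0 → k ≤ b → L k ≠ []
  le : ∀ x, lab x ≤ b

/-- The rotation of `l` that starts at `x`. -/
def startAt (l : List ℕ) (x : ℕ) : List ℕ := l.rotate (l.idxOf x)

/-- The first element of `w` with label `k`. -/
def opening (lab : ℕ → ℕ) (w : List ℕ) (k : ℕ) : ℕ := (w.filter fun x => lab x = k).headD 0

/-- A list of all labelled elements in which, for every label, the elements with this label
occur in the prescribed circular order. -/
structure IsWord (lab : ℕ → ℕ) (L : ℕ → List ℕ) (w : List ℕ) : Prop where
  nodup : w.Nodup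
  mem : ∀ x, x ∈ w ↔ lab x ≠ 0
  rot : ∀ k, k ≠ 0 → (w.filter fun x => lab x = k).IsRotated (L k)

/-- The list begins with an element with label `1`, which is the last one before the first element
with label `2`. -/
def IsNormal (lab : ℕ → ℕ) (w : List ℕ) : Prop :=
  ∃ u y z r, w = u :: (y ++ z :: r) ∧ lab u = 1 ∧ (∀ x ∈ y, lab x ≠ 1 ∧ lab x ≠ 2) ∧ lab z = 2

/-- The rotation of `w` that starts at the first element with label `2`. -/
def circular (lab : ℕ → ℕ) (w : List ℕ) : List ℕ := w.rotate (w.findIdx fun x => lab x = 2)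

/-- The first part of the code of a word: the positions of the openings in their blocks. -/
def encodeOp (lab : ℕ → ℕ) (w : List ℕ) (k : ℕ) : ℕ :=
  Nat.count (fun x => lab x = k) (opening lab w k)

/-- The positions of the openings in the circular word. -/
def openPos (b : ℕ) (lab : ℕ → ℕ) (w : List ℕ) : List ℕ :=
  (List.range (b - 2)).map fun i => (circular lab w).idxOf (opening lab w (i + 3))

/-- The second part of the code of a word. -/
def encodePos (b : ℕ) (lab : ℕ → ℕ) (w : List ℕ) : List ℕ :=
  positions (· + 1) (· - 1) (w.length - 1) (openPos b lab w)

/-- The letter at position `x` of the circular word when the openings of the blocks `3, 4, …` are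
at the positions `xs`. -/
def circ (xs : List ℕ) (x : ℕ) : ℕ :=
  if x = 0 then 2 else if x ∈ xs then xs.idxOf x + 3 else 0

/-- The circular word of length `δ` with code `ds`. -/
def decodeCircle (δ : ℕ) (ds : List ℕ) : List ℕ :=
  (List.range δ).map (circ (pickAll (· + 1) (δ - 1) ds))

/-- The word with the openings `op` and the circular word `O`. -/
def decodeWord (L : ℕ → List ℕ) (op : ℕ → ℕ) (O : List ℕ) : List ℕ :=
  (run (fun k => startAt (L k) (op k))
    ((O.set (lastUnder (fun k => (L k).length) O 0 0 0) 1).rotate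
      (lastUnder (fun k => (L k).length) O 0 0 0)) []).1

/-- A rotation of a list without repetitions is determined by its first element. -/
theorem startAt_eq {l L : List ℕ} (h : l.IsRotated L) (hL : L.Nodup) {x : ℕ} {t : List ℕ}
    (hl : l = x :: t) : startAt L x = l := by
  obtain ⟨n, hn⟩ := h.symm
  have hne : L ≠ [] := by rintro rfl; simp [hl] at hn
  have hpos : 0 < L.length := List.length_pos_iff.2 hne
  have hx : L[n % L.length]'(Nat.mod_lt _ hpos) = x := by
    have h1 := List.getElem_rotate L n 0 (by simpa using hpos)
    simp only [hn, hl, List.getElem_cons_zero, Nat.zero_add] at h1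
    exact h1.symm
  rw [startAt, ← hx, hL.idxOf_getElem, List.rotate_mod, hn]

theorem startAt_cons {L : List ℕ} {x : ℕ} (hx : x ∈ L) : ∃ t, startAt L x = x :: t := by
  obtain ⟨s, t, rfl⟩ := List.append_of_mem hx
  have hi := List.idxOf_lt_length_iff.2 hx
  rcases h : startAt (s ++ x :: t) x with _ | ⟨y, r⟩
  · simp [startAt] at h
  · have h1 := List.getElem_rotate (s ++ x :: t) ((s ++ x :: t).idxOf x) 0 (by simp)
    change (startAt (s ++ x :: t) x)[0]'(by simp [startAt]) = _ at h1
    simp only [h, List.getElem_cons_zero, Nat.zero_add, Nat.mod_eq_of_lt hi,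
      List.getElem_idxOf] at h1
    exact ⟨r, by rw [h1]⟩

theorem startAt_isRotated (L : List ℕ) (x : ℕ) : (startAt L x).IsRotated L :=
  List.IsRotated.forall _ _

theorem findIdx_append_cons (p : ℕ → Bool) (y : List ℕ) (z : ℕ) (r : List ℕ)
    (hy : ∀ x ∈ y, p x = false) (hz : p z = true) : (y ++ z :: r).findIdx p = y.length := by
  induction y with
  | nil => simp [List.findIdx_cons, hz]
  | cons a y ih =>
    rw [List.cons_append, List.findIdx_cons, hy a (by simp),
      ih fun x hx => hy x (List.mem_cons_of_mem _ hx)]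
    simp

theorem circular_eq {lab : ℕ → ℕ} {u z : ℕ} {y r : List ℕ} (hu : lab u = 1)
    (hy : ∀ x ∈ y, lab x ≠ 1 ∧ lab x ≠ 2) (hz : lab z = 2) :
    circular lab (u :: (y ++ z :: r)) = z :: r ++ u :: y := by
  have : (u :: (y ++ z :: r)).findIdx (fun x => decide (lab x = 2)) = (u :: y).length := by
    rw [← List.cons_append]
    refine findIdx_append_cons _ _ _ _ (fun x hx => ?_) (by simp [hz])
    rcases List.mem_cons.1 hx with rfl | hx
    · simp [hu]
    · simp [(hy x hx).2]
  rw [circular, this, ← List.cons_append, List.rotate_append_length_eq]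

/-- Of `m` additional elements, those that are not spent on preventing underflows stay on the stack.
-/
theorem height_mono (sz : ℕ → ℕ) (o : List ℕ) (g m : ℕ) :
    height sz o g ≤ height sz o (g + m) := by
  have h1 := height_add sz o g
  have h2 := height_add sz o (g + m)
  have h3 := under_add sz o g m
  omega

variable {b : ℕ} {lab : ℕ → ℕ} {L : ℕ → List ℕ}

theorem IsWord.opening_iff {w : List ℕ} (hw : IsWord lab L w) (pre : List ℕ) (x : ℕ)
    (v : List ℕ) (h : w = pre ++ x :: v) :
    opening lab w (lab x) = x ↔ ∀ y ∈ pre, lab y ≠ lab x := by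
  rw [opening, h, List.filter_append, List.filter_cons_of_pos (by simp)]
  constructor
  · intro h1 y hy hy'
    have hmem : y ∈ pre.filter fun a => lab a = lab x := by simp [hy, hy']
    rcases h2 : pre.filter (fun a => lab a = lab x) with _ | ⟨a, t⟩
    · rw [h2] at hmem; simp at hmem
    · rw [h2] at h1
      simp only [List.cons_append, List.headD_cons] at h1
      subst h1
      have ha : a ∈ pre := List.mem_of_mem_filter (p := fun c => lab c = lab a) (h2 ▸ by simp)
      have := hw.nodup
      rw [h, List.nodup_append] at this
      exact this.2.2 a ha a (by simp) rfl
  · intro h1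
    rw [List.filter_eq_nil_iff.2 fun y hy => by simpa using h1 y hy]
    simp

theorem Labelled.exists_mem (hL : Labelled b lab L) {k : ℕ} (h0 : k ≠ 0) (hk : k ≤ b) :
    ∃ x, lab x = k := by
  obtain ⟨x, hx⟩ := List.exists_mem_of_ne_nil _ (hL.ne_nil k h0 hk)
  exact ⟨x, (hL.mem k x h0).1 hx⟩

theorem Labelled.nil_of_lt (hL : Labelled b lab L) {k : ℕ} (hk : b < k) : L k = [] := by
  rw [List.eq_nil_iff_forall_not_mem]
  intro x hx
  have := (hL.mem k x (by omega)).1 hx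
  have := hL.le x
  omega

theorem IsWord.filter_cons (hL : Labelled b lab L) {w : List ℕ} (hw : IsWord lab L w) {k : ℕ}
    (h0 : k ≠ 0) (hk : k ≤ b) :
    ∃ t, (w.filter fun x => lab x = k) = opening lab w k :: t := by
  have h1 := hw.rot k h0
  rw [opening]
  rcases h : w.filter fun x => lab x = k with _ | ⟨a, t⟩
  · rw [h, List.isRotated_nil_iff'] at h1
    exact absurd h1.symm (hL.ne_nil k h0 hk)
  · exact ⟨t, rfl⟩

theorem IsWord.lab_opening (hL : Labelled b lab L) {w : List ℕ} (hw : IsWord lab L w) {k : ℕ}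
    (h0 : k ≠ 0) (hk : k ≤ b) : lab (opening lab w k) = k ∧ opening lab w k ∈ w := by
  obtain ⟨t, ht⟩ := hw.filter_cons hL h0 hk
  have : opening lab w k ∈ w.filter fun x => lab x = k := by rw [ht]; simp
  rw [List.mem_filter] at this
  simpa [and_comm] using this

theorem IsWord.startAt_opening (hL : Labelled b lab L) {w : List ℕ} (hw : IsWord lab L w) {k : ℕ}
    (h0 : k ≠ 0) : startAt (L k) (opening lab w k) = w.filter fun x => lab x = k := by
  by_cases hk : k ≤ b
  · obtain ⟨t, ht⟩ := hw.filter_cons hL h0 hk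
    exact startAt_eq (hw.rot k h0) (hL.nodup k) ht
  · rw [hL.nil_of_lt (by omega), startAt, List.rotate_nil, eq_comm]
    rw [← List.isRotated_nil_iff]
    have := hw.rot k h0
    rwa [hL.nil_of_lt (by omega)] at this

theorem length_startAt (l : List ℕ) (x : ℕ) : (startAt l x).length = l.length := by simp [startAt]

theorem IsNormal.opening_two {w : List ℕ} {u z : ℕ} {y r : List ℕ}
    (h : w = u :: (y ++ z :: r)) (hu : lab u = 1) (hy : ∀ x ∈ y, lab x ≠ 1 ∧ lab x ≠ 2)
    (hz : lab z = 2) : opening lab w 1 = u ∧ opening lab w 2 = z := by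
  constructor
  · rw [opening, h, List.filter_cons_of_pos (by simp [hu])]; simp
  · rw [opening, h, List.filter_cons_of_neg (by simp [hu]), List.filter_append,
      List.filter_eq_nil_iff.2 fun x hx => by simpa using (hy x hx).2,
      List.nil_append, List.filter_cons_of_pos (by simp [hz])]
    simp

theorem under_run_eq_zero {e : ℕ → List ℕ} {o w : List ℕ} (h : run e o [] = (w, []))
    (hl : w.length = o.length) : under (fun k => (e k).length) o 0 = 0 := by
  have := run_length e o []
  rw [h] at this
  simp only [List.length_nil] at this
  omega

/-- The circular word of a noncrossing normal word determines the word. -/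
theorem decodeWord_map (hL : Labelled b lab L) {w : List ℕ} (hw : IsWord lab L w)
    (hn : IsNormal lab w) (hc : NonCrossing lab w) :
    decodeWord L (opening lab w) ((circular lab w).map fun x =>
      if lab x = 1 then 0 else letter lab (opening lab w) x) = w := by
  obtain ⟨u, y, z, r, h, hu, hy, hz⟩ := hn
  obtain ⟨h1, h2⟩ := IsNormal.opening_two h hu hy hz
  set op := opening lab w with hop
  set e : ℕ → List ℕ := fun k => startAt (L k) (op k) with he
  have hrun : run e (w.map (letter lab op)) [] = (w, []) := by
    refine run_of_nonCrossing lab op e w (fun x hx => (hw.mem x).1 hx) hw.opening_iff ?_ ?_ hc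
    · simp [he, hL.zero, startAt]
    · intro k hk; exact hw.startAt_opening hL hk
  have hnot : ∀ x ∈ w, x ≠ u → letter lab op x ≠ 1 := by
    intro x hx hxu h3
    rw [letter] at h3
    split_ifs at h3 with h4
    · rw [h3, h1] at h4; exact hxu h4.symm
  have hnd := hw.nodup
  rw [h, List.nodup_cons] at hnd
  have hmapc : ∀ t : List ℕ, (∀ x ∈ t, x ∈ w ∧ x ≠ u) → t.map (fun x =>
      if lab x = 1 then 0 else letter lab op x) = t.map (letter lab op) := by
    intro t ht
    refine List.map_congr_left fun x hx => ?_
    split_ifs with h3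
    · rw [letter, if_neg]
      rw [h3, h1]
      exact (ht x hx).2.symm
    · rfl
  -- Read circularly from `z`, the word is `z :: r`, then `u`, then `y`. Only the letter of `u` is
  -- changed, from `1` to `0`: the other elements of block 1 are no openings.
  have hO : (circular lab w).map (fun x => if lab x = 1 then 0 else letter lab op x) =
      (z :: r).map (letter lab op) ++ 0 :: y.map (letter lab op) := by
    rw [h, circular_eq hu hy hz, List.map_append, List.map_cons (l := y), if_pos hu]
    rw [hmapc, hmapc]
    · intro x hx
      exact ⟨by rw [h]; simp [hx], by rintro rfl; exact hnd.1 (by simp [hx])⟩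
    · intro x hx
      exact ⟨by rw [h]; simp only [List.mem_cons, List.mem_append] at hx ⊢; tauto,
        by rintro rfl; exact hnd.1 (by simp only [List.mem_cons, List.mem_append] at hx ⊢; tauto)⟩
  have hlw : w.map (letter lab op) =
      1 :: (y.map (letter lab op) ++ (z :: r).map (letter lab op)) := by
    rw [h, List.map_cons, List.map_append]
    rw [letter, hu, h1, if_pos rfl]
  set A := (z :: r).map (letter lab op) with hA
  set B := y.map (letter lab op) with hB
  have hsz : (fun k => (e k).length) = fun k => (L k).length := by
    funext k; simp [he, length_startAt]
  set sz : ℕ → ℕ := fun k => (L k).length with hszd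
  have hU : under sz (1 :: (B ++ A)) 0 = 0 := by
    rw [← hlw, ← hsz]
    exact under_run_eq_zero hrun (by simp)
  have hs1 : 0 < sz 1 := List.length_pos_iff.2 (hL.ne_nil 1 (by omega) (by have := hL.two_le; omega))
  have hs0 : sz 0 = 0 := by simp [hszd, hL.zero]
  have hH : height sz (1 :: (B ++ A)) 0 = 0 := by
    have h3 := height_add sz (1 :: (B ++ A)) 0
    have h4 := (run_perm e (w.map (letter lab op)) []).length_eq
    rw [hrun] at h4
    simp only [List.append_nil, List.length_flatMap, hsz] at h4
    rw [hU, ← hlw, List.length_map] at h3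
    rw [← hlw]
    omega
  have hU' : under sz (B ++ A) (sz 1 - 1) = 0 := by
    rw [under, if_neg (by omega)] at hU; simpa using hU
  have hH' : height sz A (height sz B (sz 1 - 1)) = 0 := by
    rw [height] at hH
    have h3 := height_add sz (B ++ A) (sz 1 - 1)
    have h4 := height_add sz B (sz 1 - 1)
    have h5 := height_add sz A (height sz B (sz 1 - 1))
    have h6 := under_append sz B A (sz 1 - 1)
    simp only [Nat.add_zero] at hH
    simp only [List.length_append, List.map_append, List.sum_append] at h3
    omega
  -- The complete word empties the stack. Without the elements that are present when `A` begins, the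
  -- final height cannot be larger.
  have hA0 : height sz A 0 = 0 := by
    have := height_mono sz A 0 (height sz B (sz 1 - 1))
    rw [Nat.zero_add, hH'] at this
    omega
  -- If `B` needed the rest of block 1 to avoid an underflow, an element of block 1 would be popped
  -- within `y`, which contains none.
  have hB0 : under sz B 0 = 0 := by
    by_contra hB0
    obtain ⟨t, ht⟩ := startAt_cons ((hL.mem 1 u (by omega)).2 hu)
    have he1 : e 1 = u :: t := by rw [he]; simp only [h1]; exact ht
    have htl : t.length = sz 1 - 1 := by
      have := congrArg List.length he1
      rw [← hsz]; simp [this]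
    have hBU : under (fun k => (e k).length) B ([] ++ t).length = 0 := by
      rw [under_append] at hU'
      rw [hsz, List.nil_append, htl]; omega
    obtain ⟨x, hx, hx'⟩ := exists_mem_run_of_under e B [] t (by rw [hsz]; exact hB0) hBU
    rw [List.nil_append] at hx' hBU
    have h3 := hrun
    rw [hlw, run_cons_cons (by rw [he1, List.append_nil]), run_append, Prod.mk.injEq, h,
      List.cons.injEq] at h3
    have h4 := run_length e B t
    have h5 : (run e B t).1 = y := by
      refine List.append_inj_left h3.1.2 ?_
      rw [hBU] at h4
      simpa [hB] using h4
    rw [h5] at hx'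
    refine (hy x hx').1 ((hL.mem 1 x (by omega)).1 ?_)
    rw [← (startAt_isRotated (L 1) u).mem_iff, ht]
    exact List.mem_cons_of_mem _ hx
  -- Thus the erased letter stands at the last underflow. Writing `1` there and rotating restores
  -- the letters of `w`.
  rw [hO, decodeWord, lastUnder_eq sz A B 0 0 0 hs0 hA0 hB0, Nat.zero_add,
    List.set_append_right _ _ le_rfl, Nat.sub_self, List.set_cons_zero,
    List.rotate_append_length_eq, List.cons_append, ← hlw]
  rw [hrun]

theorem length_circular (w : List ℕ) : (circular lab w).length = w.length := by simp [circular]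

/-- Different blocks have different openings, and position `0` of the circular word belongs to block
2. -/
theorem openPos_spec (hL : Labelled b lab L) {w : List ℕ} (hw : IsWord lab L w)
    (hn : IsNormal lab w) :
    (openPos b lab w).Nodup ∧ ∀ x ∈ openPos b lab w, 0 < x ∧ x < w.length := by
  have hmem : ∀ i < b - 2, opening lab w (i + 3) ∈ circular lab w := fun i hi =>
    (List.IsRotated.forall w _).mem_iff.2 (hw.lab_opening hL (by omega) (by omega)).2
  have hlt : ∀ i < b - 2, (circular lab w).idxOf (opening lab w (i + 3)) < w.length := fun i hi => by
    have := List.idxOf_lt_length_iff.2 (hmem i hi)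
    rwa [length_circular] at this
  constructor
  · refine List.Nodup.map_on (fun i hi j hj h => ?_) List.nodup_range
    rw [List.mem_range] at hi hj
    have h1 := (List.idxOf_inj (hmem i hi)).1 h
    have h2 := (hw.lab_opening hL (k := i + 3) (by omega) (by omega)).1
    have h3 := (hw.lab_opening hL (k := j + 3) (by omega) (by omega)).1
    rw [h1] at h2
    omega
  · intro x hx
    simp only [openPos, List.mem_map, List.mem_range] at hx
    obtain ⟨i, hi, rfl⟩ := hx
    refine ⟨?_, hlt i hi⟩
    rw [Nat.pos_iff_ne_zero]
    intro h0
    obtain ⟨u, y, z, r, h, hu, hy, hz⟩ := hn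
    have h1 := List.getElem_idxOf (List.idxOf_lt_length_iff.2 (hmem i hi))
    simp only [h0] at h1
    have h2 : ∀ hh, (circular lab w)[0]'hh = z := by
      intro hh; simp only [h, circular_eq hu hy hz]; simp
    rw [h2] at h1
    have h3 := (hw.lab_opening hL (k := i + 3) (by omega) (by omega)).1
    rw [← h1] at h3
    omega

/-- Once the letter `1` is erased, the nonzero letters are `2` at position `0` and `3, …, b` at the
recorded positions. So the positions determine the circular word. -/
theorem circular_map_eq (hL : Labelled b lab L) {w : List ℕ} (hw : IsWord lab L w)
    (hn : IsNormal lab w) :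
    ((circular lab w).map fun x => if lab x = 1 then 0 else letter lab (opening lab w) x) =
      (List.range w.length).map (circ (openPos b lab w)) := by
  obtain ⟨hnd, hpos⟩ := openPos_spec hL hw hn
  obtain ⟨u, y, z, r, h, hu, hy, hz⟩ := hn
  obtain ⟨h1, h2⟩ := IsNormal.opening_two h hu hy hz
  have hcn : (circular lab w).Nodup := (List.IsRotated.forall w _).nodup_iff.2 hw.nodup
  have hcirc := circular_eq (r := r) hu hy hz
  rw [← h] at hcirc
  refine List.ext_getElem (by simp [length_circular]) fun i hi hi' => ?_
  simp only [List.getElem_map, List.getElem_range]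
  simp only [List.length_map, length_circular] at hi
  have hi2 : i < (circular lab w).length := by rwa [length_circular]
  have hidx := hcn.idxOf_getElem i hi2
  generalize hx : (circular lab w)[i] = x at hidx
  have hxw : x ∈ w := (List.IsRotated.forall w (w.findIdx fun x => lab x = 2)).mem_iff.1
    (show x ∈ circular lab w from hx ▸ List.getElem_mem _)
  by_cases hi0 : i = 0
  · subst hi0
    have : x = z := by rw [← hx]; simp only [hcirc]; simp
    subst this
    rw [if_neg (by omega), letter, hz, h2, if_pos rfl, circ, if_pos rfl]
  · have hxz : x ≠ z := by
      rintro rfl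
      have : (circular lab w).idxOf x = 0 := by rw [hcirc]; simp
      omega
    rw [circ, if_neg hi0]
    by_cases hin : i ∈ openPos b lab w
    · rw [if_pos hin]
      have h3 := hin
      simp only [openPos, List.mem_map, List.mem_range] at h3
      obtain ⟨m, hm, hm'⟩ := h3
      have hmo := hw.lab_opening hL (k := m + 3) (by omega) (by omega)
      have hxm : x = opening lab w (m + 3) := by
        refine (List.idxOf_inj (l := circular lab w) (hx ▸ List.getElem_mem _)).1 ?_
        rw [hidx, hm']
      have hlx : lab x = m + 3 := by rw [hxm]; exact hmo.1
      have hm2 : (openPos b lab w).idxOf i = m := by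
        have hlen : m < (openPos b lab w).length := by simpa [openPos] using hm
        have : (openPos b lab w)[m] = i := by simp [openPos, hm']
        rw [← this, hnd.idxOf_getElem]
      rw [if_neg (by omega), letter, hlx, ← hxm, if_pos rfl, hm2]
    · rw [if_neg hin]
      split_ifs with h3
      · rfl
      · rw [letter, if_neg]
        intro h4
        have h5 : lab x ≠ 0 := (hw.mem x).1 hxw
        have h6 : lab x ≠ 2 := by
          intro h6; rw [h6, h2] at h4; exact hxz h4.symm
        have h7 := hL.le x
        refine hin ?_
        simp only [openPos, List.mem_map, List.mem_range]
        refine ⟨lab x - 3, by omega, ?_⟩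
        rw [show lab x - 3 + 3 = lab x by omega, h4, hidx]

/-- The array `(· + 1)` lists the nonzero positions. There are `w.length - 1` of them, and one fewer
for each further block, which yields the bounds in `Code`. -/
theorem encodePos_spec (hL : Labelled b lab L) {w : List ℕ} (hw : IsWord lab L w)
    (hn : IsNormal lab w) :
    pickAll (· + 1) (w.length - 1) (encodePos b lab w) = openPos b lab w ∧
      (encodePos b lab w).length = b - 2 ∧
      ∀ (i : ℕ) (h : i < (encodePos b lab w).length), (encodePos b lab w)[i] < w.length - 1 - i := by
  obtain ⟨hnd, hpos⟩ := openPos_spec hL hw hn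
  obtain ⟨h1, h2⟩ := pickAll_positions (· + 1) (· - 1) (w.length - 1) (openPos b lab w)
    (fun i _ => by simp) (fun x hx => ⟨x - 1, by have := hpos x hx; omega, by
      have := hpos x hx; omega⟩) hnd
  exact ⟨h1, by simp [encodePos, length_positions, openPos], h2⟩

/-- A noncrossing normal word can be reconstructed from its code. -/
theorem decodeWord_encode (hL : Labelled b lab L) {w : List ℕ} (hw : IsWord lab L w)
    (hn : IsNormal lab w) (hc : NonCrossing lab w) :
    decodeWord L (opening lab w) (decodeCircle w.length (encodePos b lab w)) = w := by
  rw [decodeCircle, (encodePos_spec hL hw hn).1, ← circular_map_eq hL hw hn]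
  exact decodeWord_map hL hw hn hc

end Codes

/-! ### The cycle lemma: every code is the code of a normal word. -/

section Decode

variable {b : ℕ} {lab : ℕ → ℕ} {L : ℕ → List ℕ}

/-- The number of all elements of the lists `L 0, …, L b`. -/
def total (b : ℕ) (L : ℕ → List ℕ) : ℕ := ((List.range (b + 1)).map fun k => (L k).length).sum

theorem circ_ne_zero_inj {xs : List ℕ} {i j : ℕ} (h : circ xs i = circ xs j)
    (hi : circ xs i ≠ 0) : i = j := by
  have hj : circ xs j ≠ 0 := h ▸ hi
  unfold circ at h hi hj
  by_cases h1 : i = 0 <;> by_cases h2 : j = 0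
  · omega
  · rw [if_pos h1, if_neg h2] at h
    split_ifs at h
    omega
  · rw [if_neg h1, if_pos h2] at h
    split_ifs at h
    omega
  · rw [if_neg h1] at h hi
    rw [if_neg h2] at h hj
    split_ifs at h hi hj with h3 h4
    · exact (List.idxOf_inj h3).1 (by omega)
    · exact absurd rfl hi

/-- A circular word: the letters other than `0` are `2, …, b`, each of them once. -/
theorem circle_filter {xs : List ℕ} {δ : ℕ} (hb : 2 ≤ b) (hlen : xs.length = b - 2)
    (hn : xs.Nodup) (hpos : ∀ x ∈ xs, 0 < x ∧ x < δ) (hδ : 0 < δ) :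
    List.Perm (((List.range δ).map (circ xs)).filter (· ≠ 0)) (List.range' 2 (b - 1)) := by
  rw [List.perm_ext_iff_of_nodup]
  · intro k
    simp only [List.mem_filter, List.mem_map, List.mem_range, List.mem_range'_1,
      decide_eq_true_eq]
    constructor
    · rintro ⟨⟨i, hi, rfl⟩, h0⟩
      unfold circ at h0 ⊢
      split_ifs at h0 ⊢ with h1 h2
      · omega
      · have := List.idxOf_lt_length_iff.2 h2
        omega
      · omega
    · rintro ⟨h1, h2⟩
      refine ⟨?_, by omega⟩
      by_cases h3 : k = 2
      · exact ⟨0, hδ, by simp [circ, h3]⟩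
      · have h4 : k - 3 < xs.length := by omega
        have h5 := hpos xs[k - 3] (List.getElem_mem _)
        refine ⟨xs[k - 3], h5.2, ?_⟩
        rw [circ, if_neg (by omega), if_pos (List.getElem_mem _), hn.idxOf_getElem]
        omega
  · rw [List.filter_map]
    refine List.Nodup.map_on (fun i hi j hj h => circ_ne_zero_inj h ?_)
      (List.nodup_range.filter _)
    rw [List.mem_filter] at hi
    simpa using hi.2
  · exact List.nodup_range'

theorem flatMap_filter_ne_zero {e : ℕ → List ℕ} (h0 : e 0 = []) (o : List ℕ) :
    (o.filter (· ≠ 0)).flatMap e = o.flatMap e := by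
  induction o with
  | nil => rfl
  | cons k o ih =>
    by_cases hk : k = 0
    · subst hk; simp [h0] at ih ⊢; exact ih
    · rw [List.filter_cons_of_pos (by simpa using hk), List.flatMap_cons, List.flatMap_cons, ih]

theorem formPerm_of_split {α : Type*} [DecidableEq α] {l : List α} (hl : l.Nodup) {s t : List α}
    {x y : α} (h : l = s ++ x :: y :: t) : l.formPerm x = y := by
  subst h
  have h1 := List.formPerm_apply_lt_getElem _ hl s.length (by simp)
  simpa using h1

theorem formPerm_last {α : Type*} [DecidableEq α] {l : List α} {s t : List α}
    {x y : α} (h : l = s ++ [x]) (h' : l = y :: t) : l.formPerm x = y := by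
  rcases s with _ | ⟨z, s⟩
  · subst h
    simp only [List.nil_append, List.cons.injEq] at h'
    simp [h'.1]
  · subst h
    simp only [List.cons_append, List.cons.injEq] at h'
    obtain ⟨rfl, -⟩ := h'
    exact List.formPerm_cons_concat_apply_last _ _ _

theorem formPerm_cases {α : Type*} [DecidableEq α] {l : List α} (hl : l.Nodup) {x : α}
    (hx : x ∈ l) : (∃ s y t, l = s ++ x :: y :: t ∧ l.formPerm x = y) ∨
      ∃ s y t, l = s ++ [x] ∧ l = y :: t ∧ l.formPerm x = y := by
  obtain ⟨s, t, h⟩ := List.append_of_mem hx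
  rcases t with _ | ⟨y, t⟩
  · right
    rcases h' : l with _ | ⟨z, t⟩
    · simp [h'] at hx
    · exact ⟨s, z, t, by rw [← h', h], rfl, h' ▸ formPerm_last h h'⟩
  · exact Or.inl ⟨s, y, t, h, formPerm_of_split hl h⟩

/-- The suffix sums of a word behave like a potential whenever they do so on every block. -/
def SumCond (L : ℕ → List ℕ) (w : List ℕ) : Prop :=
  ∀ g : ℕ → ℚ, (∀ k, ((L k).map g).sum = 0) → ∀ k, ∀ x ∈ L k,
    suffixSum g w ((L k).formPerm x) = suffixSum g w x - g x

/-- By `suffixSum_run`, the suffix sums along a block are the sums of the tails of its list, up to a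
constant. So a step to the next element loses `g x`. The step from the last element back to the
first one is correct because the sum over the block vanishes. -/
theorem sumCond_run {e : ℕ → List ℕ} {o : List ℕ} (he : ∀ k, (e k).IsRotated (L k))
    (hL : ∀ k, (L k).Nodup) (ho : ∀ k, L k ≠ [] → k ∈ o)
    (h0 : under (fun k => (e k).length) o 0 = 0) (hr : (run e o []).2 = [])
    (hn : (run e o []).1.Nodup) : SumCond L (run e o []).1 := by
  intro g hg k x hx
  have hge : ∀ k, ((e k).map g).sum = 0 := fun k => by
    rw [((he k).perm.map g).sum_eq, hg]
  obtain ⟨c, hc⟩ := (suffixSum_run e g o [] (fun k _ => hge k) h0 hr hn).2 k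
    (ho k (List.ne_nil_of_mem hx))
  have hek : (e k).Nodup := (he k).nodup_iff.2 (hL k)
  rw [← List.formPerm_eq_of_isRotated hek (he k)]
  rcases formPerm_cases hek ((he k).mem_iff.2 hx) with ⟨s, y, t, h1, h2⟩ | ⟨s, y, t, h1, h3, h2⟩
  · rw [h2, hc s x (y :: t) h1, hc (s ++ [x]) y t (by simp [h1])]
    simp only [List.map_cons, List.sum_cons]
    ring
  · rw [h2, hc s x [] h1, hc [] y t h3]
    have := hge k
    rw [h3] at this
    simp only [List.map_cons, List.sum_cons] at this
    simp only [List.map_nil, List.sum_nil]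
    linarith

theorem perm_range'_flatMap (hL : Labelled b lab L) {e : ℕ → List ℕ}
    (he : ∀ k, (e k).IsRotated (L k)) :
    ((List.range' 1 b).flatMap e).Nodup ∧
      (∀ x, x ∈ (List.range' 1 b).flatMap e ↔ lab x ≠ 0) ∧
      ((List.range' 1 b).flatMap e).length = total b L := by
  refine ⟨?_, ?_, ?_⟩
  · rw [List.nodup_flatMap]
    refine ⟨fun k _ => (he k).nodup_iff.2 (hL.nodup k), ?_⟩
    refine List.Pairwise.imp_of_mem (R := fun i j => i ≠ j) ?_ (List.nodup_range' (step := 1))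
    intro i j hi hj hij
    simp only [Function.onFun]
    rw [List.disjoint_left]
    intro x hx hx'
    rw [List.mem_range'_1] at hi hj
    have h1 := (hL.mem i x (by omega)).1 ((he i).mem_iff.1 hx)
    have h2 := (hL.mem j x (by omega)).1 ((he j).mem_iff.1 hx')
    exact hij (h1.symm.trans h2)
  · intro x
    rw [List.mem_flatMap]
    constructor
    · rintro ⟨k, hk, hx⟩
      rw [List.mem_range'_1] at hk
      rw [(hL.mem k x (by omega)).1 ((he k).mem_iff.1 hx)]
      omega
    · intro hx
      refine ⟨lab x, ?_, (he _).mem_iff.2 ((hL.mem _ x hx).2 rfl)⟩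
      have := hL.le x
      rw [List.mem_range'_1]; omega
  · have h1 : (fun k => (e k).length) = fun k => (L k).length := by
      funext k; exact (he k).perm.length_eq
    rw [List.length_flatMap, h1, total, List.range_succ_eq_map, List.map_cons, List.sum_cons,
      hL.zero, List.range'_eq_map_range, List.map_map, List.map_map]
    simp only [List.length_nil, Nat.zero_add]
    congr 1
    refine List.map_congr_left fun i _ => ?_
    simp [Nat.add_comm]

/-- The sequence of the letters read by `decodeWord`. -/
def schedule (L : ℕ → List ℕ) (O : List ℕ) : List ℕ :=
  (O.set (lastUnder (fun k => (L k).length) O 0 0 0) 1).rotate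
    (lastUnder (fun k => (L k).length) O 0 0 0)

/-- Every choice of openings and of a circular word yields a normal word. -/
theorem decodeWord_spec (hL : Labelled b lab L) {op : ℕ → ℕ}
    (hop : ∀ k, k ≠ 0 → k ≤ b → lab (op k) = k) {xs : List ℕ} (hlen : xs.length = b - 2)
    (hnd : xs.Nodup) (hpos : ∀ x ∈ xs, 0 < x ∧ x < total b L) {w : List ℕ}
    (hw : w = decodeWord L op ((List.range (total b L)).map (circ xs))) :
    IsWord lab L w ∧ IsNormal lab w ∧ (∀ k, k ≠ 0 → k ≤ b → opening lab w k = op k) ∧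
      openPos b lab w = xs ∧ w.length = total b L ∧ SumCond L w ∧
      under (fun k => (L k).length) (schedule L ((List.range (total b L)).map (circ xs))) 0 = 0 ∧
      ((schedule L ((List.range (total b L)).map (circ xs))).flatMap
        fun k => startAt (L k) (op k)).Nodup ∧
      ((((List.range (total b L)).map (circ xs)).map fun k => (L k).length).sum ≤ total b L) ∧
      (∀ k ∈ schedule L ((List.range (total b L)).map (circ xs)), k ≤ b) ∧
      lastUnder (fun k => (L k).length) ((List.range (total b L)).map (circ xs)) 0 0 0 <
        total b L := by
  set δ := total b L with hδ
  set O := (List.range δ).map (circ xs) with hO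
  set e : ℕ → List ℕ := fun k => startAt (L k) (op k) with he
  have hb := hL.two_le
  have heL : ∀ k, (e k).IsRotated (L k) := fun k => startAt_isRotated _ _
  have hek : ∀ k, k ≠ 0 → k ≤ b → ∃ t, e k = op k :: t := fun k h0 hk =>
    startAt_cons ((hL.mem k _ h0).2 (hop k h0 hk))
  have he0 : e 0 = [] := by simp [he, hL.zero, startAt]
  have hsz : (fun k => (e k).length) = fun k => (L k).length := by
    funext k; simp [he, length_startAt]
  set sz : ℕ → ℕ := fun k => (L k).length with hszd
  have hs0 : sz 0 = 0 := by simp [hszd, hL.zero]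
  have hs : ∀ k, k ≠ 0 → k ≤ b → sz k ≠ 0 := fun k h0 hk =>
    (List.length_pos_iff.2 (hL.ne_nil k h0 hk)).ne'
  obtain ⟨hP1, hP2, hP3⟩ := perm_range'_flatMap hL heL
  have hδpos : 0 < δ := by
    rw [hδ, ← hP3, List.length_flatMap, hsz]
    have : sz 1 ≤ ((List.range' 1 b).map sz).sum :=
      List.single_le_sum (fun _ _ => Nat.zero_le _) _
        (List.mem_map.2 ⟨1, List.mem_range'_1.2 (by omega), rfl⟩)
    have := hs 1 (by omega) (by omega)
    omega
  have hF := circle_filter hb hlen hnd hpos hδpos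
  rw [← hO] at hF
  have hOmem : ∀ k ∈ O, k ≠ 0 → 2 ≤ k ∧ k ≤ b := by
    intro k hk h0
    have := hF.mem_iff.1 (List.mem_filter.2 ⟨hk, by simpa using h0⟩)
    rw [List.mem_range'_1] at this
    omega
  -- all letters together
  have hperm1 : ∀ o : List ℕ, List.Perm (o.filter (· ≠ 0)) (List.range' 1 b) →
      List.Perm (o.flatMap e) ((List.range' 1 b).flatMap e) := by
    intro o ho
    rw [← flatMap_filter_ne_zero he0]
    exact ho.flatMap_right e
  have hrange : List.range' 1 b = 1 :: List.range' 2 (b - 1) := by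
    rw [show b = (b - 1) + 1 by omega, List.range'_succ]; simp
  have hOlen : O.length = δ := by simp [hO]
  have hszsum : (O.map sz).sum + sz 1 = δ := by
    have h1 := hperm1 (1 :: O) (by
      rw [List.filter_cons_of_pos (by simp), hrange]; exact hF.cons 1)
    have h2 := h1.length_eq
    rw [hP3, List.length_flatMap, hsz, List.map_cons, List.sum_cons] at h2
    omega
  have hU0 := height_add sz O 0
  have hs1 := hs 1 (by omega) (by omega)
  -- The letter `1` is missing in `O`, so the pushes fall short of the pops by the size of block 1,
  -- which is positive. Hence there is an underflow.
  obtain ⟨A, B, hAB, hA0, hB0⟩ := exists_last_under sz O 0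
    (fun k hk h0 => hs k h0 (hOmem k hk h0).2) (by omega)
  have hO0 : ∃ O', O = 2 :: O' := by
    rw [hO, show δ = (δ - 1) + 1 by omega, List.range_succ_eq_map, List.map_cons]
    exact ⟨_, by rw [circ, if_pos rfl]⟩
  -- The circle begins with the letter `2`, which pushes something, so the last underflow is not at
  -- position `0`.
  obtain ⟨A', rfl⟩ : ∃ A', A = 2 :: A' := by
    obtain ⟨O', hO'⟩ := hO0
    rcases A with _ | ⟨k, A'⟩
    · rw [hO'] at hAB; simp at hAB
    · rw [hO'] at hAB
      simp only [List.cons_append, List.cons.injEq] at hAB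
      exact ⟨A', by rw [← hAB.1]⟩
  set A := 2 :: A' with hA
  clear_value A
  have hst := lastUnder_eq sz A B 0 0 0 hs0 hA0 hB0
  have hset : (O.set (lastUnder sz O 0 0 0) 1).rotate (lastUnder sz O 0 0 0) = 1 :: (B ++ A) := by
    rw [hAB, hst, Nat.zero_add, List.set_append_right _ _ le_rfl, Nat.sub_self, List.set_cons_zero,
      List.rotate_append_length_eq, List.cons_append]
  set o := 1 :: (B ++ A) with ho
  have hw' : w = (run e o []).1 := by rw [hw, decodeWord, hset]
  have hofilter : List.Perm (o.filter (· ≠ 0)) (List.range' 1 b) := by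
    rw [ho, List.filter_cons_of_pos (by simp), hrange]
    refine List.Perm.cons 1 ?_
    refine List.Perm.trans ?_ hF
    rw [hAB, List.filter_append, List.filter_append, List.filter_cons_of_neg (by simp)]
    exact List.perm_append_comm
  have hoP := hperm1 o hofilter
  have holen : o.length = δ := by
    rw [← hOlen, hAB, ho]; simp only [List.length_cons, List.length_append]; omega
  -- no underflow
  have hBg := under_add sz B 0 (sz 1 - 1)
  have hBh := height_add sz B 0
  have hBh' := height_add sz B (0 + (sz 1 - 1))
  have hAg := under_add sz A 0 (height sz B (sz 1 - 1))
  have hOU : under sz O 0 = under sz A 0 + 1 + under sz B 0 := by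
    rw [hAB, under_append, hA0, under, if_pos (by omega)]; omega
  have hOH : height sz O 0 = height sz B 0 := by
    have h1 := height_add sz A 0
    rw [hAB] at hU0 hOU ⊢
    simp only [List.map_append, List.map_cons, List.sum_append, List.sum_cons,
      List.length_append, List.length_cons] at hU0
    omega
  simp only [Nat.zero_add] at hBg hBh' hAg
  -- The heart of the cycle lemma. When block 1 is pushed first, the height after `B` is `under sz O
  -- 0 - 1`, which equals `under sz A 0`. This is just enough to pay for all underflows of `A`.
  have hou : under sz o 0 = 0 := by
    rw [ho, under, if_neg (by omega), Nat.add_zero, under_append, hAg]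
    omega
  have hrl := run_length e o []
  rw [hsz, List.length_nil, hou, Nat.add_zero, holen] at hrl
  have hrp := run_perm e o []
  rw [List.append_nil] at hrp
  have hrem : (run e o []).2 = [] := by
    have h1 := (hrp.trans hoP).length_eq
    rw [List.length_append, hP3, hrl] at h1
    exact List.length_eq_zero_iff.1 (by omega)
  rw [hrem, List.append_nil, ← hw'] at hrp
  have hwP := hrp.trans hoP
  have hwn : w.Nodup := hwP.nodup_iff.2 hP1
  have homem : ∀ k, k ≠ 0 → k ≤ b → k ∈ o := by
    intro k h0 hk
    have : k ∈ o.filter (· ≠ 0) := hofilter.mem_iff.2 (List.mem_range'_1.2 (by omega))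
    exact List.mem_of_mem_filter this
  -- The list `e k` occurs in the word in its order, and it already contains all elements with label
  -- `k`.
  have hfilter : ∀ k, k ≠ 0 → k ≤ b → (w.filter fun x => lab x = k) = e k := by
    intro k h0 hk
    have h1 := (run_sublist e o []).2 k (homem k h0 hk)
    rw [hrem, List.append_nil, ← hw'] at h1
    have hlab : ∀ x ∈ e k, lab x = k := fun x hx => (hL.mem k x h0).1 ((heL k).mem_iff.1 hx)
    have h2 := h1.filter fun x => decide (lab x = k)
    rw [List.filter_eq_self.2 (by simpa using hlab)] at h2
    refine (h2.eq_of_length_le ?_).symm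
    refine List.Subperm.length_le (List.subperm_of_subset (hwn.filter _) fun x hx => ?_)
    rw [List.mem_filter] at hx
    exact (heL k).mem_iff.2 ((hL.mem k x h0).2 (by simpa using hx.2))
  have hword : IsWord lab L w := by
    refine ⟨hwn, fun x => hwP.mem_iff.trans (hP2 x), fun k h0 => ?_⟩
    by_cases hk : k ≤ b
    · rw [hfilter k h0 hk]; exact heL k
    · rw [hL.nil_of_lt (by omega), List.isRotated_nil_iff, List.filter_eq_nil_iff]
      intro x _ hx
      have := hL.le x
      simp only [decide_eq_true_eq] at hx
      omega
  have hopen : ∀ k, k ≠ 0 → k ≤ b → opening lab w k = op k := by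
    intro k h0 hk
    obtain ⟨t, ht⟩ := hek k h0 hk
    rw [opening, hfilter k h0 hk, ht]; rfl
  have hletter : w.map (letter lab op) = o := by
    rw [hw']
    refine run_map_letter e _ o [] he0 (fun k hk h0 => ?_) (by simp) (by rw [hsz]; exact hou)
    have hkb : k ≤ b := by
      have := hofilter.mem_iff.1 (List.mem_filter.2 ⟨hk, by simpa using h0⟩)
      rw [List.mem_range'_1] at this; omega
    obtain ⟨t, ht⟩ := hek k h0 hkb
    have hnk := (heL k).nodup_iff.2 (hL.nodup k)
    rw [ht, List.nodup_cons] at hnk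
    refine ⟨op k, t, ht, by simp [letter, hop k h0 hkb], fun y hy => ?_⟩
    have hly : lab y = k := (hL.mem k y h0).1 ((heL k).mem_iff.1 (by rw [ht]; simp [hy]))
    rw [letter, hly, if_neg]
    rintro rfl
    exact hnk.1 hy
  -- the word is normal
  obtain ⟨t1, ht1⟩ := hek 1 (by omega) (by omega)
  have hB2 : ∀ k ∈ B, k ≠ 1 ∧ k ≠ 2 := by
    intro k hk
    have hkO : k ∈ O := by rw [hAB]; simp [hk]
    refine ⟨fun h => ?_, fun h => ?_⟩
    · have := hOmem k hkO (by omega)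
      omega
    · have h1 : (O.filter (· ≠ 0)).Nodup := hF.nodup_iff.2 List.nodup_range'
      rw [hAB, hA, List.filter_append, List.nodup_append] at h1
      exact h1.2.2 2 (by simp) 2 (List.mem_filter.2 ⟨by simp [← h, hk], by simp⟩) rfl
  obtain ⟨u, y, z, r, hdec, hyB, hzr⟩ : ∃ u y z r, w = u :: (y ++ z :: r) ∧
      y.map (letter lab op) = B ∧ (z :: r).map (letter lab op) = A := by
    rcases w with _ | ⟨u, w1⟩
    · simp [ho] at hletter
    · rw [List.map_cons, ho, List.cons.injEq] at hletter
      obtain ⟨y, v, hyv, h1, h2⟩ := List.map_eq_append_iff.1 hletter.2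
      rcases v with _ | ⟨z, r⟩
      · simp [hA] at h2
      · exact ⟨u, y, z, r, by rw [hyv], h1, h2⟩
  have hlu : lab u = 1 := by
    have h1 := hletter
    rw [hdec, List.map_cons, ho, List.cons.injEq, letter] at h1
    have := h1.1
    split_ifs at this
    exact this
  have hlz : lab z = 2 := by
    have h1 := hzr
    rw [List.map_cons, hA, List.cons.injEq, letter] at h1
    have := h1.1
    split_ifs at this
    exact this
  -- Since `B` has no underflow of its own, it never reaches the rest of block 1 below. So `y`
  -- contains only elements of blocks opened in `B`, which are neither block 1 nor block 2.
  have hyl : ∀ x ∈ y, lab x ≠ 1 ∧ lab x ≠ 2 := by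
    have h1 : run e o [] = (op 1 :: (run e (B ++ A) t1).1, (run e (B ++ A) t1).2) :=
      run_cons_cons (by rw [ht1, List.append_nil])
    have h2 : run e B t1 = ((run e B []).1, (run e B []).2 ++ t1) := by
      have := run_frame e B [] t1 (by rw [hsz]; exact hB0)
      rwa [List.nil_append] at this
    have h3 : y = (run e B []).1 := by
      have h4 := hdec
      rw [hw', h1, List.cons.injEq, run_append, h2] at h4
      refine (List.append_inj_left h4.2 ?_).symm
      have := run_length e B []
      rw [hsz, List.length_nil, hB0] at this
      rw [Nat.add_zero] at this
      rw [this, ← hyB, List.length_map]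
    intro x hx
    have h5 : x ∈ B.flatMap e := by
      have := (run_perm e B []).mem_iff (a := x)
      rw [List.append_nil] at this
      exact this.1 (List.mem_append_left _ (h3 ▸ hx))
    obtain ⟨k, hk, hxk⟩ := List.mem_flatMap.1 h5
    have hk0 : k ≠ 0 := by rintro rfl; rw [he0] at hxk; simp at hxk
    rw [(hL.mem k x hk0).1 ((heL k).mem_iff.1 hxk)]
    exact hB2 k hk
  have hnormal : IsNormal lab w := ⟨u, y, z, r, hdec, hlu, hyl, hlz⟩
  refine ⟨hword, hnormal, hopen, ?_, by rw [hw', hrl], ?_, ?_, ?_, by omega, fun k hk => ?_, ?_⟩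
  · have hcirc : circular lab w = z :: r ++ u :: y := by rw [hdec, circular_eq hlu hyl hlz]
    have hcn : (circular lab w).Nodup := (List.IsRotated.forall w _).nodup_iff.2 hwn
    have hcm : (circular lab w).map (letter lab op) = O.set A.length 1 := by
      have h1 := hletter
      rw [hdec, List.map_cons, ho, List.cons.injEq] at h1
      rw [hcirc, List.map_append, hzr, List.map_cons, hyB, h1.1, hAB,
        List.set_append_right _ _ le_rfl, Nat.sub_self, List.set_cons_zero]
    have hcl : (circular lab w).length = δ := by rw [length_circular, hw', hrl]
    refine List.ext_getElem (by simp [openPos, hlen]) fun i hi hi' => ?_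
    simp only [openPos, List.getElem_map, List.getElem_range]
    have hx := hpos xs[i] (List.getElem_mem _)
    rw [hopen _ (by omega) (by omega)]
    have hOx : O[xs[i]]'(by omega) = i + 3 := by
      simp only [hO, List.getElem_map, List.getElem_range]
      rw [circ, if_neg (by omega), if_pos (List.getElem_mem _), hnd.idxOf_getElem]
    -- The letter that is replaced by `1` was `0`, so no recorded opening is lost.
    have hxA : A.length ≠ xs[i] := by
      intro h
      have : O[A.length]'(by omega) = 0 := by simp [hAB]
      simp only [h] at this
      omega
    have h2 : ((circular lab w).map (letter lab op))[xs[i]]'(by simp; omega) = i + 3 := by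
      simp only [hcm, List.getElem_set_ne hxA, hOx]
    rw [List.getElem_map] at h2
    have h3 : (circular lab w)[xs[i]]'(by omega) = op (i + 3) := by
      rw [letter] at h2
      split_ifs at h2 with h4
      rw [h2] at h4
      exact h4.symm
    rw [← h3, hcn.idxOf_getElem]
  · rw [hw']
    refine sumCond_run heL hL.nodup (fun k hk => homem k ?_ ?_) (by rw [hsz]; exact hou) hrem
      (hw' ▸ hwn)
    · rintro rfl; exact hk hL.zero
    · by_contra h; exact hk (hL.nil_of_lt (by omega))
  · rw [schedule, hset]; exact hou
  · rw [schedule, hset]; exact hrp.nodup_iff.1 hwn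
  · rw [schedule, hset] at hk
    by_contra h
    have := hofilter.mem_iff.1 (List.mem_filter.2 ⟨hk, by simp; omega⟩)
    rw [List.mem_range'_1] at this
    omega
  · have h1 : A.length < δ := by
      rw [← hOlen, hAB, List.length_append, List.length_cons]; omega
    rw [← hAB] at hst
    rw [hst]; omega

end Decode

set_option linter.unusedSectionVars false

/-! ### Planarity as the vanishing of rational homology. -/

section Flows

variable {V : Type*} [Fintype V] [LinearOrder V] {G : SimpleGraph V}

open Classical in
/-- A unit flow along a path. -/
theorem exists_path_flow {r : V → V → Prop} {a b : V} (h : Relation.ReflTransGen r a b)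
    (hr : ∀ x y, r x y → x ≠ y) :
    ∃ g : V → V → ℚ, (∀ u x, g x u = -g u x) ∧ (∀ u x, g u x ≠ 0 → r u x ∨ r x u) ∧
      ∀ u, ∑ x, g u x = (if u = a then 1 else 0) - (if u = b then 1 else 0) := by
  induction h with
  | refl => exact ⟨0, by simp, by simp, by simp⟩
  | @tail b c _ hbc ih =>
    obtain ⟨g, h1, h2, h3⟩ := ih
    have hne := hr _ _ hbc
    refine ⟨fun u x => g u x + ((if u = b ∧ x = c then 1 else 0) -
      (if u = c ∧ x = b then 1 else 0)), fun u x => ?_, fun u x hux => ?_, fun u => ?_⟩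
    · beta_reduce
      rw [h1 u x]
      simp only [and_comm (a := x = b), and_comm (a := x = c)]
      ring
    · by_cases hg : g u x = 0
      · by_cases h4 : u = b ∧ x = c
        · rw [h4.1, h4.2]; exact Or.inl hbc
        · by_cases h5 : u = c ∧ x = b
          · rw [h5.1, h5.2]; exact Or.inr hbc
          · simp [hg, h4, h5] at hux
      · exact h2 u x hg
    · rw [Finset.sum_add_distrib, h3, Finset.sum_sub_distrib]
      have h4 : ∀ p q : V, ∑ x, (if u = p ∧ x = q then (1 : ℚ) else 0) = if u = p then 1 else 0 := by
        intro p q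
        by_cases hp : u = p <;> simp [hp]
      rw [h4, h4]
      ring

variable (H : G.Subgraph)

/-- Antisymmetric functions on the oriented edges. -/
def chains : Submodule ℚ (V → V → ℚ) where
  carrier := {g | (∀ u x, g x u = -g u x) ∧ ∀ u x, ¬ H.Adj u x → g u x = 0}
  add_mem' := by
    rintro f g ⟨h1, h2⟩ ⟨h3, h4⟩
    refine ⟨fun u x => ?_, fun u x h => ?_⟩
    · simp only [Pi.add_apply, h1 u x, h3 u x]; ring
    · simp only [Pi.add_apply, h2 u x h, h4 u x h]; ring
  zero_mem' := by simp
  smul_mem' := by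
    rintro c f ⟨h1, h2⟩
    refine ⟨fun u x => ?_, fun u x h => ?_⟩
    · simp only [Pi.smul_apply, h1 u x, smul_eq_mul]; ring
    · simp only [Pi.smul_apply, h2 u x h, smul_eq_mul]; ring

/-- The edges of `H` with their orientation towards the larger end. -/
abbrev OrientedEdge := {p : V × V // p.1 < p.2 ∧ H.Adj p.1 p.2}

theorem card_orientedEdge : Nat.card (OrientedEdge H) = H.edgeSet.ncard := by
  rw [← Nat.card_coe_set_eq]
  refine Nat.card_congr (Equiv.ofBijective (fun p => ⟨s(p.1.1, p.1.2), p.2.2⟩) ⟨?_, ?_⟩)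
  · rintro ⟨⟨a, b⟩, h1, h2⟩ ⟨⟨c, d⟩, h3, h4⟩ h
    have h := congrArg Subtype.val h
    change s(a, b) = s(c, d) at h
    rw [Sym2.eq_iff] at h
    simp only [Subtype.mk.injEq, Prod.mk.injEq]
    rcases h with h | ⟨rfl, rfl⟩
    · exact h
    · exact absurd h3 (not_lt.2 h1.le)
  · rintro ⟨e, he⟩
    induction e using Sym2.ind with
    | _ a b =>
      have hab : H.Adj a b := he
      rcases lt_trichotomy a b with h | h | h
      · exact ⟨⟨(a, b), h, hab⟩, rfl⟩
      · exact absurd h hab.ne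
      · exact ⟨⟨(b, a), h, hab.symm⟩, by simp [Sym2.eq_swap]⟩

open Classical in
/-- A chain is determined by its values on the oriented edges. -/
noncomputable def chainsEquiv : chains H ≃ₗ[ℚ] (OrientedEdge H → ℚ) where
  toFun g p := g.1 p.1.1 p.1.2
  map_add' _ _ := rfl
  map_smul' _ _ := rfl
  invFun f := ⟨fun u x => if h : u < x ∧ H.Adj u x then f ⟨(u, x), h⟩ else
      if h : x < u ∧ H.Adj x u then - f ⟨(x, u), h⟩ else 0, by
    refine ⟨fun u x => ?_, fun u x h => ?_⟩ <;> beta_reduce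
    · by_cases h1 : u < x ∧ H.Adj u x
      · have h2 : ¬ (x < u ∧ H.Adj x u) := fun h2 => absurd h1.1 (not_lt.2 h2.1.le)
        rw [dif_neg h2, dif_pos h1, dif_pos h1]
      · by_cases h2 : x < u ∧ H.Adj x u
        · rw [dif_pos h2, dif_neg h1, dif_pos h2, neg_neg]
        · rw [dif_neg h2, dif_neg h1, dif_neg h1, dif_neg h2, neg_zero]
    · rw [dif_neg fun h1 : u < x ∧ H.Adj u x => h h1.2,
        dif_neg fun h1 : x < u ∧ H.Adj x u => h h1.2.symm]⟩
  left_inv := by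
    rintro ⟨g, h1, h2⟩
    ext u x
    simp only
    split_ifs with h3 h4
    · rfl
    · rw [h1 u x, neg_neg]
    · rcases lt_trichotomy u x with h | h | h
      · exact (h2 u x fun h5 => h3 ⟨h, h5⟩).symm
      · exact (h2 u x fun h5 => h5.ne h).symm
      · exact (h2 u x fun h5 => h4 ⟨h, h5.symm⟩).symm
  right_inv := by
    intro f
    ext ⟨p, hp⟩
    simp [hp]

open Classical in
theorem finrank_chains : Module.finrank ℚ (chains H) = H.edgeSet.ncard := by
  rw [(chainsEquiv H).finrank_eq, Module.finrank_fintype_fun_eq_card, ← Nat.card_eq_fintype_card,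
    card_orientedEdge]

/-- The boundary of a chain. -/
noncomputable def boundary : chains H →ₗ[ℚ] (H.verts → ℚ) where
  toFun g u := ∑ x, g.1 u x
  map_add' f g := by ext u; simp [Finset.sum_add_distrib]
  map_smul' c g := by ext u; simp [Finset.mul_sum]

theorem reflTransGen_of_coe_reachable {u w : H.verts} (h : H.coe.Reachable u w) :
    Relation.ReflTransGen H.Adj u w := by
  rw [SimpleGraph.reachable_iff_reflTransGen] at h
  exact Relation.ReflTransGen.lift (r := H.coe.Adj) (p := H.Adj) (fun a : H.verts => (a : V))
    (fun a b hab => hab) _ _ h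

-- The image of the boundary consists of the functions with sum zero. Antisymmetry gives one
-- inclusion; for the other one, a path from `u` to a fixed vertex carries a flow whose boundary is
-- the difference of two point masses, and these differences span.
open Classical in
theorem finrank_range_boundary (hH : H.coe.Connected) :
    Module.finrank ℚ (LinearMap.range (boundary H)) + 1 = H.verts.ncard := by
  let S : (H.verts → ℚ) →ₗ[ℚ] ℚ :=
    { toFun := fun p => ∑ u, p u
      map_add' := fun p q => by simp [Finset.sum_add_distrib]
      map_smul' := fun c p => by simp [Finset.mul_sum] }
  obtain ⟨u0⟩ := hH.nonempty
  have hS : Function.Surjective S := fun c => ⟨Pi.single u0 c, by simp [S]⟩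
  have hrange : LinearMap.range (boundary H) = LinearMap.ker S := by
    apply le_antisymm
    · rintro _ ⟨g, rfl⟩
      rw [LinearMap.mem_ker]
      change ∑ u : H.verts, ∑ x, g.1 u x = 0
      have h1 : ∑ u : H.verts, ∑ x, g.1 u x = ∑ u, ∑ x, g.1 u x := by
        rw [← Finset.sum_subset (Finset.subset_univ H.verts.toFinset)]
        · exact (Finset.sum_subtype _ (by simp) fun u => ∑ x, g.1 u x).symm
        · intro u _ hu
          refine Finset.sum_eq_zero fun x _ => g.2.2 u x fun h => hu ?_
          simpa using h.fst_mem
      have h2 : ∑ u, ∑ x, g.1 u x = -∑ u, ∑ x, g.1 u x := by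
        conv_lhs => rw [Finset.sum_comm]
        rw [← Finset.sum_neg_distrib]
        refine Finset.sum_congr rfl fun u _ => ?_
        rw [← Finset.sum_neg_distrib]
        exact Finset.sum_congr rfl fun x _ => g.2.1 u x
      rw [h1]; linarith
    · intro p hp
      rw [LinearMap.mem_ker] at hp
      have h1 : ∀ u : H.verts, (Pi.single u 1 - Pi.single u0 1 : H.verts → ℚ) ∈
          LinearMap.range (boundary H) := by
        intro u
        obtain ⟨g, h1, h2, h3⟩ := exists_path_flow (reflTransGen_of_coe_reachable H (hH.preconnected u u0))
          fun x y h => h.ne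
        refine ⟨⟨g, h1, fun a b hab => ?_⟩, ?_⟩
        · by_contra h
          rcases h2 a b h with h4 | h4
          exacts [hab h4, hab h4.symm]
        · ext a
          change ∑ x, g a x = _
          rw [h3]
          simp [Pi.single_apply, Subtype.ext_iff]
      have h2 : p = ∑ u, p u • (Pi.single u 1 - Pi.single u0 1 : H.verts → ℚ) := by
        simp only [smul_sub, Finset.sum_sub_distrib, ← Finset.sum_smul]
        change ∑ u, p u = 0 at hp
        rw [hp, zero_smul, sub_zero]
        ext a
        simp [Finset.sum_apply, Pi.single_apply]
      rw [h2]
      exact Submodule.sum_mem _ fun u _ => Submodule.smul_mem _ _ (h1 u)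
  have h1 := LinearMap.finrank_range_add_finrank_ker S
  rw [LinearMap.range_eq_top.2 hS, finrank_top, Module.finrank_self,
    Module.finrank_fintype_fun_eq_card] at h1
  rw [hrange, ← Nat.card_coe_set_eq, Nat.card_eq_fintype_card]
  omega

variable {H}

open Classical in
/-- The difference of a function on the faces along the edges. -/
noncomputable def coboundary (ρ : RotationSystem H) :
    (Quot (fun d d' => d' = ρ.faceStep d) → ℚ) →ₗ[ℚ] chains H where
  toFun f := ⟨fun u x => if h : H.Adj u x then
      f (Quot.mk _ ⟨(u, x), h⟩) - f (Quot.mk _ ⟨(x, u), h.symm⟩) else 0, by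
    refine ⟨fun u x => ?_, fun u x h => dif_neg h⟩
    beta_reduce
    by_cases h : H.Adj u x
    · rw [dif_pos h, dif_pos h.symm]; ring
    · rw [dif_neg h, dif_neg fun h' => h h'.symm, neg_zero]⟩
  map_add' f g := by
    ext u x
    by_cases h : H.Adj u x
    · simp [h]; ring
    · simp [h]
  map_smul' c g := by
    ext u x
    by_cases h : H.Adj u x
    · simp [h]; ring
    · simp [h]

/-- After arriving at `u` from `a`, the boundary of the face leaves along `ρ.next u a`. Hence a
coboundary can be computed inside the rotation at one vertex, as a difference of consecutive values.
-/
theorem mk_next (ρ : RotationSystem H) (u : V) (a : H.neighborSet u) :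
    Quot.mk (fun d d' => d' = ρ.faceStep d) ⟨(u, ρ.next u a), (ρ.next u a).2⟩ =
      Quot.mk (fun d d' => d' = ρ.faceStep d) ⟨((a : V), u), H.adj_symm a.2⟩ := by
  refine (Quot.sound ?_).symm
  rfl

theorem coboundary_apply (ρ : RotationSystem H) (f) (u : V) (a : H.neighborSet u) :
    (coboundary ρ f).1 u a = f (Quot.mk _ ⟨(u, a), a.2⟩) -
      f (Quot.mk _ ⟨(u, ρ.next u a), (ρ.next u a).2⟩) := by
  rw [mk_next]
  exact dif_pos a.2

-- The sum around a vertex telescopes, since `ρ.next u` permutes the neighbours.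
open Classical in
theorem boundary_coboundary (ρ : RotationSystem H) (f) : boundary H (coboundary ρ f) = 0 := by
  ext u
  change ∑ x, (coboundary ρ f).1 u x = 0
  have h1 : ∑ x, (coboundary ρ f).1 u x = ∑ a : H.neighborSet u, (coboundary ρ f).1 u a := by
    rw [← Finset.sum_subset (Finset.subset_univ ((H.neighborSet (u : V)).toFinset))]
    · exact (Finset.sum_subtype _ (by simp) _)
    · intro x _ hx
      exact (coboundary ρ f).2.2 u x (by simpa using hx)
  rw [h1]
  simp only [coboundary_apply, Finset.sum_sub_distrib]
  rw [sub_eq_zero]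
  exact ((ρ.next (u : V)).sum_comp Finset.univ
    (fun a : H.neighborSet (u : V) => f (Quot.mk _ ⟨((u : V), (a : V)), a.2⟩)) (by simp)).symm

/-- The rotation is transitive on the neighbours of `u`. -/
theorem rotation_const {ρ : RotationSystem H} {u : V} {β : Type*} {f : H.neighborSet u → β}
    (h : ∀ a, f (ρ.next u a) = f a) (a b : H.neighborSet u) : f a = f b := by
  obtain ⟨i, hi⟩ := ρ.cyclic u a b
  have h1 : ∀ (i : ℕ) c, f ((ρ.next u ^ i) c) = f c := by
    intro i
    induction i with
    | zero => simp
    | succ i ih => intro c; rw [pow_succ', Equiv.Perm.mul_apply, h, ih]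
  obtain ⟨i, rfl | rfl⟩ := i.eq_nat_or_neg
  · rw [← hi, zpow_natCast, h1]
  · rw [← hi, zpow_neg, zpow_natCast]
    conv_lhs => rw [show a = (ρ.next u ^ i) ((ρ.next u ^ i)⁻¹ a) by simp, h1]

/-- Such a function takes the same value on all edges leaving a vertex and on both orientations of
an edge. Connectedness does the rest. -/
theorem ker_coboundary (hH : H.coe.Connected) (ρ : RotationSystem H) (f)
    (hf : coboundary ρ f = 0) (q q') : f q = f q' := by
  have h0 : ∀ u (a : H.neighborSet u), (coboundary ρ f).1 u a = 0 := fun u a => by rw [hf]; rfl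
  have hrot : ∀ u (a b : H.neighborSet u), f (Quot.mk _ ⟨(u, a), a.2⟩) =
      f (Quot.mk _ ⟨(u, b), b.2⟩) := by
    intro u
    refine rotation_const (ρ := ρ) (f := fun a => f (Quot.mk _ ⟨(u, (a : V)), a.2⟩)) fun a => ?_
    have := h0 u a
    rw [coboundary_apply] at this
    exact (sub_eq_zero.1 this).symm
  have hflip : ∀ u x (h : H.Adj u x), f (Quot.mk _ ⟨(u, x), h⟩) =
      f (Quot.mk _ ⟨(x, u), h.symm⟩) := by
    intro u x h
    have := h0 u ⟨x, h⟩
    exact sub_eq_zero.1 ((dif_pos h).symm.trans this)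
  have key : ∀ u w : V, Relation.ReflTransGen H.Adj u w → ∀ x y (hx : H.Adj u x) (hy : H.Adj w y),
      f (Quot.mk _ ⟨(u, x), hx⟩) = f (Quot.mk _ ⟨(w, y), hy⟩) := by
    intro u w h
    induction h with
    | refl => intro x y hx hy; exact hrot u ⟨x, hx⟩ ⟨y, hy⟩
    | @tail b c _ hbc ih =>
      intro x y hx hy
      rw [ih x c hx hbc, hflip]
      exact hrot c ⟨b, hbc.symm⟩ ⟨y, hy⟩
  induction q using Quot.ind with
  | mk d =>
    induction q' using Quot.ind with
    | mk d' =>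
      obtain ⟨⟨u, x⟩, hd⟩ := d
      obtain ⟨⟨w, y⟩, hd'⟩ := d'
      exact key u w (reflTransGen_of_coe_reachable H (hH.preconnected ⟨u, hd.fst_mem⟩ ⟨w, hd'.fst_mem⟩))
        x y hd hd'

/-- The kernel consists of the constants, so this is the rank-nullity theorem. The edge guarantees
that `faceCount` counts orbits and is not set by the convention for graphs without edges. -/
theorem finrank_range_coboundary (hH : H.coe.Connected) (hE : H.edgeSet.Nonempty)
    (ρ : RotationSystem H) :
    Module.finrank ℚ (LinearMap.range (coboundary ρ)) + 1 = ρ.faceCount := by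
  classical
  have hfin : Finite {p : V × V // H.Adj p.1 p.2} := inferInstance
  have hfin2 : Finite (Quot (fun d d' => d' = ρ.faceStep d)) := Quot.finite _
  let _ := Fintype.ofFinite (Quot (fun d d' => d' = ρ.faceStep d))
  have h1 := LinearMap.finrank_range_add_finrank_ker (coboundary ρ)
  have hne : Nonempty (Quot (fun d d' => d' = ρ.faceStep d)) := by
    obtain ⟨e, he⟩ := hE
    induction e using Sym2.ind with
    | _ a b => exact ⟨Quot.mk _ ⟨(a, b), he⟩⟩
  obtain ⟨q0⟩ := hne
  have hker : LinearMap.ker (coboundary ρ) =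
      Submodule.span ℚ {(fun _ => 1 : Quot (fun d d' => d' = ρ.faceStep d) → ℚ)} := by
    ext f
    rw [LinearMap.mem_ker, Submodule.mem_span_singleton]
    constructor
    · intro hf
      refine ⟨f q0, ?_⟩
      ext q
      simp [ker_coboundary hH ρ f hf q0 q]
    · rintro ⟨c, rfl⟩
      ext u x
      change (if h : H.Adj u x then _ else _) = (0 : ℚ)
      split_ifs <;> simp
  rw [hker, finrank_span_singleton (fun h => by simpa using congrFun h q0),
    Module.finrank_fintype_fun_eq_card] at h1
  rw [RotationSystem.faceCount, if_neg hE.ne_empty, Nat.card_eq_fintype_card]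
  exact h1

open Classical in
/-- A rotation system of a connected graph is planar if and only if every flow is the difference
of a function on the faces. -/
theorem planar_iff (hH : H.coe.Connected) (hE : H.edgeSet.Nonempty) (ρ : RotationSystem H) :
    H.verts.ncard + ρ.faceCount = H.edgeSet.ncard + 2 ↔
    ∀ g : V → V → ℚ, (∀ u x, g x u = -g u x) → (∀ u x, ¬ H.Adj u x → g u x = 0) →
      (∀ u, ∑ x, g u x = 0) → ∃ f : V → V → ℚ, (∀ u x, H.Adj u x → f u x - f x u = g u x) ∧
        ∀ u (a : H.neighborSet u), f u (ρ.next u a) = f u a - g u a := by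
  have h1 := finrank_range_coboundary hH hE ρ
  have h2 := finrank_range_boundary H hH
  have h3 := LinearMap.finrank_range_add_finrank_ker (boundary H)
  rw [finrank_chains] at h3
  have hle : LinearMap.range (coboundary ρ) ≤ LinearMap.ker (boundary H) := by
    rintro _ ⟨f, rfl⟩
    exact boundary_coboundary ρ f
  -- The coboundaries have dimension faces minus one, the flows have dimension edges minus vertices
  -- plus one, and the former are contained in the latter. So Euler's formula says that the two
  -- spaces coincide.
  have h4 : H.verts.ncard + ρ.faceCount = H.edgeSet.ncard + 2 ↔
      LinearMap.range (coboundary ρ) = LinearMap.ker (boundary H) := by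
    constructor
    · intro h
      exact Submodule.eq_of_le_of_finrank_eq hle (by omega)
    · intro h
      rw [h] at h1
      omega
  rw [h4]
  constructor
  · intro h g hg1 hg2 hg3
    have hg : (⟨g, hg1, hg2⟩ : chains H) ∈ LinearMap.range (coboundary ρ) := by
      rw [h, LinearMap.mem_ker]
      ext u
      exact hg3 u
    obtain ⟨f, hf⟩ := hg
    have hfg : ∀ u x, (coboundary ρ f).1 u x = g u x := fun u x => by rw [hf]
    refine ⟨fun u x => if h : H.Adj u x then f (Quot.mk _ ⟨(u, x), h⟩) else 0, fun u x hux => ?_,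
      fun u a => ?_⟩
    · beta_reduce
      rw [← hfg, dif_pos hux, dif_pos hux.symm]
      exact Eq.symm (show (coboundary ρ f).1 u x = _ from dif_pos hux)
    · have ha : H.Adj u a := a.2
      have hb : H.Adj u (ρ.next u a) := (ρ.next u a).2
      beta_reduce
      rw [dif_pos ha, dif_pos hb, ← hfg, coboundary_apply]
      ring
  · intro h
    refine le_antisymm hle ?_
    rintro ⟨g, hg1, hg2⟩ hg
    rw [LinearMap.mem_ker] at hg
    obtain ⟨f, hf1, hf2⟩ := h g hg1 hg2 fun u => by
      by_cases hu : u ∈ H.verts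
      · exact congrFun hg ⟨u, hu⟩
      · exact Finset.sum_eq_zero fun x _ => hg2 u x fun h => hu h.fst_mem
    -- Together the two conditions on `f` say that it does not change along `faceStep`, so it is a
    -- function on the faces.
    refine ⟨Quot.lift (fun d => f d.1.1 d.1.2) ?_, ?_⟩
    · rintro ⟨⟨u, w⟩, hd⟩ d' rfl
      have h5 := hf2 w ⟨u, hd.symm⟩
      have h6 := hf1 u w hd
      have h7 := hg1 u w
      change f u w = f w (ρ.next w ⟨u, hd.symm⟩)
      rw [h5, h7]
      linarith
    · ext u x
      by_cases hux : H.Adj u x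
      · exact (dif_pos hux).trans (hf1 u x hux)
      · exact (dif_neg hux).trans (hg2 u x hux).symm

end Flows

/-! ### Blocks at a cut-vertex meet only there. -/

section Blocks

variable {V : Type*} {G : SimpleGraph V}

/-- Adjacency in `K` without the vertex `x`. -/
def AdjAvoiding (K : G.Subgraph) (x a b : V) : Prop := K.Adj a b ∧ a ≠ x ∧ b ≠ x

theorem coe_preconnected_iff (K : G.Subgraph) :
    K.coe.Preconnected ↔ ∀ a ∈ K.verts, ∀ b ∈ K.verts, Relation.ReflTransGen K.Adj a b := by
  constructor
  · intro h a ha b hb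
    have := h ⟨a, ha⟩ ⟨b, hb⟩
    rw [SimpleGraph.reachable_iff_reflTransGen] at this
    exact Relation.ReflTransGen.lift (r := K.coe.Adj) (p := K.Adj) (fun a : K.verts => (a : V))
      (fun a b hab => hab) _ _ this
  · rintro h ⟨a, ha⟩ ⟨b, hb⟩
    have key : ∀ b, Relation.ReflTransGen K.Adj a b → ∀ hb : b ∈ K.verts,
        K.coe.Reachable ⟨a, ha⟩ ⟨b, hb⟩ := by
      intro b hab
      induction hab with
      | refl => intro _; exact SimpleGraph.Reachable.refl _
      | @tail b c _ hbc ih =>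
        intro hc
        exact (ih hbc.fst_mem).trans (SimpleGraph.Adj.reachable (by exact hbc))
    exact key b (h a ha b hb) hb

theorem not_isCutVertex_iff (K : G.Subgraph) (x : K.verts) :
    ¬ IsCutVertex K.coe x ↔ ∀ a ∈ K.verts, ∀ b ∈ K.verts, a ≠ x → b ≠ x →
      Relation.ReflTransGen (AdjAvoiding K x) a b := by
  rw [IsCutVertex, not_not]
  constructor
  · intro h a ha b hb hax hbx
    have := h ⟨⟨a, ha⟩, fun h => hax (congrArg Subtype.val h)⟩
      ⟨⟨b, hb⟩, fun h => hbx (congrArg Subtype.val h)⟩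
    rw [SimpleGraph.reachable_iff_reflTransGen] at this
    refine Relation.ReflTransGen.lift (p := AdjAvoiding K x)
      (fun a : {u : K.verts | u ≠ x} => ((a : K.verts) : V)) (fun a b hab => ?_) _ _ this
    exact ⟨hab, fun h => a.2 (Subtype.ext h), fun h => b.2 (Subtype.ext h)⟩
  · rintro h ⟨⟨a, ha⟩, hax⟩ ⟨⟨b, hb⟩, hbx⟩
    have key : ∀ b, Relation.ReflTransGen (AdjAvoiding K x) a b → ∀ (hb : b ∈ K.verts)
        (hbx : (⟨b, hb⟩ : K.verts) ∈ {u : K.verts | u ≠ x}),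
        (K.coe.induce {u | u ≠ x}).Reachable ⟨⟨a, ha⟩, hax⟩ ⟨⟨b, hb⟩, hbx⟩ := by
      intro b hab
      induction hab with
      | refl => intro _ _; exact SimpleGraph.Reachable.refl _
      | @tail b c _ hbc ih =>
        intro hc hcx
        refine (ih hbc.1.fst_mem fun h => hbc.2.1 (congrArg Subtype.val h)).trans
          (SimpleGraph.Adj.reachable ?_)
        exact hbc.1
    exact key b (h a ha b hb (fun h => hax (Subtype.ext h)) fun h => hbx (Subtype.ext h)) hb hbx

/-- Connected without a cut-vertex. -/
def Biconnected (K : G.Subgraph) : Prop := K.coe.Connected ∧ ∀ u, ¬ IsCutVertex K.coe u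

/-- If `x` is not in `K`, connectedness suffices, since no path in `K` meets `x`. -/
theorem Biconnected.avoiding {K : G.Subgraph} (hK : Biconnected K) (x : V) {a b : V}
    (ha : a ∈ K.verts) (hb : b ∈ K.verts) (hax : a ≠ x) (hbx : b ≠ x) :
    Relation.ReflTransGen (AdjAvoiding K x) a b := by
  by_cases hx : x ∈ K.verts
  · exact (not_isCutVertex_iff K ⟨x, hx⟩).1 (hK.2 _) a ha b hb hax hbx
  · have := (coe_preconnected_iff K).1 hK.1.preconnected a ha b hb
    refine Relation.ReflTransGen.mono (fun a b hab => ?_) _ _ this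
    exact ⟨hab, fun h => hx (h ▸ hab.fst_mem), fun h => hx (h ▸ hab.snd_mem)⟩

/-- Whichever vertex is removed, one of the two common vertices is left, and every other vertex can
be joined to it inside `H` or inside `K`. -/
theorem Biconnected.sup {H K : G.Subgraph} (hH : Biconnected H) (hK : Biconnected K) {u v : V}
    (huv : u ≠ v) (hu : u ∈ H.verts ∧ u ∈ K.verts) (hv : v ∈ H.verts ∧ v ∈ K.verts) :
    Biconnected (H ⊔ K) := by
  have hav : ∀ x, ∀ a ∈ (H ⊔ K).verts, ∀ b ∈ (H ⊔ K).verts, a ≠ x → b ≠ x →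
      Relation.ReflTransGen (AdjAvoiding (H ⊔ K) x) a b := by
    intro x a ha b hb hax hbx
    obtain ⟨s, hsx, hs⟩ : ∃ s, s ≠ x ∧ s ∈ H.verts ∧ s ∈ K.verts := by
      by_cases h : u = x
      · exact ⟨v, fun h' => huv (h.trans h'.symm), hv⟩
      · exact ⟨u, h, hu⟩
    have h1 : ∀ a ∈ (H ⊔ K).verts, ∀ b ∈ (H ⊔ K).verts, a ≠ x → b ≠ x →
        (a = s ∨ b = s) → Relation.ReflTransGen (AdjAvoiding (H ⊔ K) x) a b := by
      intro a ha b hb hax hbx hab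
      have : (a ∈ H.verts ∧ b ∈ H.verts) ∨ (a ∈ K.verts ∧ b ∈ K.verts) := by
        rw [SimpleGraph.Subgraph.verts_sup] at ha hb
        rcases hab with rfl | rfl
        · rcases hb with hb | hb
          exacts [Or.inl ⟨hs.1, hb⟩, Or.inr ⟨hs.2, hb⟩]
        · rcases ha with ha | ha
          exacts [Or.inl ⟨ha, hs.1⟩, Or.inr ⟨ha, hs.2⟩]
      rcases this with h | h
      · exact Relation.ReflTransGen.mono (fun _ _ h => ⟨Or.inl h.1, h.2⟩) _ _
          (hH.avoiding x h.1 h.2 hax hbx)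
      · exact Relation.ReflTransGen.mono (fun _ _ h => ⟨Or.inr h.1, h.2⟩) _ _
          (hK.avoiding x h.1 h.2 hax hbx)
    exact (h1 a ha s (Or.inl hs.1) hax hsx (Or.inr rfl)).trans
      (h1 s (Or.inl hs.1) b hb hsx hbx (Or.inl rfl))
  refine ⟨?_, fun x => (not_isCutVertex_iff _ x).2 (hav x)⟩
  have h2 : ∀ a ∈ (H ⊔ K).verts, Relation.ReflTransGen (H ⊔ K).Adj a u ∧
      Relation.ReflTransGen (H ⊔ K).Adj u a := by
    intro a ha
    rcases ha with ha | ha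
    · have h := (coe_preconnected_iff H).1 hH.1.preconnected
      exact ⟨Relation.ReflTransGen.mono (fun _ _ h => Or.inl h) _ _ (h a ha u hu.1),
        Relation.ReflTransGen.mono (fun _ _ h => Or.inl h) _ _ (h u hu.1 a ha)⟩
    · have h := (coe_preconnected_iff K).1 hK.1.preconnected
      exact ⟨Relation.ReflTransGen.mono (fun _ _ h => Or.inr h) _ _ (h a ha u hu.2),
        Relation.ReflTransGen.mono (fun _ _ h => Or.inr h) _ _ (h u hu.2 a ha)⟩
  have hne : Nonempty (H ⊔ K).verts := ⟨⟨u, Or.inl hu.1⟩⟩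
  exact ⟨(coe_preconnected_iff _).2 fun a ha b hb => (h2 a ha).1.trans (h2 b hb).2⟩

theorem biconnected_edge {u w : V} (h : G.Adj u w) : Biconnected (G.subgraphOfAdj h) := by
  refine ⟨(SimpleGraph.Subgraph.subgraphOfAdj_connected h).1, fun x => ?_⟩
  rw [not_isCutVertex_iff]
  intro a ha b hb hax hbx
  by_cases hab : a = b
  · subst hab; exact Relation.ReflTransGen.refl
  · refine Relation.ReflTransGen.single ⟨?_, hax, hbx⟩
    simp only [SimpleGraph.subgraphOfAdj_verts, Set.mem_insert_iff, Set.mem_singleton_iff] at ha hb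
    rw [SimpleGraph.subgraphOfAdj_adj]
    rcases ha with rfl | rfl <;> rcases hb with rfl | rfl
    · exact absurd rfl hab
    · rfl
    · exact Sym2.eq_swap
    · exact absurd rfl hab

theorem IsBlock.eq_of_le {H K : G.Subgraph} (hH : IsBlock G H) (hK : Biconnected K) (h : H ≤ K) :
    H = K := Maximal.eq_of_le hH hK h

theorem exists_isBlock [Finite V] {K : G.Subgraph} (hK : Biconnected K) :
    ∃ H, K ≤ H ∧ IsBlock G H :=
  Finite.exists_le_maximal hK

/-- The blocks at a cut-vertex `v`: connected graphs that meet only in `v`. -/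
structure Wedge {b : ℕ} (v : V) (B : Fin b → G.Subgraph) : Prop where
  two_le : 2 ≤ b
  mem : ∀ j, v ∈ (B j).verts
  connected : ∀ j, (B j).coe.Connected
  avoiding : ∀ j, ∀ x ∈ (B j).verts, ∀ y ∈ (B j).verts, x ≠ v → y ≠ v →
    Relation.ReflTransGen (AdjAvoiding (B j) v) x y
  inter : ∀ i j u, i ≠ j → u ∈ (B i).verts → u ∈ (B j).verts → u = v
  nbr : ∀ j, ∃ w, (B j).Adj v w
  cover : ∀ w, G.Adj v w → ∃ j, (B j).Adj v w

/-- A path from any other vertex to `v`, stopped just before it first reaches `v`, ends in a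
neighbour of `v`. -/
theorem not_isCutVertex_of_neighbors (hG : G.Connected) {v : V}
    (h : ∀ a b, G.Adj v a → G.Adj v b →
      Relation.ReflTransGen (fun x y => G.Adj x y ∧ x ≠ v ∧ y ≠ v) a b) :
    ¬ IsCutVertex G v := by
  rw [IsCutVertex, not_not]
  set r := fun x y => G.Adj x y ∧ x ≠ v ∧ y ≠ v with hr
  have hsymm : ∀ x y, Relation.ReflTransGen r x y → Relation.ReflTransGen r y x := by
    intro x y hxy
    induction hxy with
    | refl => exact Relation.ReflTransGen.refl
    | tail _ h1 ih => exact Relation.ReflTransGen.head ⟨h1.1.symm, h1.2.2, h1.2.1⟩ ih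
  have h1 : ∀ a, a ≠ v → ∃ w, G.Adj v w ∧ Relation.ReflTransGen r a w := by
    intro a ha
    have h2 := hG.preconnected a v
    rw [SimpleGraph.reachable_iff_reflTransGen] at h2
    have key : ∀ a, Relation.ReflTransGen G.Adj a v → a ≠ v →
        ∃ w, G.Adj v w ∧ Relation.ReflTransGen r a w := by
      intro a h2
      induction h2 using Relation.ReflTransGen.head_induction_on with
      | refl => intro h; exact absurd rfl h
      | @head a c hac _ ih =>
        intro ha
        by_cases hc : c = v
        · subst hc; exact ⟨a, hac.symm, Relation.ReflTransGen.refl⟩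
        · obtain ⟨w, hw, hw'⟩ := ih hc
          exact ⟨w, hw, Relation.ReflTransGen.head ⟨hac, ha, hc⟩ hw'⟩
    exact key a h2 ha
  rintro ⟨a, ha⟩ ⟨b, hb⟩
  obtain ⟨w, hw, haw⟩ := h1 a ha
  obtain ⟨w', hw', hbw⟩ := h1 b hb
  have hab := (haw.trans (h w w' hw hw')).trans (hsymm _ _ hbw)
  have key : ∀ b, Relation.ReflTransGen r a b → ∀ hb : b ∈ {u | u ≠ v},
      (G.induce {u | u ≠ v}).Reachable ⟨a, ha⟩ ⟨b, hb⟩ := by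
    intro b hab
    induction hab with
    | refl => intro _; exact SimpleGraph.Reachable.refl _
    | tail _ hbc ih =>
      intro hc
      exact (ih hbc.2.1).trans (SimpleGraph.Adj.reachable (by exact hbc.1))
  exact key b hab hb

theorem exists_adj_of_isCutVertex (hG : G.Connected) {v : V} (hv : IsCutVertex G v) :
    ∃ w, G.Adj v w := by
  by_contra h
  exact not_isCutVertex_of_neighbors hG (fun a _ ha => absurd ⟨a, ha⟩ h) hv

/-- All that is needed later about blocks is contained in `Wedge`. -/
theorem wedge_of_blocks [Finite V] (hG : G.Connected) {v : V} (hv : IsCutVertex G v) {b : ℕ}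
    {B : Fin b → G.Subgraph} (hinj : Function.Injective B)
    (hB : ∀ H : G.Subgraph, (∃ j, B j = H) ↔ IsBlock G H ∧ v ∈ H.verts) : Wedge v B := by
  have hBb : ∀ j, IsBlock G (B j) := fun j => ((hB (B j)).1 ⟨j, rfl⟩).1
  have hBn : ∀ j, Biconnected (B j) := fun j => (hBb j).1
  have hBv : ∀ j, v ∈ (B j).verts := fun j => ((hB (B j)).1 ⟨j, rfl⟩).2
  have hcover : ∀ w, G.Adj v w → ∃ j, (B j).Adj v w := by
    intro w hw
    obtain ⟨H, hle, hH⟩ := exists_isBlock (biconnected_edge hw)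
    have hvw : H.Adj v w := (SimpleGraph.subgraphOfAdj_le_iff hw H).1 hle
    obtain ⟨j, rfl⟩ := (hB H).2 ⟨hH, hvw.fst_mem⟩
    exact ⟨j, hvw⟩
  obtain ⟨w0, hw0⟩ := exists_adj_of_isCutVertex hG hv
  refine ⟨?_, hBv, fun j => (hBn j).1, fun j x hx y hy => (hBn j).avoiding v hx hy, ?_, ?_, hcover⟩
  -- With a single block, all neighbours of `v` would be connected without `v`.
  · by_contra hb
    refine not_isCutVertex_of_neighbors hG (fun x y hx hy => ?_) hv
    obtain ⟨i, hi⟩ := hcover x hx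
    obtain ⟨j, hj⟩ := hcover y hy
    have hij : i = j := by ext; omega
    subst hij
    exact Relation.ReflTransGen.mono (fun _ _ h => ⟨h.1.adj_sub, h.2⟩) _ _
      ((hBn i).avoiding v hi.snd_mem hj.snd_mem hx.ne' hy.ne')
  -- Two blocks with a second common vertex would have a biconnected union, against maximality.
  · intro i j u hij hui huj
    by_contra huv
    have hs := (hBn i).sup (hBn j) huv ⟨hui, huj⟩ ⟨hBv i, hBv j⟩
    exact hij (hinj (((hBb i).eq_of_le hs le_sup_left).trans
      ((hBb j).eq_of_le hs le_sup_right).symm))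
  -- A block without a neighbour of `v` would consist of `v` alone and be properly contained in an
  -- edge at `v`.
  · intro j
    by_contra h
    have hsub : ∀ x ∈ (B j).verts, x = v := by
      intro x hx
      by_contra hxv
      have := (coe_preconnected_iff _).1 (hBn j).1.preconnected v (hBv j) x hx
      rcases Relation.ReflTransGen.cases_head this with h1 | ⟨c, hc, -⟩
      · exact hxv h1.symm
      · exact h ⟨c, hc⟩
    have hle : B j ≤ G.subgraphOfAdj hw0 := by
      refine ⟨fun x hx => by simp [hsub x hx], fun x y hxy => ?_⟩
      exact absurd ((hsub x hxy.fst_mem).trans (hsub y hxy.snd_mem).symm) hxy.ne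
    have := (hBb j).eq_of_le (biconnected_edge hw0) hle
    exact h ⟨w0, by rw [this]; exact SimpleGraph.subgraphOfAdj_adj_self hw0⟩

end Blocks

set_option linter.unusedSectionVars false

/-! ### Circular lists: first returns, suffix sums and separation. -/

section Lists

variable {α : Type*} [DecidableEq α]

theorem formPerm_map {β : Type*} [DecidableEq β] {f : α → β} (hf : Function.Injective f)
    {l : List α} (hl : l.Nodup) {a : α} (ha : a ∈ l) :
    (l.map f).formPerm (f a) = f (l.formPerm a) := by
  obtain ⟨i, hi, rfl⟩ := List.mem_iff_getElem.1 ha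
  have h1 := List.formPerm_apply_getElem (l.map f) (hl.map hf) i (by simpa using hi)
  rw [List.formPerm_apply_getElem l hl i hi]
  simpa using h1

/-- Going around a circle and noting only the elements with `p` gives the circular order of the
filtered list. This links `RestrictsTo` with filtering; after a rotation, `a` stands in front. -/
theorem first_return {l : List α} (hl : l.Nodup) (p : α → Prop) [DecidablePred p] {a : α}
    (ha : a ∈ l) (hp : p a) :
    ∃ k : ℕ, 0 < k ∧ (l.formPerm ^ k) a = (l.filter p).formPerm a ∧
      ∀ i, 0 < i → i < k → ¬ p ((l.formPerm ^ i) a) := by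
  obtain ⟨s, t, h⟩ := List.append_of_mem ha
  have hrot : l.IsRotated (a :: (t ++ s)) := by
    rw [h, ← List.cons_append]; exact List.isRotated_append
  have hn := hrot.nodup_iff.1 hl
  have hrot' : (l.filter p).IsRotated ((a :: (t ++ s)).filter p) := by
    rw [h, List.filter_append, ← List.cons_append, List.filter_append]; exact List.isRotated_append
  rw [List.formPerm_eq_of_isRotated hl hrot,
    List.formPerm_eq_of_isRotated (hl.filter _) hrot', List.filter_cons_of_pos (by simpa using hp)]
  generalize t ++ s = t at hn
  have hpow : ∀ i, ((a :: t).formPerm ^ i) a = (a :: t)[i % (t.length + 1)]'(Nat.mod_lt _ (by simp)) := by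
    intro i
    have := List.formPerm_pow_apply_getElem (a :: t) hn i 0 (by simp)
    simpa using this
  rcases ht : t.filter p with _ | ⟨c, r⟩
  -- If `a` is the only element with `p`, it is met again after a full turn.
  · refine ⟨t.length + 1, by omega, ?_, fun i h0 hi => ?_⟩
    · have := List.formPerm_pow_length_eq_one_of_nodup _ hn
      rw [List.length_cons] at this
      rw [this, ht]; simp
    · rw [hpow]
      simp only [Nat.mod_eq_of_lt hi]
      obtain ⟨i, rfl⟩ := Nat.exists_eq_succ_of_ne_zero h0.ne'
      rw [List.filter_eq_nil_iff] at ht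
      have := ht _ (List.getElem_mem (l := t) (n := i) (by omega))
      simpa using this
  · obtain ⟨t1, t2, rfl, h1, h2, -⟩ := List.filter_eq_cons_iff.1 ht
    refine ⟨t1.length + 1, by omega, ?_, fun i h0 hi => ?_⟩
    · rw [hpow]
      have hn2 := hn.filter p
      rw [List.filter_cons_of_pos (by simpa using hp), ht] at hn2
      rw [ht, List.formPerm_apply_head _ _ _ hn2]
      simp only [Nat.mod_eq_of_lt (show t1.length + 1 < (t1 ++ c :: t2).length + 1 by simp)]
      simp
    · rw [hpow]
      obtain ⟨i, rfl⟩ := Nat.exists_eq_succ_of_ne_zero h0.ne'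
      have hi' : i < t1.length := by omega
      have hlt : i.succ < (t1 ++ c :: t2).length + 1 := by simp; omega
      simp only [Nat.mod_eq_of_lt hlt]
      have := h1 _ (List.getElem_mem (l := t1) (n := i) hi')
      simp only [Nat.succ_eq_add_one, List.getElem_cons_succ, List.getElem_append_left hi']
      simpa using this

theorem suffixSum_split {g : α → ℚ} {s t : List α} {x : α} (hn : (s ++ x :: t).Nodup) :
    suffixSum g (s ++ x :: t) x = g x + (t.map g).sum := by
  induction s with
  | nil => simp [suffixSum]
  | cons y s ih =>
    rw [List.cons_append, List.nodup_cons] at hn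
    rw [List.cons_append, suffixSum, if_neg, ih hn.2]
    rintro rfl
    exact hn.1 (by simp)

/-- Passing to the next element removes `g x` from the suffix. From the last element to the first
one this remains true because the total is zero. -/
theorem suffixSum_formPerm {g : α → ℚ} {l : List α} (hn : l.Nodup) (hg : (l.map g).sum = 0)
    {x : α} (hx : x ∈ l) : suffixSum g l (l.formPerm x) = suffixSum g l x - g x := by
  rcases formPerm_cases hn hx with ⟨s, y, t, h1, h2⟩ | ⟨s, y, t, h1, h3, h2⟩
  · have e1 : suffixSum g l x = g x + ((y :: t).map g).sum := by
      rw [h1] at hn ⊢; exact suffixSum_split hn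
    have e2 : suffixSum g l y = g y + (t.map g).sum := by
      have h4 : l = (s ++ [x]) ++ y :: t := by rw [h1]; simp
      rw [h4] at hn ⊢; exact suffixSum_split hn
    rw [h2, e1, e2]
    simp only [List.map_cons, List.sum_cons]
    ring
  · have e1 : suffixSum g l x = g x := by
      rw [h1] at hn ⊢; rw [suffixSum_split hn]; simp
    have e2 : suffixSum g l y = 0 := by
      rw [h3] at hg ⊢; rw [suffixSum, if_pos rfl]; simpa using hg
    rw [h2, e1, e2]; ring

theorem sub_sum_of_steps {F h : α → ℚ} {l : List α}
    (hF : ∀ s p q t, l = s ++ p :: q :: t → F q = F p - h p) :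
    ∀ (m s : List α) (p q : α) (t : List α), l = s ++ p :: (m ++ q :: t) →
      F q = F p - h p - (m.map h).sum := by
  intro m
  induction m with
  | nil => intro s p q t hl; rw [hF s p q t (by simpa using hl)]; simp
  | cons a m ih =>
    intro s p q t hl
    rw [ih (s ++ [p]) a q t (by simp [hl]), hF s p a (m ++ q :: t) (by simpa using hl)]
    simp only [List.map_cons, List.sum_cons]
    ring

/-- A potential that changes only at `x` and `y` distinguishes elements separated by `x`, `y`. -/
theorem ne_of_separated {F : α → ℚ} {l : List α} (hn : l.Nodup) {x y z z' : α}
    (hF : ∀ s p q t, l = s ++ p :: q :: t → F q = F p -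
      ((if p = x then 1 else 0) - (if p = y then 1 else 0)))
    (hs : [x, z, y, z'].Sublist l) : F z ≠ F z' := by
  rw [List.cons_sublist_iff] at hs
  obtain ⟨r1, r2, h1, hx, hs⟩ := hs
  rw [List.cons_sublist_iff] at hs
  obtain ⟨r3, r4, h2, hz, hs⟩ := hs
  rw [List.cons_sublist_iff] at hs
  obtain ⟨r5, r6, h3, hy, hs⟩ := hs
  rw [List.singleton_sublist] at hs
  obtain ⟨p, q, rfl⟩ := List.append_of_mem hz
  obtain ⟨p', q', rfl⟩ := List.append_of_mem hs
  subst h3 h2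
  have hl : l = (r1 ++ p) ++ z :: ((q ++ r5 ++ p') ++ z' :: q') := by rw [h1]; simp
  have key := sub_sum_of_steps hF _ _ _ _ _ hl
  have hn' := hn
  rw [h1, List.nodup_append] at hn'
  obtain ⟨-, hn2, hdis⟩ := hn'
  have hx2 : x ∉ z :: (q ++ r5 ++ p') := by
    intro h
    refine hdis x hx x ?_ rfl
    simp only [List.mem_cons, List.mem_append] at h ⊢
    tauto
  have hy2 : y ≠ z := by
    rintro rfl
    rw [List.nodup_append] at hn2
    exact hn2.2.2 y (by simp) y (by simp [hy]) rfl
  -- Between `z` and `z'` the potential changes at `y` only, so `F z' = F z + 1`.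
  have hsum1 : ((q ++ r5 ++ p').map fun u => (if u = x then (1 : ℚ) else 0) -
      (if u = y then 1 else 0)).sum = -1 := by
    have h4 : ((q ++ r5 ++ p').map fun u => (if u = x then (1 : ℚ) else 0) -
        (if u = y then 1 else 0)) = (q ++ r5 ++ p').map fun u => -(if u = y then (1 : ℚ) else 0) := by
      refine List.map_congr_left fun u hu => ?_
      rw [if_neg, zero_sub]
      rintro rfl
      exact hx2 (List.mem_cons_of_mem _ hu)
    have h5 : ∀ m : List α, (m.map fun u => -(if u = y then (1 : ℚ) else 0)).sum = -(m.count y : ℚ) := by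
      intro m
      induction m with
      | nil => simp
      | cons a m ih =>
        rw [List.map_cons, List.sum_cons, ih, List.count_cons]
        by_cases h : a = y <;> simp [h]
    rw [h4, h5, List.count_eq_one_of_mem]
    · norm_num
    · refine hn.sublist ?_
      rw [hl]
      exact (List.sublist_append_left _ _).trans ((List.sublist_cons_self _ _).trans
        (List.sublist_append_right _ _))
    · simp [hy]
  rw [hsum1, if_neg (fun h => hx2 (by simp [h])), if_neg (fun h => hy2 h.symm)] at key
  intro h
  rw [h] at key
  linarith

end Lists

/-! ### Rotation systems described by circular adjacency lists. -/

section RotationLists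

variable {n : ℕ} {G : SimpleGraph (Fin n)} {H : G.Subgraph}

theorem isAdjList_iff {ρ : RotationSystem H} {u : Fin n} {l : List (Fin n)} :
    ρ.IsAdjList u l ↔ l.Nodup ∧ (∀ w, w ∈ l ↔ H.Adj u w) ∧
      ∀ a : H.neighborSet u, l.formPerm a = ρ.next u a := by
  rw [RotationSystem.IsAdjList]
  refine and_congr_right fun hl => and_congr_right fun hm => ?_
  constructor
  · intro h a
    obtain ⟨i, hi, hia⟩ := List.mem_iff_getElem.1 ((hm a).2 a.2)
    have h1 := h a i (by rw [List.getElem?_eq_getElem hi, hia])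
    have h2 := List.formPerm_apply_getElem l hl i hi
    rw [hia] at h2
    rw [h2]
    have hlt : (i + 1) % l.length < l.length := Nat.mod_lt _ (by omega)
    rw [List.getElem?_eq_getElem hlt] at h1
    exact Option.some.inj h1
  · intro h a i hia
    obtain ⟨hi, hia⟩ := List.getElem?_eq_some_iff.1 hia
    have h2 := List.formPerm_apply_getElem l hl i hi
    rw [hia, h] at h2
    have hlt : (i + 1) % l.length < l.length := Nat.mod_lt _ (by omega)
    rw [List.getElem?_eq_getElem hlt, h2]

theorem exists_isAdjList (ρ : RotationSystem H) (u : Fin n) : ∃ l, ρ.IsAdjList u l := by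
  classical
  by_cases hne : Nonempty (H.neighborSet u)
  · obtain ⟨x⟩ := hne
    -- `Equiv.Perm.toList` is empty at a fixed point, so a vertex with a single neighbour is treated
    -- separately.
    by_cases hx : ρ.next u x = x
    · have h1 : ∀ a : H.neighborSet u, a = x := by
        intro a
        have h2 := (ρ.cyclic u a x).apply_eq_self_iff.2 hx
        obtain ⟨i, hi⟩ := ρ.cyclic u a x
        rw [Equiv.Perm.zpow_apply_eq_self_of_apply_eq_self h2] at hi
        exact hi
      refine ⟨[(x : Fin n)], isAdjList_iff.2 ⟨by simp, fun w => ?_, fun a => ?_⟩⟩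
      · rw [List.mem_singleton]
        constructor
        · rintro rfl; exact x.2
        · intro hw; exact congrArg Subtype.val (h1 ⟨w, hw⟩)
      · rw [h1 a, hx]; simp
    · have h1 : ∀ a, a ∈ (ρ.next u).toList x := fun a => by
        rw [Equiv.Perm.mem_toList_iff]
        exact ⟨ρ.cyclic u x a, by simpa using hx⟩
      have hnd := (ρ.next u).nodup_toList x
      have hcyc : (ρ.next u).cycleOf x = ρ.next u := by
        ext a
        rw [(ρ.cyclic u x a).cycleOf_apply]
      refine ⟨((ρ.next u).toList x).map Subtype.val, isAdjList_iff.2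
        ⟨hnd.map Subtype.val_injective, fun w => ?_, fun a => ?_⟩⟩
      · rw [List.mem_map]
        constructor
        · rintro ⟨a, -, rfl⟩; exact a.2
        · intro hw; exact ⟨⟨w, hw⟩, h1 _, rfl⟩
      · rw [formPerm_map Subtype.val_injective hnd (h1 a), Equiv.Perm.formPerm_toList, hcyc]
  · refine ⟨[], isAdjList_iff.2 ⟨by simp, fun w => ?_, fun a => absurd ⟨a⟩ hne⟩⟩
    simp only [List.not_mem_nil, false_iff]
    exact fun hw => hne ⟨⟨w, hw⟩⟩

theorem exists_rotationSystem (H : G.Subgraph) (adj : Fin n → List (Fin n))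
    (hn : ∀ u, (adj u).Nodup) (hm : ∀ u w, w ∈ adj u ↔ H.Adj u w) :
    ∃ ρ : RotationSystem H, ∀ u, ρ.IsAdjList u (adj u) := by
  have hp : ∀ u w, w ∈ H.neighborSet u ↔ (adj u).formPerm w ∈ H.neighborSet u := by
    intro u w
    simp only [SimpleGraph.Subgraph.mem_neighborSet, ← hm, List.formPerm_mem_iff_mem]
  let ρ : RotationSystem H :=
    { next := fun u => (adj u).formPerm.subtypePerm fun w => (hp u w).symm
      cyclic := by
        intro u a b
        rw [Equiv.Perm.sameCycle_subtypePerm]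
        obtain ⟨i, hi, hia⟩ := List.mem_iff_getElem.1 ((hm u a).2 a.2)
        obtain ⟨j, hj, hjb⟩ := List.mem_iff_getElem.1 ((hm u b).2 b.2)
        refine ⟨((j + ((adj u).length - i) : ℕ) : ℤ), ?_⟩
        rw [zpow_natCast, ← hia, ← hjb, List.formPerm_pow_apply_getElem _ (hn u)]
        congr 1
        rw [show i + (j + ((adj u).length - i)) = j + (adj u).length by omega,
          Nat.add_mod_right, Nat.mod_eq_of_lt hj] }
  exact ⟨ρ, fun u => isAdjList_iff.2 ⟨hn u, hm u, fun a => rfl⟩⟩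

theorem pow_next_val {ρ : RotationSystem H} {u : Fin n} {l : List (Fin n)} (hl : ρ.IsAdjList u l)
    (i : ℕ) (a : H.neighborSet u) : (((ρ.next u ^ i) a : H.neighborSet u) : Fin n) =
      (l.formPerm ^ i) a := by
  induction i with
  | zero => rfl
  | succ i ih => rw [pow_succ', Equiv.Perm.mul_apply, pow_succ', Equiv.Perm.mul_apply, ← ih,
      (isAdjList_iff.1 hl).2.2]

/-- The restriction of rotation systems at one vertex. -/
def RestrictsAt (ρ : RotationSystem H) {K : G.Subgraph} (σ : RotationSystem K) (u : Fin n) : Prop :=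
  ∀ (a : K.neighborSet u) (a' : H.neighborSet u), (a' : Fin n) = a →
    ∃ k : ℕ, 0 < k ∧ (((ρ.next u ^ k) a' : H.neighborSet u) : Fin n) = σ.next u a ∧
      ∀ i : ℕ, 0 < i → i < k → (((ρ.next u ^ i) a' : H.neighborSet u) : Fin n) ∉ K.neighborSet u

-- Both sides describe the first return map of the rotation to the neighbours in `K`. In one
-- direction the two first return times must be compared, in the other one `first_return` applies
-- directly.
open Classical in
theorem restrictsAt_iff {ρ : RotationSystem H} {K : G.Subgraph} {σ : RotationSystem K} {u : Fin n}
    (hK : K ≤ H) {l m : List (Fin n)} (hl : ρ.IsAdjList u l) (hm : σ.IsAdjList u m) :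
    RestrictsAt ρ σ u ↔ (l.filter fun w => K.Adj u w).IsRotated m := by
  obtain ⟨hl1, hl2, hl3⟩ := isAdjList_iff.1 hl
  obtain ⟨hm1, hm2, hm3⟩ := isAdjList_iff.1 hm
  have hmem : ∀ w, w ∈ l.filter (fun w => K.Adj u w) ↔ w ∈ m := by
    intro w
    simp only [List.mem_filter, hl2, hm2, decide_eq_true_eq, and_iff_right_iff_imp]
    exact fun h => hK.2 h
  constructor
  · intro h
    have h1 : (l.filter fun w => K.Adj u w).formPerm = m.formPerm := by
      ext1 w
      by_cases hw : w ∈ m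
      · have hKw : K.Adj u w := (hm2 w).1 hw
        have hHw : H.Adj u w := hK.2 hKw
        obtain ⟨k, hk0, hk1, hk2⟩ := h ⟨w, hKw⟩ ⟨w, hHw⟩ rfl
        obtain ⟨k', hk0', hk1', hk2'⟩ := first_return hl1 (fun w => K.Adj u w) ((hl2 w).2 hHw) hKw
        simp only [pow_next_val hl] at hk1 hk2
        have hmw := hm3 ⟨w, hKw⟩
        rw [← hk1', hmw, ← hk1]
        have hkk : k = k' := by
          rcases lt_trichotomy k k' with h | h | h
          · refine absurd ?_ (hk2' k hk0 h)
            rw [hk1]; exact (σ.next u ⟨w, hKw⟩).2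
          · exact h
          · refine absurd ?_ (hk2 k' hk0' h)
            have : (l.formPerm ^ k') w ∈ m := by
              rw [hk1', ← hmem]
              exact List.formPerm_apply_mem_of_mem ((hmem w).2 hw)
            exact (hm2 _).1 this
        rw [hkk]
      · rw [List.formPerm_apply_of_notMem hw, List.formPerm_apply_of_notMem]
        rwa [hmem]
    -- Lists with at most one element all induce the identity, so in this case equality follows from
    -- equality of the members.
    rcases (List.formPerm_eq_formPerm_iff (hl1.filter _) hm1).1 h1 with h2 | ⟨h2, h3⟩
    · exact h2
    · have hperm := (List.perm_ext_iff_of_nodup (hl1.filter _) hm1).2 hmem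
      generalize l.filter (fun w => decide (K.Adj u w)) = l' at h2 hperm
      rcases l' with _ | ⟨x, _ | ⟨_, _⟩⟩
      · rw [List.nil_perm.1 hperm]
      · rw [List.singleton_perm.1 hperm]
      · simp at h2
  · intro h a a' haa
    obtain ⟨k, hk0, hk1, hk2⟩ := first_return hl1 (fun w => K.Adj u w) ((hl2 a').2 a'.2)
      (show K.Adj u a' from haa ▸ a.2)
    refine ⟨k, hk0, ?_, fun i h0 hi => ?_⟩
    · rw [pow_next_val hl, hk1, List.formPerm_eq_of_isRotated (hl1.filter _) h, haa, hm3]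
    · rw [pow_next_val hl]; exact hk2 i h0 hi

/-- If the neighbours are the same, restriction means equality. -/
theorem restrictsAt_iff_eq {ρ : RotationSystem H} {K : G.Subgraph} {σ : RotationSystem K}
    {u : Fin n} (hK : ∀ w, H.Adj u w ↔ K.Adj u w) :
    RestrictsAt ρ σ u ↔ ∀ (a : K.neighborSet u) (a' : H.neighborSet u), (a' : Fin n) = a →
      (ρ.next u a' : Fin n) = σ.next u a := by
  constructor
  · intro h a a' haa
    obtain ⟨k, hk0, hk1, hk2⟩ := h a a' haa
    have : k = 1 := by
      by_contra hk
      exact hk2 1 (by omega) (by omega) ((hK _).1 ((ρ.next u ^ 1) a').2)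
    subst this
    simpa using hk1
  · intro h a a' haa
    exact ⟨1, by omega, by simpa using h a a' haa, fun i h0 h1 => by omega⟩

end RotationLists

/-! ### Words around the cut-vertex; planar embeddings have no crossings. -/

section WedgeEmbeddings

variable {n : ℕ} {G : SimpleGraph (Fin n)} {v : Fin n} {b : ℕ} {B : Fin b → G.Subgraph}

/-- An edge has two ends, but two blocks share only `v`. -/
theorem Wedge.eq_of_adj (hW : Wedge v B) {i j : Fin b} {u w : Fin n} (hi : (B i).Adj u w)
    (hj : (B j).Adj u w) : i = j := by
  by_contra hij
  exact hi.ne ((hW.inter i j u hij hi.fst_mem hj.fst_mem).trans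
    (hW.inter i j w hij hi.snd_mem hj.snd_mem).symm)

theorem Wedge.adj_iff (hW : Wedge v B) {j : Fin b} {u : Fin n} (hu : u ≠ v)
    (huj : u ∈ (B j).verts) (w : Fin n) : (⨆ j, B j).Adj u w ↔ (B j).Adj u w := by
  rw [SimpleGraph.Subgraph.iSup_adj]
  constructor
  · rintro ⟨i, hi⟩
    by_cases hij : i = j
    · rwa [← hij]
    · exact absurd (hW.inter i j u hij hi.fst_mem huj) hu
  · exact fun h => ⟨j, h⟩

theorem Wedge.connected_iSup (hW : Wedge v B) : (⨆ j, B j).coe.Connected := by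
  have h1 : ∀ a ∈ (⨆ j, B j).verts, Relation.ReflTransGen (⨆ j, B j).Adj a v ∧
      Relation.ReflTransGen (⨆ j, B j).Adj v a := by
    intro a ha
    rw [SimpleGraph.Subgraph.verts_iSup, Set.mem_iUnion] at ha
    obtain ⟨j, hj⟩ := ha
    have h := (coe_preconnected_iff (B j)).1 (hW.connected j).preconnected
    have hm : ∀ x y, (B j).Adj x y → (⨆ j, B j).Adj x y := fun x y hxy =>
      SimpleGraph.Subgraph.iSup_adj.2 ⟨j, hxy⟩
    exact ⟨Relation.ReflTransGen.mono hm _ _ (h a hj v (hW.mem j)),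
      Relation.ReflTransGen.mono hm _ _ (h v (hW.mem j) a hj)⟩
  have hv : v ∈ (⨆ j, B j).verts := by
    rw [SimpleGraph.Subgraph.verts_iSup, Set.mem_iUnion]
    exact ⟨⟨0, by have := hW.two_le; omega⟩, hW.mem _⟩
  have hne : Nonempty (⨆ j, B j).verts := ⟨⟨v, hv⟩⟩
  exact ⟨(coe_preconnected_iff _).2 fun a ha b hb => (h1 a ha).1.trans (h1 b hb).2⟩

open Classical in
/-- The label of a number: `j + 1` if it is a neighbour of `v` in the block `j`, otherwise `0`. -/
noncomputable def label (v : Fin n) (B : Fin b → G.Subgraph) (x : ℕ) : ℕ :=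
  if h : ∃ j : Fin b, ∃ w : Fin n, (w : ℕ) = x ∧ (B j).Adj v w then (h.choose : ℕ) + 1 else 0

theorem Wedge.label_eq_iff (hW : Wedge v B) (j : Fin b) (x : ℕ) :
    label v B x = j + 1 ↔ ∃ w : Fin n, (w : ℕ) = x ∧ (B j).Adj v w := by
  rw [label]
  constructor
  · intro h
    split_ifs at h with h1
    have := h1.choose_spec
    rwa [show h1.choose = j from Fin.ext (by omega)] at this
  · rintro ⟨w, hw, hj⟩
    have h1 : ∃ j : Fin b, ∃ w : Fin n, (w : ℕ) = x ∧ (B j).Adj v w := ⟨j, w, hw, hj⟩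
    rw [dif_pos h1]
    obtain ⟨w', hw', hj'⟩ := h1.choose_spec
    have : w' = w := Fin.ext (hw'.trans hw.symm)
    subst this
    rw [hW.eq_of_adj hj' hj]

theorem label_le (v : Fin n) (B : Fin b → G.Subgraph) (x : ℕ) : label v B x ≤ b := by
  rw [label]; split_ifs with h <;> omega

theorem label_ne_zero_iff (x : ℕ) :
    label v B x ≠ 0 ↔ ∃ j : Fin b, ∃ w : Fin n, (w : ℕ) = x ∧ (B j).Adj v w := by
  rw [label]; split_ifs with h <;> simp [h]

theorem Wedge.label_val_eq_iff (hW : Wedge v B) (j : Fin b) (w : Fin n) :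
    label v B w = j + 1 ↔ (B j).Adj v w := by
  rw [hW.label_eq_iff]
  exact ⟨fun ⟨w', h, h'⟩ => Fin.ext h ▸ h', fun h => ⟨w, rfl, h⟩⟩

variable (ℰ : (j : Fin b) → SphereEmbedding (B j))

/-- The circular order of the neighbours of `v` in a block, as a list. -/
noncomputable def blockList (v : Fin n) (k : ℕ) : List ℕ :=
  if h : 0 < k ∧ k - 1 < b then
    (exists_isAdjList (ℰ ⟨k - 1, h.2⟩).toRotationSystem v).choose.map Fin.val
  else []

theorem blockList_succ (j : Fin b) : ∃ l, (ℰ j).toRotationSystem.IsAdjList v l ∧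
    blockList ℰ v (j + 1) = l.map Fin.val := by
  have h : 0 < (j : ℕ) + 1 ∧ (j : ℕ) + 1 - 1 < b := ⟨by omega, by simp⟩
  exact ⟨_, (exists_isAdjList (ℰ j).toRotationSystem v).choose_spec, by rw [blockList, dif_pos h]⟩

theorem Wedge.labelled (hW : Wedge v B) : Labelled b (label v B) (blockList ℰ v) := by
  have hcases : ∀ k, k ≠ 0 → k ≤ b → ∃ j : Fin b, k = j + 1 := fun k h0 hk =>
    ⟨⟨k - 1, by omega⟩, by simp; omega⟩
  refine ⟨hW.two_le, fun k => ?_, fun k x h0 => ?_, by simp [blockList], fun k h0 hk => ?_,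
    label_le v B⟩
  · by_cases h : k ≠ 0 ∧ k ≤ b
    · obtain ⟨j, rfl⟩ := hcases k h.1 h.2
      obtain ⟨l, hl, h2⟩ := blockList_succ (v := v) ℰ j
      rw [h2]
      exact hl.1.map Fin.val_injective
    · rw [blockList, dif_neg (by omega)]; simp
  · by_cases hk : k ≤ b
    · obtain ⟨j, rfl⟩ := hcases k h0 hk
      obtain ⟨l, hl, h2⟩ := blockList_succ (v := v) ℰ j
      rw [h2, hW.label_eq_iff, List.mem_map]
      exact ⟨fun ⟨w, h3, h4⟩ => ⟨w, h4, (hl.2.1 w).1 h3⟩, fun ⟨w, h3, h4⟩ => ⟨w, (hl.2.1 w).2 h4, h3⟩⟩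
    · rw [blockList, dif_neg (by omega)]
      have := label_le v B x
      simp only [List.not_mem_nil, false_iff]
      omega
  · obtain ⟨j, rfl⟩ := hcases k h0 hk
    obtain ⟨l, hl, h2⟩ := blockList_succ (v := v) ℰ j
    obtain ⟨w, hw⟩ := hW.nbr j
    rw [h2]
    exact List.ne_nil_of_mem (List.mem_map_of_mem ((hl.2.1 w).2 hw))

variable {ℰ}

theorem filter_map_val (hW : Wedge v B) (l : List (Fin n)) (j : Fin b)
    [DecidablePred fun w => (B j).Adj v w] :
    ((l.map Fin.val).filter fun x => label v B x = j + 1) =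
      (l.filter fun w => (B j).Adj v w).map Fin.val := by
  rw [List.filter_map]
  congr 1
  refine List.filter_congr fun w _ => ?_
  simp only [Function.comp_apply, decide_eq_decide]
  exact hW.label_val_eq_iff j w

theorem isRotated_map_iff {α β : Type*} {f : α → β} (hf : Function.Injective f) {l m : List α} :
    (l.map f).IsRotated (m.map f) ↔ l.IsRotated m := by
  constructor
  · rintro ⟨k, hk⟩
    rw [← List.map_rotate] at hk
    exact ⟨k, List.map_injective_iff.2 hf hk⟩
  · exact fun h => h.map f

theorem isWord_of_restrictsAt (hW : Wedge v B) {ρ : RotationSystem (⨆ j, B j)} {l : List (Fin n)}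
    (hl : ρ.IsAdjList v l) (hr : ∀ j, RestrictsAt ρ (ℰ j).toRotationSystem v) :
    IsWord (label v B) (blockList ℰ v) (l.map Fin.val) := by
  classical
  refine ⟨hl.1.map Fin.val_injective, fun x => ?_, fun k h0 => ?_⟩
  · rw [label_ne_zero_iff, List.mem_map]
    simp only [hl.2.1, SimpleGraph.Subgraph.iSup_adj]
    exact ⟨fun ⟨w, ⟨j, hj⟩, hw⟩ => ⟨j, w, hw, hj⟩, fun ⟨j, w, hw, hj⟩ => ⟨w, ⟨j, hj⟩, hw⟩⟩
  · by_cases hk : k ≤ b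
    · obtain ⟨j, rfl⟩ : ∃ j : Fin b, k = j + 1 := ⟨⟨k - 1, by omega⟩, by simp; omega⟩
      obtain ⟨m, hm, h2⟩ := blockList_succ (v := v) ℰ j
      rw [h2, filter_map_val hW, isRotated_map_iff Fin.val_injective]
      exact (restrictsAt_iff (le_iSup B j) hl hm).1 (hr j)
    · rw [blockList, dif_neg (by omega), List.isRotated_nil_iff, List.filter_eq_nil_iff]
      intro x _ hx
      have := label_le v B x
      simp only [decide_eq_true_eq] at hx
      omega

/-- The chain that consists of one oriented edge. -/
def unitChain (p q u t : Fin n) : ℚ :=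
  (if u = p ∧ t = q then 1 else 0) - (if u = q ∧ t = p then 1 else 0)

theorem unitChain_symm (p q u t : Fin n) : unitChain p q t u = -unitChain p q u t := by
  simp only [unitChain, and_comm (a := t = p), and_comm (a := t = q)]
  ring

theorem sum_unitChain (p q u : Fin n) : ∑ t, unitChain p q u t =
    (if u = p then 1 else 0) - (if u = q then 1 else 0) := by
  have h4 : ∀ p q : Fin n, ∑ x, (if u = p ∧ x = q then (1 : ℚ) else 0) = if u = p then 1 else 0 := by
    intro p q
    by_cases hp : u = p <;> simp [hp]
  simp only [unitChain, Finset.sum_sub_distrib, h4]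

theorem unitChain_ne_zero {p q u t : Fin n} (h : unitChain p q u t ≠ 0) :
    (u = p ∧ t = q) ∨ (u = q ∧ t = p) := by
  by_contra hn
  push Not at hn
  apply h
  rw [unitChain, if_neg fun h => hn.1 h.1 h.2, if_neg fun h => hn.2 h.1 h.2, sub_zero]

/-- In a planar embedding, the blocks do not cross at `v`. -/
theorem nonCrossing_of_planar (hW : Wedge v B) (E : SphereEmbedding (⨆ j, B j))
    {l : List (Fin n)} (hl : E.toRotationSystem.IsAdjList v l) :
    NonCrossing (label v B) (l.map Fin.val) := by
  classical
  obtain ⟨hl1, hl2, hl3⟩ := isAdjList_iff.1 hl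
  have hconn := hW.connected_iSup
  have hE : (⨆ j, B j).edgeSet.Nonempty := by
    obtain ⟨w, hw⟩ := hW.nbr ⟨0, by have := hW.two_le; omega⟩
    exact ⟨s(v, w), SimpleGraph.Subgraph.iSup_adj.2 ⟨_, hw⟩⟩
  have hplanar := (planar_iff hconn hE E.toRotationSystem).1 E.euler
  intro a c a' c' hs ha hc
  obtain ⟨l4, hs4, hl4⟩ := List.sublist_map_iff.1 hs
  obtain ⟨x, z, y, z', rfl⟩ : ∃ x z y z', l4 = [x, z, y, z'] := by
    rcases l4 with _ | ⟨x, _ | ⟨z, _ | ⟨y, _ | ⟨z', _ | ⟨_, _⟩⟩⟩⟩⟩ <;> simp at hl4 ⊢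
  simp only [List.map_cons, List.map_nil, List.cons.injEq, and_true] at hl4
  obtain ⟨rfl, rfl, rfl, rfl⟩ := hl4
  have hadj : ∀ w ∈ [x, z, y, z'], ∃ j, (B j).Adj v w := fun w hw =>
    SimpleGraph.Subgraph.iSup_adj.1 ((hl2 w).1 (hs4.subset hw))
  obtain ⟨j, hjx⟩ := hadj x (by simp)
  obtain ⟨i, hiz⟩ := hadj z (by simp)
  have hjy : (B j).Adj v y := by
    rw [← hW.label_val_eq_iff] at hjx ⊢; rw [← ha, hjx]
  have hiz' : (B i).Adj v z' := by
    rw [← hW.label_val_eq_iff] at hiz ⊢; rw [← hc, hiz]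
  rw [(hW.label_val_eq_iff j x).2 hjx, (hW.label_val_eq_iff i z).2 hiz]
  by_contra hne
  have hij : i ≠ j := fun h => hne (by rw [h])
  -- a flow through `v` along the edges to `x` and `y`
  obtain ⟨g0, hg1, hg2, hg3⟩ := exists_path_flow
    (hW.avoiding j x hjx.snd_mem y hjy.snd_mem hjx.ne.symm hjy.ne.symm) fun _ _ h => h.1.ne
  have hg0 : ∀ u t, g0 u t ≠ 0 → AdjAvoiding (B j) v u t := fun u t h => by
    rcases hg2 u t h with h | h
    · exact h
    · exact ⟨h.1.symm, h.2.2, h.2.1⟩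
  set g : Fin n → Fin n → ℚ := fun u t => g0 u t + unitChain v x u t - unitChain v y u t with hg
  have hgsupp : ∀ u t, g u t ≠ 0 → (B j).Adj u t := by
    intro u t h
    by_cases h0 : g0 u t = 0
    · by_cases h1 : unitChain v x u t = 0
      · have h2 : unitChain v y u t ≠ 0 := fun h2 => h (by simp [hg, h0, h1, h2])
        rcases unitChain_ne_zero h2 with ⟨rfl, rfl⟩ | ⟨rfl, rfl⟩
        exacts [hjy, hjy.symm]
      · rcases unitChain_ne_zero h1 with ⟨rfl, rfl⟩ | ⟨rfl, rfl⟩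
        exacts [hjx, hjx.symm]
    · exact (hg0 u t h0).1
  obtain ⟨f, hf1, hf2⟩ := hplanar g
    (fun u t => by simp only [hg, hg1 u t, unitChain_symm _ _ u t]; ring)
    (fun u t h => by
      by_contra h0
      exact h (SimpleGraph.Subgraph.iSup_adj.2 ⟨j, hgsupp u t h0⟩))
    (fun u => by
      simp only [hg, Finset.sum_sub_distrib, Finset.sum_add_distrib, hg3, sum_unitChain]
      ring)
  -- The flow lives in block `j`, so in block `i` outside `v` the function `f` changes neither
  -- around a vertex nor across an edge. Thus all of block `i` without `v` lies on one side of the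
  -- cycle.
  have hgi : ∀ u ∈ (B i).verts, u ≠ v → ∀ t, g u t = 0 := by
    intro u hu huv t
    by_contra h
    exact huv (hW.inter i j u hij hu (hgsupp u t h).fst_mem)
  have hrot : ∀ u ∈ (B i).verts, u ≠ v → ∀ p q (hp : (⨆ j, B j).Adj u p)
      (hq : (⨆ j, B j).Adj u q), f u p = f u q := by
    intro u hu huv p q hp hq
    exact rotation_const (ρ := E.toRotationSystem) (f := fun a => f u a)
      (fun a => by rw [hf2, hgi u hu huv, sub_zero]) ⟨p, hp⟩ ⟨q, hq⟩
  have hpath : ∀ t, Relation.ReflTransGen (AdjAvoiding (B i) v) z t →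
      ∀ p q (hp : (⨆ j, B j).Adj z p) (hq : (⨆ j, B j).Adj t q), f z p = f t q := by
    intro t ht
    induction ht with
    | refl => intro p q hp hq; exact hrot z hiz.snd_mem hiz.ne.symm p q hp hq
    | @tail s t _ hst ih =>
      intro p q hp hq
      have h1 : (⨆ j, B j).Adj s t := SimpleGraph.Subgraph.iSup_adj.2 ⟨i, hst.1⟩
      have h2 := hf1 s t h1
      rw [hgi s hst.1.fst_mem hst.2.1] at h2
      rw [ih p t hp h1, sub_eq_zero.1 h2]
      exact hrot t hst.1.snd_mem hst.2.2 s q h1.symm hq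
  have hvz : ∀ w, (B i).Adj v w → f v w = f w v := by
    intro w hw
    have h1 := hf1 w v (SimpleGraph.Subgraph.iSup_adj.2 ⟨i, hw.symm⟩)
    rw [hgi w hw.snd_mem hw.ne.symm] at h1
    exact (sub_eq_zero.1 h1).symm
  -- Around `v`, on the other hand, `f` changes at `x` and at `y` only, and these separate `z` from
  -- `z'`.
  refine ne_of_separated (F := f v) hl1 (x := x) (y := y) ?_ hs4 ?_
  · intro s p q t hlpq
    have hp : (⨆ j, B j).Adj v p := (hl2 p).1 (by simp [hlpq])
    have h1 := formPerm_of_split hl1 hlpq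
    have h2 := hl3 ⟨p, hp⟩
    rw [h1] at h2
    have h3 := hf2 v ⟨p, hp⟩
    rw [← h2] at h3
    have h4 : g v p = (if p = x then 1 else 0) - (if p = y then 1 else 0) := by
      have h5 : g0 v p = 0 := by
        by_contra h5; exact (hg0 v p h5).2.1 rfl
      have h6 : ¬ (v = x ∧ p = v) := fun h => hjx.ne h.1
      have h7 : ¬ (v = y ∧ p = v) := fun h => hjy.ne h.1
      simp only [hg, h5, unitChain, true_and, if_neg h6, if_neg h7]
      ring
    rw [h3, h4]
  · rw [hvz z hiz, hvz z' hiz']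
    exact hpath z' (hW.avoiding i z hiz.snd_mem z' hiz'.snd_mem hiz.ne.symm hiz'.ne.symm) v v
      (SimpleGraph.Subgraph.iSup_adj.2 ⟨i, hiz.symm⟩) (SimpleGraph.Subgraph.iSup_adj.2 ⟨i, hiz'.symm⟩)

end WedgeEmbeddings

/-! ### Gluing the embeddings of the blocks along a word. -/

section Gluing

variable {n : ℕ} {G : SimpleGraph (Fin n)} {v : Fin n} {b : ℕ} {B : Fin b → G.Subgraph}
  {ℰ : (j : Fin b) → SphereEmbedding (B j)}

theorem Wedge.edgeSet_nonempty (hW : Wedge v B) (j : Fin b) : (B j).edgeSet.Nonempty := by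
  obtain ⟨w, hw⟩ := hW.nbr j
  exact ⟨s(v, w), hw⟩

theorem Wedge.edgeSet_iSup_nonempty (hW : Wedge v B) : (⨆ j, B j).edgeSet.Nonempty := by
  obtain ⟨w, hw⟩ := hW.nbr ⟨0, by have := hW.two_le; omega⟩
  exact ⟨s(v, w), SimpleGraph.Subgraph.iSup_adj.2 ⟨_, hw⟩⟩

open Classical in
/-- The part of a chain in a subgraph. -/
noncomputable def restrictChain (K : G.Subgraph) (g : Fin n → Fin n → ℚ) (u x : Fin n) : ℚ :=
  if K.Adj u x then g u x else 0

theorem restrictChain_of_adj {K : G.Subgraph} {g : Fin n → Fin n → ℚ} {u x : Fin n}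
    (h : K.Adj u x) : restrictChain K g u x = g u x := if_pos h

theorem restrictChain_of_not_adj {K : G.Subgraph} {g : Fin n → Fin n → ℚ} {u x : Fin n}
    (h : ¬ K.Adj u x) : restrictChain K g u x = 0 := if_neg h

theorem restrictChain_symm {K : G.Subgraph} {g : Fin n → Fin n → ℚ} (hg : ∀ u x, g x u = -g u x)
    (u x : Fin n) : restrictChain K g x u = -restrictChain K g u x := by
  by_cases h : K.Adj u x
  · rw [restrictChain_of_adj h, restrictChain_of_adj h.symm, hg]
  · rw [restrictChain_of_not_adj h, restrictChain_of_not_adj fun h' => h h'.symm, neg_zero]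

theorem sum_sum_eq_zero {g : Fin n → Fin n → ℚ} (hg : ∀ u x, g x u = -g u x) :
    ∑ u, ∑ x, g u x = 0 := by
  have h1 : ∑ u, ∑ x, g u x = ∑ u, ∑ x, g x u := Finset.sum_comm
  have h2 : ∑ u, ∑ x, g x u = ∑ u, ∑ x, -g u x :=
    Finset.sum_congr rfl fun u _ => Finset.sum_congr rfl fun x _ => hg u x
  simp only [Finset.sum_neg_distrib] at h2
  linarith

/-- The part of a flow in a block is a flow. -/
theorem Wedge.sum_restrictChain (hW : Wedge v B) {g : Fin n → Fin n → ℚ}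
    (h1 : ∀ u x, g x u = -g u x) (h2 : ∀ u x, ¬ (⨆ j, B j).Adj u x → g u x = 0)
    (h3 : ∀ u, ∑ x, g u x = 0) (j : Fin b) (u : Fin n) : ∑ x, restrictChain (B j) g u x = 0 := by
  have key : ∀ u, u ≠ v → ∑ x, restrictChain (B j) g u x = 0 := by
    intro u hu
    by_cases huj : u ∈ (B j).verts
    · rw [← h3 u]
      refine Finset.sum_congr rfl fun x _ => ?_
      by_cases h : (B j).Adj u x
      · exact restrictChain_of_adj h
      · rw [restrictChain_of_not_adj h, h2]
        rwa [hW.adj_iff hu huj]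
    · exact Finset.sum_eq_zero fun x _ => restrictChain_of_not_adj fun h => huj h.fst_mem
  -- At `v` conservation follows from conservation at all other vertices, because the values of an
  -- antisymmetric function add up to zero.
  by_cases hu : u = v
  · subst hu
    have := sum_sum_eq_zero (restrictChain_symm (K := B j) h1)
    rwa [Finset.sum_eq_single u (fun w _ hw => key w hw) (by simp)] at this
  · exact key u hu

theorem sum_map_eq_sum {l : List (Fin n)} (hl : l.Nodup) {g : Fin n → ℚ} (h : ∀ x, x ∉ l → g x = 0) :
    (l.map g).sum = ∑ x, g x := by
  rw [← List.sum_toFinset g hl]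
  exact Finset.sum_subset (Finset.subset_univ _) fun x _ hx => h x (by simpa using hx)

open Classical in
theorem Wedge.exists_adj (hW : Wedge v B) (l : List (Fin n)) : ∃ adj : Fin n → List (Fin n),
    adj v = l ∧ (∀ u, u ≠ v → ∀ j, u ∈ (B j).verts → (ℰ j).toRotationSystem.IsAdjList u (adj u)) ∧
      ∀ u, u ≠ v → (∀ j, u ∉ (B j).verts) → adj u = [] := by
  refine ⟨fun u => if u = v then l else if h : ∃ j, u ∈ (B j).verts then
    (exists_isAdjList (ℰ h.choose).toRotationSystem u).choose else [], by simp, ?_, ?_⟩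
  · intro u hu j hj
    have h : ∃ j, u ∈ (B j).verts := ⟨j, hj⟩
    simp only [if_neg hu, dif_pos h]
    have h1 : h.choose = j := by
      by_contra hne
      exact hu (hW.inter _ _ u hne h.choose_spec hj)
    have h2 := (exists_isAdjList (ℰ h.choose).toRotationSystem u).choose_spec
    revert h2
    generalize (exists_isAdjList (ℰ h.choose).toRotationSystem u).choose = m
    rw [h1]
    exact id
  · intro u hu hj
    have h : ¬ ∃ j, u ∈ (B j).verts := fun ⟨j, h⟩ => hj j h
    simp only [if_neg hu, dif_neg h]

/-- A word with the right suffix sums is the circular order at `v` of an embedding. -/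
theorem exists_preservingEmbedding (hW : Wedge v B) {w : List ℕ}
    (hw : IsWord (label v B) (blockList ℰ v) w) (hs : SumCond (blockList ℰ v) w) :
    ∃ (E : PreservingEmbedding ℰ) (l : List (Fin n)),
      E.1.toRotationSystem.IsAdjList v l ∧ l.map Fin.val = w := by
  classical
  obtain ⟨l, rfl⟩ : w ∈ Set.range (List.map (Fin.val : Fin n → ℕ)) := by
    rw [Set.range_list_map]
    intro x hx
    obtain ⟨j, y, hy, -⟩ := (label_ne_zero_iff x).1 ((hw.mem x).1 hx)
    exact ⟨y, hy⟩
  have hln : l.Nodup := List.Nodup.of_map _ hw.nodup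
  have hlm : ∀ x, x ∈ l ↔ (⨆ j, B j).Adj v x := by
    intro x
    have h1 := hw.mem x
    rw [List.mem_map_of_injective Fin.val_injective, label_ne_zero_iff] at h1
    rw [h1, SimpleGraph.Subgraph.iSup_adj]
    exact ⟨fun ⟨j, y, hy, h⟩ => ⟨j, Fin.ext hy ▸ h⟩, fun ⟨j, h⟩ => ⟨j, x, rfl, h⟩⟩
  obtain ⟨adj, hadjv, hadj, hadj0⟩ := hW.exists_adj (ℰ := ℰ) l
  obtain ⟨ρ, hρ⟩ := exists_rotationSystem (⨆ j, B j) adj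
    (by
      intro u
      by_cases hu : u = v
      · rw [hu, hadjv]; exact hln
      · by_cases h : ∃ j, u ∈ (B j).verts
        · obtain ⟨j, hj⟩ := h
          exact (hadj u hu j hj).1
        · rw [hadj0 u hu fun j hj => h ⟨j, hj⟩]; simp)
    (by
      intro u x
      by_cases hu : u = v
      · rw [hu, hadjv]; exact hlm x
      · by_cases h : ∃ j, u ∈ (B j).verts
        · obtain ⟨j, hj⟩ := h
          rw [(hadj u hu j hj).2.1, hW.adj_iff hu hj]
        · rw [hadj0 u hu fun j hj => h ⟨j, hj⟩, SimpleGraph.Subgraph.iSup_adj]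
          simp only [List.not_mem_nil, false_iff]
          exact fun ⟨j, hj⟩ => h ⟨j, hj.fst_mem⟩)
  have hρv : ρ.IsAdjList v l := hadjv ▸ hρ v
  have hnext : ∀ u, u ≠ v → ∀ j (a : (⨆ j, B j).neighborSet u) (h : (B j).Adj u a),
      (ρ.next u a : Fin n) = (ℰ j).next u ⟨a, h⟩ := by
    intro u hu j a h
    rw [← (isAdjList_iff.1 (hρ u)).2.2,
      ← (isAdjList_iff.1 (hadj u hu j h.fst_mem)).2.2 ⟨a, h⟩]
  have hplanar : (⨆ j, B j).verts.ncard + ρ.faceCount = (⨆ j, B j).edgeSet.ncard + 2 := by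
    rw [planar_iff hW.connected_iSup hW.edgeSet_iSup_nonempty]
    intro g h1 h2 h3
    choose f hf1 hf2 using fun j => (planar_iff (hW.connected j) (hW.edgeSet_nonempty j)
      (ℰ j).toRotationSystem).1 (ℰ j).euler (restrictChain (B j) g) (restrictChain_symm h1)
      (fun u x h => restrictChain_of_not_adj h) (hW.sum_restrictChain h1 h2 h3 j)
    let gN : ℕ → ℚ := fun x => if h : x < n then g v ⟨x, h⟩ else 0
    have hgN : ∀ x : Fin n, gN x = g v x := fun x => by simp [gN]
    have hmap : ∀ m : List (Fin n), (m.map Fin.val).map gN = m.map (g v) := by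
      intro m; rw [List.map_map]; exact List.map_congr_left fun x _ => hgN x
    have hL0 : ∀ k, ((blockList ℰ v k).map gN).sum = 0 := by
      intro k
      by_cases hk : k ≠ 0 ∧ k ≤ b
      · obtain ⟨j, rfl⟩ : ∃ j : Fin b, k = j + 1 := ⟨⟨k - 1, by omega⟩, by simp; omega⟩
        obtain ⟨m, hm, hm2⟩ := blockList_succ (v := v) ℰ j
        rw [hm2, hmap, ← hW.sum_restrictChain h1 h2 h3 j v, ← sum_map_eq_sum hm.1]
        · congr 1
          exact List.map_congr_left fun x hx => (restrictChain_of_adj ((hm.2.1 x).1 hx)).symm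
        · exact fun x hx => restrictChain_of_not_adj fun h => hx ((hm.2.1 x).2 h)
      · rw [blockList, dif_neg (by omega)]; simp
    have htot : ((l.map Fin.val).map gN).sum = 0 := by
      rw [hmap, sum_map_eq_sum hln, h3]
      intro x hx
      exact h2 v x fun h => hx ((hlm x).2 h)
    -- `F` is the potential around `v` prescribed by the common rotation. The hypothesis `hs` makes
    -- it also a potential for the rotation of every single block.
    let F : Fin n → ℚ := fun x => suffixSum gN (l.map Fin.val) x
    have hFblock : ∀ j (a : (B j).neighborSet v), F ((ℰ j).next v a) = F a - g v a := by
      intro j a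
      obtain ⟨m, hm, hm2⟩ := blockList_succ (v := v) ℰ j
      have h4 := hs gN hL0 (j + 1) (a : Fin n)
        (by rw [hm2]; exact List.mem_map_of_mem ((hm.2.1 a).2 a.2))
      rw [hm2, formPerm_map Fin.val_injective hm.1 ((hm.2.1 a).2 a.2),
        (isAdjList_iff.1 hm).2.2 a, hgN] at h4
      exact h4
    have hFword : ∀ a : (⨆ j, B j).neighborSet v, F (ρ.next v a) = F a - g v a := by
      intro a
      have h4 := suffixSum_formPerm hw.nodup htot (List.mem_map_of_mem (f := Fin.val) ((hlm a).2 a.2))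
      rw [formPerm_map Fin.val_injective hln ((hlm a).2 a.2), (isAdjList_iff.1 hρv).2.2 a, hgN] at h4
      exact h4
    -- Around `v`, both `F` and `f j` lose `g v a` at each step of the rotation of block `j`, so
    -- their difference is constant.
    have hc : ∀ j, ∃ c, ∀ a, (B j).Adj v a → F a = f j v a + c := by
      intro j
      obtain ⟨x, hx⟩ := hW.nbr j
      refine ⟨F x - f j v x, fun a ha => ?_⟩
      have h4 := rotation_const (ρ := (ℰ j).toRotationSystem) (u := v) (f := fun a => F a - f j v a)
        (fun a => by
          rw [hFblock, hf2, restrictChain_of_adj a.2]; ring) ⟨a, ha⟩ ⟨x, hx⟩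
      simp only at h4
      linarith
    choose c hc using hc
    -- Adding a constant to `f j` changes none of the differences required in its block, and these
    -- constants make the functions fit together at `v`. The value on pairs that are not edges is
    -- irrelevant.
    let f' : Fin n → Fin n → ℚ := fun u x =>
      if h : ∃ j, (B j).Adj u x then f h.choose u x + c h.choose else 0
    have hf' : ∀ j u x, (B j).Adj u x → f' u x = f j u x + c j := by
      intro j u x h
      have h4 : ∃ j, (B j).Adj u x := ⟨j, h⟩
      simp only [f', dif_pos h4]
      rw [hW.eq_of_adj h4.choose_spec h]
    have hfv : ∀ a, (⨆ j, B j).Adj v a → f' v a = F a := by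
      intro a ha
      obtain ⟨j, hj⟩ := SimpleGraph.Subgraph.iSup_adj.1 ha
      rw [hf' j v a hj, hc j a hj]
    refine ⟨f', fun u x h => ?_, fun u a => ?_⟩
    · obtain ⟨j, hj⟩ := SimpleGraph.Subgraph.iSup_adj.1 h
      rw [hf' j u x hj, hf' j x u hj.symm, add_sub_add_right_eq_sub, hf1 j u x hj,
        restrictChain_of_adj hj]
    · by_cases hu : u = v
      · subst hu
        rw [hfv _ (ρ.next u a).2, hfv _ a.2, hFword]
      · obtain ⟨j, hj⟩ := SimpleGraph.Subgraph.iSup_adj.1 a.2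
        rw [hnext u hu j a hj, hf' j u _ ((ℰ j).next u ⟨a, hj⟩).2, hf2, hf' j u a hj,
          restrictChain_of_adj hj]
        ring
  refine ⟨⟨⟨ρ, hplanar⟩, fun j u => ?_⟩, l, hρv, rfl⟩
  change RestrictsAt ρ (ℰ j).toRotationSystem u
  by_cases hu : u = v
  · subst hu
    obtain ⟨m, hm, hm2⟩ := blockList_succ (v := u) ℰ j
    rw [restrictsAt_iff (le_iSup B j) hρv hm]
    have h4 := hw.rot (j + 1) (by omega)
    rwa [hm2, filter_map_val hW, isRotated_map_iff Fin.val_injective] at h4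
  · by_cases huj : u ∈ (B j).verts
    · rw [restrictsAt_iff_eq (fun x => hW.adj_iff hu huj x)]
      intro a a' haa
      have h4 : (B j).Adj u a' := by rw [haa]; exact a.2
      rw [hnext u hu j a' h4]
      congr 2
      exact Subtype.ext haa
    · intro a
      exact absurd (SimpleGraph.Subgraph.Adj.fst_mem a.2) huj

end Gluing

/-! ### Normal rotations and the bijection between embeddings and codes. -/

section Ranking

theorem exists_last_eq {lab : ℕ → ℕ} {k : ℕ} {m : List ℕ} (hex : ∃ x ∈ m, lab x = k) :
    ∃ p u y, m = p ++ u :: y ∧ lab u = k ∧ ∀ a ∈ y, lab a ≠ k := by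
  induction m with
  | nil => simp at hex
  | cons a m ih =>
    by_cases hm : ∃ x ∈ m, lab x = k
    · obtain ⟨p, u, y, h1, h2, h3⟩ := ih hm
      exact ⟨a :: p, u, y, by rw [h1]; rfl, h2, h3⟩
    · obtain ⟨c, hc, hc1⟩ := hex
      rcases List.mem_cons.1 hc with rfl | h
      · exact ⟨[], c, m, rfl, hc1, fun e he h => hm ⟨e, he, h⟩⟩
      · exact absurd ⟨c, h, hc1⟩ hm

/-- The list `y` may contain elements with label `2`; then the first of them takes the role of `z`.
-/
theorem isNormal_of_last {lab : ℕ → ℕ} {u z : ℕ} {y p : List ℕ} (hu : lab u = 1)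
    (hy : ∀ a ∈ y, lab a ≠ 1) (hz : lab z = 2) : IsNormal lab (u :: (y ++ z :: p)) := by
  obtain ⟨y1, z1, y2, hy1, hz1, hy2⟩ : ∃ y1 z1 y2, y ++ z :: p = y1 ++ z1 :: y2 ∧ lab z1 = 2 ∧
      ∀ a ∈ y1, lab a ≠ 1 ∧ lab a ≠ 2 := by
    induction y with
    | nil => exact ⟨[], z, p, rfl, hz, by simp⟩
    | cons a y ih =>
      by_cases ha : lab a = 2
      · exact ⟨[], a, y ++ z :: p, rfl, ha, by simp⟩
      · obtain ⟨y1, z1, y2, h1, h2, h3⟩ := ih fun c hc => hy c (List.mem_cons_of_mem _ hc)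
        refine ⟨a :: y1, z1, y2, by rw [List.cons_append, h1]; rfl, h2, fun c hc => ?_⟩
        rcases List.mem_cons.1 hc with rfl | hc
        · exact ⟨hy c (by simp), ha⟩
        · exact h3 c hc
  exact ⟨u, y1, z1, y2, by rw [hy1], hu, hy2, hz1⟩

/-- Start at an element with label `2` and go around once. The word has to begin at the last element
with label `1` that is met. -/
theorem exists_isNormal_rotate {lab : ℕ → ℕ} {w : List ℕ} (h1 : ∃ x ∈ w, lab x = 1)
    (h2 : ∃ x ∈ w, lab x = 2) : ∃ k, IsNormal lab (w.rotate k) := by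
  obtain ⟨z, hz, hz2⟩ := h2
  obtain ⟨x, hx, hx1⟩ := h1
  obtain ⟨s, t, rfl⟩ := List.append_of_mem hz
  have hx' : x ∈ t ++ s := by
    simp only [List.mem_append, List.mem_cons] at hx ⊢
    rcases hx with h | rfl | h
    · exact Or.inr h
    · omega
    · exact Or.inl h
  obtain ⟨p, u, y, hp, hu, hy⟩ := exists_last_eq ⟨x, hx', hx1⟩
  have hrot : (s ++ z :: t).IsRotated (u :: (y ++ z :: p)) := by
    have e1 : (s ++ z :: t).IsRotated (z :: t ++ s) := List.isRotated_append
    rw [List.cons_append, hp] at e1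
    have e2 : (z :: p ++ u :: y).IsRotated (u :: y ++ z :: p) := List.isRotated_append
    exact e1.trans e2
  obtain ⟨k, hk⟩ := hrot
  exact ⟨k, hk ▸ isNormal_of_last hu hy hz2⟩

/-- Two different starting points `u`, `u'` have label `1` and are each followed by an element with
label `2` before the other one is reached, so blocks 1 and 2 would cross. -/
theorem IsNormal.eq_of_isRotated {lab : ℕ → ℕ} {w w' : List ℕ} (h : IsNormal lab w)
    (h' : IsNormal lab w') (hr : w.IsRotated w') (hn : w.Nodup) (hc : NonCrossing lab w) :
    w = w' := by
  obtain ⟨u, y, z, r, hw, hu, hy, hz⟩ := h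
  obtain ⟨u', y', z', r', hw', hu', hy', hz'⟩ := h'
  have key : ∀ (t t' : List ℕ), w = u :: t → u :: t' = w' → w = w' := by
    intro t t' e1 e2
    have a1 : startAt w u = w := by rw [e1, startAt, List.idxOf_cons_self, List.rotate_zero]
    rw [← a1]
    exact startAt_eq (t := t') hr.symm hn e2.symm
  by_cases huu : u = u'
  · subst huu
    exact key _ _ hw hw'.symm
  · exfalso
    have hmem : u' ∈ r := by
      have : u' ∈ w := hr.mem_iff.2 (hw' ▸ by simp)
      rw [hw] at this
      simp only [List.mem_cons, List.mem_append] at this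
      rcases this with h | h | h | h
      · exact absurd h.symm huu
      · exact absurd hu' (hy _ h).1
      · subst h; omega
      · exact h
    obtain ⟨r1, r2, rfl⟩ := List.append_of_mem hmem
    have h1 : w' = u' :: (r2 ++ u :: (y ++ z :: r1)) := by
      have e1 : (u :: (y ++ z :: (r1 ++ u' :: r2))).IsRotated (u' :: (r2 ++ u :: (y ++ z :: r1))) := by
        have := List.isRotated_append (l := u :: (y ++ z :: r1)) (l' := u' :: r2)
        simpa using this
      rw [hw] at hn hr
      have e2 := startAt_eq hr.symm hn hw'
      have e3 := startAt_eq e1.symm hn rfl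
      rw [← e2, e3]
    rw [h1, List.cons.injEq] at hw'
    have hz'm : z' ∈ r2 := by
      rcases List.append_eq_append_iff.1 hw'.2 with ⟨a, ha, hb⟩ | ⟨a, ha, hb⟩
      · rcases a with _ | ⟨c, a⟩
        · simp only [List.nil_append, List.cons.injEq] at hb
          rw [← hb.1] at hz'; omega
        · simp only [List.cons_append, List.cons.injEq] at hb
          exact absurd hu (hy' u (by rw [ha, hb.1]; simp)).1
      · rcases a with _ | ⟨c, a⟩
        · simp only [List.nil_append, List.cons.injEq] at hb
          rw [hb.1] at hz'; omega
        · simp only [List.cons_append, List.cons.injEq] at hb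
          rw [ha, hb.1]; simp
    have hs : [u, z, u', z'].Sublist w := by
      rw [hw]
      refine List.Sublist.cons_cons _ ?_
      refine List.Sublist.trans ?_ (List.sublist_append_right _ _)
      refine List.Sublist.cons_cons _ ?_
      refine List.Sublist.trans ?_ (List.sublist_append_right _ _)
      exact List.Sublist.cons_cons _ (List.singleton_sublist.2 hz'm)
    have := hc u z u' z' hs (hu.trans hu'.symm) (hz.trans hz'.symm)
    omega

variable {n : ℕ} {G : SimpleGraph (Fin n)} {v : Fin n} {b : ℕ} {B : Fin b → G.Subgraph}
  {ℰ : (j : Fin b) → SphereEmbedding (B j)}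

/-- A rotation system restricts to itself, so this is a case of `restrictsAt_iff` in which the
filter removes nothing. -/
theorem isRotated_of_isAdjList {H : G.Subgraph} {ρ : RotationSystem H} {u : Fin n}
    {l m : List (Fin n)} (hl : ρ.IsAdjList u l) (hm : ρ.IsAdjList u m) : l.IsRotated m := by
  classical
  have h1 : RestrictsAt ρ ρ u := by
    rw [restrictsAt_iff_eq fun _ => Iff.rfl]
    intro a a' h
    rw [Subtype.ext h]
  have h2 := (restrictsAt_iff le_rfl hl hm).1 h1
  rwa [List.filter_eq_self.2 fun w hw => by simpa using (hl.2.1 w).1 hw] at h2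

theorem isAdjList_of_isRotated {H : G.Subgraph} {ρ : RotationSystem H} {u : Fin n}
    {l m : List (Fin n)} (hl : ρ.IsAdjList u l) (h : l.IsRotated m) : ρ.IsAdjList u m := by
  rw [isAdjList_iff] at hl ⊢
  refine ⟨h.nodup_iff.1 hl.1, fun w => by rw [← h.mem_iff, hl.2.1], fun a => ?_⟩
  rw [← List.formPerm_eq_of_isRotated hl.1 h, hl.2.2]

/-- Around a vertex other than `v` the rotation is that of its block. -/
theorem preservingEmbedding_ext (hW : Wedge v B) {E E' : PreservingEmbedding ℰ} {l : List (Fin n)}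
    (h : E.1.toRotationSystem.IsAdjList v l) (h' : E'.1.toRotationSystem.IsAdjList v l) :
    E = E' := by
  obtain ⟨⟨⟨f, hf⟩, e⟩, r⟩ := E
  obtain ⟨⟨⟨f', hf'⟩, e'⟩, r'⟩ := E'
  have : f = f' := by
    funext u
    refine Equiv.ext fun a => Subtype.ext ?_
    by_cases hu : u = v
    · subst hu
      exact ((isAdjList_iff.1 h).2.2 a).symm.trans ((isAdjList_iff.1 h').2.2 a)
    · obtain ⟨j, hj⟩ := SimpleGraph.Subgraph.iSup_adj.1 a.2
      exact ((restrictsAt_iff_eq fun x => hW.adj_iff hu hj.fst_mem x).1 (r j u) ⟨a, hj⟩ a rfl).trans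
        ((restrictsAt_iff_eq fun x => hW.adj_iff hu hj.fst_mem x).1 (r' j u) ⟨a, hj⟩ a rfl).symm
  subst this
  rfl

theorem isWord_of_isAdjList (hW : Wedge v B) (E : PreservingEmbedding ℰ) {l : List (Fin n)}
    (h : E.1.toRotationSystem.IsAdjList v l) :
    IsWord (label v B) (blockList ℰ v) (l.map Fin.val) :=
  isWord_of_restrictsAt hW h fun j => E.2 j v

theorem exists_isNormal (hW : Wedge v B) (E : PreservingEmbedding ℰ) : ∃ l : List (Fin n),
    E.1.toRotationSystem.IsAdjList v l ∧ IsNormal (label v B) (l.map Fin.val) := by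
  obtain ⟨l, hl⟩ := exists_isAdjList E.1.toRotationSystem v
  have hw := isWord_of_isAdjList hW E hl
  have hL := hW.labelled ℰ
  have hb := hL.two_le
  have hex : ∀ k, k ≠ 0 → k ≤ b → ∃ x ∈ l.map Fin.val, label v B x = k := fun k h0 hk => by
    obtain ⟨x, hx⟩ := hL.exists_mem h0 hk
    exact ⟨x, (hw.mem x).2 (by omega), hx⟩
  obtain ⟨k, hk⟩ := exists_isNormal_rotate (hex 1 (by omega) (by omega)) (hex 2 (by omega) hb)
  exact ⟨l.rotate k, isAdjList_of_isRotated hl ⟨k, rfl⟩, by rwa [List.map_rotate]⟩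

theorem deg_eq_length {H : G.Subgraph} {u : Fin n} {l : List ℕ} (hl : l.Nodup)
    (h : ∀ x, x ∈ l ↔ ∃ w : Fin n, (w : ℕ) = x ∧ H.Adj u w) : deg H u = l.length := by
  rw [deg, ← List.toFinset_card_of_nodup hl, ← Set.ncard_coe_finset,
    ← Set.ncard_image_of_injective _ (Fin.val_injective (n := n))]
  congr 1
  ext x
  simp only [Set.mem_image, SimpleGraph.Subgraph.mem_neighborSet, List.coe_toFinset, h,
    Set.mem_ofPred_eq]
  exact ⟨fun ⟨w, h1, h2⟩ => ⟨w, h2, h1⟩, fun ⟨w, h1, h2⟩ => ⟨w, h2, h1⟩⟩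

theorem Wedge.deg_block (hW : Wedge v B) (j : Fin b) :
    deg (B j) v = (blockList ℰ v (j + 1)).length := by
  have hL := hW.labelled ℰ
  refine deg_eq_length (hL.nodup _) fun x => ?_
  rw [hL.mem _ _ (by omega), hW.label_eq_iff]

theorem Wedge.deg_top (hW : Wedge v B) {l : List ℕ} (hl : l.Nodup)
    (h : ∀ x, x ∈ l ↔ label v B x ≠ 0) : deg (⊤ : G.Subgraph) v = l.length := by
  refine deg_eq_length hl fun x => ?_
  rw [h, label_ne_zero_iff]
  constructor
  · rintro ⟨j, w, hw, h⟩
    exact ⟨w, hw, h.adj_sub⟩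
  · rintro ⟨w, hw, h⟩
    obtain ⟨j, hj⟩ := hW.cover w h
    exact ⟨j, w, hw, hj⟩

theorem Wedge.deg_top_eq_total (hW : Wedge v B) :
    deg (⊤ : G.Subgraph) v = total b (blockList ℰ v) := by
  obtain ⟨h1, h2, h3⟩ := perm_range'_flatMap (hW.labelled ℰ)
    (e := blockList ℰ v) (fun k => List.IsRotated.refl _)
  rw [hW.deg_top h1 h2, h3]


/-- Openings are recorded by their rank among the neighbours of `v` in the block, ordered as
numbers. So the code does not depend on where the given adjacency lists are started. -/
theorem Wedge.count_lt (hW : Wedge v B) (ℰ : (j : Fin b) → SphereEmbedding (B j)) (j : Fin b)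
    {x : ℕ} (hx : label v B x = j + 1) : Nat.count (fun x => label v B x = j + 1) x < deg (B j) v := by
  have hL := hW.labelled ℰ
  have hm : ∀ y, y ∈ (blockList ℰ v (j + 1)).toFinset ↔ label v B y = j + 1 := fun y => by
    rw [List.mem_toFinset, hL.mem _ _ (by omega)]
  rw [hW.deg_block (ℰ := ℰ) j, ← List.toFinset_card_of_nodup (hL.nodup _), Nat.count_eq_card_filter_range]
  refine Finset.card_lt_card ⟨fun y hy => ?_, fun h => ?_⟩
  · rw [hm]; exact (Finset.mem_filter.1 hy).2
  · have := h ((hm x).2 hx)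
    simp at this

theorem Wedge.exists_count_eq (hW : Wedge v B) (ℰ : (j : Fin b) → SphereEmbedding (B j)) (j : Fin b)
    {c : ℕ} (hc : c < deg (B j) v) :
    ∃ x, label v B x = j + 1 ∧ Nat.count (fun x => label v B x = j + 1) x = c := by
  have hL := hW.labelled ℰ
  have hm : ∀ y, y ∈ (blockList ℰ v (j + 1)).toFinset ↔ label v B y = j + 1 := fun y => by
    rw [List.mem_toFinset, hL.mem _ _ (by omega)]
  have hlt : ∀ hf : (Set.ofPred fun x => label v B x = j + 1).Finite, c < hf.toFinset.card := by
    intro hf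
    have : hf.toFinset = (blockList ℰ v (j + 1)).toFinset := by
      ext y; rw [hm]; simp
    rw [this, List.toFinset_card_of_nodup (hL.nodup _), ← hW.deg_block]
    exact hc
  exact ⟨_, Nat.nth_mem c hlt, Nat.count_nth hlt⟩

theorem decodeWord_congr {L : ℕ → List ℕ} {op op' : ℕ → ℕ} (h : ∀ k, L k ≠ [] → op k = op' k)
    (O : List ℕ) : decodeWord L op O = decodeWord L op' O := by
  have : (fun k => startAt (L k) (op k)) = fun k => startAt (L k) (op' k) := by
    funext k
    by_cases hk : L k = []
    · simp [startAt, hk]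
    · rw [h k hk]
  rw [decodeWord, decodeWord, this]

theorem length_eq_total_of_isWord (hW : Wedge v B) {w : List ℕ}
    (hw : IsWord (label v B) (blockList ℰ v) w) : w.length = deg (⊤ : G.Subgraph) v :=
  (hW.deg_top hw.nodup hw.mem).symm

/-- The code of a normal word. -/
noncomputable def wordCode (hW : Wedge v B) {w : List ℕ}
    (hw : IsWord (label v B) (blockList ℰ v) w) (hn : IsNormal (label v B) w) : Code v B :=
  (fun j => ⟨encodeOp (label v B) w (j + 1), hW.count_lt ℰ j
      (hw.lab_opening (hW.labelled ℰ) (by omega) (by omega)).1⟩,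
    fun j => ⟨(encodePos b (label v B) w)[(j : ℕ)]'(by
        rw [(encodePos_spec (hW.labelled ℰ) hw hn).2.1]; exact j.2), by
      have := (encodePos_spec (hW.labelled ℰ) hw hn).2.2 j (by
        rw [(encodePos_spec (hW.labelled ℰ) hw hn).2.1]; exact j.2)
      have h1 := length_eq_total_of_isWord hW hw
      omega⟩)

theorem ofFn_wordCode (hW : Wedge v B) {w : List ℕ} (hw : IsWord (label v B) (blockList ℰ v) w)
    (hn : IsNormal (label v B) w) :
    (List.ofFn fun j => ((wordCode hW hw hn).2 j : ℕ)) = encodePos b (label v B) w := by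
  have := (encodePos_spec (hW.labelled ℰ) hw hn).2.1
  refine List.ext_getElem (by simp [this]) fun i h1 h2 => ?_
  simp [wordCode]

/-- If `op` has the positions given by the first part of the code, the word is decoded. -/
theorem decodeWord_wordCode (hW : Wedge v B) {w : List ℕ}
    (hw : IsWord (label v B) (blockList ℰ v) w) (hn : IsNormal (label v B) w)
    (hc : NonCrossing (label v B) w) {op : ℕ → ℕ}
    (hop : ∀ j : Fin b, label v B (op (j + 1)) = j + 1 ∧
      Nat.count (fun x => label v B x = j + 1) (op (j + 1)) = (wordCode hW hw hn).1 j) :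
    decodeWord (blockList ℰ v) op (decodeCircle (deg (⊤ : G.Subgraph) v)
      (List.ofFn fun j => ((wordCode hW hw hn).2 j : ℕ))) = w := by
  have hL := hW.labelled ℰ
  rw [ofFn_wordCode, ← length_eq_total_of_isWord hW hw]
  refine (decodeWord_congr (fun k hk => ?_) _).trans (decodeWord_encode hL hw hn hc)
  have hk0 : k ≠ 0 := by rintro rfl; exact hk hL.zero
  have hkb : k ≤ b := by by_contra h; exact hk (hL.nil_of_lt (by omega))
  obtain ⟨j, rfl⟩ : ∃ j : Fin b, k = j + 1 := ⟨⟨k - 1, by omega⟩, by simp; omega⟩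
  exact Nat.count_injective (hop j).1 (hw.lab_opening hL hk0 hkb).1 (hop j).2

/-- Ranking of the embeddings, described by words. -/
theorem exists_equiv_code (hW : Wedge v B) : ∃ φ : PreservingEmbedding ℰ ≃ Code v B,
    (∀ (E : PreservingEmbedding ℰ) (l : List (Fin n)), E.1.toRotationSystem.IsAdjList v l →
      IsNormal (label v B) (l.map Fin.val) → (φ E).toList =
        ((List.range b).map fun k => encodeOp (label v B) (l.map Fin.val) (k + 1)) ++
          encodePos b (label v B) (l.map Fin.val)) ∧
    ∀ (t : Code v B) (op : ℕ → ℕ), (∀ j : Fin b, label v B (op (j + 1)) = j + 1 ∧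
      Nat.count (fun x => label v B x = j + 1) (op (j + 1)) = t.1 j) →
      ∃ l : List (Fin n), (φ.symm t).1.toRotationSystem.IsAdjList v l ∧
        l.map Fin.val = decodeWord (blockList ℰ v) op (decodeCircle (deg (⊤ : G.Subgraph) v)
          (List.ofFn fun j => (t.2 j : ℕ))) := by
  have hL := hW.labelled ℰ
  choose l hl1 hl2 using fun E : PreservingEmbedding ℰ => exists_isNormal hW E
  have hword : ∀ E : PreservingEmbedding ℰ, IsWord (label v B) (blockList ℰ v) ((l E).map Fin.val) :=
    fun E => isWord_of_isAdjList hW E (hl1 E)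
  have hnc : ∀ E : PreservingEmbedding ℰ, NonCrossing (label v B) ((l E).map Fin.val) :=
    fun E => nonCrossing_of_planar hW E.1 (hl1 E)
  have huniq : ∀ (E : PreservingEmbedding ℰ) (m : List (Fin n)),
      E.1.toRotationSystem.IsAdjList v m → IsNormal (label v B) (m.map Fin.val) → m = l E := by
    intro E m hm hn
    refine List.map_injective_iff.2 Fin.val_injective ?_
    exact (hn.eq_of_isRotated (hl2 E) ((isRotated_of_isAdjList hm (hl1 E)).map _)
      (isWord_of_isAdjList hW E hm).nodup (nonCrossing_of_planar hW E.1 hm))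
  let f : PreservingEmbedding ℰ → Code v B := fun E => wordCode hW (hword E) (hl2 E)
  have hdec : ∀ (E : PreservingEmbedding ℰ) (op : ℕ → ℕ), (∀ j : Fin b,
      label v B (op (j + 1)) = j + 1 ∧
      Nat.count (fun x => label v B x = j + 1) (op (j + 1)) = (f E).1 j) →
      decodeWord (blockList ℰ v) op (decodeCircle (deg (⊤ : G.Subgraph) v)
        (List.ofFn fun j => ((f E).2 j : ℕ))) = (l E).map Fin.val :=
    fun E op hop => decodeWord_wordCode hW (hword E) (hl2 E) (hnc E) hop
  have hopen : ∀ t : Code v B, ∃ op : ℕ → ℕ, ∀ j : Fin b, label v B (op (j + 1)) = j + 1 ∧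
      Nat.count (fun x => label v B x = j + 1) (op (j + 1)) = t.1 j := by
    intro t
    choose x hx1 hx2 using fun j => hW.exists_count_eq ℰ j (t.1 j).2
    refine ⟨fun k => if h : 0 < k ∧ k - 1 < b then x ⟨k - 1, h.2⟩ else 0, fun j => ?_⟩
    have h : 0 < (j : ℕ) + 1 ∧ (j : ℕ) + 1 - 1 < b := ⟨by omega, by simp⟩
    simp only [dif_pos h]
    exact ⟨hx1 j, hx2 j⟩
  -- Injectivity: decoding recovers the order around `v`, which determines the embedding.
  -- Surjectivity: the decoded word satisfies `SumCond`, hence belongs to an embedding, and encoding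
  -- it returns the given code.
  have hbij : Function.Bijective f := by
    constructor
    · intro E E' h
      obtain ⟨op, hop⟩ := hopen (f E)
      have e1 := hdec E op hop
      have e2 := hdec E' op (h ▸ hop)
      rw [← h, e1] at e2
      have e3 : l E = l E' := List.map_injective_iff.2 Fin.val_injective e2
      exact preservingEmbedding_ext hW (hl1 E) (e3 ▸ hl1 E')
    · intro t
      obtain ⟨op, hop⟩ := hopen t
      have hδ := hW.deg_top_eq_total (ℰ := ℰ)
      set ds := List.ofFn fun j => (t.2 j : ℕ) with hds
      set δ := deg (⊤ : G.Subgraph) v with hδ'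
      have hbd : ∀ (i : ℕ) (h : i < ds.length), ds[i] < δ - 1 - i := by
        intro i h
        have h1 := (t.2 ⟨i, by simpa [hds] using h⟩).2
        simp only [hds, List.getElem_ofFn]
        simp only at h1
        omega
      obtain ⟨hp1, hp2⟩ := pickAll_spec (· + 1) (· - 1) (δ - 1) ds (fun i _ => by simp) hbd
      have hpos : ∀ x ∈ pickAll (· + 1) (δ - 1) ds, 0 < x ∧ x < total b (blockList ℰ v) := by
        intro x hx
        obtain ⟨i, hi, rfl⟩ := hp2 x hx
        omega
      obtain ⟨h1, h2, h3, h4, h5, h6, -⟩ := decodeWord_spec hL (op := op) (fun k h0 hk => by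
        obtain ⟨j, rfl⟩ : ∃ j : Fin b, k = j + 1 := ⟨⟨k - 1, by omega⟩, by simp; omega⟩
        exact (hop j).1) (by rw [length_pickAll]; simp [hds]) hp1 hpos rfl
      set w := decodeWord (blockList ℰ v) op ((List.range (total b (blockList ℰ v))).map
        (circ (pickAll (· + 1) (δ - 1) ds))) with hw
      obtain ⟨E, m, hm1, hm2⟩ := exists_preservingEmbedding hW h1 h6
      -- The decoded word is normal, so it is the very list that was chosen for `E`.
      have hm3 := huniq E m hm1 (hm2 ▸ h2)
      have hlw : (l E).map Fin.val = w := hm3 ▸ hm2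
      refine ⟨E, Prod.ext (funext fun j => Fin.ext ?_) (funext fun j => Fin.ext ?_)⟩
      · change encodeOp (label v B) ((l E).map Fin.val) (j + 1) = t.1 j
        rw [hlw, encodeOp, h3 _ (by omega) (by omega), (hop j).2]
      · have e1 : encodePos b (label v B) ((l E).map Fin.val) = ds := by
          rw [hlw, encodePos, h4, h5, ← hδ]
          exact positions_pickAll _ _ _ _ (fun i _ => by simp) hbd
        change (encodePos b (label v B) ((l E).map Fin.val))[(j : ℕ)]'_ = t.2 j
        simp only [e1, hds, List.getElem_ofFn]
  refine ⟨Equiv.ofBijective f hbij, fun E m hm hn => ?_, fun t op hop => ?_⟩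
  · rw [huniq E m hm hn]
    change (f E).toList = _
    rw [Code.toList, ofFn_wordCode]
    congr 1
    exact List.ext_getElem (by simp) fun i h1 h2 => by simp [f, wordCode]
  · refine ⟨l ((Equiv.ofBijective f hbij).symm t), hl1 _, ?_⟩
    have e1 : f ((Equiv.ofBijective f hbij).symm t) = t := Equiv.ofBijective_apply_symm_apply f hbij t
    rw [← hdec _ op (by rw [e1]; exact hop), e1]

theorem card_code (v : Fin n) (B : Fin b → G.Subgraph) : Nat.card (Code v B) =
    (∏ j : Fin b, deg (B j) v) * ∏ j ∈ Finset.Icc 1 (b - 2), (deg (⊤ : G.Subgraph) v - j) := by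
  rw [Nat.card_prod, Nat.card_pi, Nat.card_pi]
  simp only [Nat.card_eq_fintype_card, Fintype.card_fin]
  congr 1
  rw [← Finset.prod_range (fun i => deg (⊤ : G.Subgraph) v - (i + 1)),
    Finset.range_eq_Ico, Finset.prod_Ico_add' (fun i => deg (⊤ : G.Subgraph) v - i) 0 (b - 2) 1]
  rfl

end Ranking

/-! ### Planar graphs have linearly many edges. -/

section Size

variable {n : ℕ} {G : SimpleGraph (Fin n)}

theorem card_darts (H : G.Subgraph) :
    Nat.card {p : Fin n × Fin n // H.Adj p.1 p.2} = ∑ u, deg H u := by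
  classical
  have e : {p : Fin n × Fin n // H.Adj p.1 p.2} ≃ Σ u, H.neighborSet u :=
    { toFun := fun p => ⟨p.1.1, p.1.2, p.2⟩
      invFun := fun p => ⟨(p.1, p.2.1), p.2.2⟩
      left_inv := fun _ => rfl
      right_inv := fun _ => rfl }
  rw [Nat.card_congr e, Nat.card_sigma]
  exact Finset.sum_congr rfl fun u _ => Nat.card_coe_set_eq _

theorem sum_deg_top : ∑ u, deg (⊤ : G.Subgraph) u = 2 * (⊤ : G.Subgraph).edgeSet.ncard := by
  classical
  have h := SimpleGraph.sum_degrees_eq_twice_card_edges G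
  have h1 : ∀ u, deg (⊤ : G.Subgraph) u = G.degree u := fun u => by
    rw [deg, SimpleGraph.Subgraph.neighborSet_top, ← SimpleGraph.card_neighborSet_eq_degree,
      ← Nat.card_coe_set_eq, Nat.card_eq_fintype_card]
  simp only [h1, h, SimpleGraph.Subgraph.edgeSet_top]
  rw [← SimpleGraph.coe_edgeFinset, Set.ncard_coe_finset]

theorem eq_of_next_eq {H : G.Subgraph} {ρ : RotationSystem H} {u : Fin n} {x : H.neighborSet u}
    (hx : ρ.next u x = x) (a : H.neighborSet u) : a = x := by
  have h2 := (ρ.cyclic u a x).apply_eq_self_iff.2 hx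
  obtain ⟨i, hi⟩ := ρ.cyclic u a x
  rwa [Equiv.Perm.zpow_apply_eq_self_of_apply_eq_self h2] at hi

/-- A face with two sides forces both ends of its edge to have no other neighbour, so a connected
graph would have only two vertices. -/
theorem faceStep_faceStep_ne (hG : G.Connected) (hn : 3 ≤ n) (ρ : RotationSystem (⊤ : G.Subgraph))
    (d : {p : Fin n × Fin n // (⊤ : G.Subgraph).Adj p.1 p.2}) :
    ρ.faceStep (ρ.faceStep d) ≠ d := by
  obtain ⟨⟨u, w⟩, huw⟩ := d
  intro h
  have h1 : (ρ.next w ⟨u, huw.symm⟩ : Fin n) = u := congrArg (fun d => d.1.1) h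
  have hx : ρ.next w ⟨u, huw.symm⟩ = ⟨u, huw.symm⟩ := Subtype.ext h1
  have h2 : ρ.faceStep ⟨(u, w), huw⟩ = ⟨(w, u), huw.symm⟩ := Subtype.ext (Prod.ext rfl h1)
  rw [h2] at h
  have h3 : (ρ.next u ⟨w, huw⟩ : Fin n) = w := congrArg (fun d => d.1.2) h
  have hy : ρ.next u ⟨w, huw⟩ = ⟨w, huw⟩ := Subtype.ext h3
  have hall : ∀ x, x = u ∨ x = w := by
    intro x
    have := (SimpleGraph.reachable_iff_reflTransGen u x).1 (hG.preconnected u x)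
    induction this with
    | refl => exact Or.inl rfl
    | @tail a c _ hac ih =>
      rcases ih with rfl | rfl
      · exact Or.inr (congrArg Subtype.val (eq_of_next_eq hy ⟨c, hac⟩))
      · exact Or.inl (congrArg Subtype.val (eq_of_next_eq hx ⟨c, hac⟩))
  have hcard : (Finset.univ : Finset (Fin n)).card ≤ ({u, w} : Finset (Fin n)).card :=
    Finset.card_le_card fun x _ => by simpa using hall x
  rw [Finset.card_univ, Fintype.card_fin] at hcard
  have := Finset.card_le_two (a := u) (b := w)
  omega

/-- Every face of a connected graph with at least three vertices has at least three sides. -/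
theorem three_mul_faceCount_le (hG : G.Connected) (hn : 3 ≤ n)
    (ρ : RotationSystem (⊤ : G.Subgraph)) : 3 * ρ.faceCount ≤ ∑ u, deg (⊤ : G.Subgraph) u := by
  classical
  have hE : (⊤ : G.Subgraph).edgeSet ≠ ∅ := by
    intro h
    have : (⟨0, by omega⟩ : Fin n) ≠ ⟨1, by omega⟩ := by simp
    obtain ⟨w, hw⟩ : ∃ w, G.Adj ⟨0, by omega⟩ w := by
      rcases (Relation.ReflTransGen.cases_head ((SimpleGraph.reachable_iff_reflTransGen _ _).1
        (hG.preconnected ⟨0, by omega⟩ ⟨1, by omega⟩))) with h | ⟨w, hw, -⟩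
      · exact absurd h this
      · exact ⟨w, hw⟩
    have h2 : s(_, w) ∈ (⊤ : G.Subgraph).edgeSet :=
      (SimpleGraph.Subgraph.mem_edgeSet (G' := (⊤ : G.Subgraph))).2 hw
    rw [h] at h2
    exact h2
  rw [RotationSystem.faceCount, if_neg hE, ← card_darts]
  let _ := Fintype.ofFinite {p : Fin n × Fin n // (⊤ : G.Subgraph).Adj p.1 p.2}
  have : Finite (Quot fun d d' => d' = ρ.faceStep d) := Quot.finite _
  let _ := Fintype.ofFinite (Quot fun d d' => d' = ρ.faceStep d)
  rw [Nat.card_eq_fintype_card, Nat.card_eq_fintype_card, ← Finset.card_univ, ← Finset.card_univ,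
    mul_comm]
  -- Double counting: each face contains three different oriented edges, and each oriented edge lies
  -- in one face.
  refine Finset.card_mul_le_card_mul (fun (q : Quot fun d d' => d' = ρ.faceStep d) d =>
    Quot.mk _ d = q) (m := 3) (n := 1) ?_ ?_ |>.trans_eq (mul_one _)
  · rintro ⟨d⟩ -
    have hsub : ({d, ρ.faceStep d, ρ.faceStep (ρ.faceStep d)} : Finset _) ⊆
        Finset.bipartiteAbove (fun (q : Quot fun d d' => d' = ρ.faceStep d) d =>
          Quot.mk _ d = q) Finset.univ (Quot.mk _ d) := by
      intro x hx
      simp only [Finset.mem_insert, Finset.mem_singleton] at hx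
      rw [Finset.mem_bipartiteAbove]
      refine ⟨Finset.mem_univ _, ?_⟩
      have h1 : ∀ d, Quot.mk (fun d d' => d' = ρ.faceStep d) (ρ.faceStep d) = Quot.mk _ d :=
        fun d => (Quot.sound (r := fun d d' => d' = ρ.faceStep d) (a := d) rfl).symm
      rcases hx with rfl | rfl | rfl
      · rfl
      · exact h1 _
      · exact (h1 _).trans (h1 _)
    have hstep : ∀ d, d ≠ ρ.faceStep d := fun d h =>
      (SimpleGraph.Subgraph.Adj.ne d.2) (congrArg (fun d => d.1.1) h)
    refine le_trans (le_of_eq ?_) (Finset.card_le_card hsub)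
    rw [Finset.card_eq_three.2 ⟨_, _, _, hstep d, (faceStep_faceStep_ne hG hn ρ d).symm,
      hstep _, rfl⟩]
  · intro d _
    refine Finset.card_le_one.2 fun q hq q' hq' => ?_
    rw [Finset.mem_bipartiteBelow] at hq hq'
    exact hq.2.symm.trans hq'.2

/-- Euler's formula together with three times the faces being at most twice the edges. This makes
the input linear in `n`. -/
theorem sum_deg_top_le (hG : G.Connected) (hn : 3 ≤ n) (E : SphereEmbedding (⊤ : G.Subgraph)) :
    ∑ u, deg (⊤ : G.Subgraph) u ≤ 6 * n := by
  have h1 := three_mul_faceCount_le hG hn E.toRotationSystem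
  have h2 := E.euler
  rw [sum_deg_top] at h1 ⊢
  have h3 : (⊤ : G.Subgraph).verts.ncard = n := by
    rw [SimpleGraph.Subgraph.verts_top, Set.ncard_univ, Nat.card_eq_fintype_card, Fintype.card_fin]
  omega

variable {v : Fin n} {b : ℕ} {B : Fin b → G.Subgraph}

theorem Wedge.three_le (hW : Wedge v B) : 3 ≤ n := by
  have hb := hW.two_le
  obtain ⟨x, hx⟩ := hW.nbr ⟨0, by omega⟩
  obtain ⟨y, hy⟩ := hW.nbr ⟨1, by omega⟩
  have hxy : x ≠ y := by
    rintro rfl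
    simpa using hW.eq_of_adj hx hy
  have := Finset.card_le_univ ({v, x, y} : Finset (Fin n))
  rwa [Finset.card_eq_three.2 ⟨v, x, y, hx.ne, hy.ne, hxy, rfl⟩, Fintype.card_fin] at this

theorem Wedge.sum_deg_le (hW : Wedge v B) (u : Fin n) :
    ∑ j, deg (B j) u ≤ deg (⊤ : G.Subgraph) u := by
  classical
  have h1 : ∀ H : G.Subgraph, deg H u = (Finset.univ.filter fun w => H.Adj u w).card := by
    intro H
    rw [deg, ← Set.ncard_coe_finset]
    congr 1
    ext w
    simp
  simp only [h1]
  rw [← Finset.card_biUnion]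
  · refine Finset.card_le_card fun w hw => ?_
    rw [Finset.mem_biUnion] at hw
    obtain ⟨j, -, hj⟩ := hw
    rw [Finset.mem_filter] at hj ⊢
    exact ⟨Finset.mem_univ _, hj.2.adj_sub⟩
  · intro i _ j _ hij
    refine Finset.disjoint_left.2 fun w hi hj => ?_
    rw [Finset.mem_filter] at hi hj
    exact hij (hW.eq_of_adj hi.2 hj.2)

theorem Wedge.exists_adj_of_mem (hW : Wedge v B) (j : Fin b) {u : Fin n} (hu : u ∈ (B j).verts) :
    ∃ w, (B j).Adj u w := by
  by_cases huv : u = v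
  · subst huv; exact hW.nbr j
  · rcases Relation.ReflTransGen.cases_head ((coe_preconnected_iff _).1
      (hW.connected j).preconnected u hu v (hW.mem j)) with h | ⟨w, hw, -⟩
    · exact absurd h huv
    · exact ⟨w, hw⟩

theorem deg_iSup_le (H : G.Subgraph) (u : Fin n) : deg H u ≤ deg (⊤ : G.Subgraph) u :=
  Set.ncard_le_ncard (fun _ h => h.adj_sub) (Set.toFinite _)

end Size

/-! ### Reasoning about programs: word size, frames, loops, arrays. -/

section Machine

/-- `Run p s s' t`: the program `p`, started in `s`, halts in `s'` after `t` units of time. -/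
inductive Run : Prog → State → State → ℕ → Prop
  | skip (s : State) : Run .skip s s 1
  | assign (s : State) (r : ℕ) (x : Expr) : Run (.assign r x) s (s.setReg r (x.eval s)) (x.cost + 1)
  | store (s : State) (a : ℕ) (i x : Expr) :
      Run (.store a i x) s (s.setMem a (i.eval s) (x.eval s)) (i.cost + x.cost + 1)
  | seq {p q : Prog} {s s' s'' : State} {t t' : ℕ} (hp : Run p s s' t) (hq : Run q s' s'' t') :
      Run (.seq p q) s s'' (t + t')
  | ite_true {x : Expr} {p q : Prog} {s s' : State} {t : ℕ} (h : x.eval s ≠ 0)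
      (hp : Run p s s' t) : Run (.ite x p q) s s' (x.cost + 1 + t)
  | ite_false {x : Expr} {p q : Prog} {s s' : State} {t : ℕ} (h : x.eval s = 0)
      (hq : Run q s s' t) : Run (.ite x p q) s s' (x.cost + 1 + t)
  | loop_true {x : Expr} {p : Prog} {s s' s'' : State} {t t' : ℕ} (h : x.eval s ≠ 0)
      (hp : Run p s s' t) (hl : Run (.loop x p) s' s'' t') :
      Run (.loop x p) s s'' (x.cost + 1 + t + t')
  | loop_false {x : Expr} {p : Prog} {s : State} (h : x.eval s = 0) :
      Run (.loop x p) s s (x.cost + 1)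

/-- All registers and memory cells contain numbers up to `M`. -/
def State.Bounded (M : ℕ) (s : State) : Prop := (∀ r, s.reg r ≤ M) ∧ ∀ a i, s.mem a i ≤ M

theorem State.Bounded.mono {M M' : ℕ} {s : State} (h : s.Bounded M) (hM : M ≤ M') : s.Bounded M' :=
  ⟨fun r => (h.1 r).trans hM, fun a i => (h.2 a i).trans hM⟩

theorem State.Bounded.setReg {M : ℕ} {s : State} (h : s.Bounded M) {r x : ℕ} (hx : x ≤ M) :
    (s.setReg r x).Bounded M := by
  refine ⟨fun q => ?_, h.2⟩
  simp only [State.setReg, Function.update_apply]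
  split_ifs
  exacts [hx, h.1 q]

theorem State.Bounded.setMem {M : ℕ} {s : State} (h : s.Bounded M) {a i x : ℕ} (hx : x ≤ M) :
    (s.setMem a i x).Bounded M := by
  refine ⟨h.1, fun c k => ?_⟩
  simp only [State.setMem, Function.update_apply]
  split_ifs
  · rw [Function.update_apply]
    split_ifs
    exacts [hx, h.2 a k]
  · exact h.2 c k

/-- Expressions without multiplication and division, with small constants. -/
def Expr.linear : Expr → Bool
  | const k => k ≤ 4
  | reg _ => true
  | load _ i => i.linear
  | add x y => x.linear && y.linear
  | sub x y => x.linear && y.linear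
  | mul _ _ => false
  | div _ _ => false

/-- Constants of value at most `4`. -/
def Expr.isConst : Expr → Bool
  | const k => k ≤ 4
  | _ => false

/-- Expressions whose value exceeds the numbers in the memory by a constant only. -/
def Expr.slow : Expr → Bool
  | const k => k ≤ 4
  | reg _ => true
  | load _ i => i.linear
  | add x y => x.slow && y.isConst
  | sub x y => x.slow && y.linear
  | mul _ _ => false
  | div _ _ => false

theorem Expr.isConst_iff {x : Expr} : x.isConst ↔ ∃ k ≤ 4, x = const k := by
  cases x <;> simp [isConst]

theorem Expr.slow.linear {x : Expr} (h : x.slow) : x.linear := by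
  induction x with
  | const k => exact h
  | reg r => rfl
  | load a i => exact h
  | add x y ihx ihy =>
    simp only [slow, Bool.and_eq_true] at h
    obtain ⟨k, hk, rfl⟩ := isConst_iff.1 h.2
    simp [Expr.linear, ihx h.1, hk]
  | sub x y ihx ihy =>
    simp only [slow, Bool.and_eq_true] at h
    simp [Expr.linear, ihx h.1, h.2]
  | mul x y => simp [slow] at h
  | div x y => simp [slow] at h

/-- The value is at most the sum over the leaves that are added, each of which contributes at most
`M`. -/
theorem Expr.eval_le {M : ℕ} (hM : 4 ≤ M) {s : State} (hs : s.Bounded M) {x : Expr}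
    (h : x.linear) : x.eval s ≤ x.cost * M := by
  induction x with
  | const k => simp only [linear, decide_eq_true_eq] at h; simp only [eval, cost]; omega
  | reg r => simpa [eval, cost] using hs.1 r
  | load a i =>
    simp only [eval, cost]
    exact (hs.2 a _).trans (Nat.le_mul_of_pos_left _ (by omega))
  | add x y ihx ihy =>
    simp only [linear, Bool.and_eq_true] at h
    have := ihx h.1
    have := ihy h.2
    simp only [eval, cost, Nat.add_mul]
    omega
  | sub x y ihx ihy =>
    simp only [linear, Bool.and_eq_true] at h
    have := ihx h.1
    simp only [eval, cost, Nat.add_mul]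
    omega
  | mul x y => simp [linear] at h
  | div x y => simp [linear] at h

theorem Expr.fits_of_linear {M W : ℕ} (hM : 4 ≤ M) {s : State} (hs : s.Bounded M) {x : Expr}
    (h : x.linear) (hW : x.cost * M ≤ W) : x.Fits W s := by
  induction x with
  | const k =>
    simp only [linear, decide_eq_true_eq] at h
    simp only [cost] at hW
    simp only [Fits]; omega
  | reg r =>
    simp only [cost, one_mul] at hW
    exact (hs.1 r).trans hW
  | load a i ih =>
    simp only [cost, Nat.add_mul] at hW
    exact ⟨ih h (by omega), (hs.2 _ _).trans (by omega)⟩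
  | add x y ihx ihy =>
    simp only [linear, Bool.and_eq_true] at h
    have h1 := eval_le hM hs h.1
    have h2 := eval_le hM hs h.2
    simp only [cost, Nat.add_mul] at hW
    exact ⟨ihx h.1 (by omega), ihy h.2 (by omega), by omega⟩
  | sub x y ihx ihy =>
    simp only [linear, Bool.and_eq_true] at h
    simp only [cost, Nat.add_mul] at hW
    exact ⟨ihx h.1 (by omega), ihy h.2 (by omega)⟩
  | mul x y => simp [linear] at h
  | div x y => simp [linear] at h

/-- Only constants up to `4` may be added at the outer level, so a stored number exceeds the earlier
ones by a constant per unit of time. Without this restriction repeated doubling would be possible.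
-/
theorem Expr.eval_le_of_slow {M : ℕ} {s : State} (hs : s.Bounded M) {x : Expr}
    (h : x.slow) : x.eval s ≤ M + 4 * x.cost := by
  induction x with
  | const k => simp only [slow, decide_eq_true_eq] at h; simp only [eval, cost]; omega
  | reg r => have := hs.1 r; simp only [eval]; omega
  | load a i => have := hs.2 a (i.eval s); simp only [eval]; omega
  | add x y ihx ihy =>
    simp only [slow, Bool.and_eq_true] at h
    obtain ⟨k, hk, rfl⟩ := isConst_iff.1 h.2
    have := ihx h.1
    simp only [eval, cost]
    omega
  | sub x y ihx ihy =>
    simp only [slow, Bool.and_eq_true] at h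
    have := ihx h.1
    simp only [eval, cost]
    omega
  | mul x y => simp [slow] at h
  | div x y => simp [slow] at h

/-- Programs in which the numbers grow only by constants. -/
def Prog.tame : Prog → Bool
  | skip => true
  | assign _ x => x.slow
  | store _ i x => i.linear && x.slow
  | seq p q => p.tame && q.tame
  | ite x p q => x.linear && p.tame && q.tame
  | loop x p => x.linear && p.tame

/-- A tame program needs only words of logarithmic length. -/
theorem Run.exec {p : Prog} {s s' : State} {t : ℕ} (h : Run p s s' t) (hp : p.tame) {W T N : ℕ}
    (hW : T * N ≤ W) : ∀ M, 4 ≤ M → s.Bounded M → M + 4 * t ≤ N → t ≤ T →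
      Exec W p s s' t ∧ s'.Bounded (M + 4 * t) := by
  -- Stored numbers stay below `N`, and an expression costs at most the total time `T`, so
  -- intermediate values are at most `T * N`.
  have key : ∀ {M : ℕ} {s : State} {x : Expr}, 4 ≤ M → s.Bounded M → x.linear → M ≤ N →
      x.cost ≤ T → x.Fits W s := fun hM hs hx hMN hT =>
    Expr.fits_of_linear hM hs hx ((Nat.mul_le_mul hT hMN).trans hW)
  induction h with
  | skip s => exact fun M hM hs _ _ => ⟨.skip s, hs.mono (by omega)⟩
  | assign s r x =>
    intro M hM hs hN hT
    simp only [Prog.tame] at hp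
    exact ⟨.assign s r x (key hM hs (Expr.slow.linear hp) (by omega) (by omega)),
      (hs.mono (by omega)).setReg ((Expr.eval_le_of_slow hs hp).trans (by omega))⟩
  | store s a i x =>
    intro M hM hs hN hT
    simp only [Prog.tame, Bool.and_eq_true] at hp
    exact ⟨.store s a i x (key hM hs hp.1 (by omega) (by omega))
      (key hM hs (Expr.slow.linear hp.2) (by omega) (by omega)),
      (hs.mono (by omega)).setMem ((Expr.eval_le_of_slow hs hp.2).trans (by omega))⟩
  | seq _ _ ih1 ih2 =>
    intro M hM hs hN hT
    simp only [Prog.tame, Bool.and_eq_true] at hp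
    obtain ⟨a1, a2⟩ := ih1 hp.1 M hM hs (by omega) (by omega)
    obtain ⟨b1, b2⟩ := ih2 hp.2 _ (by omega) a2 (by omega) (by omega)
    exact ⟨.seq a1 b1, b2.mono (by omega)⟩
  | ite_true h _ ih =>
    intro M hM hs hN hT
    simp only [Prog.tame, Bool.and_eq_true] at hp
    obtain ⟨a1, a2⟩ := ih hp.1.2 M hM hs (by omega) (by omega)
    exact ⟨.ite_true (key hM hs hp.1.1 (by omega) (by omega)) h a1, a2.mono (by omega)⟩
  | ite_false h _ ih =>
    intro M hM hs hN hT
    simp only [Prog.tame, Bool.and_eq_true] at hp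
    obtain ⟨a1, a2⟩ := ih hp.2 M hM hs (by omega) (by omega)
    exact ⟨.ite_false (key hM hs hp.1.1 (by omega) (by omega)) h a1, a2.mono (by omega)⟩
  | loop_true h _ _ ih1 ih2 =>
    intro M hM hs hN hT
    have hp' := hp
    simp only [Prog.tame, Bool.and_eq_true] at hp'
    obtain ⟨a1, a2⟩ := ih1 hp'.2 M hM hs (by omega) (by omega)
    obtain ⟨b1, b2⟩ := ih2 hp _ (by omega) a2 (by omega) (by omega)
    exact ⟨.loop_true (key hM hs hp'.1 (by omega) (by omega)) h a1 b1, b2.mono (by omega)⟩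
  | loop_false h =>
    intro M hM hs hN hT
    simp only [Prog.tame, Bool.and_eq_true] at hp
    exact ⟨.loop_false (key hM hs hp.1 (by omega) (by omega)) h, hs.mono (by omega)⟩

/-- The registers to which a program writes. -/
def Prog.regs : Prog → List ℕ
  | skip => []
  | assign r _ => [r]
  | store _ _ _ => []
  | seq p q => p.regs ++ q.regs
  | ite _ p q => p.regs ++ q.regs
  | loop _ p => p.regs

/-- The memory banks to which a program writes. -/
def Prog.banks : Prog → List ℕ
  | skip => []
  | assign _ _ => []
  | store a _ _ => [a]
  | seq p q => p.banks ++ q.banks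
  | ite _ p q => p.banks ++ q.banks
  | loop _ p => p.banks

/-- The states `s` and `s'` agree outside the given registers and banks. -/
def Frame (R A : List ℕ) (s s' : State) : Prop :=
  (∀ r, r ∉ R → s'.reg r = s.reg r) ∧ ∀ a, a ∉ A → s'.mem a = s.mem a

theorem Frame.refl (R A : List ℕ) (s : State) : Frame R A s s := ⟨fun _ _ => rfl, fun _ _ => rfl⟩

theorem Frame.trans {R R' R'' A A' A'' : List ℕ} {s s' s'' : State} (h : Frame R A s s')
    (h' : Frame R' A' s' s'') (hR : R ⊆ R'') (hA : A ⊆ A'') (hR' : R' ⊆ R'') (hA' : A' ⊆ A'') :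
    Frame R'' A'' s s'' :=
  ⟨fun r hr => (h'.1 r fun h => hr (hR' h)).trans (h.1 r fun h => hr (hR h)),
    fun a ha => (h'.2 a fun h => ha (hA' h)).trans (h.2 a fun h => ha (hA h))⟩

theorem Frame.mono {R R' A A' : List ℕ} {s s' : State} (h : Frame R A s s') (hR : R ⊆ R')
    (hA : A ⊆ A') : Frame R' A' s s' :=
  ⟨fun r hr => h.1 r fun h => hr (hR h), fun a ha => h.2 a fun h => ha (hA h)⟩

/-- The sets of written registers and banks are syntactic, so that a concrete program is seen to
preserve a register by evaluation. -/
theorem Run.frame {p : Prog} {s s' : State} {t : ℕ} (h : Run p s s' t) :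
    Frame p.regs p.banks s s' := by
  induction h with
  | skip s => exact Frame.refl _ _ _
  | assign s r x =>
    refine ⟨fun q hq => ?_, fun _ _ => rfl⟩
    simp only [Prog.regs, List.mem_singleton] at hq
    exact Function.update_of_ne hq _ _
  | store s a i x =>
    refine ⟨fun _ _ => rfl, fun q hq => ?_⟩
    simp only [Prog.banks, List.mem_singleton] at hq
    exact Function.update_of_ne hq _ _
  | seq _ _ ih1 ih2 =>
    exact ih1.trans ih2 (List.subset_append_left _ _) (List.subset_append_left _ _)
      (List.subset_append_right _ _) (List.subset_append_right _ _)
  | ite_true _ _ ih => exact ih.mono (List.subset_append_left _ _) (List.subset_append_left _ _)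
  | ite_false _ _ ih => exact ih.mono (List.subset_append_right _ _) (List.subset_append_right _ _)
  | loop_true _ _ _ ih1 ih2 =>
    exact ih1.trans ih2 (List.Subset.refl _) (List.Subset.refl _) (List.Subset.refl _)
      (List.Subset.refl _)
  | loop_false _ => exact Frame.refl _ _ _

/-- Started in `s`, the program halts within time `T` in a state with the property `Q`. -/
def Reach (p : Prog) (s : State) (T : ℕ) (Q : State → Prop) : Prop :=
  ∃ s' t, Run p s s' t ∧ t ≤ T ∧ Q s'

theorem Reach.imp {p : Prog} {s : State} {T T' : ℕ} {Q Q' : State → Prop} (h : Reach p s T Q)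
    (hT : T ≤ T') (hQ : ∀ s', Frame p.regs p.banks s s' → Q s' → Q' s') : Reach p s T' Q' := by
  obtain ⟨s', t, h1, h2, h3⟩ := h
  exact ⟨s', t, h1, h2.trans hT, hQ s' h1.frame h3⟩

theorem Reach.seq {p q : Prog} {s : State} {T T' : ℕ} {Q Q' : State → Prop} (h : Reach p s T Q)
    (h' : ∀ s', Frame p.regs p.banks s s' → Q s' → Reach q s' T' Q') :
    Reach (.seq p q) s (T + T') Q' := by
  obtain ⟨s', t, h1, h2, h3⟩ := h
  obtain ⟨s'', t', h4, h5, h6⟩ := h' s' h1.frame h3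
  exact ⟨s'', t + t', .seq h1 h4, by omega, h6⟩

theorem Reach.ite {x : Expr} {p q : Prog} {s : State} {T : ℕ} {Q : State → Prop}
    (h : x.eval s ≠ 0 → Reach p s T Q) (h' : x.eval s = 0 → Reach q s T Q) :
    Reach (.ite x p q) s (x.cost + 1 + T) Q := by
  by_cases hx : x.eval s = 0
  · obtain ⟨s', t, h1, h2, h3⟩ := h' hx
    exact ⟨s', _, .ite_false hx h1, by omega, h3⟩
  · obtain ⟨s', t, h1, h2, h3⟩ := h hx
    exact ⟨s', _, .ite_true hx h1, by omega, h3⟩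

/-- Programs without loops. -/
def Prog.straight : Prog → Bool
  | seq p q => p.straight && q.straight
  | ite _ p q => p.straight && q.straight
  | loop _ _ => false
  | _ => true

/-- The effect of a program without loops. -/
def Prog.step : Prog → State → State
  | skip, s => s
  | assign r x, s => s.setReg r (x.eval s)
  | store a i x, s => s.setMem a (i.eval s) (x.eval s)
  | seq p q, s => q.step (p.step s)
  | ite x p q, s => if x.eval s = 0 then q.step s else p.step s
  | loop _ _, s => s

/-- A bound for the running time of a program without loops. -/
def Prog.time : Prog → ℕ
  | skip => 1
  | assign _ x => x.cost + 1
  | store _ i x => i.cost + x.cost + 1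
  | seq p q => p.time + q.time
  | ite x p q => x.cost + 1 + (p.time + q.time)
  | loop _ _ => 0

theorem Prog.run_step {p : Prog} (hp : p.straight) (s : State) :
    ∃ t ≤ p.time, Run p s (p.step s) t := by
  induction p generalizing s with
  | skip => exact ⟨1, le_rfl, .skip s⟩
  | assign r x => exact ⟨_, le_rfl, .assign s r x⟩
  | store a i x => exact ⟨_, le_rfl, .store s a i x⟩
  | seq p q ihp ihq =>
    simp only [straight, Bool.and_eq_true] at hp
    obtain ⟨t, ht, h⟩ := ihp hp.1 s
    obtain ⟨t', ht', h'⟩ := ihq hp.2 (p.step s)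
    exact ⟨t + t', by simp only [time]; omega, .seq h h'⟩
  | ite x p q ihp ihq =>
    simp only [straight, Bool.and_eq_true] at hp
    by_cases hx : x.eval s = 0
    · obtain ⟨t, ht, h⟩ := ihq hp.2 s
      exact ⟨x.cost + 1 + t, by simp only [time]; omega, by
        simp only [step, if_pos hx]; exact .ite_false hx h⟩
    · obtain ⟨t, ht, h⟩ := ihp hp.1 s
      exact ⟨x.cost + 1 + t, by simp only [time]; omega, by
        simp only [step, if_neg hx]; exact .ite_true hx h⟩
  | loop x p => simp [straight] at hp

/-- Correctness of code without loops becomes a computation with `Prog.step`; only the loops need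
invariants. -/
theorem Reach.of_straight {p : Prog} {s : State} {T : ℕ} {Q : State → Prop} (hp : p.straight)
    (hT : p.time ≤ T) (hQ : Q (p.step s)) : Reach p s T Q := by
  obtain ⟨t, ht, h⟩ := p.run_step hp s
  exact ⟨_, t, h, ht.trans hT, hQ⟩

/-- The loop that is executed as often as register `r` says. -/
def Prog.count (r : ℕ) (p : Prog) : Prog :=
  .loop (.reg r) (.seq (.assign r (.sub (.reg r) (.const 1))) p)

/-- The body leaves the counter alone and the invariant does not depend on it. In each round the
test costs `2` and the decrement `4`; the last test costs another `2`. -/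
theorem Reach.count {r : ℕ} {p : Prog} {s : State} {k : ℕ} {f : ℕ → ℕ} {Inv : ℕ → State → Prop}
    (hk : s.reg r = k) (hr : r ∉ p.regs) (hinv : ∀ i s x, Inv i s → Inv i (s.setReg r x))
    (h0 : Inv 0 s) (hstep : ∀ i < k, ∀ s', Frame (r :: p.regs) p.banks s s' → Inv i s' →
      Reach p s' (f i) (Inv (i + 1))) :
    Reach (.count r p) s (∑ i ∈ Finset.range k, (f i + 6) + 2) (Inv k) := by
  have hsub : p.regs ⊆ r :: p.regs := List.subset_cons_self _ _
  have key : ∀ m i s', m + i = k → s'.reg r = m → Frame (r :: p.regs) p.banks s s' → Inv i s' →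
      Reach (.count r p) s' (∑ i ∈ Finset.Ico i k, (f i + 6) + 2) (Inv k) := by
    intro m
    induction m with
    | zero =>
      intro i s' hi hs hf hI
      obtain rfl : i = k := by omega
      refine ⟨s', 2, .loop_false hs, by omega, hI⟩
    | succ m ih =>
      intro i s' hi hs hf hI
      set s1 := s'.setReg r m with hs1
      have hs1r : s1.reg r = m := by simp [hs1, State.setReg]
      have hf1 : Frame (r :: p.regs) p.banks s s1 := by
        refine ⟨fun q hq => ?_, hf.2⟩
        rw [← hf.1 q hq]
        exact Function.update_of_ne (fun h : q = r => hq (h ▸ List.mem_cons_self)) _ _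
      obtain ⟨s2, t, h1, h2, h3⟩ := hstep i (by omega) s1 hf1 (hinv _ _ _ hI)
      obtain ⟨s3, t', h4, h5, h6⟩ := ih (i + 1) s2 (by omega) ((h1.frame.1 r hr).trans hs1r)
        (hf1.trans h1.frame (List.Subset.refl _) (List.Subset.refl _) hsub (List.Subset.refl _)) h3
      have h7 : Run (.seq (.assign r (.sub (.reg r) (.const 1))) p) s' s2 (4 + t) := by
        refine .seq ?_ h1
        have := Run.assign s' r (.sub (.reg r) (.const 1))
        simp only [Expr.eval, hs, Nat.add_sub_cancel] at this
        exact this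
      refine ⟨s3, _, .loop_true (by simp [Expr.eval, hs]) h7 h4, ?_, h6⟩
      rw [Finset.sum_eq_sum_Ico_succ_bot (by omega)]
      simp only [Expr.cost]
      omega
  rw [Finset.range_eq_Ico]
  exact key k 0 s (by omega) hk (Frame.refl _ _ _) h0

theorem Reach.count_const {r : ℕ} {p : Prog} {s : State} {k F : ℕ} {Inv : ℕ → State → Prop}
    (hk : s.reg r = k) (hr : r ∉ p.regs) (hinv : ∀ i s x, Inv i s → Inv i (s.setReg r x))
    (h0 : Inv 0 s) (hstep : ∀ i < k, ∀ s', Frame (r :: p.regs) p.banks s s' → Inv i s' →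
      Reach p s' F (Inv (i + 1))) :
    Reach (.count r p) s (k * (F + 6) + 2) (Inv k) := by
  have := Reach.count hk hr hinv h0 hstep
  rwa [Finset.sum_const, Finset.card_range, smul_eq_mul] at this

/-- The list `l` stands in the array `m` from position `p` on. -/
def Holds (m : ℕ → ℕ) (p : ℕ) (l : List ℕ) : Prop := ∀ (i : ℕ) (h : i < l.length), m (p + i) = l[i]

theorem holds_nil (m : ℕ → ℕ) (p : ℕ) : Holds m p [] := fun i h => by simp at h

theorem holds_cons {m : ℕ → ℕ} {p x : ℕ} {l : List ℕ} :
    Holds m p (x :: l) ↔ m p = x ∧ Holds m (p + 1) l := by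
  constructor
  · refine fun h => ⟨h 0 (by simp), fun i hi => ?_⟩
    have := h (i + 1) (by simpa using hi)
    rwa [List.getElem_cons_succ, show p + (i + 1) = p + 1 + i by omega] at this
  · rintro ⟨h1, h2⟩ (_ | i) hi
    · simpa using h1
    · have := h2 i (by simpa using hi)
      rwa [List.getElem_cons_succ, show p + (i + 1) = p + 1 + i by omega]

theorem holds_append {m : ℕ → ℕ} {p : ℕ} {l l' : List ℕ} :
    Holds m p (l ++ l') ↔ Holds m p l ∧ Holds m (p + l.length) l' := by
  induction l generalizing p with
  | nil => simp [holds_nil]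
  | cons x l ih =>
    rw [List.cons_append, holds_cons, ih, holds_cons, and_assoc, List.length_cons,
      show p + 1 + l.length = p + (l.length + 1) by omega]

theorem Holds.congr {m m' : ℕ → ℕ} {p : ℕ} {l : List ℕ} (h : Holds m p l)
    (h' : ∀ i, p ≤ i → i < p + l.length → m' i = m i) : Holds m' p l := fun i hi => by
  rw [h' _ (by omega) (by omega), h i hi]

theorem Holds.concat {m : ℕ → ℕ} {p x q : ℕ} {l : List ℕ} (h : Holds m p l) (hq : q = p + l.length) :
    Holds (Function.update m q x) p (l ++ [x]) := by
  rw [holds_append, holds_cons]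
  refine ⟨h.congr fun i _ hi => ?_, ?_, holds_nil _ _⟩
  · rw [Function.update_of_ne (by omega)]
  · rw [hq, Function.update_self]

theorem Holds.get {m : ℕ → ℕ} {p : ℕ} {l : List ℕ} (h : Holds m p l) {q i : ℕ} (hi : i < l.length)
    (hq : q = p + i) : m q = l[i] := by rw [hq, h i hi]

end Machine

/-! ### Reading adjacency lists and linking the neighbours of the cut-vertex. -/

section Parsing

/-! Both programs read the data with the same code. For the blocks (`c = 0`) and for the embedding of
their union (`c = 1`) the labels of the neighbours of the cut-vertex are put into bank `3 + c`, and
their successors and predecessors into the banks `5 + c` and `7 + c`. The registers `11`, `12` and `13`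
hold the number of vertices, the cut-vertex and the number of blocks, register `14` the length of the
list of neighbours, and register `9` the place of the next number of the output. -/

/-- The entry for a vertex and its circular adjacency list. -/
def enc (e : ℕ × List ℕ) : List ℕ := e.1 :: e.2.length :: e.2

theorem length_enc (e : ℕ × List ℕ) : (enc e).length = e.2.length + 2 := rfl

/-- The code of a list of entries. -/
def encAll (es : List (ℕ × List ℕ)) : List ℕ := es.length :: es.flatMap enc

/-- In the circular list `l`, successors are given by `nxt` and predecessors by `prv`. -/
def Linked (nxt prv : ℕ → ℕ) (l : List ℕ) : Prop :=
  ∀ x ∈ l, nxt (l.formPerm⁻¹ x) = x ∧ prv x = l.formPerm⁻¹ x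

/-- The situation after some entries were copied to bank `2` and other, labelled lists
were linked. -/
structure Parsed (c o m : ℕ) (Y : List (ℕ × List ℕ)) (Z : List (ℕ × List ℕ)) (s : State) :
    Prop where
  out : Holds (s.mem 2) o (Y.flatMap enc)
  pos : s.reg 9 = o + (Y.flatMap enc).length
  num : s.reg 10 = m + Y.length
  lab : ∀ z ∈ Z, ∀ x ∈ z.2, s.mem (3 + c) x = z.1
  zero : ∀ x, (∀ z ∈ Z, x ∉ z.2) → s.mem (3 + c) x = 0
  linked : ∀ z ∈ Z, Linked (s.mem (5 + c)) (s.mem (7 + c)) z.2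
  last : ∀ Z' z, Z = Z' ++ [z] → s.reg 14 = z.2.length ∧ (z.2 ≠ [] → s.reg 7 ∈ z.2)

/-- Read the next number into register `r`. -/
def read (c r : ℕ) : Prog := .seq (.assign r (.load c (.reg 3))) (.assign 3 (.add (.reg 3) (.const 1)))

/-- Write the value of `x` to the output. -/
def write (x : Expr) : Prog := .seq (.store 2 (.reg 9) x) (.assign 9 (.add (.reg 9) (.const 1)))

/-- Copy one number to the output. -/
def copyBody (c : ℕ) : Prog := .seq (read c 8) (write (.reg 8))

/-- Label one neighbour of the vertex in register `12` and link it to its predecessor. -/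
def linkBody (c : ℕ) : Prog :=
  .seq (read c 8) (.seq (.store (3 + c) (.reg 8) (.reg 4)) (.seq (.store (5 + c) (.reg 7) (.reg 8))
    (.seq (.store (7 + c) (.reg 8) (.reg 7)) (.assign 7 (.reg 8)))))

theorem take_succ_eq {α : Type*} (l : List α) {i : ℕ} (h : i < l.length) :
    l.take (i + 1) = l.take i ++ [l[i]] := by simp

theorem reach_copy {c p o : ℕ} {l X : List ℕ} {s : State} (hc : c = 0 ∨ c = 1)
    (hd : s.reg 2 = l.length) (hp : s.reg 3 = p) (hin : Holds (s.mem c) p l)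
    (hX : Holds (s.mem 2) o X) (h9 : s.reg 9 = o + X.length) :
    Reach (.count 2 (copyBody c)) s (l.length * 30 + 2) (fun s' => s'.reg 3 = p + l.length ∧
      Holds (s'.mem 2) o (X ++ l) ∧ s'.reg 9 = o + (X ++ l).length) := by
  have h := Reach.count_const (s := s) (r := 2) (p := copyBody c) (F := 24)
    (Inv := fun i s' => s'.reg 3 = p + i ∧ Holds (s'.mem 2) o (X ++ l.take i) ∧
      s'.reg 9 = o + (X ++ l.take i).length) hd (by simp [copyBody, Prog.regs, read, write])
      (fun _ _ _ h => h) (by simpa using ⟨hp, hX, h9⟩) ?_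
  · simpa using h
  · rintro i hi s' hf ⟨h3, h2, h9⟩
    have hm : s'.mem c = s.mem c := hf.2 c (by
      rcases hc with rfl | rfl <;> simp [copyBody, Prog.banks, read, write])
    have hr : s'.mem c (p + i) = l[i] := by rw [hm]; exact hin i hi
    refine Reach.of_straight rfl (by simp [copyBody, read, write, Prog.time, Expr.cost]) ?_
    have := h2.concat (x := l[i]) h9
    rw [List.append_assoc, ← take_succ_eq l hi] at this
    simp only [copyBody, read, write, Prog.step, Expr.eval, State.setReg, State.setMem, h3, hr]
    refine ⟨?_, ?_, ?_⟩
    · simp; omega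
    · simpa using this
    · simp [h9]; omega

theorem formPerm_inv_mem {l : List ℕ} {x : ℕ} : l.formPerm⁻¹ x ∈ l ↔ x ∈ l := by
  rw [← List.formPerm_mem_iff_mem]; simp

/-- Register `7` holds the predecessor of the element that is read. It starts with the last element
of the list, so that the first round closes the circle. The links of elements outside `l` are
untouched, which lets all blocks share the same banks. -/
theorem reach_link {c p j : ℕ} {l : List ℕ} {s : State} (hc : c = 0 ∨ c = 1)
    (hd : s.reg 2 = l.length) (hp : s.reg 3 = p) (h4 : s.reg 4 = j) (hin : Holds (s.mem c) p l)
    (hn : l.Nodup) (h7 : ∀ h : l ≠ [], s.reg 7 = l.getLast h) :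
    Reach (.count 2 (linkBody c)) s (l.length * 30 + 2) (fun s' => s'.reg 3 = p + l.length ∧
      (∀ x, s'.mem (3 + c) x = if x ∈ l then j else s.mem (3 + c) x) ∧
      Linked (s'.mem (5 + c)) (s'.mem (7 + c)) l ∧ (l ≠ [] → s'.reg 7 ∈ l) ∧
      ∀ x, x ∉ l → s'.mem (5 + c) x = s.mem (5 + c) x ∧ s'.mem (7 + c) x = s.mem (7 + c) x) := by
  have h := Reach.count_const (s := s) (r := 2) (p := linkBody c) (F := 24)
    (Inv := fun i s' => s'.reg 3 = p + i ∧
      (∀ x, s'.mem (3 + c) x = if x ∈ l.take i then j else s.mem (3 + c) x) ∧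
      (∀ (m : ℕ) (h : m < l.length), m < i → s'.mem (5 + c) (l.formPerm⁻¹ l[m]) = l[m] ∧
        s'.mem (7 + c) l[m] = l.formPerm⁻¹ l[m]) ∧
      ((∀ h : i < l.length, s'.reg 7 = l.formPerm⁻¹ l[i]) ∧ (l ≠ [] → s'.reg 7 ∈ l)) ∧
      ∀ x, x ∉ l → s'.mem (5 + c) x = s.mem (5 + c) x ∧ s'.mem (7 + c) x = s.mem (7 + c) x)
      hd (by simp [linkBody, Prog.regs, read]) (fun _ _ _ h => h) ?_ ?_
  · refine h.imp le_rfl ?_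
    rintro s' - ⟨e1, e2, e3, e4, e5⟩
    refine ⟨e1, by simpa using e2, fun x hx => ?_, e4.2, e5⟩
    obtain ⟨m, hm, rfl⟩ := List.mem_iff_getElem.1 hx
    exact e3 m hm hm
  · refine ⟨by simpa using hp, by simp, by simp, ⟨fun h => ?_, fun h => ?_⟩, by simp⟩
    · have hne : l ≠ [] := List.ne_nil_of_length_pos h
      rw [h7 hne, Equiv.Perm.eq_inv_iff_eq, List.getLast_eq_getElem]
      rw [List.formPerm_apply_getElem l hn]
      simp [Nat.sub_add_cancel h]
    · rw [h7 h]; exact List.getLast_mem h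
  · rintro i hi s' hf ⟨h3, hl, hnx, ⟨h7, -⟩, ho⟩
    have hm : s'.mem c = s.mem c := hf.2 c (by
      rcases hc with rfl | rfl <;> simp [linkBody, Prog.banks, read])
    have h4' : s'.reg 4 = j := (hf.1 4 (by simp [linkBody, Prog.regs, read])).trans h4
    have hr : s'.mem c (p + i) = l[i] := by rw [hm]; exact hin i hi
    have h7 := h7 hi
    refine Reach.of_straight rfl (by simp [linkBody, read, Prog.time, Expr.cost]) ?_
    have hmem : l[i] ∈ l := List.getElem_mem _
    have hmem' : l.formPerm⁻¹ l[i] ∈ l := formPerm_inv_mem.2 hmem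
    have hstep : ∀ h : i + 1 < l.length, l[i] = l.formPerm⁻¹ l[i + 1] := fun h => by
      rw [Equiv.Perm.eq_inv_iff_eq, List.formPerm_apply_lt_getElem _ hn]
    have main : ∀ s2 : State, s2.reg 3 = p + i + 1 → s2.reg 7 = l[i] →
        s2.mem (3 + c) = Function.update (s'.mem (3 + c)) l[i] j →
        s2.mem (5 + c) = Function.update (s'.mem (5 + c)) (l.formPerm⁻¹ l[i]) l[i] →
        s2.mem (7 + c) = Function.update (s'.mem (7 + c)) l[i] (l.formPerm⁻¹ l[i]) →
        s2.reg 3 = p + (i + 1) ∧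
        (∀ x, s2.mem (3 + c) x = if x ∈ l.take (i + 1) then j else s.mem (3 + c) x) ∧
        (∀ (m : ℕ) (h : m < l.length), m < i + 1 → s2.mem (5 + c) (l.formPerm⁻¹ l[m]) = l[m] ∧
          s2.mem (7 + c) l[m] = l.formPerm⁻¹ l[m]) ∧
        ((∀ h : i + 1 < l.length, s2.reg 7 = l.formPerm⁻¹ l[i + 1]) ∧ (l ≠ [] → s2.reg 7 ∈ l)) ∧
        ∀ x, x ∉ l → s2.mem (5 + c) x = s.mem (5 + c) x ∧ s2.mem (7 + c) x = s.mem (7 + c) x := by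
      intro s2 e3 e7 el en ep
      refine ⟨by omega, fun x => ?_, fun m hm hmi => ?_, ⟨fun h => e7.trans (hstep h), fun _ => e7 ▸ hmem⟩,
        fun x hx => ?_⟩
      · rw [el, take_succ_eq l hi, Function.update_apply, hl]
        simp only [List.mem_append, List.mem_singleton]
        by_cases hx : x = l[i] <;> simp [hx]
      · rw [en, ep]
        by_cases hmi' : m = i
        · subst hmi'; simp
        · have hne : l[m] ≠ l[i] := fun h => hmi' ((hn.getElem_inj_iff).1 h)
          rw [Function.update_of_ne fun h => hne ((l.formPerm⁻¹).injective h),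
            Function.update_of_ne hne]
          exact hnx m hm (by omega)
      · rw [en, ep, Function.update_of_ne fun h : x = _ => hx (h ▸ hmem'),
          Function.update_of_ne fun h : x = _ => hx (h ▸ hmem)]
        exact ho x hx
    rcases hc with rfl | rfl <;>
    · apply main <;>
        simp [linkBody, read, Prog.step, Expr.eval, State.setReg, State.setMem, h3, hr, h7, h4']

/-- The value is `0` if and only if the two values are equal. -/
def neqExpr (x y : Expr) : Expr := .add (.sub x y) (.sub y x)

theorem eval_neqExpr (x y : Expr) (s : State) : (neqExpr x y).eval s = 0 ↔ x.eval s = y.eval s := by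
  simp only [neqExpr, Expr.eval]; omega

/-- Read the vertex and the length of an entry. -/
def entryHead (c : ℕ) : Prog := .seq (read c 5) (read c 2)

/-- Copy the vertex and the length of an entry to the output. -/
def copyHead : Prog := .seq (write (.reg 5)) (write (.reg 2))

/-- Remember the length and the last element of the list that follows. -/
def linkHead (c : ℕ) : Prog :=
  .seq (.assign 14 (.reg 2)) (.assign 7 (.load c (.sub (.add (.reg 3) (.reg 2)) (.const 1))))

/-- Read an entry: copy it to the output, or link it if it belongs to the vertex in register `12`. -/
def entry (c : ℕ) : Prog :=
  .seq (entryHead c) (.ite (neqExpr (.reg 5) (.reg 12))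
    (.seq copyHead (.seq (.count 2 (copyBody c)) (.assign 10 (.add (.reg 10) (.const 1)))))
    (.seq (linkHead c) (.count 2 (linkBody c))))

theorem Parsed.congr {c o m : ℕ} {Y Z : List (ℕ × List ℕ)} {s s' : State} (h : Parsed c o m Y Z s)
    (h7 : s'.reg 7 = s.reg 7) (h9 : s'.reg 9 = s.reg 9) (h10 : s'.reg 10 = s.reg 10)
    (h14 : s'.reg 14 = s.reg 14) (hm : s'.mem = s.mem) : Parsed c o m Y Z s' := by
  obtain ⟨a1, a2, a3, a4, a5, a6, a7⟩ := h
  constructor <;> simp only [h7, h9, h10, h14, hm] <;> assumption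

/-- Only the rotation at the cut-vertex is to be changed, so the entries of all other vertices go to
the output as they are. -/
theorem reach_entry {c p j v o m u : ℕ} {l : List ℕ} {Y Z : List (ℕ × List ℕ)} {s : State}
    (hc : c = 0 ∨ c = 1) (hp : s.reg 3 = p) (h4 : s.reg 4 = j) (h12 : s.reg 12 = v)
    (hin : Holds (s.mem c) p (enc (u, l))) (hP : Parsed c o m Y Z s)
    (hv : u = v → l.Nodup ∧ ∀ z ∈ Z, ∀ x ∈ z.2, x ∉ l) :
    Reach (entry c) s (60 * (l.length + 1)) (fun s' => s'.reg 3 = p + (enc (u, l)).length ∧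
      (u = v → Parsed c o m Y (Z ++ [(j, l)]) s') ∧ (u ≠ v → Parsed c o m (Y ++ [(u, l)]) Z s')) := by
  obtain ⟨i1, hin⟩ := holds_cons.1 hin
  obtain ⟨i2, hin⟩ := holds_cons.1 hin
  simp only at i1 i2 hin
  have hcl : ∀ r, r ∉ [5, 3, 2] → ((entryHead c).step s).reg r = s.reg r := fun r hr => by
    have h := (Prog.run_step (p := entryHead c) rfl s).choose_spec.2.frame
    refine h.1 r ?_
    simp [entryHead, Prog.regs, read] at hr ⊢
    omega
  set s1 := (entryHead c).step s with hs1
  have e5 : s1.reg 5 = u := by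
    simp [hs1, entryHead, read, Prog.step, Expr.eval, State.setReg, hp, i1]
  have e2 : s1.reg 2 = l.length := by
    simp [hs1, entryHead, read, Prog.step, Expr.eval, State.setReg, hp, i2]
  have e3 : s1.reg 3 = p + 2 := by
    simp [hs1, entryHead, read, Prog.step, Expr.eval, State.setReg, hp]
  have em : s1.mem = s.mem := by
    simp [hs1, entryHead, read, Prog.step, State.setReg]
  have hP1 : Parsed c o m Y Z s1 := hP.congr (hcl 7 (by simp)) (hcl 9 (by simp)) (hcl 10 (by simp))
    (hcl 14 (by simp)) em
  have h4' := (hcl 4 (by simp)).trans h4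
  have h12' := (hcl 12 (by simp)).trans h12
  refine Reach.imp (T := 14 + (8 + ((16 + (l.length * 30 + 2)) + 4)))
    (Reach.seq (Q := fun s' => s' = s1) (Reach.of_straight rfl (by simp [entryHead, read, Prog.time, Expr.cost]) rfl) ?_)
    (by omega) (fun _ _ h => h)
  rintro s' - rfl
  refine Reach.ite (fun h => ?_) (fun h => ?_)
  · rw [Ne, eval_neqExpr] at h
    simp only [Expr.eval, e5, h12'] at h
    set s2 := copyHead.step s1 with hs2
    have hf2 := (Prog.run_step (p := copyHead) rfl s1).choose_spec.2.frame
    have f9 : s2.reg 9 = o + (Y.flatMap enc ++ [u, l.length]).length := by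
      simp [hs2, copyHead, write, Prog.step, Expr.eval, State.setReg, State.setMem, hP1.pos]; omega
    have f2 : Holds (s2.mem 2) o (Y.flatMap enc ++ [u, l.length]) := by
      have a1 := hP1.out.concat (x := u) hP1.pos
      have a2 := a1.concat (x := l.length) (q := s1.reg 9 + 1) (by simp [hP1.pos]; omega)
      rw [List.append_assoc] at a2
      simpa [hs2, copyHead, write, Prog.step, Expr.eval, State.setReg, State.setMem, e2, e5] using a2
    have hcb : (c : ℕ) ∉ [2, 2] := by rcases hc with rfl | rfl <;> simp
    have f3 : Holds (s2.mem c) (p + 2) l := by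
      rw [hf2.2 c hcb, em]; exact hin
    refine Reach.seq (T := 16) (Q := fun s' => s' = s2)
      (Reach.of_straight rfl (by simp [copyHead, write, Prog.time, Expr.cost]) rfl) ?_ |>.imp
      (T := 16 + ((l.length * 30 + 2) + 4)) (by omega) fun _ _ h => h
    rintro s' - rfl
    refine Reach.seq (reach_copy hc ((hf2.1 2 (by simp [copyHead, Prog.regs, write])).trans e2)
      ((hf2.1 3 (by simp [copyHead, Prog.regs, write])).trans e3) f3 f2 f9) ?_
    rintro s3 hf3 ⟨g3, g2, g9⟩
    refine Reach.of_straight rfl (by simp [Prog.time, Expr.cost]) ?_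
    simp only [Prog.count, copyBody, Prog.regs, Prog.banks, read, write] at hf3
    have hr : ∀ r, r ∉ [2, 3, 5, 8, 9] → s3.reg r = s.reg r := fun r hr => by
      simp only [List.mem_cons, List.not_mem_nil, not_or, or_false] at hr
      rw [hf3.1 r (by simp; omega), hf2.1 r (by simp [copyHead, Prog.regs, write]; omega),
        hcl r (by simp; omega)]
    have hm : ∀ a, a ≠ 2 → s3.mem a = s.mem a := fun a ha => by
      rw [hf3.2 a (by simpa using ha), hf2.2 a (by simpa [copyHead, Prog.banks, write] using ha), em]
    have hY : (Y ++ [(u, l)]).flatMap enc = Y.flatMap enc ++ [u, l.length] ++ l := by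
      simp [enc]
    refine ⟨?_, fun h' => absurd h' h, fun _ => ?_⟩
    · simp [Prog.step, State.setReg, g3, length_enc]; omega
    · refine ⟨?_, ?_, ?_, ?_, ?_, ?_, ?_⟩
      · rw [hY]; exact g2
      · rw [hY]; exact g9
      · simp [Prog.step, Expr.eval, State.setReg, hr 10 (by simp), hP.num]; omega
      · simp only [Prog.step, State.setReg, hm (3 + c) (by omega)]; exact hP.lab
      · simp only [Prog.step, State.setReg, hm (3 + c) (by omega)]; exact hP.zero
      · simp only [Prog.step, State.setReg, hm (5 + c) (by omega), hm (7 + c) (by omega)]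
        exact hP.linked
      · intro Z' z hz
        have := hP.last Z' z hz
        simp only [Prog.step, State.setReg]
        rw [Function.update_of_ne (by omega), Function.update_of_ne (by omega), hr 14 (by simp),
          hr 7 (by simp)]
        exact this
  · rw [eval_neqExpr] at h
    simp only [Expr.eval, e5, h12'] at h
    obtain ⟨hn, hdisj⟩ := hv h
    set s2 := (linkHead c).step s1 with hs2
    have hf2 := (Prog.run_step (p := linkHead c) rfl s1).choose_spec.2.frame
    have em2 : s2.mem = s.mem := by rw [← em]; simp [hs2, linkHead, Prog.step, State.setReg]
    have f14 : s2.reg 14 = l.length := by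
      simp [hs2, linkHead, Prog.step, Expr.eval, State.setReg, e2]
    have f7 : ∀ hne : l ≠ [], s2.reg 7 = l.getLast hne := fun hne => by
      have hpos := List.length_pos_iff.2 hne
      have : s2.reg 7 = s.mem c (p + 2 + l.length - 1) := by
        simp [hs2, linkHead, Prog.step, Expr.eval, State.setReg, e2, e3, em]
      rw [this, List.getLast_eq_getElem]
      exact hin.get (by omega) (by omega)
    have hr2 : ∀ r, r ∉ [14, 7] → s2.reg r = s1.reg r := fun r hr => hf2.1 r hr
    refine Reach.seq (T := 10) (Q := fun s' => s' = s2)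
      (Reach.of_straight rfl (by simp [linkHead, Prog.time, Expr.cost]) rfl) ?_ |>.imp
      (T := 10 + (l.length * 30 + 2)) (by omega) fun _ _ h => h
    rintro s' - rfl
    refine Reach.imp (reach_link (j := j) hc ((hr2 2 (by simp)).trans e2) ((hr2 3 (by simp)).trans e3)
      ((hr2 4 (by simp)).trans h4') (by rw [em2]; exact hin) hn f7) le_rfl ?_
    rintro s3 hf3 ⟨g3, gl, glink, g7, gout⟩
    simp only [Prog.count, linkBody, Prog.regs, Prog.banks, read] at hf3
    rw [em2] at gl gout
    have hr : ∀ r, r ∉ [2, 3, 5, 7, 8, 14] → s3.reg r = s.reg r := fun r hr => by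
      simp only [List.mem_cons, List.not_mem_nil, not_or, or_false] at hr
      rw [hf3.1 r (by simp; omega), hr2 r (by simp; omega), hcl r (by simp; omega)]
    have hm2 : s3.mem 2 = s.mem 2 := by
      rw [hf3.2 2 (by simp; omega), em2]
    refine ⟨by rw [g3, length_enc]; simp only; omega, fun _ => ?_, fun h' => absurd h h'⟩
    refine ⟨?_, ?_, ?_, ?_, ?_, ?_, ?_⟩
    · rw [hm2]; exact hP.out
    · rw [hr 9 (by simp)]; exact hP.pos
    · rw [hr 10 (by simp)]; exact hP.num
    · intro z hz x hx
      rw [gl]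
      rcases List.mem_append.1 hz with hz | hz
      · rw [if_neg (hdisj z hz x hx), hP.lab z hz x hx]
      · rw [List.mem_singleton.1 hz] at hx ⊢
        exact if_pos hx
    · intro x hx
      rw [gl, if_neg (hx (j, l) (by simp)), hP.zero x fun z hz => hx z (by simp [hz])]
    · intro z hz
      rcases List.mem_append.1 hz with hz | hz
      · intro x hx
        have h1 := hP.linked z hz x hx
        rw [(gout _ (hdisj z hz _ (formPerm_inv_mem.2 hx))).1, (gout _ (hdisj z hz _ hx)).2]
        exact h1
      · rw [List.mem_singleton.1 hz]; exact glink
    · intro Z' z hz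
      obtain rfl : (j, l) = z := by
        have := congrArg List.getLast? hz
        simpa using this
      refine ⟨?_, g7⟩
      rw [hf3.1 14 (by simp)]
      exact f14

/-- Read a list of entries from bank `c`. -/
def block (c : ℕ) : Prog := .seq (read c 1) (.count 1 (entry c))

/-- The number of numbers in the adjacency lists of the entries, and of the entries. -/
def entriesSize (es : List (ℕ × List ℕ)) : ℕ := (es.map fun e => e.2.length + 1).sum

/-- The entries of the vertices other than `v`. -/
def others (v : ℕ) (es : List (ℕ × List ℕ)) : List (ℕ × List ℕ) := es.filter fun e => e.1 ≠ v

/-- The adjacency lists of `v`, with a label. -/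
def lists (v j : ℕ) (es : List (ℕ × List ℕ)) : List (ℕ × List ℕ) :=
  (es.filter fun e => e.1 = v).map fun e => (j, e.2)

theorem sum_range_entries (es : List (ℕ × List ℕ)) : ∑ i ∈ Finset.range es.length,
    (60 * ((es.getD i (0, [])).2.length + 1) + 6) ≤ 66 * entriesSize es := by
  induction es with
  | nil => simp
  | cons e es ih =>
    rw [List.length_cons, Finset.sum_range_succ']
    simp only [List.getD_cons_succ, List.getD_cons_zero, entriesSize, List.map_cons, List.sum_cons] at ih ⊢
    omega

/-- Disjointness of the lists guarantees that the links and labels set earlier are not overwritten.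
-/
theorem reach_block {c p j v o m : ℕ} {es : List (ℕ × List ℕ)} {Y Z : List (ℕ × List ℕ)} {s : State}
    (hc : c = 0 ∨ c = 1) (hp : s.reg 3 = p) (h4 : s.reg 4 = j) (h12 : s.reg 12 = v)
    (hin : Holds (s.mem c) p (encAll es)) (hP : Parsed c o m Y Z s)
    (hn : ((Z ++ lists v j es).flatMap Prod.snd).Nodup) :
    Reach (block c) s (66 * entriesSize es + 9) (fun s' => s'.reg 3 = p + (encAll es).length ∧
      Parsed c o m (Y ++ others v es) (Z ++ lists v j es) s') := by
  obtain ⟨i1, hin⟩ := holds_cons.1 hin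
  set s1 := (read c 1).step s with hs1
  have hf1 := (Prog.run_step (p := read c 1) rfl s).choose_spec.2.frame
  have hr1 : ∀ r, r ∉ [1, 3] → s1.reg r = s.reg r := fun r hr => hf1.1 r hr
  have e1 : s1.reg 1 = es.length := by
    simp [hs1, read, Prog.step, Expr.eval, State.setReg, hp, i1]
  have e3 : s1.reg 3 = p + 1 := by
    simp [hs1, read, Prog.step, Expr.eval, State.setReg, hp]
  have em : s1.mem = s.mem := by simp [hs1, read, Prog.step, State.setReg]
  have hP1 : Parsed c o m Y Z s1 := hP.congr (hr1 7 (by simp)) (hr1 9 (by simp)) (hr1 10 (by simp))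
    (hr1 14 (by simp)) em
  have key := Reach.count (s := s1) (r := 1) (p := entry c)
    (f := fun i => 60 * ((es.getD i (0, [])).2.length + 1))
    (Inv := fun i s' => s'.reg 3 = p + 1 + ((es.take i).flatMap enc).length ∧
      Parsed c o m (Y ++ others v (es.take i)) (Z ++ lists v j (es.take i)) s') e1
    (by simp [entry, entryHead, copyHead, linkHead, read, write, copyBody, linkBody, Prog.count, Prog.regs])
    (fun i s x h => ⟨h.1, h.2.congr rfl rfl rfl rfl rfl⟩)
    ⟨by simpa using e3, by simpa [others, lists] using hP1⟩ ?_
  · refine Reach.imp (T := 7 + (66 * entriesSize es + 2)) (Reach.seq (Q := fun s' => s' = s1)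
      (Reach.of_straight rfl (by simp [read, Prog.time, Expr.cost]) rfl) ?_) (by omega)
      fun _ _ h => h
    rintro s' - rfl
    refine key.imp (by have := sum_range_entries es; omega) ?_
    rintro s' - ⟨h1, h2⟩
    rw [List.take_length] at h1 h2
    exact ⟨by rw [h1, encAll, List.length_cons]; omega, h2⟩
  · rintro i hi s' hf ⟨h3, hP'⟩
    have hregs : ∀ r, r ∈ [4, 12] → s'.reg r = s1.reg r := fun r hr => hf.1 r (by
      simp [entry, entryHead, copyHead, linkHead, read, write, copyBody, linkBody, Prog.count, Prog.regs]
      simp at hr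
      omega)
    have hmc : s'.mem c = s.mem c := by
      rw [← em]
      refine hf.2 c ?_
      rcases hc with rfl | rfl <;> simp [entry, entryHead, copyHead, linkHead, read, write,
        copyBody, linkBody, Prog.count, Prog.banks]
    have hsplit : es = es.take i ++ es[i] :: es.drop (i + 1) := by
      rw [← List.drop_eq_getElem_cons hi, List.take_append_drop]
    have hin' : Holds (s'.mem c) (p + 1 + ((es.take i).flatMap enc).length) (enc es[i]) := by
      rw [hmc]
      rw [hsplit, List.flatMap_append, List.flatMap_cons, holds_append, holds_append] at hin
      exact hin.2.1
    have hgd : es.getD i (0, []) = es[i] := by simp [hi]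
    rw [hgd]
    have hY : others v (es.take (i + 1)) = others v (es.take i) ++ others v [es[i]] := by
      rw [take_succ_eq es hi, others, List.filter_append]; rfl
    have hZ : lists v j (es.take (i + 1)) = lists v j (es.take i) ++ lists v j [es[i]] := by
      rw [take_succ_eq es hi, lists, List.filter_append, List.map_append]; rfl
    have hnd : ((Z ++ lists v j (es.take i)).flatMap Prod.snd ++
        (lists v j [es[i]]).flatMap Prod.snd).Nodup := by
      have h1 : lists v j es = lists v j (es.take i) ++ (lists v j [es[i]] ++ lists v j (es.drop (i + 1))) := by
        conv_lhs => rw [hsplit]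
        simp only [lists, List.filter_append, List.map_append, List.filter_cons, List.filter_nil]
        split_ifs <;> simp
      rw [h1] at hn
      simp only [List.flatMap_append, ← List.append_assoc] at hn ⊢
      exact hn.of_append_left
    refine (reach_entry (u := es[i].1) (l := es[i].2) hc h3 ((hregs 4 (by simp)).trans
      ((hr1 4 (by simp)).trans h4)) ((hregs 12 (by simp)).trans ((hr1 12 (by simp)).trans h12))
      hin' hP' ?_).imp le_rfl ?_
    · intro huv
      have h1 : lists v j [es[i]] = [(j, es[i].2)] := by simp [lists, huv]
      rw [h1] at hnd
      simp only [List.flatMap_cons, List.flatMap_nil, List.append_nil] at hnd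
      rw [List.nodup_append] at hnd
      refine ⟨hnd.2.1, fun z hz x hx hx' => hnd.2.2 x ?_ x hx' rfl⟩
      exact List.mem_flatMap.2 ⟨z, hz, hx⟩
    · rintro s2 - ⟨g3, g1, g2⟩
      refine ⟨?_, ?_⟩
      · rw [g3, take_succ_eq es hi, List.flatMap_append, List.length_append]
        simp; omega
      · rw [hY, hZ, ← List.append_assoc, ← List.append_assoc]
        by_cases huv : es[i].1 = v
        · have := g1 huv
          simpa [others, lists, huv] using this
        · have := g2 huv
          simpa [others, lists, huv] using this

/-- Read the blocks, as many as register `0` says, and number them in register `4`. -/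
def blocks : Prog := .count 0 (.seq (.assign 4 (.add (.reg 4) (.const 1))) (block 0))

theorem reach_blocks {p v b o m : ℕ} {es : ℕ → List (ℕ × List ℕ)} {s : State}
    (h0 : s.reg 0 = b) (hp : s.reg 3 = p) (h4 : s.reg 4 = 0) (h12 : s.reg 12 = v)
    (hin : Holds (s.mem 0) p ((List.range b).flatMap fun j => encAll (es j)))
    (hP : Parsed 0 o m [] [] s)
    (hn : (((List.range b).flatMap fun j => lists v (j + 1) (es j)).flatMap Prod.snd).Nodup) :
    Reach blocks s (∑ j ∈ Finset.range b, (66 * entriesSize (es j) + 19) + 2)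
      (Parsed 0 o m ((List.range b).flatMap fun j => others v (es j))
        ((List.range b).flatMap fun j => lists v (j + 1) (es j))) := by
  have hregs : (Prog.seq (.assign 4 (.add (.reg 4) (.const 1))) (block 0)).regs =
      4 :: (block 0).regs := rfl
  have key := Reach.count (s := s) (r := 0) (p := .seq (.assign 4 (.add (.reg 4) (.const 1))) (block 0))
    (f := fun j => 66 * entriesSize (es j) + 13)
    (Inv := fun i s' => s'.reg 3 = p + ((List.range i).flatMap fun j => encAll (es j)).length ∧
      s'.reg 4 = i ∧ Parsed 0 o m ((List.range i).flatMap fun j => others v (es j))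
        ((List.range i).flatMap fun j => lists v (j + 1) (es j)) s') h0
    (by simp [block, entry, entryHead, copyHead, linkHead, read, write, copyBody, linkBody, Prog.count, Prog.regs])
    (fun i s x h => ⟨h.1, h.2.1, h.2.2.congr rfl rfl rfl rfl rfl⟩)
    ⟨by simpa using hp, h4, by simpa using hP⟩ ?_
  · exact key.imp le_rfl fun s' _ h => h.2.2
  · rintro i hi s' hf ⟨h3, h4, hP'⟩
    have hreg12 : s'.reg 12 = v := (hf.1 12 (by
      simp [block, entry, entryHead, copyHead, linkHead, read, write, copyBody, linkBody, Prog.count,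
        Prog.regs])).trans h12
    have hmc : s'.mem 0 = s.mem 0 := hf.2 0 (by
      simp [block, entry, entryHead, copyHead, linkHead, read, write,
        copyBody, linkBody, Prog.count, Prog.banks])
    have hsplit : ∀ {α : Type} (f : ℕ → List α), (List.range b).flatMap f =
        (List.range i).flatMap f ++ (f i ++ ((List.range' (i + 1) (b - (i + 1))).flatMap f)) := by
      intro α f
      have h1 : List.range b = List.range i ++ i :: List.range' (i + 1) (b - (i + 1)) := by
        rw [List.range_eq_range', List.range_eq_range', ← List.range'_succ,
          show b - (i + 1) + 1 = b - i by omega]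
        have := List.range'_append_1 (s := 0) (m := i) (n := b - i)
        rw [Nat.zero_add, show i + (b - i) = b by omega] at this
        exact this.symm
      rw [h1, List.flatMap_append, List.flatMap_cons]
    rw [hsplit, holds_append, holds_append] at hin
    rw [hsplit, ← List.append_assoc, List.flatMap_append] at hn
    refine Reach.imp (T := 4 + (66 * entriesSize (es i) + 9)) (Reach.seq
      (Q := fun s2 => s2 = s'.setReg 4 (i + 1)) (Reach.of_straight rfl
      (by simp [Prog.time, Expr.cost]) (by simp [Prog.step, Expr.eval, h4])) ?_) (by omega)
      fun _ _ h => h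
    rintro s2 - rfl
    refine Reach.imp (reach_block (j := i + 1) (Or.inl rfl) (p := p + ((List.range i).flatMap fun j => encAll (es j)).length)
      h3 (by simp [State.setReg]) hreg12 ?_ (hP'.congr rfl rfl rfl rfl rfl) hn.of_append_left) le_rfl ?_
    · change Holds (s'.mem 0) _ _
      rw [hmc]; exact hin.2.1
    · rintro s3 hf3 ⟨g3, gP⟩
      refine ⟨?_, ?_, ?_⟩
      · rw [g3, List.range_succ, List.flatMap_append]; simp; omega
      · rw [hf3.1 4 (by simp [block, entry, entryHead, copyHead, linkHead, read, write, copyBody,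
          linkBody, Prog.count, Prog.regs])]
        simp [State.setReg]
      · rw [List.range_succ, List.flatMap_append, List.flatMap_append]
        simpa using gP

end Parsing

/-! ### The loops of the ranking program. -/

section RankLoops

theorem Linked.isRotated {nxt prv : ℕ → ℕ} {l m : List ℕ} (h : Linked nxt prv l) (hn : l.Nodup)
    (hr : l.IsRotated m) : Linked nxt prv m := by
  intro x hx
  rw [← List.formPerm_eq_of_isRotated hn hr]
  exact h x (hr.mem_iff.2 hx)

theorem Linked.getElem {nxt prv : ℕ → ℕ} {l : List ℕ} (h : Linked nxt prv l) (hn : l.Nodup)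
    {i : ℕ} (hi : i + 1 < l.length) : nxt l[i] = l[i + 1] := by
  have h1 := (h (l.formPerm l[i]) (by simp)).1
  rwa [Equiv.Perm.inv_def, Equiv.symm_apply_apply, List.formPerm_apply_lt_getElem _ hn _ hi] at h1

theorem mem_startAt {l : List ℕ} {x y : ℕ} : y ∈ startAt l x ↔ y ∈ l :=
  (startAt_isRotated l x).mem_iff

theorem nodup_startAt {l : List ℕ} {x : ℕ} (h : l.Nodup) : (startAt l x).Nodup :=
  (startAt_isRotated l x).nodup_iff.2 h

/-- Go once around the list of which register `15` contains an element and register `14` the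
length. -/
def walk (body : Prog) : Prog :=
  .seq (.assign 0 (.reg 14)) (.count 0 (.seq body (.assign 15 (.load 6 (.reg 15)))))

/-- The walk follows the links, so it visits the rotation of `l` that starts at `x`. Besides the
body, a round costs `3` for following the link and `6` for the counter. -/
theorem reach_walk {body : Prog} (hst : body.straight) (hr0 : 0 ∉ body.regs) (hr : 15 ∉ body.regs)
    (hb : 6 ∉ body.banks) {s : State} {prv : ℕ → ℕ} {l : List ℕ} {x : ℕ} (hn : l.Nodup)
    (hl : Linked (s.mem 6) prv l) (h14 : s.reg 14 = l.length) (h15 : s.reg 15 = x) (hx : x ∈ l)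
    (J : ℕ → State → Prop) (hJ0 : ∀ i s x, J i s → J i (s.setReg 0 x))
    (hJ : ∀ i s x, J i s → J i (s.setReg 15 x)) (h0 : J 0 s)
    (hstep : ∀ i (hi : i < (startAt l x).length) s', Frame (0 :: 15 :: body.regs) body.banks s s' →
      s'.reg 15 = (startAt l x)[i] → J i s' → J (i + 1) (body.step s')) :
    Reach (walk body) s (l.length * (body.time + 9) + 4) (J l.length) := by
  set w := startAt l x with hw
  have hwl : w.length = l.length := length_startAt _ _
  obtain ⟨t, ht⟩ := startAt_cons hx
  have hwn : w.Nodup := nodup_startAt hn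
  have hlw : Linked (s.mem 6) prv w := hl.isRotated hn (startAt_isRotated l x).symm
  refine Reach.imp (T := 2 + (l.length * ((body.time + 3) + 6) + 2)) (Reach.seq
    (Q := fun s' => s' = s.setReg 0 l.length) (Reach.of_straight rfl (by simp [Prog.time, Expr.cost])
    (by simp [Prog.step, Expr.eval, h14])) ?_) (by
      rw [show body.time + 3 + 6 = body.time + 9 by omega]; omega) fun _ _ h => h
  rintro s1 - rfl
  have hsub1 : body.regs ⊆ 0 :: (Prog.seq body (.assign 15 (.load 6 (.reg 15)))).regs := by
    intro r hr; simp [Prog.regs, hr]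
  refine Reach.imp (Reach.count_const (k := l.length) (Inv := fun i s' => (∀ h : i < w.length, s'.reg 15 = w[i]) ∧ J i s')
    (by simp [State.setReg]) (by simp [Prog.regs, hr0]) (fun i s x h => ⟨h.1, hJ0 i s x h.2⟩)
    ⟨fun h => ?_, hJ0 _ _ _ h0⟩ ?_) le_rfl fun _ _ h => h.2
  · simp only [hw, ht, List.getElem_cons_zero]; exact h15
  · rintro i hi s' hf ⟨h1, h2⟩
    have hi' : i < w.length := by omega
    refine Reach.of_straight (by simp [Prog.straight, hst]) (by simp [Prog.time, Expr.cost]) ?_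
    have hf' : Frame (0 :: 15 :: body.regs) body.banks s s' := by
      refine Frame.trans (R := [0]) (A := []) (s' := s.setReg 0 l.length) ⟨fun r hr => ?_, fun _ _ => rfl⟩
        hf (by simp) (by simp) ?_ ?_
      · simp only [List.mem_singleton] at hr
        exact Function.update_of_ne hr _ _
      · intro r; simp only [Prog.regs, List.mem_cons, List.mem_append, List.not_mem_nil, or_false]
        tauto
      · intro r; simp [Prog.banks]
    have h3 := hstep i hi' s' hf' (h1 hi') h2
    have hfb := (Prog.run_step hst s').choose_spec.2.frame
    refine ⟨fun h => ?_, hJ _ _ _ h3⟩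
    simp only [Prog.step, Expr.eval, State.setReg, Function.update_self]
    rw [hfb.1 15 hr, hfb.2 6 hb, h1 hi', hf'.2 6 hb, hlw.getElem hwn h]

/-- Execute `p` if two values are equal. -/
def ifEq (x y : Expr) (p : Prog) : Prog := .ite (neqExpr x y) .skip p

theorem step_ifEq (x y : Expr) (p : Prog) (s : State) :
    (ifEq x y p).step s = if x.eval s = y.eval s then p.step s else s := by
  simp only [ifEq, Prog.step, eval_neqExpr]

/-- One step of `findTwo`. -/
def findTwoBody : Prog :=
  ifEq (.load 3 (.reg 15)) (.const 2) (.assign 16 (.reg 15))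

/-- Find a neighbour with label `2`. -/
def findTwo : Prog :=
  .seq (.assign 15 (.reg 7)) (walk findTwoBody)

variable {lab : ℕ → ℕ} {l : List ℕ}

theorem reach_findTwo {s : State} {prv : ℕ → ℕ} (hn : l.Nodup) (hl : Linked (s.mem 6) prv l)
    (h14 : s.reg 14 = l.length) (h7 : s.reg 7 ∈ l) (h3 : s.mem 3 = lab) (h2 : ∃ x ∈ l, lab x = 2) :
    Reach findTwo s (l.length * 40 + 10) (fun s' => s'.reg 16 ∈ l ∧ lab (s'.reg 16) = 2) := by
  refine Reach.imp (T := 2 + (l.length * (13 + 9) + 4)) (Reach.seq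
    (Q := fun s' => s' = s.setReg 15 (s.reg 7)) (Reach.of_straight rfl (by simp [Prog.time, Expr.cost])
    (by simp [Prog.step, Expr.eval])) ?_) (by omega) fun _ _ h => h
  rintro s1 - rfl
  refine Reach.imp (reach_walk (s := s.setReg 15 (s.reg 7)) (body := findTwoBody) rfl (by simp [findTwoBody, ifEq, Prog.regs]) (by simp [findTwoBody, ifEq, Prog.regs])
    (by simp [findTwoBody, ifEq, Prog.banks]) hn hl h14 (x := s.reg 7) (by simp [State.setReg]) h7
    (J := fun i s' => (∃ y ∈ (startAt l (s.reg 7)).take i, lab y = 2) →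
      s'.reg 16 ∈ l ∧ lab (s'.reg 16) = 2) (fun _ _ _ h => h) (fun _ _ _ h => h) (by simp) ?_)
    (by simp [findTwoBody, ifEq, neqExpr, Prog.time, Expr.cost]) ?_
  · rintro i hi s' hf h15 hJ ⟨y, hy, hy2⟩
    have hm : s'.mem 3 = lab := (hf.2 3 (by simp [findTwoBody, ifEq, Prog.banks])).trans h3
    rw [findTwoBody, step_ifEq]
    simp only [Expr.eval, hm, h15]
    rw [take_succ_eq _ hi, List.mem_append, List.mem_singleton] at hy
    split_ifs with h
    · simp only [Prog.step, State.setReg, Function.update_self, Expr.eval, h15]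
      exact ⟨mem_startAt.1 (List.getElem_mem _), h⟩
    · rcases hy with hy | rfl
      · exact hJ ⟨y, hy, hy2⟩
      · exact absurd hy2 h
  · rintro s' - hJ
    refine hJ ?_
    obtain ⟨x, hx, hx2⟩ := h2
    refine ⟨x, ?_, hx2⟩
    rw [← length_startAt l (s.reg 7), List.take_length]
    exact mem_startAt.2 hx

/-- One step of `findRoot`. -/
def findRootBody : Prog :=
  ifEq (.load 3 (.reg 15)) (.const 1) (.assign 17 (.reg 15))

/-- Find the first element of the normal word. -/
def findRoot : Prog :=
  .seq (.assign 15 (.reg 16)) (walk findRootBody)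

/-- The register is overwritten at every label `1`, so after a turn that begins at a label `2` it
holds the last such element, where the normal word begins. -/
theorem reach_findRoot {s : State} {prv : ℕ → ℕ} (hn : l.Nodup) (hl : Linked (s.mem 6) prv l)
    (h14 : s.reg 14 = l.length) (h16 : s.reg 16 ∈ l) (h2 : lab (s.reg 16) = 2) (h3 : s.mem 3 = lab)
    (h1 : ∃ x ∈ l, lab x = 1) :
    Reach findRoot s (l.length * 40 + 10)
      (fun s' => s'.reg 17 ∈ l ∧ IsNormal lab (startAt l (s'.reg 17))) := by
  refine Reach.imp (T := 2 + (l.length * (13 + 9) + 4)) (Reach.seq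
    (Q := fun s' => s' = s.setReg 15 (s.reg 16)) (Reach.of_straight rfl (by simp [Prog.time, Expr.cost])
    (by simp [Prog.step, Expr.eval])) ?_) (by omega) fun _ _ h => h
  rintro s1 - rfl
  refine Reach.imp (reach_walk (s := s.setReg 15 (s.reg 16)) (body := findRootBody) rfl (by simp [findRootBody, ifEq, Prog.regs]) (by simp [findRootBody, ifEq, Prog.regs])
    (by simp [findRootBody, ifEq, Prog.banks]) hn hl h14 (x := s.reg 16) (by simp [State.setReg]) h16
    (J := fun i s' => ∀ p u y, (startAt l (s.reg 16)).take i = p ++ u :: y → lab u = 1 →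
      (∀ a ∈ y, lab a ≠ 1) → s'.reg 17 = u) (fun _ _ _ h => h) (fun _ _ _ h => h) (by simp) ?_)
    (by simp [findRootBody, ifEq, neqExpr, Prog.time, Expr.cost]) ?_
  · rintro i hi s' hf h15 hJ p u y hpy hu hy
    have hm : s'.mem 3 = lab := (hf.2 3 (by simp [findRootBody, ifEq, Prog.banks])).trans h3
    rw [findRootBody, step_ifEq]
    simp only [Expr.eval, hm, h15]
    rw [take_succ_eq _ hi] at hpy
    rcases List.eq_nil_or_concat y with rfl | ⟨y', a, rfl⟩
    · obtain ⟨-, h⟩ := List.append_inj' hpy rfl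
      simp only [List.cons.injEq, and_true] at h
      rw [h, if_pos hu]
      simp [Prog.step, State.setReg, Expr.eval, h15, h]
    · rw [List.concat_eq_append] at hpy hy
      have h5 : p ++ u :: (y' ++ [a]) = (p ++ u :: y') ++ [a] := by simp
      rw [h5] at hpy
      obtain ⟨h6, h⟩ := List.append_inj' hpy rfl
      simp only [List.cons.injEq, and_true] at h
      rw [h, if_neg (hy a (by simp))]
      exact hJ p u y' h6 hu fun c hc => hy c (by simp [hc])
  · rintro s' - hJ
    obtain ⟨x, hx, hx1⟩ := h1
    obtain ⟨t, ht⟩ := startAt_cons h16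
    obtain ⟨p, u, y, hp, hu, hy⟩ := exists_last_eq (m := startAt l (s.reg 16)) ⟨x, mem_startAt.2 hx, hx1⟩
    have h17 := hJ p u y (by rw [← length_startAt l (s.reg 16), List.take_length, hp]) hu hy
    have hul : u ∈ l := by rw [← mem_startAt (x := s.reg 16), hp]; simp
    rw [h17]
    refine ⟨hul, ?_⟩
    obtain ⟨p', rfl⟩ : ∃ p', p = s.reg 16 :: p' := by
      rw [ht] at hp
      rcases p with _ | ⟨a, p⟩
      · simp only [List.nil_append, List.cons.injEq] at hp
        rw [← hp.1] at hu; omega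
      · rw [List.cons_append, List.cons.injEq] at hp
        exact ⟨p, by rw [← hp.1]⟩
    have hrot : (u :: (y ++ s.reg 16 :: p')).IsRotated l := by
      refine List.IsRotated.trans ?_ (startAt_isRotated l (s.reg 16))
      rw [hp]
      exact List.isRotated_append (l := u :: y)
    rw [startAt_eq hrot hn rfl]
    exact isNormal_of_last hu hy h2

/-- One step of `findOpenings`. -/
def findOpeningsBody : Prog :=
  .ite (.load 10 (.load 3 (.reg 15))) .skip
    (.store 10 (.load 3 (.reg 15)) (.add (.reg 15) (.const 1)))

/-- Find the openings; they are stored increased by one. -/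
def findOpenings : Prog :=
  .seq (.assign 15 (.reg 17)) (walk findOpeningsBody)

/-- A cell is written only while it is zero, so the first element with each label remains. The shift
by one distinguishes the neighbour `0` from an empty cell. -/
theorem reach_findOpenings {s : State} {prv : ℕ → ℕ} (hn : l.Nodup) (hl : Linked (s.mem 6) prv l)
    (h14 : s.reg 14 = l.length) (h17 : s.reg 17 ∈ l) (h3 : s.mem 3 = lab) (h10 : ∀ k, s.mem 10 k = 0) :
    Reach findOpenings s (l.length * 40 + 10) (fun s' =>
      (∀ k, (∃ x ∈ l, lab x = k) → s'.mem 10 k = opening lab (startAt l (s.reg 17)) k + 1) ∧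
      ∀ k, (∀ x ∈ l, lab x ≠ k) → s'.mem 10 k = 0) := by
  refine Reach.imp (T := 2 + (l.length * (11 + 9) + 4)) (Reach.seq
    (Q := fun s' => s' = s.setReg 15 (s.reg 17)) (Reach.of_straight rfl (by simp [Prog.time, Expr.cost])
    (by simp [Prog.step, Expr.eval])) ?_) (by omega) fun _ _ h => h
  rintro s1 - rfl
  set w := startAt l (s.reg 17) with hw
  refine Reach.imp (reach_walk (s := s.setReg 15 (s.reg 17)) (body := findOpeningsBody) rfl (by simp [findOpeningsBody, Prog.regs]) (by simp [findOpeningsBody, Prog.regs])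
    (by simp [findOpeningsBody, Prog.banks]) hn hl h14 (x := s.reg 17) (by simp [State.setReg]) h17
    (J := fun i s' => ∀ k, s'.mem 10 k = ((w.take i).filter fun x => lab x = k).head?.elim 0 (· + 1))
    (fun _ _ _ h => h) (fun _ _ _ h => h) (by simpa [State.setReg] using h10) ?_)
    (by simp [findOpeningsBody, Prog.time, Expr.cost]) ?_
  · rintro i hi s' hf h15 hJ k
    have hm : s'.mem 3 = lab := (hf.2 3 (by simp [findOpeningsBody, Prog.banks])).trans h3
    simp only [← hw] at h15 hi
    rw [take_succ_eq w hi, List.filter_append, List.head?_append]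
    have hJi := hJ (lab w[i])
    simp only [findOpeningsBody, Prog.step, Expr.eval, hm, h15, hJi]
    by_cases hk : lab w[i] = k
    · subst hk
      rcases hh : ((w.take i).filter fun x => lab x = lab w[i]).head? with _ | a
      · simp [State.setMem]
      · simp [hh, hJi]
    · rw [List.filter_cons_of_neg (by simpa using hk), List.filter_nil, List.head?_nil, Option.or_none]
      rw [← hJ k]
      split_ifs
      · simp [State.setMem, Function.update_of_ne (Ne.symm hk)]
      · rfl
  · rintro s' - hJ
    refine ⟨?_, fun k hk => ?_⟩
    swap
    · rw [hJ k, List.filter_eq_nil_iff.2 fun x hx => by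
        simpa using hk x (mem_startAt.1 (List.mem_of_mem_take hx))]
      rfl
    rintro k ⟨x, hx, hxk⟩
    rw [hJ k, ← length_startAt l (s.reg 17), ← hw, List.take_length, opening, List.headD_eq_head?_getD]
    have hx' : x ∈ w.filter fun x => lab x = k := by
      rw [List.mem_filter]; exact ⟨mem_startAt.2 hx, by simpa using hxk⟩
    rcases hh : w.filter fun x => lab x = k with _ | ⟨a, t⟩
    · rw [hh] at hx'; simp at hx'
    · simp

/-- One step of `findPositions`. -/
def findPositionsBody : Prog :=
  .seq (ifEq (.load 10 (.load 3 (.reg 15))) (.add (.reg 15) (.const 1))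
      (.store 13 (.load 3 (.reg 15)) (.reg 18))) (.assign 18 (.add (.reg 18) (.const 1)))

/-- Find the positions of the openings in the circular word. -/
def findPositions : Prog :=
  .seq (.seq (.assign 15 (.sub (.load 10 (.const 2)) (.const 1))) (.assign 18 (.const 0)))
    (walk findPositionsBody)

/-- The turn begins at the opening of block 2, as the circular word does, and register `18` counts
the positions. -/
theorem reach_findPositions {s : State} {prv : ℕ → ℕ} {op : ℕ → ℕ} (hn : l.Nodup)
    (hl : Linked (s.mem 6) prv l) (h14 : s.reg 14 = l.length) (h2 : op 2 ∈ l) (h3 : s.mem 3 = lab)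
    (hop2 : s.mem 10 2 = op 2 + 1)
    (hop : ∀ x ∈ l, s.mem 10 (lab x) = op (lab x) + 1) :
    Reach findPositions s (l.length * 60 + 20) (fun s' => ∀ k, op k ∈ l → lab (op k) = k →
      s'.mem 13 k = (startAt l (op 2)).idxOf (op k)) := by
  refine Reach.imp (T := 8 + (l.length * (25 + 9) + 4)) (Reach.seq
    (Q := fun s' => s' = (s.setReg 15 (op 2)).setReg 18 0)
    (Reach.of_straight rfl (by simp [Prog.time, Expr.cost])
    (by simp [Prog.step, Expr.eval, hop2])) ?_) (by omega) fun _ _ h => h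
  rintro s1 - rfl
  set w := startAt l (op 2) with hw
  refine Reach.imp (reach_walk (s := (s.setReg 15 (op 2)).setReg 18 0) (body := findPositionsBody) rfl (by simp [findPositionsBody, ifEq, Prog.regs]) (by simp [findPositionsBody, ifEq, Prog.regs])
    (by simp [findPositionsBody, ifEq, Prog.banks]) hn hl h14 (x := op 2) (by simp [State.setReg]) h2
    (J := fun i s' => s'.reg 18 = i ∧ ∀ k, op k ∈ w.take i → lab (op k) = k →
      s'.mem 13 k = w.idxOf (op k)) (fun _ _ _ h => h) (fun _ _ _ h => h) ⟨by simp [State.setReg], by simp⟩ ?_)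
    (by simp [findPositionsBody, ifEq, neqExpr, Prog.time, Expr.cost]) ?_
  · rintro i hi s' hf h15 ⟨h18, hJ⟩
    have hm : s'.mem 3 = lab := (hf.2 3 (by simp [findPositionsBody, ifEq, Prog.banks])).trans h3
    have hm10 : s'.mem 10 = s.mem 10 := hf.2 10 (by simp [findPositionsBody, ifEq, Prog.banks])
    simp only [← hw] at h15 hi
    have hwn : w.Nodup := nodup_startAt hn
    have hopi := hop w[i] (mem_startAt.1 (List.getElem_mem hi))
    simp only [findPositionsBody, Prog.step, step_ifEq, Expr.eval, hm, h15, hm10, hopi, h18]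
    refine ⟨by split_ifs <;> simp [State.setReg, State.setMem, h18], fun k hk hlk => ?_⟩
    rw [take_succ_eq w hi, List.mem_append, List.mem_singleton] at hk
    by_cases hki : op k = w[i]
    · have : lab w[i] = k := by rw [← hki, hlk]
      simp [this, hki, State.setReg, State.setMem, hwn.idxOf_getElem]
    · have h1 := hJ k (hk.resolve_right hki) hlk
      split_ifs with h
      · have hne : k ≠ lab w[i] := by
          rintro rfl
          exact hki (by omega)
        simp [State.setReg, State.setMem, Function.update_of_ne hne, h1]
      · simpa [State.setReg] using h1
  · rintro s' - ⟨-, hJ⟩ k hk hlk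
    refine hJ k ?_ hlk
    rw [← length_startAt l (op 2), ← hw, List.take_length]
    exact mem_startAt.2 hk

/-- Output the positions of the openings among the numbers with the same label. -/
def countOpenings : Prog :=
  .seq (.seq (.assign 19 (.const 0)) (.assign 0 (.reg 11)))
    (.count 0 (.seq (.seq (ifEq (.load 10 (.load 3 (.reg 19))) (.add (.reg 19) (.const 1))
      (.store 2 (.sub (.load 3 (.reg 19)) (.const 1)) (.load 9 (.load 3 (.reg 19)))))
      (.store 9 (.load 3 (.reg 19)) (.add (.load 9 (.load 3 (.reg 19))) (.const 1))))
      (.assign 19 (.add (.reg 19) (.const 1)))))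

/-- One pass through all numbers in increasing order, with a counter for each label, yields the
ranks of all openings together. -/
theorem reach_countOpenings {s : State} {op : ℕ → ℕ} {n : ℕ} (h11 : s.reg 11 = n)
    (h3 : s.mem 3 = lab) (h9 : ∀ k, s.mem 9 k = 0) (hz : s.mem 10 0 = 0)
    (hop : ∀ x, lab x ≠ 0 → s.mem 10 (lab x) = op (lab x) + 1) :
    Reach countOpenings s (n * 60 + 10) (fun s' => ∀ k, k ≠ 0 → op k < n → lab (op k) = k →
      s'.mem 2 (k - 1) = Nat.count (fun x => lab x = k) (op k)) := by
  refine Reach.imp (T := 4 + (n * (41 + 6) + 2)) (Reach.seq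
    (Q := fun s' => s' = (s.setReg 19 0).setReg 0 n)
    (Reach.of_straight rfl (by simp [Prog.time, Expr.cost])
    (by simp [Prog.step, Expr.eval, h11, State.setReg])) ?_) (by omega) fun _ _ h => h
  rintro s1 - rfl
  refine Reach.imp (Reach.count_const (k := n) (F := 41) (Inv := fun i s' => s'.reg 19 = i ∧
    (∀ k, s'.mem 9 k = Nat.count (fun x => lab x = k) i) ∧ ∀ k, k ≠ 0 → op k < i → lab (op k) = k →
      s'.mem 2 (k - 1) = Nat.count (fun x => lab x = k) (op k))
    (by simp [State.setReg]) (by simp [ifEq, Prog.regs]) (fun i s x h => h)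
    ⟨by simp [State.setReg], by simpa [State.setReg] using h9, by simp⟩ ?_) le_rfl fun _ _ h => h.2.2
  rintro i hi s' hf ⟨h19, hc, hJ⟩
  have hm : s'.mem 3 = lab := (hf.2 3 (by simp [ifEq, Prog.banks])).trans h3
  have hm10 : s'.mem 10 = s.mem 10 := hf.2 10 (by simp [ifEq, Prog.banks])
  refine Reach.of_straight rfl (by simp [ifEq, neqExpr, Prog.time, Expr.cost]) ?_
  simp only [Prog.step, step_ifEq, Expr.eval, hm, h19, hm10]
  -- Numbers that are not neighbours have label `0`; the cell of this label is empty, so they are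
  -- never taken for openings.
  have hcond : s.mem 10 (lab i) = i + 1 ↔ lab i ≠ 0 ∧ op (lab i) = i := by
    by_cases h0 : lab i = 0
    · simp [h0, hz]
    · rw [hop i h0]; simp [h0]
  have h92 : ∀ s2 : State, s2.mem 9 = s'.mem 9 → s2.mem 3 = lab → s2.reg 19 = i → ∀ k,
      ((s2.setMem 9 (s2.mem 3 (s2.reg 19)) (s2.mem 9 (s2.mem 3 (s2.reg 19)) + 1)).mem 9 k) =
        Nat.count (fun x => lab x = k) (i + 1) := by
    intro s2 a1 a2 a3 k
    rw [Nat.count_succ, a1, a2, a3]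
    by_cases hk : lab i = k
    · subst hk; simp [State.setMem, hc]
    · simp [State.setMem, Function.update_of_ne (Ne.symm hk), hk, hc, a1]
  by_cases hi' : lab i ≠ 0 ∧ op (lab i) = i
  · rw [if_pos (hcond.2 hi')]
    refine ⟨?_, ?_, ?_⟩
    · simp [State.setReg, State.setMem, h19]
    · intro k
      have := h92 (s'.setMem 2 (lab i - 1) (s'.mem 9 (lab i))) (by simp [State.setMem])
        (by simp [State.setMem, hm]) (by simp [State.setMem, h19]) k
      simpa [State.setReg, State.setMem, h19, hm] using this
    · intro k hk hki hlk
      by_cases hk2 : op k = i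
      · have : lab i = k := by rw [← hk2, hlk]
        simp [State.setReg, State.setMem, this, hk2, hc]
      · have hne : k - 1 ≠ lab i - 1 := by
          intro h
          have h5 : k = lab i := by omega
          exact hk2 (by rw [h5]; exact hi'.2)
        simp [State.setReg, State.setMem, Function.update_of_ne hne]
        exact hJ k hk (by omega) hlk
  · rw [if_neg (fun h => hi' (hcond.1 h))]
    refine ⟨?_, ?_, ?_⟩
    · simp [State.setReg, State.setMem, h19]
    · intro k
      have := h92 s' rfl hm h19 k
      simpa [State.setReg, State.setMem, h19, hm] using this
    · intro k hk hki hlk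
      have hk2 : op k ≠ i := by
        rintro rfl
        exact hi' ⟨by omega, by rw [hlk]⟩
      have := hJ k hk (by omega) hlk
      simpa [State.setReg, State.setMem] using this

/-- Set up the array of the numbers `1, 2, …` and its inverse. -/
def initArrays : Prog :=
  .seq (.seq (.assign 18 (.const 0)) (.assign 0 (.reg 14)))
    (.count 0 (.seq (.seq (.store 11 (.reg 18) (.add (.reg 18) (.const 1)))
      (.store 12 (.add (.reg 18) (.const 1)) (.reg 18))) (.assign 18 (.add (.reg 18) (.const 1)))))

theorem reach_initArrays {s : State} {δ : ℕ} (h14 : s.reg 14 = δ) :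
    Reach initArrays s (δ * 30 + 10) (fun s' => ∀ i < δ, s'.mem 11 i = i + 1 ∧ s'.mem 12 (i + 1) = i) := by
  refine Reach.imp (T := 4 + (δ * (14 + 6) + 2)) (Reach.seq
    (Q := fun s' => s' = (s.setReg 18 0).setReg 0 δ)
    (Reach.of_straight rfl (by simp [Prog.time, Expr.cost])
    (by simp [Prog.step, Expr.eval, h14, State.setReg])) ?_) (by omega) fun _ _ h => h
  rintro s1 - rfl
  refine Reach.imp (Reach.count_const (k := δ) (F := 14) (Inv := fun i s' => s'.reg 18 = i ∧
    ∀ m < i, s'.mem 11 m = m + 1 ∧ s'.mem 12 (m + 1) = m)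
    (by simp [State.setReg]) (by simp [Prog.regs]) (fun i s x h => h)
    ⟨by simp [State.setReg], by simp⟩ ?_) le_rfl fun _ _ h => h.2
  rintro i hi s' hf ⟨h18, hJ⟩
  refine Reach.of_straight rfl (by simp [Prog.time, Expr.cost]) ⟨?_, fun m hm => ?_⟩
  · simp [Prog.step, Expr.eval, State.setReg, State.setMem, h18]
  · by_cases hmi : m = i
    · subst hmi
      simp [Prog.step, Expr.eval, State.setReg, State.setMem, h18]
    · have := hJ m (by omega)
      have hmi' : m + 1 ≠ i + 1 := by omega
      simpa [Prog.step, Expr.eval, State.setReg, State.setMem, h18, Function.update_of_ne hmi,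
        Function.update_of_ne hmi'] using this

/-- Only the first `s` entries are ever read. The array in memory agrees with `(· + 1)` only on a
finite range. -/
theorem pickAll_congr {a a' : ℕ → ℕ} {s : ℕ} {ds : List ℕ} (h : ∀ i < s, a i = a' i)
    (hd : ∀ (i : ℕ) (h : i < ds.length), ds[i] < s - i) : pickAll a s ds = pickAll a' s ds := by
  induction ds generalizing a a' s with
  | nil => rfl
  | cons d ds ih =>
    have hd0 : d < s := by
      have := hd 0 (by simp)
      rw [List.getElem_cons_zero] at this
      omega
    rw [pickAll, pickAll, h d hd0, ih]
    · intro i hi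
      rw [h (s - 1) (by omega)]
      simp only [Function.update_apply]
      split_ifs
      · rfl
      · exact h i (by omega)
    · intro i hi
      have := hd (i + 1) (by simpa using hi)
      rw [List.getElem_cons_succ] at this
      omega

/-- Output the second part of the code. -/
def outputPositions : Prog :=
  .seq (.seq (.seq (.assign 20 (.const 3)) (.assign 21 (.sub (.reg 14) (.const 1))))
    (.seq (.assign 9 (.reg 13)) (.assign 0 (.sub (.reg 13) (.const 2)))))
    (.count 0 (.seq (.seq (.assign 18 (.load 12 (.load 13 (.reg 20)))) (write (.reg 18)))
      (.seq (.seq (.assign 21 (.sub (.reg 21) (.const 1))) (.assign 22 (.load 11 (.reg 21))))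
        (.seq (.seq (.store 11 (.reg 18) (.reg 22)) (.store 12 (.reg 22) (.reg 18)))
          (.assign 20 (.add (.reg 20) (.const 1)))))))

theorem reach_outputPositions {s : State} {δ b : ℕ} {pre xs : List ℕ} (h14 : s.reg 14 = δ)
    (h13 : s.reg 13 = b) (hpre : pre.length = b) (hout : Holds (s.mem 2) 0 pre)
    (hlen : xs.length = b - 2) (hxs : ∀ (i : ℕ) (h : i < xs.length), s.mem 13 (i + 3) = xs[i]) :
    Reach outputPositions s (b * 60 + 20) (fun s' => Holds (s'.mem 2) 0 (pre ++
      positions (s.mem 11) (s.mem 12) (δ - 1) xs)) := by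
  refine Reach.imp (T := 12 + ((b - 2) * (30 + 6) + 2)) (Reach.seq
    (Q := fun s' => s' = (((s.setReg 20 3).setReg 21 (δ - 1)).setReg 9 b).setReg 0 (b - 2))
    (Reach.of_straight rfl (by simp [Prog.time, Expr.cost])
    (by simp [Prog.step, Expr.eval, h14, h13, State.setReg])) ?_) (by omega) fun _ _ h => h
  rintro s1 - rfl
  -- The numbers `ys` written so far, followed by those computed from the current arrays for the
  -- remaining positions, are always the whole list. Register `20` starts with `3`, the first block
  -- whose position is recorded.
  refine Reach.imp (Reach.count_const (k := b - 2) (F := 30) (Inv := fun i s' => s'.reg 20 = i + 3 ∧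
    ∃ ys, Holds (s'.mem 2) 0 (pre ++ ys) ∧ s'.reg 9 = (pre ++ ys).length ∧
      positions (s.mem 11) (s.mem 12) (δ - 1) xs =
        ys ++ positions (s'.mem 11) (s'.mem 12) (s'.reg 21) (xs.drop i))
    (by simp [State.setReg]) (by simp [Prog.regs, write]) (fun i s x h => h)
    ⟨by simp [State.setReg], [], by simpa [State.setReg] using hout, by simp [State.setReg, hpre], by simp [State.setReg]⟩ ?_)
    le_rfl ?_
  · rintro i hi s' hf ⟨h20, ys, hys, h9, hpos⟩
    have hm : s'.mem 13 = s.mem 13 := hf.2 13 (by simp [Prog.banks, write])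
    have hxi := hxs i (by omega)
    rw [List.drop_eq_getElem_cons (by omega), positions] at hpos
    set x := xs[i]'(by omega) with hx
    refine Reach.of_straight rfl (by simp [write, Prog.time, Expr.cost]) ⟨?_, ys ++ [s'.mem 12 x], ?_, ?_, ?_⟩
    · simp [Prog.step, write, Expr.eval, State.setReg, State.setMem, h20]
    · have := hys.concat (x := s'.mem 12 x) (q := s'.reg 9) (by rw [h9]; simp)
      rw [List.append_assoc] at this
      simpa [Prog.step, write, Expr.eval, State.setReg, State.setMem, h20, hm, hxi, h9] using this
    · simp [Prog.step, write, Expr.eval, State.setReg, State.setMem, h9]; omega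
    · rw [hpos]
      simp [Prog.step, write, Expr.eval, State.setReg, State.setMem, h20, hm, hxi]
  · rintro s' - ⟨-, ys, hys, -, hpos⟩
    rw [hpos, List.drop_eq_nil_of_le (by omega), positions, List.append_nil]
    exact hys

end RankLoops

/-! ### The ranking program. -/

section RankProgram

/-- Read the first three numbers of the input. -/
def header : Prog :=
  .seq (.seq (.assign 11 (.load 0 (.const 0))) (.seq (.assign 12 (.load 0 (.const 1)))
    (.assign 13 (.load 0 (.const 2))))) (.seq (.assign 0 (.reg 13)) (.seq (.assign 3 (.const 3))
      (.assign 9 (.const 1))))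

/-- Read the header of the input and the blocks. -/
def parse : Prog := .seq header blocks

/-- The effect of parsing. -/
structure IsParsed (n v b : ℕ) (es : ℕ → List (ℕ × List ℕ)) (lab : ℕ → ℕ) (s : State) : Prop where
  regN : s.reg 11 = n
  regV : s.reg 12 = v
  regB : s.reg 13 = b
  lab : s.mem 3 = lab
  linked : ∀ j < b, ∀ z ∈ lists v (j + 1) (es j), Linked (s.mem 5) (s.mem 7) z.2
  out : Holds (s.mem 2) 1 (((List.range b).flatMap fun j => others v (es j)).flatMap enc)
  pos : s.reg 9 = 1 + (((List.range b).flatMap fun j => others v (es j)).flatMap enc).length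
  num : s.reg 10 = ((List.range b).flatMap fun j => others v (es j)).length

/-- The time for parsing. -/
def parseTime (b : ℕ) (es : ℕ → List (ℕ × List ℕ)) : ℕ :=
  ∑ j ∈ Finset.range b, (66 * entriesSize (es j) + 19) + 30

/-- `lab` describes the labelled lists. -/
def IsLabel (Z : List (ℕ × List ℕ)) (lab : ℕ → ℕ) : Prop :=
  (∀ z ∈ Z, ∀ x ∈ z.2, lab x = z.1) ∧ ∀ x, (∀ z ∈ Z, x ∉ z.2) → lab x = 0

/-- The output begins in cell `1`, because cell `0` is reserved for the number of vertices. Ranking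
makes no use of the entries copied here and overwrites the beginning of the bank. -/
theorem reach_parse {n v b : ℕ} {es : ℕ → List (ℕ × List ℕ)} {lab : ℕ → ℕ} {inp : List ℕ}
    (hn : (((List.range b).flatMap fun j => lists v (j + 1) (es j)).flatMap Prod.snd).Nodup)
    (hlab : IsLabel ((List.range b).flatMap fun j => lists v (j + 1) (es j)) lab) :
    Reach parse (State.init (n :: v :: b :: (List.range b).flatMap fun j => encAll (es j)) inp)
      (parseTime b es) (IsParsed n v b es lab) := by
  set inp0 := n :: v :: b :: (List.range b).flatMap fun j => encAll (es j) with hinp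
  set s := State.init inp0 inp with hs
  have hin : Holds (s.mem 0) 0 inp0 := by
    intro i hi
    simp only [hs, State.init, if_true, Nat.zero_add, List.getD_eq_getElem?_getD,
      List.getElem?_eq_getElem hi, Option.getD_some]
  rw [hinp] at hin
  obtain ⟨h0, hin⟩ := holds_cons.1 hin
  obtain ⟨h1, hin⟩ := holds_cons.1 hin
  obtain ⟨h2, hin⟩ := holds_cons.1 hin
  set s1 := header.step s with hs1
  have hf1 := (Prog.run_step (p := header) rfl s).choose_spec.2.frame
  have em : s1.mem = s.mem := by simp [hs1, header, Prog.step, State.setReg]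
  have e0 : s1.reg 0 = b := by simp [hs1, header, Prog.step, Expr.eval, State.setReg, h2]
  have e3 : s1.reg 3 = 3 := by simp [hs1, header, Prog.step, Expr.eval, State.setReg]
  have e9 : s1.reg 9 = 1 := by simp [hs1, header, Prog.step, Expr.eval, State.setReg]
  have e11 : s1.reg 11 = n := by simp [hs1, header, Prog.step, Expr.eval, State.setReg, h0]
  have e12 : s1.reg 12 = v := by simp [hs1, header, Prog.step, Expr.eval, State.setReg, h1]
  have e13 : s1.reg 13 = b := by simp [hs1, header, Prog.step, Expr.eval, State.setReg, h2]
  have e4 : s1.reg 4 = 0 := hf1.1 4 (by decide)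
  have e10 : s1.reg 10 = 0 := hf1.1 10 (by decide)
  have hP : Parsed 0 1 0 [] [] s1 := by
    refine ⟨holds_nil _ _, by simpa using e9, by simpa using e10, by simp, fun x _ => ?_, by simp, by simp⟩
    rw [em]; simp [hs, State.init]
  refine Reach.imp (T := 28 + (∑ j ∈ Finset.range b, (66 * entriesSize (es j) + 19) + 2))
    (Reach.seq (Q := fun s' => s' = s1) (Reach.of_straight rfl (by decide) rfl) ?_)
    (by simp only [parseTime]; omega) fun _ _ h => h
  rintro s' - rfl
  refine Reach.imp (reach_blocks e0 e3 e4 e12 (by rw [em]; exact hin) hP hn) le_rfl ?_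
  rintro s2 hf ⟨g1, g2, g3, g4, g5, g6, -⟩
  refine ⟨(hf.1 11 (by decide)).trans e11, (hf.1 12 (by decide)).trans e12,
    (hf.1 13 (by decide)).trans e13, funext fun x => ?_, fun j hj z hz => ?_, g1, g2, by simpa using g3⟩
  · by_cases hx : ∃ z ∈ (List.range b).flatMap fun j => lists v (j + 1) (es j), x ∈ z.2
    · obtain ⟨z, hz, hx⟩ := hx
      exact (g4 z hz x hx).trans (hlab.1 z hz x hx).symm
    · push Not at hx
      exact (g5 x hx).trans (hlab.2 x hx).symm
  · exact g6 z (List.mem_flatMap.2 ⟨j, by simpa using hj, hz⟩)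

theorem isRotated_filter {α : Type*} {l m : List α} (h : l.IsRotated m) (p : α → Bool) :
    (l.filter p).IsRotated (m.filter p) := by
  obtain ⟨k, rfl⟩ := h
  rw [List.rotate_eq_drop_append_take_mod, List.filter_append]
  conv_lhs => rw [← List.take_append_drop (k % l.length) l, List.filter_append]
  exact List.isRotated_append

theorem IsWord.isRotated {lab : ℕ → ℕ} {L : ℕ → List ℕ} {w w' : List ℕ} (hw : IsWord lab L w)
    (h : w.IsRotated w') : IsWord lab L w' :=
  ⟨h.nodup_iff.1 hw.nodup, fun x => by rw [← h.mem_iff, hw.mem],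
    fun k h0 => (isRotated_filter h.symm _).trans (hw.rot k h0)⟩

/-- The program that computes the code of an embedding. -/
def rankProg : Prog :=
  .seq parse (.seq (.seq (.assign 3 (.const 0)) (.assign 4 (.const 1))) (.seq (block 1)
    (.seq findTwo (.seq findRoot (.seq findOpenings (.seq findPositions (.seq countOpenings
      (.seq initArrays outputPositions))))))))

/-- The adjacency list of the embedding may start anywhere, so the result is expressed by a normal
rotation of it. -/
theorem reach_rankProg {n v b : ℕ} {es : ℕ → List (ℕ × List ℕ)} {eE : List (ℕ × List ℕ)}
    {lab : ℕ → ℕ} {L : ℕ → List ℕ} {l : List ℕ} (hL : Labelled b lab L) (hl : IsWord lab L l)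
    (hn : (((List.range b).flatMap fun j => lists v (j + 1) (es j)).flatMap Prod.snd).Nodup)
    (hlab : IsLabel ((List.range b).flatMap fun j => lists v (j + 1) (es j)) lab)
    (hE : lists v 1 eE = [(1, l)]) (hlt : ∀ x ∈ l, x < n) :
    Reach rankProg
      (State.init (n :: v :: b :: (List.range b).flatMap fun j => encAll (es j)) (encAll eE))
      (parseTime b es + 66 * entriesSize eE + l.length * 210 + n * 60 + b * 60 + 200)
      (fun s => ∃ w, l.IsRotated w ∧ IsNormal lab w ∧
        s.HasOutput (((List.range b).map fun k => encodeOp lab w (k + 1)) ++ encodePos b lab w)) := by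
  have hb := hL.two_le
  have hex : ∀ k, k ≠ 0 → k ≤ b → ∃ x ∈ l, lab x = k := fun k h0 hk => by
    obtain ⟨x, hx⟩ := hL.exists_mem h0 hk
    exact ⟨x, (hl.mem x).2 (by omega), hx⟩
  have hinit : ∀ i, (State.init (n :: v :: b :: (List.range b).flatMap fun j => encAll (es j))
      (encAll eE)).mem (i + 2) = fun _ => 0 := fun i => by simp [State.init]
  have hin1 : Holds ((State.init (n :: v :: b :: (List.range b).flatMap fun j => encAll (es j))
      (encAll eE)).mem 1) 0 (encAll eE) := by
    intro i hi
    simp only [State.init, if_true, Nat.zero_add, List.getD_eq_getElem?_getD, if_neg one_ne_zero,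
      List.getElem?_eq_getElem hi, Option.getD_some]
  have hparse := reach_parse (n := n) (inp := encAll eE) hn hlab
  generalize State.init (n :: v :: b :: (List.range b).flatMap fun j => encAll (es j)) (encAll eE) = s0
    at hinit hin1 hparse ⊢
  refine Reach.imp (T := parseTime b es + (6 + ((66 * entriesSize eE + 9) + ((l.length * 40 + 10) +
    ((l.length * 40 + 10) + ((l.length * 40 + 10) + ((l.length * 60 + 20) + ((n * 60 + 10) +
    ((l.length * 30 + 10) + (b * 60 + 20)))))))))) (Reach.seq hparse ?_) (by omega) fun _ _ h => h
  rintro s1 f1 ⟨p11, p12, p13, plab, -, -, -, -⟩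
  refine Reach.seq (Q := fun s' => s' = (s1.setReg 3 0).setReg 4 1)
    (Reach.of_straight rfl (by decide) rfl) ?_
  rintro s2 - rfl
  -- The label `1` given to the list at this point goes to bank `4` and plays no role; the labels of
  -- the blocks remain in bank `3`. The links of the common rotation go to the banks `6` and `8`.
  refine Reach.seq (reach_block (c := 1) (p := 0) (j := 1) (v := v) (o := s1.reg 9) (m := s1.reg 10)
    (es := eE) (Y := []) (Z := []) (Or.inr rfl) (by simp [State.setReg]) (by simp [State.setReg])
    (by simpa [State.setReg] using p12) ?_ ⟨holds_nil _ _, by simp [State.setReg], by simp [State.setReg],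
      by simp, fun x _ => ?_, by simp, by simp⟩ (by simpa [hE] using hl.nodup)) ?_
  · simpa [State.setReg, f1.2 1 (by decide)] using hin1
  · simp [State.setReg, f1.2 4 (by decide), hinit 2]
  rintro s3 f3 ⟨-, hP⟩
  rw [hE, List.nil_append, List.nil_append] at hP
  have hlink := hP.linked (1, l) (by simp)
  obtain ⟨h14, h7⟩ := hP.last [] (1, l) rfl
  simp only at h14 h7 hlink
  have hl0 : l ≠ [] := by
    obtain ⟨x, hx, -⟩ := hex 1 (by omega) (by omega)
    exact List.ne_nil_of_mem hx
  have h3 : s3.mem 3 = lab := (f3.2 3 (by decide)).trans plab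
  have h11 : s3.reg 11 = n := (f3.1 11 (by decide)).trans p11
  have h13 : s3.reg 13 = b := (f3.1 13 (by decide)).trans p13
  have h9 : s3.mem 9 = fun _ => 0 :=
    (f3.2 9 (by decide)).trans ((f1.2 9 (by decide)).trans (hinit 7))
  have h10 : s3.mem 10 = fun _ => 0 :=
    (f3.2 10 (by decide)).trans ((f1.2 10 (by decide)).trans (hinit 8))
  refine Reach.seq (reach_findTwo hl.nodup hlink h14 (h7 hl0) h3 (hex 2 (by omega) hb)) ?_
  rintro s4 f4 ⟨h16, h16'⟩
  have k6 : s4.mem 6 = s3.mem 6 := f4.2 6 (by decide)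
  refine Reach.seq (reach_findRoot (s := s4) (prv := s3.mem 8) hl.nodup (by rw [k6]; exact hlink)
    ((f4.1 14 (by decide)).trans h14) h16 h16' ((f4.2 3 (by decide)).trans h3)
    (hex 1 (by omega) (by omega))) ?_
  rintro s5 f5 ⟨h17, hnorm⟩
  set w := startAt l (s5.reg 17) with hw
  have hrot : l.IsRotated w := (startAt_isRotated _ _).symm
  have hword := hl.isRotated hrot
  have k6 : s5.mem 6 = s3.mem 6 := (f5.2 6 (by decide)).trans k6
  refine Reach.seq (reach_findOpenings (s := s5) (lab := lab) (prv := s3.mem 8) hl.nodup (by rw [k6]; exact hlink)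
    ((f5.1 14 (by decide)).trans ((f4.1 14 (by decide)).trans h14)) h17
    ((f5.2 3 (by decide)).trans ((f4.2 3 (by decide)).trans h3)) (fun k => by
      rw [f5.2 10 (by decide), f4.2 10 (by decide), h10])) ?_
  rintro s6 f6 ⟨hop, hop0⟩
  rw [← hw] at hop
  have k6 : s6.mem 6 = s3.mem 6 := (f6.2 6 (by decide)).trans k6
  have k14 : s6.reg 14 = l.length :=
    (f6.1 14 (by decide)).trans ((f5.1 14 (by decide)).trans ((f4.1 14 (by decide)).trans h14))
  have k3 : s6.mem 3 = lab :=
    (f6.2 3 (by decide)).trans ((f5.2 3 (by decide)).trans ((f4.2 3 (by decide)).trans h3))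
  have hopm : ∀ k, k ≠ 0 → k ≤ b → lab (opening lab w k) = k ∧ opening lab w k ∈ l := fun k h0 hk => by
    have := hword.lab_opening hL h0 hk
    exact ⟨this.1, hrot.mem_iff.2 this.2⟩
  refine Reach.seq (reach_findPositions (s := s6) (lab := lab) (prv := s3.mem 8) (op := opening lab w)
    hl.nodup (by rw [k6]; exact hlink) k14 (hopm 2 (by omega) hb).2 k3
    (hop 2 (hex 2 (by omega) hb)) fun x hx => hop _ ⟨x, hx, rfl⟩) ?_
  rintro s7 f7 hpos
  have k10 : s7.mem 10 = s6.mem 10 := f7.2 10 (by decide)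
  have hz10 : s6.mem 10 0 = 0 := hop0 0 fun x hx => (hl.mem x).1 hx
  refine Reach.seq (reach_countOpenings (s := s7) (lab := lab) (op := opening lab w) (n := n) ?_
    ((f7.2 3 (by decide)).trans k3) (fun k => ?_) (by rw [k10]; exact hz10) fun x hx => ?_) ?_
  · rw [f7.1 11 (by decide), f6.1 11 (by decide), f5.1 11 (by decide), f4.1 11 (by decide), h11]
  · rw [f7.2 9 (by decide), f6.2 9 (by decide), f5.2 9 (by decide), f4.2 9 (by decide), h9]
  · rw [k10]; exact hop _ ⟨x, (hl.mem x).2 hx, rfl⟩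
  rintro s8 f8 hcnt
  refine Reach.seq (reach_initArrays (s := s8) (δ := l.length) ?_) ?_
  · rw [f8.1 14 (by decide), f7.1 14 (by decide), k14]
  rintro s9 f9 harr
  have k13 : s9.mem 13 = s7.mem 13 := (f9.2 13 (by decide)).trans (f8.2 13 (by decide))
  have hcirc : startAt l (opening lab w 2) = circular lab w := by
    obtain ⟨u, y, z, r, hwd, hu, hy, hz⟩ := hnorm
    have h2 := (IsNormal.opening_two hwd hu hy hz).2
    have hc := circular_eq (r := r) hu hy hz
    rw [← hwd] at hc
    rw [h2]
    have hcr : (circular lab w).IsRotated l := (List.IsRotated.forall w _).trans hrot.symm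
    exact startAt_eq hcr hl.nodup hc
  obtain ⟨e1, e2, e3⟩ := encodePos_spec hL hword hnorm
  have hwl : w.length = l.length := length_startAt _ _
  rw [hwl] at e1 e3
  have hinv : ∀ i < l.length - 1, s9.mem 12 (s9.mem 11 i) = i := fun i hi => by
    rw [(harr i (by omega)).1, (harr i (by omega)).2]
  -- `positions` is not compared directly for the two pairs of arrays, which agree on finitely many
  -- cells only. Instead the list is written as a value of `pickAll`, which depends on these cells
  -- alone, and then inverted.
  have hxs : positions (s9.mem 11) (s9.mem 12) (l.length - 1) (openPos b lab w) = encodePos b lab w := by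
    rw [← e1, pickAll_congr (a' := s9.mem 11) (fun i hi => (harr i (by omega)).1.symm) e3]
    exact positions_pickAll _ _ _ _ hinv e3
  refine Reach.imp (reach_outputPositions (δ := l.length) (b := b)
    (pre := (List.range b).map fun k => encodeOp lab w (k + 1)) (xs := openPos b lab w) ?_ ?_ (by simp) ?_
    (by simp [openPos]) fun i hi => ?_) le_rfl ?_
  · rw [f9.1 14 (by decide), f8.1 14 (by decide), f7.1 14 (by decide), k14]
  · rw [f9.1 13 (by decide), f8.1 13 (by decide), f7.1 13 (by decide), f6.1 13 (by decide),
      f5.1 13 (by decide), f4.1 13 (by decide), h13]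
  · intro k hk
    simp only [List.length_map, List.length_range] at hk
    have h1 := hopm (k + 1) (by omega) (by omega)
    rw [f9.2 2 (by decide)]
    have := hcnt (k + 1) (by omega) (hlt _ h1.2) h1.1
    simpa [encodeOp] using this
  · simp only [openPos, List.length_map, List.length_range] at hi
    have h1 := hopm (i + 3) (by omega) (by omega)
    rw [k13, hpos (i + 3) h1.2 h1.1, hcirc]
    simp [openPos]
  · rintro s10 - hout
    rw [hxs] at hout
    refine ⟨w, hrot, hnorm, fun i hi => ?_⟩
    have := hout i hi
    rwa [Nat.zero_add] at this

end RankProgram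

/-! ### The loops of the unranking program. -/

section UnrankLoops

/-- Count the elements of the blocks and find the openings. -/
def unrankOpenings : Prog :=
  .seq (.seq (.seq (.assign 19 (.const 0)) (.assign 14 (.const 0))) (.assign 0 (.reg 11)))
    (.count 0 (.seq (.seq (.assign 18 (.load 3 (.reg 19))) (.ite (.reg 18)
      (.seq (ifEq (.load 9 (.reg 18)) (.load 1 (.sub (.reg 18) (.const 1)))
          (.store 10 (.reg 18) (.reg 19)))
        (.seq (.store 9 (.reg 18) (.add (.load 9 (.reg 18)) (.const 1)))
          (.assign 14 (.add (.reg 14) (.const 1))))) .skip))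
      (.assign 19 (.add (.reg 19) (.const 1)))))

variable {lab : ℕ → ℕ}

/-- While the numbers are scanned, the counter of a label is the rank of the current number, so the
opening is found when it agrees with the code. At the end the counters are the sizes of the blocks,
as needed for `lastUnder`. -/
theorem reach_unrankOpenings {s : State} {n : ℕ} (h11 : s.reg 11 = n) (h3 : s.mem 3 = lab)
    (h9 : ∀ k, s.mem 9 k = 0) :
    Reach unrankOpenings s (n * 60 + 10) (fun s' =>
      s'.reg 14 = Nat.count (fun x => lab x ≠ 0) n ∧
      (∀ k, s'.mem 9 k = if k = 0 then 0 else Nat.count (fun x => lab x = k) n) ∧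
      ∀ k x, k ≠ 0 → x < n → lab x = k → Nat.count (fun x => lab x = k) x = s.mem 1 (k - 1) →
        s'.mem 10 k = x) := by
  refine Reach.imp (T := 6 + (n * (40 + 6) + 2)) (Reach.seq
    (Q := fun s' => s' = ((s.setReg 19 0).setReg 14 0).setReg 0 n)
    (Reach.of_straight rfl (by simp [Prog.time, Expr.cost])
    (by simp [Prog.step, Expr.eval, h11, State.setReg])) ?_) (by omega) fun _ _ h => h
  rintro s1 - rfl
  refine Reach.imp (Reach.count_const (k := n) (F := 40) (Inv := fun i s' => s'.reg 19 = i ∧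
    s'.reg 14 = Nat.count (fun x => lab x ≠ 0) i ∧
    (∀ k, s'.mem 9 k = if k = 0 then 0 else Nat.count (fun x => lab x = k) i) ∧
      ∀ k x, k ≠ 0 → x < i → lab x = k → Nat.count (fun x => lab x = k) x = s.mem 1 (k - 1) →
        s'.mem 10 k = x)
    (by simp [State.setReg]) (by simp [ifEq, Prog.regs]) (fun i s x h => h)
    ⟨by simp [State.setReg], by simp [State.setReg], by simpa [State.setReg] using h9, by simp⟩ ?_)
    le_rfl fun _ _ h => h.2
  rintro i hi s' hf ⟨h19, h14, hc, hJ⟩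
  have hm : s'.mem 3 = lab := (hf.2 3 (by simp [ifEq, Prog.banks])).trans h3
  have hm1 : s'.mem 1 = s.mem 1 := hf.2 1 (by simp [ifEq, Prog.banks])
  refine Reach.of_straight rfl (by simp [ifEq, neqExpr, Prog.time, Expr.cost]) ?_
  by_cases h0 : lab i = 0
  · refine ⟨?_, ?_, fun k => ?_, fun k x hk hx hl ht => ?_⟩
    · simp [Prog.step, Expr.eval, State.setReg, hm, h19, h0]
    · simp [Prog.step, Expr.eval, State.setReg, hm, h19, h0, h14, Nat.count_succ]
    · have : s'.mem 9 k = if k = 0 then 0 else Nat.count (fun x => lab x = k) (i + 1) := ?_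
      · simpa [Prog.step, Expr.eval, State.setReg, hm, h19, h0] using this
      rw [hc k, Nat.count_succ]
      by_cases hk : k = 0
      · simp [hk]
      · simp [h0, Ne.symm hk]
    · have h1 : x ≠ i := by rintro rfl; exact hk (hl.symm.trans h0)
      have := hJ k x hk (by omega) hl ht
      simpa [Prog.step, Expr.eval, State.setReg, hm, h19, h0] using this
  · have hci := hc (lab i)
    rw [if_neg h0] at hci
    have key : ∀ s2 : State, s2.reg 19 = i + 1 → s2.reg 14 = s'.reg 14 + 1 →
        s2.mem 9 = Function.update (s'.mem 9) (lab i) (s'.mem 9 (lab i) + 1) →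
        s2.mem 10 = (if s'.mem 9 (lab i) = s.mem 1 (lab i - 1) then
          Function.update (s'.mem 10) (lab i) i else s'.mem 10) →
        s2.reg 19 = i + 1 ∧ s2.reg 14 = Nat.count (fun x => lab x ≠ 0) (i + 1) ∧
        (∀ k, s2.mem 9 k = if k = 0 then 0 else Nat.count (fun x => lab x = k) (i + 1)) ∧
        ∀ k x, k ≠ 0 → x < i + 1 → lab x = k →
          Nat.count (fun x => lab x = k) x = s.mem 1 (k - 1) → s2.mem 10 k = x := by
      intro s2 e1 e2 e3 e4
      refine ⟨e1, by rw [e2, h14, Nat.count_succ, if_pos h0], fun k => ?_, fun k x hk hx hl ht => ?_⟩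
      · rw [e3, Nat.count_succ, Function.update_apply]
        by_cases hk : k = lab i
        · subst hk; simp [hci, h0]
        · simp only [hk, if_false, hc k, Ne.symm hk]
          rfl
      · rw [e4]
        by_cases hxi : x = i
        · subst hxi
          subst hl
          rw [if_pos (by rw [hci, ht]), Function.update_self]
        · have hx' : x < i := by omega
          have h5 := hJ k x hk hx' hl ht
          split_ifs with h6
          · rw [Function.update_apply, if_neg, h5]
            rintro rfl
            -- Ranks increase strictly within a label, so an opening once found is not overwritten.
            have h7 := Nat.count_strict_mono (p := fun x => lab x = lab i) hl hx'
            rw [hci] at h6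
            omega
          · exact h5
    by_cases h1 : s'.mem 9 (lab i) = s.mem 1 (lab i - 1) <;> refine key _ ?_ ?_ ?_ ?_ <;>
      simp [Prog.step, step_ifEq, Expr.eval, State.setReg, State.setMem, hm, h19, h0, hm1, h1]

/-- Set up the circular word. -/
def fillCircle : Prog :=
  .seq (.seq (.seq (.store 14 (.const 0) (.const 2)) (.assign 20 (.const 3)))
      (.seq (.assign 21 (.sub (.reg 14) (.const 1))) (.assign 0 (.sub (.reg 13) (.const 2)))))
    (.count 0 (.seq (.seq (.assign 18 (.load 1 (.sub (.add (.reg 13) (.reg 20)) (.const 3))))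
        (.store 14 (.load 11 (.reg 18)) (.reg 20)))
      (.seq (.assign 21 (.sub (.reg 21) (.const 1)))
        (.seq (.store 11 (.reg 18) (.load 11 (.reg 21))) (.assign 20 (.add (.reg 20) (.const 1)))))))

theorem circ_concat {ys : List ℕ} {x : ℕ} (h0 : x ≠ 0) (hx : x ∉ ys) :
    circ (ys ++ [x]) = Function.update (circ ys) x (ys.length + 3) := by
  funext y
  rw [Function.update_apply]
  split_ifs with h
  · subst h
    rw [circ, if_neg h0, if_pos (by simp), List.idxOf_append_of_notMem hx]
    simp
  · simp only [circ, List.mem_append, List.mem_singleton, h, or_false]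
    split_ifs with h1 h2
    · rfl
    · rw [List.idxOf_append_of_mem h2]
    · rfl

theorem reach_fillCircle {s : State} {δ b : ℕ} {ds : List ℕ} (h14 : s.reg 14 = δ)
    (h13 : s.reg 13 = b) (hlen : ds.length = b - 2) (hds : Holds (s.mem 1) b ds)
    (h0 : ∀ x, s.mem 14 x = 0) (hn : (pickAll (s.mem 11) (δ - 1) ds).Nodup)
    (hpos : ∀ x ∈ pickAll (s.mem 11) (δ - 1) ds, x ≠ 0) :
    Reach fillCircle s (b * 60 + 20)
      (fun s' => s'.mem 14 = circ (pickAll (s.mem 11) (δ - 1) ds)) := by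
  refine Reach.imp (T := 13 + ((b - 2) * (30 + 6) + 2)) (Reach.seq
    (Q := fun s' => s' = (((s.setMem 14 0 2).setReg 20 3).setReg 21 (δ - 1)).setReg 0 (b - 2))
    (Reach.of_straight rfl (by simp [Prog.time, Expr.cost])
    (by simp [Prog.step, Expr.eval, h14, h13, State.setReg, State.setMem])) ?_) (by omega)
    fun _ _ h => h
  rintro s1 - rfl
  refine Reach.imp (Reach.count_const (k := b - 2) (F := 30) (Inv := fun i s' => s'.reg 20 = i + 3 ∧
    ∃ ys : List ℕ, ys.length = i ∧ s'.mem 14 = circ ys ∧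
      pickAll (s.mem 11) (δ - 1) ds = ys ++ pickAll (s'.mem 11) (s'.reg 21) (ds.drop i))
    (by simp [State.setReg]) (by simp [Prog.regs]) (fun i s x h => h)
    ⟨by simp [State.setReg], [], rfl, ?_, by simp [State.setReg, State.setMem]⟩ ?_)
    le_rfl ?_
  · funext x
    by_cases hx : x = 0 <;> simp [State.setReg, State.setMem, circ, hx, h0]
  · rintro i hi s' hf ⟨h20, ys, hys, hc, hp⟩
    have hm : s'.mem 1 = s.mem 1 := hf.2 1 (by simp [Prog.banks])
    have hr : s'.reg 13 = b := (hf.1 13 (by simp [Prog.regs])).trans h13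
    -- The second part of the code begins in cell `b`, and register `20` is ahead of the index by
    -- `3`.
    have hd : s.mem 1 (b + (i + 3) - 3) = ds[i] := hds.get (by omega) (by omega)
    rw [List.drop_eq_getElem_cons (by omega), pickAll] at hp
    set d := ds[i]'(by omega) with hdd
    have hxn : s'.mem 11 d ∉ ys := by
      rw [hp, List.nodup_append] at hn
      exact fun h => hn.2.2 _ h _ List.mem_cons_self rfl
    have hx0 : s'.mem 11 d ≠ 0 := hpos _ (by rw [hp]; simp)
    refine Reach.of_straight rfl (by simp [Prog.time, Expr.cost])
      ⟨?_, ys ++ [s'.mem 11 d], by simp [hys], ?_, ?_⟩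
    · simp [Prog.step, Expr.eval, State.setReg, State.setMem, h20]
    · rw [circ_concat hx0 hxn, hys, ← hc]
      simp [Prog.step, Expr.eval, State.setReg, State.setMem, h20, hm, hr, hd]
    · rw [hp]
      simp [Prog.step, Expr.eval, State.setReg, State.setMem, h20, hm, hr, hd]
  · rintro s' - ⟨-, ys, -, hc, hp⟩
    rw [hp, List.drop_eq_nil_of_le (by omega), pickAll, List.append_nil]
    exact hc

/-- Find the position of the root. -/
def findStart : Prog :=
  .seq (.seq (.seq (.assign 22 (.const 0)) (.assign 23 (.const 0)))
      (.seq (.assign 24 (.const 0)) (.assign 0 (.reg 14))))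
    (.count 0 (.seq (.seq (.assign 18 (.load 14 (.reg 22)))
        (.assign 23 (.sub (.reg 14) (.sub (.reg 14) (.add (.reg 23) (.load 9 (.reg 18)))))))
      (.seq (.ite (.reg 23) (.assign 23 (.sub (.reg 23) (.const 1))) (.assign 24 (.reg 22)))
        (.assign 22 (.add (.reg 22) (.const 1))))))

theorem reach_findStart {s : State} {δ : ℕ} {c sz : ℕ → ℕ} (h14 : s.reg 14 = δ)
    (hc : s.mem 14 = c) (hsz : s.mem 9 = sz)
    (hsum : (((List.range δ).map c).map sz).sum ≤ δ) :
    Reach findStart s (δ * 60 + 10)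
      (fun s' => s'.reg 24 = lastUnder sz ((List.range δ).map c) 0 0 0) := by
  set O := (List.range δ).map c with hO
  have hOl : O.length = δ := by simp [hO]
  refine Reach.imp (T := 8 + (δ * (30 + 6) + 2)) (Reach.seq
    (Q := fun s' => s' = (((s.setReg 22 0).setReg 23 0).setReg 24 0).setReg 0 δ)
    (Reach.of_straight rfl (by simp [Prog.time, Expr.cost])
    (by simp [Prog.step, Expr.eval, h14, State.setReg])) ?_) (by omega) fun _ _ h => h
  rintro s1 - rfl
  refine Reach.imp (Reach.count_const (k := δ) (F := 30) (Inv := fun i s' => s'.reg 22 = i ∧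
    lastUnder sz (O.drop i) (s'.reg 23) i (s'.reg 24) = lastUnder sz O 0 0 0 ∧
      s'.reg 23 + ((O.drop i).map sz).sum ≤ δ)
    (by simp [State.setReg]) (by simp [Prog.regs]) (fun i s x h => h)
    ⟨by simp [State.setReg], by simp [State.setReg], by simpa [State.setReg] using hsum⟩ ?_)
    le_rfl ?_
  · rintro i hi s' hf ⟨h22, hu, hs⟩
    have hm : s'.mem 14 = c := (hf.2 14 (by simp [Prog.banks])).trans hc
    have hm9 : s'.mem 9 = sz := (hf.2 9 (by simp [Prog.banks])).trans hsz
    have hr : s'.reg 14 = δ := (hf.1 14 (by simp [Prog.regs])).trans h14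
    have hOi : O[i]'(by omega) = c i := by simp [hO]
    rw [List.drop_eq_getElem_cons (by omega), hOi] at hu hs
    rw [List.map_cons, List.sum_cons] at hs
    -- The sum of two stored numbers is not a `slow` expression. The double truncated subtraction
    -- caps it at `δ`, which changes nothing, since no more than `δ` elements are pushed altogether.
    have hmin : δ - (δ - (s'.reg 23 + sz (c i))) = s'.reg 23 + sz (c i) := by omega
    refine Reach.of_straight rfl (by simp [Prog.time, Expr.cost]) ?_
    rw [lastUnder] at hu
    have key : ∀ s2 : State, s2.reg 22 = i + 1 → s2.reg 23 = s'.reg 23 + sz (c i) - 1 →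
        s2.reg 24 = (if s'.reg 23 + sz (c i) = 0 then i else s'.reg 24) →
        s2.reg 22 = i + 1 ∧
        lastUnder sz (O.drop (i + 1)) (s2.reg 23) (i + 1) (s2.reg 24) = lastUnder sz O 0 0 0 ∧
          s2.reg 23 + ((O.drop (i + 1)).map sz).sum ≤ δ := by
      intro s2 e1 e2 e3
      refine ⟨e1, ?_, by omega⟩
      rw [← hu, e2, e3]
      split_ifs with h1 h2 h3
      · rw [h1]
      · omega
      · omega
      · rw [Nat.add_comm (s'.reg 23)]
    by_cases h : s'.reg 23 + sz (c i) = 0 <;> refine key _ ?_ ?_ ?_ <;>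
      simp [Prog.step, Expr.eval, State.setReg, hm, h22, hm9, hr, hmin, h, -Nat.add_eq_zero_iff, -add_eq_zero]
  · rintro s' - ⟨-, hu, -⟩
    rw [List.drop_eq_nil_of_le (by omega), lastUnder] at hu
    exact hu

/-- The list `S` is met when going along `nxt` from `t`. -/
def Follows (nxt : ℕ → ℕ) : ℕ → List ℕ → Prop
  | _, [] => True
  | t, x :: S => t = x ∧ Follows nxt (nxt x) S

theorem Follows.congr {nxt nxt' : ℕ → ℕ} {t : ℕ} {S : List ℕ} (h : Follows nxt t S)
    (h' : ∀ x ∈ S, nxt' x = nxt x) : Follows nxt' t S := by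
  induction S generalizing t with
  | nil => trivial
  | cons x S ih =>
    refine ⟨h.1, ?_⟩
    rw [h' x (by simp)]
    exact ih h.2 fun y hy => h' y (by simp [hy])

theorem follows_append {nxt : ℕ → ℕ} {x : ℕ} {t S : List ℕ}
    (hc : ∀ (i : ℕ) (h : i + 1 < (x :: t).length), nxt (x :: t)[i] = (x :: t)[i + 1])
    (h : Follows nxt (nxt ((x :: t).getLast (by simp))) S) : Follows nxt x (x :: t ++ S) := by
  induction t generalizing x with
  | nil => exact ⟨rfl, by simpa using h⟩
  | cons y t ih =>
    have h0 := hc 0 (by simp)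
    simp only [List.getElem_cons_zero, Nat.zero_add, List.getElem_cons_succ] at h0
    refine ⟨rfl, ?_⟩
    rw [h0]
    refine ih (fun i hi => ?_) (by simpa using h)
    have := hc (i + 1) (by simpa using hi)
    simpa using this

/-- The circular list of a block is cut open before its opening `x`: the link of the last element,
`prv x`, is redirected from `x` to the old top. So a whole block is pushed in constant time. -/
theorem follows_push {nxt prv : ℕ → ℕ} {x top : ℕ} {t S : List ℕ} (hl : Linked nxt prv (x :: t))
    (hn : ((x :: t) ++ S).Nodup) (h : Follows nxt top S) :
    Follows (Function.update nxt (prv x) top) x (x :: t ++ S) ∧ prv x ∈ x :: t := by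
  have hn' : (x :: t).Nodup := hn.of_append_left
  have hp : prv x = (x :: t).getLast (by simp) := by
    rw [(hl x (by simp)).2, Equiv.Perm.inv_eq_iff_eq, List.formPerm_apply_getLast]
  have hmem : prv x ∈ x :: t := hp ▸ List.getLast_mem _
  refine ⟨follows_append (fun i hi => ?_) ?_, hmem⟩
  · rw [Function.update_of_ne, hl.getElem hn' hi]
    rw [hp, List.getLast_eq_getElem]
    intro h
    have := hn'.getElem_inj_iff.1 h
    simp at this hi
    omega
  · rw [← hp, Function.update_self]
    refine h.congr fun y hy => Function.update_of_ne ?_ _ _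
    rintro rfl
    exact (List.nodup_append.1 hn).2.2 _ hmem _ hy rfl

theorem Linked.update {nxt prv : ℕ → ℕ} {l : List ℕ} {x y : ℕ} (h : Linked nxt prv l) (hx : x ∉ l) :
    Linked (Function.update nxt x y) prv l := fun z hz => by
  rw [Function.update_of_ne]
  · exact h z hz
  · rintro rfl
    exact hx (formPerm_inv_mem.2 hz)

/-- One step of `outputWord`. -/
def outputWordBody : Prog :=
  .seq (.seq (.assign 18 (.load 14 (.reg 22))) (.ite (.reg 18)
      (.seq (.store 5 (.load 7 (.load 10 (.reg 18))) (.reg 25)) (.assign 25 (.load 10 (.reg 18)))) .skip))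
    (.seq (.seq (write (.reg 25)) (.assign 25 (.load 5 (.reg 25))))
      (.seq (.assign 22 (.add (.reg 22) (.const 1))) (ifEq (.reg 22) (.reg 14) (.assign 22 (.const 0)))))

/-- Output the decoded word. -/
def outputWord : Prog := .seq (.assign 0 (.reg 14)) (.count 0 outputWordBody)

/-- The stack of `run` is the chain of links beginning at register `25`. A pop follows one link, a
push redirects one, so the word takes time linear in its length. -/
theorem reach_outputWord {s : State} {δ st p : ℕ} {op : ℕ → ℕ} {e : ℕ → List ℕ} {o X : List ℕ}
    (h14 : s.reg 14 = δ) (h22 : s.reg 22 = st) (hst : st < δ) (ho : o.length = δ)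
    (hc : ∀ (i : ℕ) (h : i < o.length), s.mem 14 ((st + i) % δ) = o[i])
    (he0 : e 0 = []) (he : ∀ k ∈ o, k ≠ 0 → ∃ t, e k = op k :: t) (hop : ∀ k ∈ o, s.mem 10 k = op k)
    (hlink : ∀ k ∈ o, k ≠ 0 → Linked (s.mem 5) (s.mem 7) (e k))
    (hu : under (fun k => (e k).length) o 0 = 0) (hn : (o.flatMap e).Nodup)
    (hX : Holds (s.mem 2) p X) (h9 : s.reg 9 = p + X.length) :
    Reach outputWord s (δ * 60 + 10) (fun s' => Holds (s'.mem 2) p (X ++ (run e o []).1)) := by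
  refine Reach.imp (T := 2 + (δ * (50 + 6) + 2)) (Reach.seq
    (Q := fun s' => s' = s.setReg 0 δ)
    (Reach.of_straight rfl (by simp [Prog.time, Expr.cost])
    (by simp [Prog.step, Expr.eval, h14])) ?_) (by omega) fun _ _ h => h
  rintro s1 - rfl
  -- The links form the current stack `S`, while the circular lists of the letters still to be read
  -- are intact. The latter remains true because the lists are disjoint from each other and from
  -- `S`.
  refine Reach.imp (Reach.count_const (k := δ) (F := 50) (Inv := fun i s' => s'.reg 22 = (st + i) % δ ∧
    ∃ S ys, Follows (s'.mem 5) (s'.reg 25) S ∧ (run e o []).1 = ys ++ (run e (o.drop i) S).1 ∧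
      under (fun k => (e k).length) (o.drop i) S.length = 0 ∧ (S ++ (o.drop i).flatMap e).Nodup ∧
      (∀ k ∈ o.drop i, k ≠ 0 → Linked (s'.mem 5) (s'.mem 7) (e k)) ∧
      Holds (s'.mem 2) p (X ++ ys) ∧ s'.reg 9 = p + (X ++ ys).length)
    (by simp [State.setReg]) (by decide) (fun i s x h => h)
    ⟨by simp [State.setReg, h22, Nat.mod_eq_of_lt hst], [], [], trivial, by simp, by simpa using hu,
      by simpa using hn, by simpa [State.setReg] using hlink, by simpa [State.setReg] using hX,
      by simpa [State.setReg] using h9⟩ ?_)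
    le_rfl ?_
  · rintro i hi s' hf ⟨h22, S, ys, hS, hrun, hu, hn, hlink, hout, h9⟩
    have hio : i < o.length := by omega
    have hm14 : s'.mem 14 ((st + i) % δ) = o[i] := by
      rw [hf.2 14 (by decide)]; exact hc i hio
    have hm10 : ∀ k ∈ o, s'.mem 10 k = op k := by
      rw [hf.2 10 (by decide)]; exact hop
    have hr : s'.reg 14 = δ := (hf.1 14 (by decide)).trans h14
    have hko : o[i] ∈ o := List.getElem_mem _
    rw [List.drop_eq_getElem_cons hio] at hrun hu hn hlink
    set k := o[i] with hk
    have hmod : ∀ t, t = (st + i) % δ + 1 → (if t = δ then 0 else t) = (st + (i + 1)) % δ := by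
      rintro t rfl
      have h1 := Nat.mod_lt (st + i) (by omega : 0 < δ)
      rw [← Nat.add_assoc, Nat.add_mod (st + i) 1]
      split_ifs with h
      · by_cases hδ : δ = 1
        · subst hδ; rw [Nat.mod_one]
        · rw [Nat.mod_eq_of_lt (by omega : 1 < δ), h, Nat.mod_self]
      · rw [Nat.mod_eq_of_lt (by omega : 1 < δ),
          Nat.mod_eq_of_lt (by omega : (st + i) % δ + 1 < δ)]
    -- the state after pushing
    obtain ⟨x, S', hES⟩ : ∃ x S', e k ++ S = x :: S' := by
      rcases h : e k ++ S with _ | ⟨x, S'⟩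
      · have h1 := congrArg List.length h
        simp only [List.length_append, List.length_nil] at h1
        rw [under, if_pos h1] at hu
        omega
      · exact ⟨x, S', rfl⟩
    have hlen := congrArg List.length hES
    simp only [List.length_append, List.length_cons] at hlen
    rw [under, if_neg (by omega), show (e k).length + S.length - 1 = S'.length by omega] at hu
    rw [run_cons_cons hES] at hrun
    rw [List.flatMap_cons] at hn
    have hn2 : ((e k ++ S) ++ (o.drop (i + 1)).flatMap e).Nodup := by
      refine (List.Perm.nodup_iff ?_).1 hn
      rw [← List.append_assoc]
      exact List.perm_append_comm.append_right _
    -- The second half of the round, which pops an element and advances cyclically, is the same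
    -- whether or not a block has been pushed.
    have key : ∀ s2 : State, Follows (s2.mem 5) (s2.reg 25) (x :: S') →
        (∀ k' ∈ o.drop (i + 1), k' ≠ 0 → Linked (s2.mem 5) (s2.mem 7) (e k')) →
        s2.mem 2 = s'.mem 2 → s2.reg 9 = s'.reg 9 → s2.reg 22 = s'.reg 22 → s2.reg 14 = δ →
        (fun s' : State => s'.reg 22 = (st + (i + 1)) % δ ∧
    ∃ S ys, Follows (s'.mem 5) (s'.reg 25) S ∧ (run e o []).1 = ys ++ (run e (o.drop (i + 1)) S).1 ∧
      under (fun k => (e k).length) (o.drop (i + 1)) S.length = 0 ∧ (S ++ (o.drop (i + 1)).flatMap e).Nodup ∧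
      (∀ k ∈ o.drop (i + 1), k ≠ 0 → Linked (s'.mem 5) (s'.mem 7) (e k)) ∧
      Holds (s'.mem 2) p (X ++ ys) ∧ s'.reg 9 = p + (X ++ ys).length)
        ((Prog.seq (.seq (write (.reg 25)) (.assign 25 (.load 5 (.reg 25))))
      (.seq (.assign 22 (.add (.reg 22) (.const 1)))
        (ifEq (.reg 22) (.reg 14) (.assign 22 (.const 0))))).step s2) := by
      intro s2 e1 e2 e3 e4 e5 e6
      have hx : s2.reg 25 = x := e1.1
      rw [hES] at hn2
      simp only [Prog.step, step_ifEq]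
      refine ⟨?_, S', ys ++ [x], ?_, by rw [hrun]; simp, hu, hn2.of_cons, ?_, ?_, ?_⟩
      · rw [← hmod _ rfl]
        split_ifs with h1 h2 h2 <;>
          simp [write, Prog.step, Expr.eval, State.setReg, State.setMem, e5, h22, e6] at h1 h2 ⊢ <;> omega
      · have := e1.2
        split_ifs <;> simpa [write, Prog.step, Expr.eval, State.setReg, State.setMem, hx] using this
      · split_ifs <;> simpa [write, Prog.step, Expr.eval, State.setReg, State.setMem] using e2
      · have := hout.concat (x := x) (h9)
        rw [List.append_assoc] at this
        split_ifs <;>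
          simpa [write, Prog.step, Expr.eval, State.setReg, State.setMem, hx, e3, e4] using this
      · split_ifs <;>
          simp [write, Prog.step, Expr.eval, State.setReg, State.setMem, e4, h9] <;> omega
    refine Reach.of_straight rfl (by decide) ?_
    rw [outputWordBody, Prog.step]
    apply key
    all_goals simp only [Prog.step, Expr.eval, State.setReg, Function.update_self, h22, hm14]
    all_goals by_cases hk0 : k = 0
    all_goals simp only [hk0, if_true, if_neg, not_false_eq_true]
    all_goals try simp [State.setMem, hr, h22]
    · rw [hk0, he0, List.nil_append] at hES
      rwa [hES] at hS
    · obtain ⟨t, ht⟩ := he k hko hk0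
      have h1 := follows_push (top := s'.reg 25) (S := S) (ht ▸ hlink k (by simp) hk0)
        (ht ▸ hn2.of_append_left) hS
      rw [← ht, hES] at h1
      rw [hm10 k hko]
      exact h1.1
    · exact fun k' hk' h0 => hlink k' (List.mem_cons_of_mem _ hk') h0
    · obtain ⟨t, ht⟩ := he k hko hk0
      have h1 := follows_push (top := s'.reg 25) (S := S) (ht ▸ hlink k (by simp) hk0)
        (ht ▸ hn2.of_append_left) hS
      rw [← ht] at h1
      rw [hm10 k hko]
      intro k' hk' h0
      refine (hlink k' (List.mem_cons_of_mem _ hk') h0).update fun h2 => ?_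
      exact (List.nodup_append.1 hn2).2.2 _ (List.mem_append_left _ h1.2) _
        (List.mem_flatMap.2 ⟨k', hk', h2⟩) rfl
  · rintro s' - ⟨-, S, ys, -, hrun, -, -, -, hout, -⟩
    rw [List.drop_eq_nil_of_le (by omega), run, List.append_nil] at hrun
    rw [hrun]; exact hout

end UnrankLoops

/-! ### The unranking program. -/

section UnrankProgram

theorem count_eq_length {p : ℕ → Prop} [DecidablePred p] {n : ℕ} {l : List ℕ} (hl : l.Nodup)
    (h : ∀ x, x ∈ l ↔ p x) (hn : ∀ x, p x → x < n) : Nat.count p n = l.length := by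
  rw [Nat.count_eq_card_filter_range, ← List.toFinset_card_of_nodup hl]
  congr 1
  ext x
  simp only [Finset.mem_filter, Finset.mem_range, List.mem_toFinset, h]
  exact ⟨fun h => h.2, fun h => ⟨hn x h, h⟩⟩

/-- Complete the output up to the adjacency list of the cut-vertex, and mark the root. -/
def outputHead : Prog :=
  .seq (.seq (write (.reg 12)) (write (.reg 14)))
    (.seq (.store 2 (.const 0) (.add (.reg 10) (.const 1)))
      (.seq (.store 14 (.reg 24) (.const 1)) (.assign 22 (.reg 24))))

/-- The program that computes the embedding with a given code. -/
def unrankProg : Prog :=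
  .seq parse (.seq unrankOpenings (.seq initArrays (.seq fillCircle (.seq findStart
    (.seq outputHead outputWord)))))

/-- Reading the circle modulo `δ` from the root on, with the letter `1` written there, amounts to
reading the rotated list. -/
theorem getElem_schedule {L : ℕ → List ℕ} {c : ℕ → ℕ} {δ st : ℕ}
    (hst : st = lastUnder (fun k => (L k).length) ((List.range δ).map c) 0 0 0)
    {i : ℕ} (hi : i < (schedule L ((List.range δ).map c)).length) :
    Function.update c st 1 ((st + i) % δ) = (schedule L ((List.range δ).map c))[i] := by
  simp only [schedule, ← hst, List.getElem_rotate, List.getElem_set, List.length_set,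
    List.length_map, List.length_range, List.getElem_map, List.getElem_range, Function.update_apply,
    Nat.add_comm i st]
  simp only [eq_comm]

theorem reach_unrankProg {n v b : ℕ} {es : ℕ → List (ℕ × List ℕ)} {lab : ℕ → ℕ} {L : ℕ → List ℕ}
    {cs ds : List ℕ} (hL : Labelled b lab L)
    (hn : (((List.range b).flatMap fun j => lists v (j + 1) (es j)).flatMap Prod.snd).Nodup)
    (hlab : IsLabel ((List.range b).flatMap fun j => lists v (j + 1) (es j)) lab)
    (hrot : ∀ j < b, ∃ z ∈ lists v (j + 1) (es j), z.2.IsRotated (L (j + 1)))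
    (hlt : ∀ x, lab x ≠ 0 → x < n) (hcs : cs.length = b) (hds : ds.length = b - 2)
    (hex : ∀ (j : ℕ) (h : j < cs.length), ∃ x, lab x = j + 1 ∧
      Nat.count (fun y => lab y = j + 1) x = cs[j])
    (hbd : ∀ (i : ℕ) (h : i < ds.length), ds[i] < total b L - 1 - i) :
    Reach unrankProg
      (State.init (n :: v :: b :: (List.range b).flatMap fun j => encAll (es j)) (cs ++ ds))
      (parseTime b es + n * 60 + total b L * 150 + b * 60 + 200)
      (fun s => ∃ op : ℕ → ℕ, (∀ (j : ℕ) (h : j < cs.length), lab (op (j + 1)) = j + 1 ∧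
        Nat.count (fun y => lab y = j + 1) (op (j + 1)) = cs[j]) ∧
        s.HasOutput (encAll (((List.range b).flatMap fun j => others v (es j)) ++
          [(v, decodeWord L op (decodeCircle (total b L) ds))]))) := by
  have hinit : ∀ i, (State.init (n :: v :: b :: (List.range b).flatMap fun j => encAll (es j))
      (cs ++ ds)).mem (i + 2) = fun _ => 0 := fun i => by simp [State.init]
  have hin1 : Holds ((State.init (n :: v :: b :: (List.range b).flatMap fun j => encAll (es j))
      (cs ++ ds)).mem 1) 0 (cs ++ ds) := by
    intro i hi
    simp only [State.init, if_true, Nat.zero_add, List.getD_eq_getElem?_getD, if_neg one_ne_zero,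
      List.getElem?_eq_getElem hi, Option.getD_some]
  have hparse := reach_parse (n := n) (inp := cs ++ ds) hn hlab
  generalize State.init (n :: v :: b :: (List.range b).flatMap fun j => encAll (es j)) (cs ++ ds) = s0
    at hinit hin1 hparse ⊢
  set δ := total b L with hδ
  refine Reach.imp (T := parseTime b es + ((n * 60 + 10) + ((δ * 30 + 10) + ((b * 60 + 20) +
    ((δ * 60 + 10) + (40 + (δ * 60 + 10))))))) (Reach.seq hparse ?_) (by omega) fun _ _ h => h
  rintro s1 f1 ⟨p11, p12, p13, plab, plink, pout, ppos, pnum⟩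
  have h1 : s1.mem 1 = s0.mem 1 := f1.2 1 (by decide)
  rw [← h1] at hin1
  obtain ⟨hin1, hin2⟩ := holds_append.1 hin1
  rw [Nat.zero_add, hcs] at hin2
  refine Reach.seq (reach_unrankOpenings p11 plab
    (fun k => by rw [f1.2 9 (by decide), hinit 7])) ?_
  rintro s2 f2 ⟨a14, a9, a10⟩
  obtain ⟨hP1, hP2, hP3⟩ := perm_range'_flatMap hL (fun k => List.IsRotated.refl (L k))
  rw [count_eq_length (p := fun x => lab x ≠ 0) hP1 hP2 hlt, hP3, ← hδ] at a14
  have a9 : s2.mem 9 = fun k => (L k).length := by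
    funext k
    rw [a9 k]
    split_ifs with hk
    · rw [hk, hL.zero]; rfl
    · exact count_eq_length (hL.nodup k) (fun x => hL.mem k x hk) fun x hx => hlt x (by omega)
  have hop : ∀ (j : ℕ) (h : j < cs.length), lab (s2.mem 10 (j + 1)) = j + 1 ∧
      Nat.count (fun y => lab y = j + 1) (s2.mem 10 (j + 1)) = cs[j] := by
    intro j hj
    obtain ⟨x, hx, hx'⟩ := hex j hj
    rw [a10 (j + 1) x (by omega) (hlt x (by omega)) hx (hx'.trans (by simpa using (hin1 j hj).symm))]
    exact ⟨hx, hx'⟩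
  have hop' : ∀ k, k ≠ 0 → k ≤ b → lab (s2.mem 10 k) = k := fun k h0 hk => by
    obtain ⟨j, rfl⟩ := Nat.exists_eq_succ_of_ne_zero h0
    exact (hop j (by omega)).1
  refine Reach.seq (reach_initArrays a14) ?_
  rintro s3 f3 harr
  have k14 : s3.reg 14 = δ := (f3.1 14 (by decide)).trans a14
  have hpick : pickAll (s3.mem 11) (δ - 1) ds = pickAll (· + 1) (δ - 1) ds :=
    pickAll_congr (fun i hi => (harr i (by omega)).1) hbd
  obtain ⟨hp1, hp2⟩ := pickAll_spec (· + 1) (· - 1) (δ - 1) ds (fun i _ => by simp) hbd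
  have hpos : ∀ x ∈ pickAll (· + 1) (δ - 1) ds, 0 < x ∧ x < δ := by
    intro x hx
    obtain ⟨i, hi, rfl⟩ := hp2 x hx
    omega
  refine Reach.seq (reach_fillCircle (s := s3) (δ := δ) (b := b) (ds := ds) k14 ?_ hds ?_ (fun x => ?_) ?_ ?_) ?_
  · rw [f3.1 13 (by decide), f2.1 13 (by decide), p13]
  · rw [f3.2 1 (by decide), f2.2 1 (by decide)]; exact hin2
  · rw [f3.2 14 (by decide), f2.2 14 (by decide), f1.2 14 (by decide), hinit 12]
  · rw [hpick]; exact hp1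
  · rw [hpick]; exact fun x hx => (hpos x hx).1.ne'
  rintro s4 f4 hcirc
  rw [hpick] at hcirc
  -- Here the cycle lemma provides the hypotheses of the last two loops: no underflow, disjoint
  -- lists, a bounded height, letters up to `b`, and a root on the circle.
  obtain ⟨-, -, -, -, -, -, d1, d2, d3, d4, d5⟩ := decodeWord_spec hL (op := s2.mem 10) hop'
    (by rw [length_pickAll, hds]) hp1 hpos rfl
  rw [← hδ] at d1 d2 d3 d4 d5
  set c := circ (pickAll (· + 1) (δ - 1) ds) with hc
  have m14 : s4.reg 14 = δ := (f4.1 14 (by decide)).trans k14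
  have m9 : s4.mem 9 = fun k => (L k).length := by
    rw [f4.2 9 (by decide), f3.2 9 (by decide), a9]
  refine Reach.seq (reach_findStart m14 hcirc m9 d3) ?_
  rintro s5 f5 hst
  set st := lastUnder (fun k => (L k).length) ((List.range δ).map c) 0 0 0 with hstd
  set s6 := outputHead.step s5 with hs6
  have f6 := (Prog.run_step (p := outputHead) rfl s5).choose_spec.2.frame
  refine Reach.seq (Q := fun s' => s' = s6) (Reach.of_straight rfl (by decide) rfl) ?_
  rintro s6' - rfl
  have q2 : s5.mem 2 = s1.mem 2 := by
    rw [f5.2 2 (by decide), f4.2 2 (by decide), f3.2 2 (by decide), f2.2 2 (by decide)]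
  have q9 : s5.reg 9 = s1.reg 9 := by
    rw [f5.1 9 (by decide), f4.1 9 (by decide), f3.1 9 (by decide), f2.1 9 (by decide)]
  have q10 : s5.reg 10 = s1.reg 10 := by
    rw [f5.1 10 (by decide), f4.1 10 (by decide), f3.1 10 (by decide), f2.1 10 (by decide)]
  have q12 : s5.reg 12 = v := by
    rw [f5.1 12 (by decide), f4.1 12 (by decide), f3.1 12 (by decide), f2.1 12 (by decide), p12]
  have q14 : s5.reg 14 = δ := by rw [f5.1 14 (by decide), m14]
  have qm14 : s5.mem 14 = c := by rw [f5.2 14 (by decide), hcirc]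
  set Y := (List.range b).flatMap fun j => others v (es j) with hY
  have r22 : s6.reg 22 = st := by
    simp [hs6, outputHead, write, Prog.step, Expr.eval, State.setReg, State.setMem, hst]
  have r9 : s6.reg 9 = 0 + ((Y.length + 1) :: (Y.flatMap enc ++ [v, δ])).length := by
    simp [hs6, outputHead, write, Prog.step, Expr.eval, State.setReg, State.setMem, q9, ppos]; omega
  have rm14 : s6.mem 14 = Function.update c st 1 := by
    simp [hs6, outputHead, write, Prog.step, Expr.eval, State.setReg, State.setMem, hst, qm14]
  have rm2 : s6.mem 2 = Function.update (Function.update (Function.update (s1.mem 2) (s1.reg 9) v)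
      (s1.reg 9 + 1) δ) 0 (Y.length + 1) := by
    simp [hs6, outputHead, write, Prog.step, Expr.eval, State.setReg, State.setMem, q2, q9, q12, q14,
      q10, pnum]
  have r14 : s6.reg 14 = δ := (f6.1 14 (by decide)).trans q14
  have rm10 : s6.mem 10 = s2.mem 10 := by
    rw [f6.2 10 (by decide), f5.2 10 (by decide), f4.2 10 (by decide), f3.2 10 (by decide)]
  have rm5 : s6.mem 5 = s1.mem 5 := by
    rw [f6.2 5 (by decide), f5.2 5 (by decide), f4.2 5 (by decide), f3.2 5 (by decide),
      f2.2 5 (by decide)]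
  have rm7 : s6.mem 7 = s1.mem 7 := by
    rw [f6.2 7 (by decide), f5.2 7 (by decide), f4.2 7 (by decide), f3.2 7 (by decide),
      f2.2 7 (by decide)]
  -- The reserved cell `0` now receives the number of entries: the copied ones and that of the
  -- cut-vertex.
  have hX : Holds (s6.mem 2) 0 ((Y.length + 1) :: (Y.flatMap enc ++ [v, δ])) := by
    rw [holds_cons]
    refine ⟨by rw [rm2, Function.update_self], ?_⟩
    rw [Nat.zero_add]
    have b1 := (pout.concat (x := v) ppos).concat (x := δ) (q := s1.reg 9 + 1) (by simp [ppos]; omega)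
    rw [List.append_assoc] at b1
    refine b1.congr fun i hi _ => ?_
    rw [rm2, Function.update_of_ne (by omega)]
  refine Reach.imp (reach_outputWord (s := s6) (st := st) (op := s2.mem 10)
    (e := fun k => startAt (L k) (s2.mem 10 k)) (o := schedule L ((List.range δ).map c))
    r14 r22 d5 (by simp [schedule]) (fun i hi => ?_) (by simp [hL.zero, startAt]) (fun k hk h0 => ?_)
    (fun k _ => by rw [rm10]) (fun k hk h0 => ?_) ?_ d2 hX r9) le_rfl ?_
  · rw [rm14]; exact getElem_schedule hstd hi
  · exact startAt_cons ((hL.mem k _ h0).2 (hop' k h0 (d4 k hk)))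
  · obtain ⟨j, rfl⟩ := Nat.exists_eq_succ_of_ne_zero h0
    have hjb := d4 _ hk
    obtain ⟨z, hz, hzr⟩ := hrot j (by omega)
    rw [rm5, rm7]
    exact (plink j (by omega) z hz).isRotated (hzr.nodup_iff.2 (hL.nodup _))
      (hzr.trans (startAt_isRotated _ _).symm)
  · simpa only [length_startAt] using d1
  · rintro s7 f7 hout
    refine ⟨s2.mem 10, hop, ?_⟩
    set w := decodeWord L (s2.mem 10) (decodeCircle δ ds) with hw
    have hwl : w.length = δ := by
      have h1 := run_length (fun k => startAt (L k) (s2.mem 10 k)) (schedule L ((List.range δ).map c)) []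
      simp only [length_startAt, List.length_nil] at h1
      rw [d1, Nat.add_zero] at h1
      exact h1.trans (by simp [schedule])
    have e1 : encAll (Y ++ [(v, w)]) = (Y.length + 1) :: (Y.flatMap enc ++ [v, δ]) ++ w := by
      simp [encAll, enc, hwl]
    intro i hi
    simp only [e1] at hi ⊢
    have := hout i hi
    rwa [Nat.zero_add] at this

end UnrankProgram

/-! ### From adjacency lists of embeddings to the input and output of the programs. -/

section Representation

variable {n : ℕ} {G : SimpleGraph (Fin n)}

/-- The entries for the vertices `vs` with the adjacency lists `adj`. -/
def entries (vs : List (Fin n)) (adj : Fin n → List (Fin n)) : List (ℕ × List ℕ) :=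
  vs.map fun u : Fin n => ((u : ℕ), (adj u).map Fin.val)

/-- A rotation system is given by a list of the vertices and by circular adjacency lists. -/
structure IsAdjacency {H : G.Subgraph} (ρ : RotationSystem H) (vs : List (Fin n))
    (adj : Fin n → List (Fin n)) : Prop where
  nodup : vs.Nodup
  mem : ∀ u, u ∈ vs ↔ u ∈ H.verts
  isAdjList : ∀ u ∈ H.verts, ρ.IsAdjList u (adj u)

theorem isRepr_iff {H : G.Subgraph} {E : SphereEmbedding H} {code : List ℕ} :
    E.IsRepr code ↔ ∃ vs adj, IsAdjacency E.toRotationSystem vs adj ∧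
      code = encAll (entries vs adj) := by
  have h : ∀ (vs : List (Fin n)) (adj : Fin n → List (Fin n)), encAll (entries vs adj) = vs.length ::
      vs.flatMap fun u : Fin n => (u : ℕ) :: (adj u).length :: (adj u).map fun w => (w : ℕ) :=
    fun vs adj => by
      simp [encAll, entries, enc, List.flatMap_map, show ∀ l : List (Fin n),
        (l.flatMap fun a : Fin n => [(a : ℕ)]) = l.map Fin.val from fun l => List.map_eq_flatMap.symm]
      rfl
  constructor
  · rintro ⟨vs, adj, h1, h2, h3, h4⟩
    exact ⟨vs, adj, ⟨h1, h2, h3⟩, by rw [h, h4]⟩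
  · rintro ⟨vs, adj, ⟨h1, h2, h3⟩, h4⟩
    exact ⟨vs, adj, h1, h2, h3, by rw [← h, h4]⟩

theorem lists_entries {vs : List (Fin n)} {adj : Fin n → List (Fin n)} {v : Fin n} (hn : vs.Nodup)
    (hv : v ∈ vs) (j : ℕ) : lists v j (entries vs adj) = [(j, (adj v).map Fin.val)] := by
  have h1 : vs.filter (fun u => u = v) = [v] := by
    rw [List.filter_eq, List.count_eq_one_of_mem hn hv]; rfl
  rw [lists, entries, List.filter_map, List.map_map]
  have h2 : vs.filter ((fun e : ℕ × List ℕ => decide (e.1 = v)) ∘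
      fun u : Fin n => ((u : ℕ), (adj u).map Fin.val)) = [v] := by
    rw [← h1]
    refine List.filter_congr fun u _ => ?_
    simp [Fin.ext_iff]
  rw [h2]; rfl

theorem others_entries (vs : List (Fin n)) (adj : Fin n → List (Fin n)) (v : Fin n) :
    others v (entries vs adj) = entries (vs.filter fun u => u ≠ v) adj := by
  rw [others, entries, List.filter_map, entries]
  congr 1
  refine List.filter_congr fun u _ => ?_
  simp [Fin.ext_iff]

theorem length_eq_deg {H : G.Subgraph} {ρ : RotationSystem H} {u : Fin n} {l : List (Fin n)}
    (h : ρ.IsAdjList u l) : l.length = deg H u := by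
  rw [deg_eq_length (l := l.map Fin.val) (h.1.map Fin.val_injective), List.length_map]
  intro x
  simp only [List.mem_map, h.2.1]
  exact ⟨fun ⟨w, h1, h2⟩ => ⟨w, h2, h1⟩, fun ⟨w, h1, h2⟩ => ⟨w, h2, h1⟩⟩

/-- Every vertex has a neighbour, so its degree plus one is at most twice its degree. -/
theorem entriesSize_entries_le {H : G.Subgraph} {ρ : RotationSystem H} {vs : List (Fin n)}
    {adj : Fin n → List (Fin n)} (h : IsAdjacency ρ vs adj)
    (hH : ∀ u ∈ H.verts, ∃ w, H.Adj u w) : entriesSize (entries vs adj) ≤ 2 * ∑ u, deg H u := by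
  have h1 : entriesSize (entries vs adj) = (vs.map fun u => (adj u).length + 1).sum := by
    simp [entriesSize, entries, Function.comp_def]
  rw [h1, ← List.sum_toFinset _ h.nodup, Finset.mul_sum]
  refine le_trans (Finset.sum_le_sum (g := fun u => 2 * deg H u) fun u hu => ?_)
    (Finset.sum_le_sum_of_subset (Finset.subset_univ _))
  rw [List.mem_toFinset, h.mem] at hu
  rw [length_eq_deg (h.isAdjList u hu)]
  have : 0 < deg H u := by
    rw [deg, Set.ncard_pos]
    exact hH u hu
  omega

theorem length_le_of_nodup {l : List (Fin n)} (h : l.Nodup) : l.length ≤ n := by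
  simpa using h.length_le_card

theorem le_of_mem_encAll {H : G.Subgraph} {ρ : RotationSystem H} {vs : List (Fin n)}
    {adj : Fin n → List (Fin n)} (h : IsAdjacency ρ vs adj) {x : ℕ}
    (hx : x ∈ encAll (entries vs adj)) : x ≤ n := by
  simp only [encAll, entries, enc, List.flatMap_map, List.mem_cons, List.mem_flatMap, List.mem_map,
    List.length_map] at hx
  rcases hx with rfl | ⟨u, hu, rfl | rfl | ⟨w, -, rfl⟩⟩
  · exact length_le_of_nodup h.nodup
  · exact u.2.le
  · exact length_le_of_nodup (h.isAdjList u ((h.mem u).1 hu)).1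
  · exact w.2.le

theorem State.init_bounded {M : ℕ} {inp₀ inp₁ : List ℕ} (h₀ : ∀ x ∈ inp₀, x ≤ M)
    (h₁ : ∀ x ∈ inp₁, x ≤ M) : (State.init inp₀ inp₁).Bounded M := by
  have key : ∀ l : List ℕ, (∀ x ∈ l, x ≤ M) → ∀ i, l.getD i 0 ≤ M := by
    intro l hl i
    rw [List.getD_eq_getElem?_getD]
    rcases h : l[i]? with _ | x
    · simp
    · exact hl x (List.mem_of_getElem? h)
  refine ⟨fun r => Nat.zero_le _, fun a i => ?_⟩
  simp only [State.init]
  split_ifs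
  exacts [key _ h₀ i, key _ h₁ i, Nat.zero_le _]

theorem Reach.computes {p : Prog} {inp₀ inp₁ : List ℕ} {T T' W M : ℕ} {Q : State → Prop}
    {out : List ℕ → Prop} (h : Reach p (State.init inp₀ inp₁) T Q) (hp : p.tame) (hM : 4 ≤ M)
    (h₀ : ∀ x ∈ inp₀, x ≤ M) (h₁ : ∀ x ∈ inp₁, x ≤ M) (hT : T ≤ T') (hW : T' * (M + 4 * T') ≤ W)
    (hQ : ∀ s, Q s → ∃ l, out l ∧ s.HasOutput l) : Computes p W T' inp₀ inp₁ out := by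
  obtain ⟨s, t, hr, ht, hs⟩ := h
  obtain ⟨l, hl, hl'⟩ := hQ s hs
  exact ⟨s, t, l, (hr.exec hp hW M hM (State.init_bounded h₀ h₁) (by omega) (by omega)).1,
    by omega, hl, hl'⟩

variable {v : Fin n} {b : ℕ} {B : Fin b → G.Subgraph} {ℰ : (j : Fin b) → SphereEmbedding (B j)}
  {vs : Fin b → List (Fin n)} {adj : Fin b → Fin n → List (Fin n)}

/-- The entries of the blocks, numbered from `0`. -/
def blockEntries (vs : Fin b → List (Fin n)) (adj : Fin b → Fin n → List (Fin n)) (k : ℕ) :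
    List (ℕ × List ℕ) :=
  if h : k < b then entries (vs ⟨k, h⟩) (adj ⟨k, h⟩) else []

theorem blockEntries_val (j : Fin b) : blockEntries vs adj j = entries (vs j) (adj j) := by
  rw [blockEntries, dif_pos j.2]

theorem flatMap_range_eq {α : Type*} (f : ℕ → List α) :
    (List.range b).flatMap f = (List.finRange b).flatMap fun j : Fin b => f j := by
  rw [← List.map_coe_finRange_eq_range, List.flatMap_map]

theorem instanceRepr_eq {blockCode : Fin b → List ℕ}
    (h : ∀ j, blockCode j = encAll (entries (vs j) (adj j))) : instanceRepr v blockCode =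
      n :: (v : ℕ) :: b :: (List.range b).flatMap fun j => encAll (blockEntries vs adj j) := by
  rw [instanceRepr, flatMap_range_eq, List.ofFn_eq_map, ← List.flatMap_def]
  simp only [blockEntries_val, ← h]

variable (hA : ∀ j, IsAdjacency (ℰ j).toRotationSystem (vs j) (adj j))
include hA

theorem Wedge.lists_blockEntries (hW : Wedge v B) (j : Fin b) :
    lists v (j + 1) (blockEntries vs adj j) = [((j : ℕ) + 1, (adj j v).map Fin.val)] := by
  rw [blockEntries_val]
  exact lists_entries (hA j).nodup (((hA j).mem v).2 (hW.mem j)) _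

theorem Wedge.isRotated_blockList (hW : Wedge v B) (j : Fin b) :
    ((adj j v).map Fin.val).IsRotated (blockList ℰ v (j + 1)) := by
  obtain ⟨l, hl, hl'⟩ := blockList_succ (v := v) ℰ j
  rw [hl']
  exact (isRotated_of_isAdjList ((hA j).isAdjList v (hW.mem j)) hl).map _

theorem Wedge.flatMap_lists (hW : Wedge v B) :
    ((List.range b).flatMap fun j => lists v (j + 1) (blockEntries vs adj j)) =
      (List.finRange b).map fun j : Fin b => ((j : ℕ) + 1, (adj j v).map Fin.val) := by
  rw [flatMap_range_eq]
  simp only [hW.lists_blockEntries hA]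
  exact List.flatMap_pure_eq_map _ _

theorem Wedge.nodup_lists (hW : Wedge v B) :
    (((List.range b).flatMap fun j => lists v (j + 1) (blockEntries vs adj j)).flatMap
      Prod.snd).Nodup := by
  rw [hW.flatMap_lists hA, List.flatMap_map, List.nodup_flatMap]
  refine ⟨fun j _ => (hW.isRotated_blockList hA j).nodup_iff.2 ((hW.labelled ℰ).nodup _), ?_⟩
  refine List.Pairwise.imp (R := (· ≠ ·)) (fun {i j} hij => ?_) (List.nodup_finRange b)
  simp only [Function.onFun]
  rw [List.disjoint_left]
  intro x hi hj
  rw [(hW.isRotated_blockList hA _).mem_iff, (hW.labelled ℰ).mem _ _ (by omega)] at hi hj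
  exact hij (Fin.ext (by omega))

theorem Wedge.isLabel (hW : Wedge v B) :
    IsLabel ((List.range b).flatMap fun j => lists v (j + 1) (blockEntries vs adj j))
      (label v B) := by
  rw [hW.flatMap_lists hA]
  constructor
  · intro z hz x hx
    obtain ⟨j, -, rfl⟩ := List.mem_map.1 hz
    exact ((hW.labelled ℰ).mem _ _ (by simp)).1 ((hW.isRotated_blockList hA j).mem_iff.1 hx)
  · intro x hx
    by_contra h0
    obtain ⟨j, w, hw, hj⟩ := (label_ne_zero_iff x).1 h0
    refine hx _ (List.mem_map.2 ⟨j, List.mem_finRange j, rfl⟩) ?_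
    rw [(hW.isRotated_blockList hA j).mem_iff, (hW.labelled ℰ).mem _ _ (by omega), ← hw]
    exact (hW.label_val_eq_iff j w).2 hj

/-- The blocks have no edge in common, so together they have at most `6 * n` oriented edges and
entries of size at most `12 * n`; and `792` is `66 * 12`. -/
theorem Wedge.parseTime_le (hW : Wedge v B) (hdeg : ∑ u, deg (⊤ : G.Subgraph) u ≤ 6 * n) :
    parseTime b (blockEntries vs adj) ≤ 792 * n + 19 * b + 30 := by
  have h1 : ∑ j : Fin b, entriesSize (entries (vs j) (adj j)) ≤ 12 * n := by
    calc _ ≤ ∑ j : Fin b, 2 * ∑ u, deg (B j) u :=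
          Finset.sum_le_sum fun j _ => entriesSize_entries_le (hA j) fun u hu =>
            hW.exists_adj_of_mem j hu
      _ = 2 * ∑ u, ∑ j : Fin b, deg (B j) u := by rw [← Finset.mul_sum, Finset.sum_comm]
      _ ≤ 2 * ∑ u, deg (⊤ : G.Subgraph) u :=
          Nat.mul_le_mul_left _ (Finset.sum_le_sum fun u _ => hW.sum_deg_le u)
      _ ≤ _ := by omega
  rw [parseTime, Finset.sum_range fun j => 66 * entriesSize (blockEntries vs adj j) + 19]
  simp only [blockEntries_val, Finset.sum_add_distrib, ← Finset.mul_sum, Finset.sum_const,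
    Finset.card_univ, Fintype.card_fin, smul_eq_mul]
  omega

theorem le_of_mem_instance (hb : b ≤ n) {x : ℕ}
    (hx : x ∈ n :: (v : ℕ) :: b :: (List.range b).flatMap fun j => encAll (blockEntries vs adj j)) :
    x ≤ n := by
  simp only [List.mem_cons, flatMap_range_eq, List.mem_flatMap, blockEntries_val] at hx
  rcases hx with rfl | rfl | rfl | ⟨j, -, hx⟩
  · exact le_rfl
  · exact v.2.le
  · exact hb
  · exact le_of_mem_encAll (hA j) hx

-- Away from `v` the adjacency lists of the blocks are also those of the union, and each vertex
-- occurs in one block only. So the copied entries may be followed by a single new one for `v`.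
open Classical in
theorem Wedge.isRepr_of_isAdjList (hW : Wedge v B) (E : PreservingEmbedding ℰ) {l : List (Fin n)}
    (hl : E.1.toRotationSystem.IsAdjList v l) :
    E.1.IsRepr (encAll (((List.range b).flatMap fun j => others v (blockEntries vs adj j)) ++
      [((v : ℕ), l.map Fin.val)])) := by
  set adj' : Fin n → List (Fin n) := fun u => if u = v then l else
    if h : ∃ j, u ∈ (B j).verts then adj h.choose u else [] with hadj'
  have hadj : ∀ j u, u ∈ (B j).verts → u ≠ v → adj' u = adj j u := by
    intro j u hj hu
    have h : ∃ j, u ∈ (B j).verts := ⟨j, hj⟩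
    have : h.choose = j := by
      by_contra hne
      exact hu (hW.inter _ _ _ hne h.choose_spec hj)
    simp only [hadj', if_neg hu, dif_pos h]
    rw [this]
  refine isRepr_iff.2 ⟨((List.finRange b).flatMap fun j => (vs j).filter fun u => u ≠ v) ++ [v], adj',
    ⟨?_, fun u => ?_, fun u hu => ?_⟩, ?_⟩
  · rw [List.nodup_append]
    refine ⟨?_, by simp, fun x hx y hy => ?_⟩
    · rw [List.nodup_flatMap]
      refine ⟨fun j _ => (hA j).nodup.filter _, ?_⟩
      refine List.Pairwise.imp (R := (· ≠ ·)) (fun {i j} hij => ?_) (List.nodup_finRange b)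
      simp only [Function.onFun]
      rw [List.disjoint_left]
      intro x hi hj
      simp only [List.mem_filter, (hA _).mem, decide_eq_true_eq] at hi hj
      exact hi.2 (hW.inter i j x hij hi.1 hj.1)
    · simp only [List.mem_flatMap, List.mem_filter, decide_eq_true_eq] at hx
      obtain ⟨j, -, -, hx⟩ := hx
      rw [List.mem_singleton] at hy
      rwa [hy]
  · simp only [List.mem_append, List.mem_flatMap, List.mem_filter, decide_eq_true_eq, (hA _).mem,
      List.mem_singleton, List.mem_finRange, true_and, SimpleGraph.Subgraph.verts_iSup, Set.mem_iUnion]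
    constructor
    · rintro (⟨j, hj, -⟩ | rfl)
      · exact ⟨j, hj⟩
      · exact ⟨⟨0, by have := hW.two_le; omega⟩, hW.mem _⟩
    · rintro ⟨j, hj⟩
      by_cases hu : u = v
      · exact Or.inr hu
      · exact Or.inl ⟨j, hj, hu⟩
  · by_cases huv : u = v
    · subst huv
      simpa [hadj'] using hl
    · rw [SimpleGraph.Subgraph.verts_iSup, Set.mem_iUnion] at hu
      obtain ⟨j, hj⟩ := hu
      rw [hadj j u hj huv]
      obtain ⟨h1, h2, h3⟩ := isAdjList_iff.1 ((hA j).isAdjList u hj)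
      have hiff : ∀ w, (⨆ j, B j).Adj u w ↔ (B j).Adj u w := hW.adj_iff huv hj
      refine isAdjList_iff.2 ⟨h1, fun w => (h2 w).trans (hiff w).symm, fun a => ?_⟩
      have ha : (B j).Adj u a := (hiff a).1 a.2
      exact (h3 ⟨a, ha⟩).trans ((restrictsAt_iff_eq hiff).1 (E.2 j u) ⟨a, ha⟩ a rfl).symm
  · congr 1
    rw [entries, List.map_append, List.map_flatMap, flatMap_range_eq]
    congr 1
    · refine List.flatMap_congr fun j _ => ?_
      rw [blockEntries_val, others_entries, entries]
      refine List.map_congr_left fun u hu => ?_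
      simp only [List.mem_filter, (hA _).mem, decide_eq_true_eq] at hu
      rw [hadj j u hu.1 hu.2]
    · simp [hadj']

end Representation

/-! ### The constants of the time and word bounds. -/

section Main

variable {n : ℕ} {G : SimpleGraph (Fin n)} {v : Fin n} {b : ℕ} {B : Fin b → G.Subgraph}
  {ℰ : (j : Fin b) → SphereEmbedding (B j)}

theorem deg_le (H : G.Subgraph) (u : Fin n) : deg H u ≤ n := by
  rw [deg]
  exact (Set.ncard_le_card _).trans (by simp)

theorem Wedge.le_card (hW : Wedge v B) : b ≤ n := by
  have h1 : ∑ _j : Fin b, 1 ≤ ∑ j, deg (B j) v := Finset.sum_le_sum fun j _ => by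
    obtain ⟨w, hw⟩ := hW.nbr j
    exact Nat.one_le_iff_ne_zero.2 ((Set.ncard_pos).2 ⟨w, hw⟩).ne'
  have h2 := hW.sum_deg_le v
  have h3 := deg_le (⊤ : G.Subgraph) v
  simp only [Finset.sum_const, Finset.card_univ, Fintype.card_fin, smul_eq_mul, mul_one] at h1
  omega

/-- The bound is quadratic in `n` with a large coefficient, which is at most `3 ^ 16` and hence at
most `n ^ 16`. For `c = 2500` the coefficient is `25007500`. -/
theorem word_bound (hn : 3 ≤ n) {c m : ℕ} (hm : m ≤ 3 * n) (hc : c * (3 + 4 * c) ≤ 3 ^ 16) :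
    c * n * (m + 4 * (c * n)) ≤ n ^ 18 := by
  calc c * n * (m + 4 * (c * n)) ≤ c * n * (3 * n + 4 * (c * n)) := by gcongr
    _ = c * (3 + 4 * c) * n ^ 2 := by ring
    _ ≤ n ^ 16 * n ^ 2 := by
        gcongr
        exact hc.trans (Nat.pow_le_pow_left hn 16)
    _ = n ^ 18 := by ring

theorem Wedge.computes_rank (hW : Wedge v B) (hdeg : ∑ u, deg (⊤ : G.Subgraph) u ≤ 6 * n)
    {φ : PreservingEmbedding ℰ ≃ Code v B}
    (hφ : ∀ (E : PreservingEmbedding ℰ) (l : List (Fin n)), E.1.toRotationSystem.IsAdjList v l →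
      IsNormal (label v B) (l.map Fin.val) → (φ E).toList =
        ((List.range b).map fun k => encodeOp (label v B) (l.map Fin.val) (k + 1)) ++
          encodePos b (label v B) (l.map Fin.val))
    {blockCode : Fin b → List ℕ} (hcode : ∀ j, (ℰ j).IsRepr (blockCode j))
    (E : PreservingEmbedding ℰ) {code : List ℕ} (hE : E.1.IsRepr code) :
    Computes rankProg (n ^ 18) (2500 * n) (instanceRepr v blockCode) code
      (fun out => out = (φ E).toList) := by
  have hn := hW.three_le
  have hb := hW.le_card
  choose vs adj hA hc using fun j => isRepr_iff.1 (hcode j)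
  obtain ⟨vsE, adjE, hAE, rfl⟩ := isRepr_iff.1 hE
  have hv : v ∈ (⨆ j, B j).verts := by
    rw [SimpleGraph.Subgraph.verts_iSup, Set.mem_iUnion]
    exact ⟨⟨0, by have := hW.two_le; omega⟩, hW.mem _⟩
  have hl := hAE.isAdjList v hv
  have hword := isWord_of_isAdjList hW E hl
  have hsize : entriesSize (entries vsE adjE) ≤ 12 * n := by
    refine (entriesSize_entries_le hAE fun u hu => ?_).trans ?_
    · rw [SimpleGraph.Subgraph.verts_iSup, Set.mem_iUnion] at hu
      obtain ⟨j, hj⟩ := hu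
      obtain ⟨w, hw⟩ := hW.exists_adj_of_mem j hj
      exact ⟨w, SimpleGraph.Subgraph.iSup_adj.2 ⟨j, hw⟩⟩
    · have := Finset.sum_le_sum fun u (_ : u ∈ Finset.univ) => deg_iSup_le (⨆ j, B j) u
      omega
  rw [instanceRepr_eq hc]
  have hreach := reach_rankProg (n := n) (v := v) (hW.labelled ℰ) hword (hW.nodup_lists hA)
    (hW.isLabel hA) (lists_entries hAE.nodup ((hAE.mem v).2 hv) 1) (fun x hx => by
      obtain ⟨w, -, rfl⟩ := List.mem_map.1 hx
      exact w.2)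
  have htime := hW.parseTime_le hA hdeg
  have hlen : ((adjE v).map Fin.val).length ≤ n := by
    rw [List.length_map]; exact length_le_of_nodup hl.1
  -- The input consists of numbers up to `n`; the bound `3 * n` also covers the constants up to `4`.
  -- The time adds up to at most `1933 * n + 230`.
  refine hreach.computes (by decide) (M := 3 * n) (by omega)
    (fun x hx => (le_of_mem_instance hA hb hx).trans (by omega))
    (fun x hx => (le_of_mem_encAll hAE hx).trans (by omega)) (by omega)
    (word_bound hn le_rfl (by norm_num)) ?_
  rintro s ⟨w, hw, hnorm, hout⟩
  refine ⟨_, ?_, hout⟩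
  obtain ⟨k, rfl⟩ := hw
  rw [← List.map_rotate] at hnorm ⊢
  exact (hφ E _ (isAdjList_of_isRotated hl (List.IsRotated.forall _ k).symm) hnorm).symm

theorem Wedge.computes_unrank (hW : Wedge v B) (hdeg : ∑ u, deg (⊤ : G.Subgraph) u ≤ 6 * n)
    {φ : PreservingEmbedding ℰ ≃ Code v B}
    (hφ : ∀ (t : Code v B) (op : ℕ → ℕ), (∀ j : Fin b, label v B (op (j + 1)) = j + 1 ∧
        Nat.count (fun x => label v B x = j + 1) (op (j + 1)) = t.1 j) →
      ∃ l : List (Fin n), (φ.symm t).1.toRotationSystem.IsAdjList v l ∧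
        l.map Fin.val = decodeWord (blockList ℰ v) op
          (decodeCircle (deg (⊤ : G.Subgraph) v) (List.ofFn fun j => (t.2 j : ℕ))))
    {blockCode : Fin b → List ℕ} (hcode : ∀ j, (ℰ j).IsRepr (blockCode j)) (t : Code v B) :
    Computes unrankProg (n ^ 18) (2500 * n) (instanceRepr v blockCode) t.toList
      (fun out => (φ.symm t).1.IsRepr out) := by
  have hn := hW.three_le
  have hb := hW.le_card
  have htotal := hW.deg_top_eq_total (ℰ := ℰ)
  have hδ := deg_le (⊤ : G.Subgraph) v
  choose vs adj hA hc using fun j => isRepr_iff.1 (hcode j)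
  rw [instanceRepr_eq hc]
  have hreach := reach_unrankProg (n := n) (v := v) (cs := List.ofFn fun j => (t.1 j : ℕ))
    (ds := List.ofFn fun j => (t.2 j : ℕ)) (hW.labelled ℰ) (hW.nodup_lists hA) (hW.isLabel hA)
    (fun j hj => ⟨_, by
      rw [hW.lists_blockEntries hA ⟨j, hj⟩]; exact List.mem_singleton_self _,
      hW.isRotated_blockList hA ⟨j, hj⟩⟩)
    (fun x hx => by
      obtain ⟨j, w, rfl, -⟩ := (label_ne_zero_iff x).1 hx
      exact w.2)
    (by simp) (by simp) (fun j hj => by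
      rw [List.length_ofFn] at hj
      have := hW.exists_count_eq ℰ ⟨j, hj⟩ (t.1 ⟨j, hj⟩).2
      simpa using this)
    (fun i hi => by
      rw [List.length_ofFn] at hi
      have : ((t.2 ⟨i, hi⟩ : ℕ)) < deg (⊤ : G.Subgraph) v - (i + 1) := (t.2 ⟨i, hi⟩).2
      simp only [List.getElem_ofFn]
      omega)
  have htime := hW.parseTime_le hA hdeg
  refine hreach.computes (by decide) (M := 3 * n) (by omega)
    (fun x hx => (le_of_mem_instance hA hb hx).trans (by omega))
    (fun x hx => ?_) (by omega) (word_bound hn le_rfl (by norm_num)) ?_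
  · simp only [List.mem_append, List.mem_ofFn] at hx
    rcases hx with ⟨j, rfl⟩ | ⟨j, rfl⟩
    · have := (t.1 j).2
      have := deg_le (B j) v
      omega
    · have := (t.2 j).2
      omega
  · rintro s ⟨op, hop, hout⟩
    obtain ⟨l, hl, hl'⟩ := hφ t op fun j => by simpa using hop j (by simp)
    refine ⟨_, ?_, hout⟩
    rw [← htotal, ← hl']
    exact hW.isRepr_of_isAdjList hA _ hl

/-- `ack 0 0` is `1`, which is less than `n`. -/
theorem one_le_invAck (hn : 2 ≤ n) : 1 ≤ invAck n := by
  rw [invAck, Nat.one_le_iff_ne_zero, Ne, Nat.find_eq_zero]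
  simp
  omega

theorem Computes.mono {p : Prog} {W T T' : ℕ} {inp₀ inp₁ : List ℕ} {out : List ℕ → Prop}
    (h : Computes p W T inp₀ inp₁ out) (hT : T ≤ T') : Computes p W T' inp₀ inp₁ out := by
  obtain ⟨s, t, l, h1, h2, h3⟩ := h
  exact ⟨s, t, l, h1, h2.trans hT, h3⟩

end Main

end CutVertexRanking

theorem mainTheorem3 :
    ∃ (rank unrank : Prog) (C K : ℕ),
      ∀ (n : ℕ) (G : SimpleGraph (Fin n)) (_hconn : G.Connected)
        (_hplanar : Nonempty (SphereEmbedding (⊤ : G.Subgraph)))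
        (v : Fin n) (_hv : IsCutVertex G v)
        (b : ℕ) (B : Fin b → G.Subgraph) (_hinj : Function.Injective B)
        (_hB : ∀ H : G.Subgraph, (∃ j, B j = H) ↔ IsBlock G H ∧ v ∈ H.verts)
        (ℰ : (j : Fin b) → SphereEmbedding (B j)),
      ∃ φ : PreservingEmbedding ℰ ≃ Code v B,
        Nat.card (PreservingEmbedding ℰ) =
            (∏ j : Fin b, deg (B j) v) *
              ∏ j ∈ Finset.Icc 1 (b - 2), (deg (⊤ : G.Subgraph) v - j) ∧
        ∀ blockCode : Fin b → List ℕ, (∀ j, (ℰ j).IsRepr (blockCode j)) →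
          (∀ (E : PreservingEmbedding ℰ) (code : List ℕ), E.1.IsRepr code →
            Computes rank (n ^ K) (C * n) (instanceRepr v blockCode) code
              (fun out => out = (φ E).toList)) ∧
          (∀ t : Code v B,
            Computes unrank (n ^ K) (C * (n * invAck n)) (instanceRepr v blockCode) t.toList
              (fun out => (φ.symm t).1.IsRepr out)) := by
  refine ⟨rankProg, unrankProg, 2500, 18, fun n G hconn hplanar v hv b B hinj hB ℰ => ?_⟩
  obtain ⟨E⟩ := hplanar
  have hW := wedge_of_blocks hconn hv hinj hB
  have hn := hW.three_le
  have hdeg := sum_deg_top_le hconn hn E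
  obtain ⟨φ, h1, h2⟩ := exists_equiv_code (ℰ := ℰ) hW
  refine ⟨φ, (Nat.card_congr φ).trans (card_code v B), fun blockCode hcode =>
    ⟨fun E code hE => hW.computes_rank hdeg h1 hcode E hE, fun t =>
      (hW.computes_unrank hdeg h2 hcode t).mono ?_⟩⟩
  -- Unranking takes linear time, and the factor `invAck n` is at least one.
  exact Nat.mul_le_mul_left _ (Nat.le_mul_of_pos_right n (one_le_invAck (by omega)))
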